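/- **Setting.** Let $\Gamma$ be the lattice freely generated by $\gamma_1,\dots,\gamma_{\ell_1},\eta_1,\dots,\eta_{\ell_2}$ with the skew form $\langle\gamma_i,\gamma_k\rangle=\langle\eta_j,\eta_k\rangle=0$, $\langle\gamma_i,\eta_j\rangle=1$, and $\pi\colon\Gamma\to\mathbb Z^2$, $\pi(\gamma_i)=(0,1)$, $\pi(\eta_j)=(1,0)$. Let $Z^{\pm}\colon\Gamma\to\mathbb C$ be central charges with common values $Z^\pm(\gamma)$ on all $\gamma_i$ and $Z^\pm(\eta)$ on all $\eta_j$, in the open first quadrant, with $\arg Z^+(\eta)<\arg Z^-(\gamma)<\arg Z^-(\eta)<\arg Z^+(\gamma)$. Put $Z^\tau=(1-\tau)Z^++\tau Z^-$ and let $\tau_0\in[0,1]$ be the value for which $Z^{\tau_0}(\Gamma)$ lies on a real line. Let $\mathcal C$ be the union of the two closed cones spanned by $Z^+(\gamma),Z^+(\eta)$ and by $Z^+(-\gamma),Z^+(-\eta)$. Let $\mathcal T$ be a finite rooted tree with vertices $v$ decorated by $\alpha(v)\in\Gamma$, each a positive multiple of some $\gamma_i$ or some $\eta_j$, the root by a multiple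 of a $\gamma_i$, with $\langle\alpha(v),\alpha(w)\rangle\neq0$ for every arrow $v\to w$. Write $c(\mathcal T)=\sum_v\alpha(v)$, $\bar c(\mathcal T)=\pi(c(\mathcal T))$, and $\deg(\mathcal T)$ for the formal sum of the $\pi(\alpha(v))$. A labelling $\nu$ is a total order of the vertices. With $\rho(\zeta,\zeta')=\frac1{4\pi i}\frac{\zeta'+\zeta}{\zeta'-\zeta}$, $\psi^0_\alpha(\zeta)=e^{\pi R(\zeta^{-1}Z(\alpha)+\zeta\bar Z(\alpha))}e_\alpha$, $\ell_\alpha=\mathbb R_{<0}Z(\alpha)$ and $e_\alpha e_\beta=(-1)^{\langle\alpha,\beta\rangle}e_{\alpha+\beta}$, let $\mathcal G_{\mathcal T}(\zeta)=\int_{\ell_{\alpha}}\frac{d\zeta'}{\zeta'}\rho(\zeta,\zeta')\psi^0_{\alpha}(\zeta')\prod_{\mathcal T'}\mathcal G_{\mathcal T'}(\zeta')$ recursively, where $\alpha$ decorates the root and $\mathcal T'$ runs over the trees left after removing it. Define $J_{\mathcal T}(\varepsilon,R)$ by $\mathcal G_{\mathcal T}(\zeta,Z^{\tau_0-\varepsilon})-\mathcal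 G_{\mathcal T}(\zeta,Z^{\tau_0+\varepsilon})=J_{\mathcal T}(\varepsilon,R)\,e_{c(\mathcal T)}$. Write $\ell^\pm_\alpha=\ell_\alpha(Z^{\tau_0\mp\varepsilon})$. **Moving the rays:** in the order of $\nu$, move the rays of the vertices from $\ell^+$ to $\ell^-$, clockwise for $\gamma$-vertices and counterclockwise for $\eta$-vertices, by Fubini and the residue theorem. When the ray of $v$ crosses the ray $\ell^-_{\alpha(w)}$ of an adjacent, already moved, vertex $w$, the integral is the sum of the one with the ray of $v$ pushed further, and a residue term, in which $v,w$ are contracted to one vertex on $\ell^-_{\alpha(w)}$, decorated by $\alpha(v)+\alpha(w)$, which is moved on to $\ell^-_{\alpha(v)+\alpha(w)}$; the sign of the residue is $(-1)^{\langle\alpha(v),\alpha(w)\rangle}$ times $-1$ if $w\to v$ is crossed clockwise or $v\to w$ counterclockwise, and times $+1$ otherwise. A moving ray stops just before rays coinciding with its destination; coinciding rays are infinitesimally separated in this order. One obtains a finite signed sum of terms $\mathcal G_u$, each the iterated integral of a contraction $\mathcal T_u$ of $\mathcal T$. To each term $u$ with $|\mathcal T_u^{[0]}|=1$ reached by at least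 one contraction, with sign $(-1)^{[\Upsilon_u]}$, attach the combinatorial type $[\Upsilon_u]$ with one trivalent vertex for each contraction (with vectors $-\pi(\alpha),-\pi(\beta),\pi(\alpha+\beta)$ if vertices decorated by $\alpha,\beta$ are contracted), one incoming unbounded edge for each vertex of $\mathcal T$, and one outgoing unbounded edge. Let $\{[\Upsilon_j]\}_{\mathcal T}$ be the collection of these signed types. **Lemma A.** Suppose that $\bar c(\mathcal T)$ is primitive. 1. For every $\nu$, each $[\Upsilon_j]$ is the combinatorial type of a connected trivalent plane rational tropical curve of degree $\deg(\mathcal T)$ (unbounded edges with weighted outgoing directions $-\pi(\alpha(v))$, and one with $\bar c(\mathcal T)$). For every weight vector ${\bf w}$ with primitive sum there is a general choice $\mathfrak d$ of lines (with positions linearly independent over $\mathbb Q$) such that each $\mathcal T$ with $\deg(\mathcal T)={\bf w}$ has a labelling $\nu$ for which all $[\Upsilon_j]$ belong to $[\mathcal S(\mathfrak d,{\bf w})]$, the set of types of connected rational tropical curves with incoming unbounded edges of weights $w_{1j}$ (direction $(0,1)$) and $w_{2j}$ (direction $(1,0)$) lying in the lines $\mathfrak d$, and one outgoing unbounded edge.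 2. Let $z_0=Z^{\tau_0}(c(\mathcal T))$ and $f(\zeta,R)=\int_{\mathbb R_{<0}z_0}\frac{d\zeta'}{\zeta'}\rho(\zeta,\zeta')e^{\pi R(\zeta'^{-1}z_0+\zeta'\bar z_0)}$. For every $\nu$ and $\zeta\notin\mathcal C$ and all sufficiently small $\varepsilon>0$: for integrands given by any central charge with values in the open first quadrant on $\gamma,\eta$, the integral of $\mathcal T$ over the rays $\ell^+$ equals the signed sum of the terms $\mathcal G_u$ (over the rays $\ell^-$, infinitesimally separated as above); and $$J_{\mathcal T}(\varepsilon,R)=\sum_{\{[\Upsilon_j]\}_{\mathcal T}}(-1)^{[\Upsilon_j]}f(\zeta,R)+E_1(\varepsilon,R)+E_2(\varepsilon,R),$$ where $E_1(\varepsilon,R)=o_\varepsilon\big(e^{-2\pi|z_0|R}/\sqrt{|z_0|R}\big)$ as $R\to+\infty$ for fixed $\varepsilon$, and $E_2(\varepsilon,R)=O(\varepsilon)$ uniformly in $R\ge1$. Here $E_1$ is the signed sum of the terms $\mathcal G_u$ with $|\mathcal T_u^{[0]}|>1$ and at least one contraction, evaluated for the central charge $\frac{|z_0|}{|Z^{\tau_0+\varepsilon}(c(\mathcal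 T))|}Z^{\tau_0+\varepsilon}$. Moreover $f_0(R)=\lim_{\zeta\to0}f(\zeta,R)$ exists nontangentially to $\partial\mathcal C$, and $$f_0(R)\sim\frac1{4\pi i}\,\frac{e^{-2\pi|z_0|R}}{\sqrt{|z_0|R}}\qquad(R\to+\infty).$$ -/

import Mathlib

noncomputable section

/-! ### The charge lattice -/

/-- The lattice freely generated by `γ_1, …, γ_{l₁}` and `η_1, …, η_{l₂}`. -/
abbrev ChargeLattice (l₁ l₂ : ℕ) : Type := (Fin l₁ → ℤ) × (Fin l₂ → ℤ)

namespace ChargeLattice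

variable {l₁ l₂ : ℕ}

/-- The generator `γ_i`. -/
def gam (i : Fin l₁) : ChargeLattice l₁ l₂ := (Pi.single i 1, 0)

/-- The generator `η_j`. -/
def eta (j : Fin l₂) : ChargeLattice l₁ l₂ := (0, Pi.single j 1)

/-- The projection to `ℤ²` with `γ_i ↦ (0, 1)` and `η_j ↦ (1, 0)`. -/
def proj (α : ChargeLattice l₁ l₂) : ℤ × ℤ := (∑ j, α.2 j, ∑ i, α.1 i)

/-- The skew-symmetric form with `⟨γ_i, γ_k⟩ = ⟨η_j, η_k⟩ = 0` and `⟨γ_i, η_j⟩ = 1`. -/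
def pairing (α β : ChargeLattice l₁ l₂) : ℤ :=
  (∑ i, α.1 i) * (∑ j, β.2 j) - (∑ j, α.2 j) * (∑ i, β.1 i)

/-- The central charge taking the common value `x` on all `γ_i` and `y` on all `η_j`. -/
def centralCharge (x y : ℂ) (α : ChargeLattice l₁ l₂) : ℂ :=
  ((∑ i, α.1 i : ℤ) : ℂ) * x + ((∑ j, α.2 j : ℤ) : ℂ) * y

/-- With the twisted commutative product `e_α e_β = (-1)^{⟨α, β⟩} e_{α + β}`, the sign `σ` such that
`e_{α₁} e_{α₂} ⋯ e_{α_m} = σ e_{α₁ + ⋯ + α_m}`. -/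
def twist : List (ChargeLattice l₁ l₂) → ℤˣ
  | [] => 1
  | α :: L => Int.negOnePow (pairing α L.sum) * twist L

end ChargeLattice

/-- The open first quadrant of `ℂ`. -/
def firstQuadrant : Set ℂ := {z | 0 < z.re ∧ 0 < z.im}

/-- The common values `gP, eP` of `Z⁺` on the `γ_i`, `η_j`, and the values `gM, eM` of `Z⁻`.
They lie in the first quadrant; `Z⁺(γ)` precedes `Z⁺(η)` in the clockwise order, `Z⁻(η)` precedes
`Z⁻(γ)`, and the cone of `Z⁺(γ), Z⁺(η)` strictly contains the cone of `Z⁻(γ), Z⁻(η)`. -/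
structure WallCrossing where
  gP : ℂ
  eP : ℂ
  gM : ℂ
  eM : ℂ
  gP_mem : gP ∈ firstQuadrant
  eP_mem : eP ∈ firstQuadrant
  gM_mem : gM ∈ firstQuadrant
  eM_mem : eM ∈ firstQuadrant
  arg_lt₁ : eP.arg < gM.arg
  arg_lt₂ : gM.arg < eM.arg
  arg_lt₃ : eM.arg < gP.arg

namespace WallCrossing

/-- `Z^τ(γ_i)` for the interpolation `Z^τ = (1 - τ) Z⁺ + τ Z⁻`. -/
def g (D : WallCrossing) (τ : ℝ) : ℂ := (1 - τ) * D.gP + τ * D.gM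

/-- `Z^τ(η_j)`. -/
def e (D : WallCrossing) (τ : ℝ) : ℂ := (1 - τ) * D.eP + τ * D.eM

/-- The central charge `Z^τ`. -/
def Z (D : WallCrossing) {l₁ l₂ : ℕ} (τ : ℝ) : ChargeLattice l₁ l₂ → ℂ :=
  ChargeLattice.centralCharge (D.g τ) (D.e τ)

/-- `τ` is the critical value: all values of `Z^τ` lie on one real line. -/
def IsCritical (D : WallCrossing) (τ : ℝ) : Prop :=
  τ ∈ Set.Icc (0 : ℝ) 1 ∧ (D.g τ * (starRingEnd ℂ) (D.e τ)).im = 0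

/-- The union of the (closed) cones spanned by `Z⁺(γ), Z⁺(η)` and by `Z⁺(-γ), Z⁺(-η)`. -/
def cone (D : WallCrossing) : Set ℂ :=
  {z | ∃ a b : ℝ, 0 ≤ a ∧ 0 ≤ b ∧ (z = a * D.gP + b * D.eP ∨ z = -(a * D.gP + b * D.eP))}

/-- Regions of nontangential approach to `0` (relative to the boundary of the cone): points outside
the cone whose distance to the cone is at least `κ` times their modulus. -/
def nontangential (D : WallCrossing) (κ : ℝ) : Set ℂ :=
  {z | z ≠ 0 ∧ κ * ‖z‖ ≤ Metric.infDist z D.cone}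

end WallCrossing

/-! ### Decorated rooted trees and their propagators -/

/-- A connected rooted tree with vertex set `V`, with arrows `parent v → v`, decorated by charges. -/
structure DecoratedTree (l₁ l₂ : ℕ) (V : Type) where
  parent : V → Option V
  root : V
  parent_eq_none_iff : ∀ v, parent v = none ↔ v = root
  wf : WellFounded fun v w : V => parent w = some v
  charge : V → ChargeLattice l₁ l₂

namespace DecoratedTree

variable {l₁ l₂ : ℕ} {V : Type}

/-- Every vertex is decorated by a positive multiple of some `γ_i` or some `η_j`, the root by a
positive multiple of some `γ_i`, and `⟨α(v), α(w)⟩ ≠ 0` along every arrow `v → w`. -/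
structure IsPositive (T : DecoratedTree l₁ l₂ V) : Prop where
  charge_pos : ∀ v, (∃ (i : Fin l₁) (p : ℕ), 0 < p ∧ T.charge v = p • ChargeLattice.gam i) ∨
    (∃ (j : Fin l₂) (p : ℕ), 0 < p ∧ T.charge v = p • ChargeLattice.eta j)
  root_gam : ∃ (i : Fin l₁) (p : ℕ), 0 < p ∧ T.charge T.root = p • ChargeLattice.gam i
  pairing_ne_zero : ∀ v w, T.parent w = some v →
    ChargeLattice.pairing (T.charge v) (T.charge w) ≠ 0

/-- The charge `c(T)`. -/
def totalCharge [Fintype V] (T : DecoratedTree l₁ l₂ V) : ChargeLattice l₁ l₂ := ∑ v, T.charge v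

/-- The reduced charge of `T`. -/
def reducedCharge [Fintype V] (T : DecoratedTree l₁ l₂ V) : ℤ × ℤ := T.totalCharge.proj

/-- The degree of `T`: the formal sum of the projected decorations, as a multiset. -/
def degree [Fintype V] (T : DecoratedTree l₁ l₂ V) : Multiset (ℤ × ℤ) :=
  Finset.univ.val.map fun v => (T.charge v).proj

end DecoratedTree

/-- The kernel `ρ(ζ, ζ')`. -/
def rhoKernel (ζ ζ' : ℂ) : ℂ := 1 / (4 * Real.pi * Complex.I) * ((ζ' + ζ) / (ζ' - ζ))

/-- The coefficient of `e_α` in the semiflat `ψ⁰_α(ζ)` of radius `R`, for `z = Z(α)`. -/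
def psiZero (R : ℝ) (z ζ : ℂ) : ℂ :=
  Complex.exp (Real.pi * R * (ζ⁻¹ * z + ζ * (starRingEnd ℂ) z))

section Propagator

variable {l₁ l₂ : ℕ} {V : Type} [Fintype V] [DecidableEq V]

/-- The iterated integral of the subtree rooted at `v`,
`∫_{ℓ_v} dζ'/ζ' ρ(ζ, ζ') ψ⁰_{α(v)}(ζ') ∏_{v → w} (subtree at w)(ζ')`,
where `ℓ_v` is the ray from `0` to `∞` through `ray v`, parametrized by `ζ' = e^s ray v`.
The first argument only has to be at least the depth of the subtree. -/
def iteratedIntegral (parent : V → Option V) (z ray : V → ℂ) (R : ℝ) : ℕ → V → ℂ → ℂ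
  | 0, _, _ => 1
  | k + 1, v, ζ => ∫ s : ℝ, rhoKernel ζ (Real.exp s * ray v) * psiZero R (z v) (Real.exp s * ray v) *
      ∏ w with parent w = some v, iteratedIntegral parent z ray R k w (Real.exp s * ray v)

/-- The coefficient of `e_c`, with `c` the sum of all decorations `α v`, in the propagator of the
rooted tree `parent` decorated by `α`, with integrands given by the central charge `Z`
and integration rays through `ray v`. -/
def propagator (parent : V → Option V) (α : V → ChargeLattice l₁ l₂)
    (Z : ChargeLattice l₁ l₂ → ℂ) (ray : V → ℂ) (R : ℝ) (ζ : ℂ) : ℂ :=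
  ((ChargeLattice.twist (Finset.univ.toList.map α) : ℤ) : ℂ) *
    ∏ v with parent v = none,
      iteratedIntegral parent (fun w => Z (α w)) ray R (Fintype.card V) v ζ

/-- The propagator of `T` for the central charge `Z`, with rays `ℓ_α = ℝ_{<0} Z'(α)`. -/
def DecoratedTree.G (T : DecoratedTree l₁ l₂ V) (Z Z' : ChargeLattice l₁ l₂ → ℂ) (R : ℝ) (ζ : ℂ) :
    ℂ :=
  propagator T.parent T.charge Z (fun v => -Z' (T.charge v)) R ζ

/-- The jump `J_T(ε, R)` at the critical value `τ₀`. -/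
def DecoratedTree.jump (T : DecoratedTree l₁ l₂ V) (D : WallCrossing) (τ₀ : ℝ) (ζ : ℂ) (ε R : ℝ) :
    ℂ :=
  T.G (D.Z (τ₀ - ε)) (D.Z (τ₀ - ε)) R ζ - T.G (D.Z (τ₀ + ε)) (D.Z (τ₀ + ε)) R ζ

end Propagator

/-- The integral `∫_{ℓ_c} dζ'/ζ' ρ(ζ, ζ') ψ⁰_c(ζ')`, with `z = Z(c)` and `ℓ_c = ℝ_{<0} z`. -/
def singleIntegral (z ζ : ℂ) (R : ℝ) : ℂ :=
  ∫ s : ℝ, rhoKernel ζ (Real.exp s * -z) * psiZero R z (Real.exp s * -z)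

/-! ### Moving the rays: the Fubini and residue bookkeeping -/

/-- The history of a vertex obtained by successive contractions from vertices of a tree. -/
inductive MergeTree (V : Type) : Type
  | leaf (v : V) : MergeTree V
  | node (l r : MergeTree V) : MergeTree V

namespace MergeTree

variable {V : Type}

/-- The original vertices which have been contracted to a vertex. -/
def members : MergeTree V → List V
  | leaf v => [v]
  | node l r => l.members ++ r.members

/-- The decoration of a contracted vertex: the sum of the decorations of its members. -/
def total {A : Type} [Add A] (α : V → A) : MergeTree V → A
  | leaf v => α v
  | node l r => l.total α + r.total α

end MergeTree

namespace DecoratedTree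

variable {l₁ l₂ : ℕ} {V : Type}

/-- In the contracted tree there is an arrow `B → A`. -/
def IsArrow (T : DecoratedTree l₁ l₂ V) (B A : MergeTree V) : Prop :=
  ∃ a ∈ A.members, ∃ b ∈ B.members, T.parent a = some b

instance [DecidableEq V] (T : DecoratedTree l₁ l₂ V) (B A : MergeTree V) :
    Decidable (T.IsArrow B A) := by
  unfold IsArrow; infer_instance

/-- `det (π α(A), π α(B))`. It is positive, zero or negative according to whether the ray
`ℓ⁻_{α(B)}` lies in clockwise direction from `ℓ⁻_{α(A)}`, coincides with it, or lies in
counterclockwise direction from it. -/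
def det (T : DecoratedTree l₁ l₂ V) (A B : MergeTree V) : ℤ :=
  (A.total T.charge).proj.1 * (B.total T.charge).proj.2 -
    (A.total T.charge).proj.2 * (B.total T.charge).proj.1

/-- Move the integration ray of the vertex `A` to `ℓ⁻_{α(A)}`, clockwise if `cw` and
counterclockwise otherwise, across the vertices which already sit on their final rays `ℓ⁻`:
`passed` lists those already passed and the next list those ahead, both in the order in which
they are met. The ray stops just before the first ray which is not strictly before its
destination (in particular just before rays coinciding with `ℓ⁻_{α(A)}`). When it moves across
the ray of a vertex `h`, one term is the integral over the ray pushed beyond `h`; if `h` and `A`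
are adjacent, there is also a residue term, in which `A` and `h` are contracted to a vertex, on the
ray of `h`, decorated by `α(A) + α(h)`, to be moved further. Its sign is `(-1)^{⟨α(A), α(h)⟩}` times
`-1` if `h → A` is crossed clockwise or `A → h` counterclockwise, and times `+1` otherwise. -/
def push [DecidableEq V] (T : DecoratedTree l₁ l₂ V) (cw : Bool) :
    MergeTree V → List (MergeTree V) → List (MergeTree V) → ℤˣ → List (List (MergeTree V) × ℤˣ)
  | A, passed, [], σ => [(passed ++ [A], σ)]
  | A, passed, h :: rest, σ =>
    if (cw = true ∧ 0 < T.det h A) ∨ (cw = false ∧ T.det h A < 0) then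
      push T cw A (passed ++ [h]) rest σ ++
        (if T.IsArrow h A then
          push T cw (.node A h) passed rest (σ * (if cw then -1 else 1) *
            Int.negOnePow (ChargeLattice.pairing (A.total T.charge) (h.total T.charge)))
        else if T.IsArrow A h then
          push T cw (.node A h) passed rest (σ * (if cw then 1 else -1) *
            Int.negOnePow (ChargeLattice.pairing (A.total T.charge) (h.total T.charge)))
        else [])
    else [(passed ++ A :: h :: rest, σ)]

/-- Move the ray of an original vertex `v` from `ℓ⁺` to `ℓ⁻`. The vertices already moved are listed
in clockwise order of their rays; all these rays lie between `ℓ⁺_γ` and `ℓ⁺_η`. A ray `ℓ⁺_γ` comes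
from the counterclockwise end and moves clockwise, `ℓ⁺_η` the other way round. -/
def moveVertex [DecidableEq V] (T : DecoratedTree l₁ l₂ V) (v : V)
    (p : List (MergeTree V) × ℤˣ) : List (List (MergeTree V) × ℤˣ) :=
  if (T.charge v).proj.1 = 0 then T.push true (.leaf v) [] p.1 p.2
  else (T.push false (.leaf v) [] p.1.reverse p.2).map fun q => (q.1.reverse, q.2)

/-- All the terms obtained from the propagator of `T` by moving the rays from `ℓ⁺` to `ℓ⁻` in the
order given by the labelling `ν`. A term is given by the list of vertices of a contraction of `T`,
in clockwise order of their rays, with their histories, and by a sign. -/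
def residueTerms [Fintype V] [DecidableEq V] (T : DecoratedTree l₁ l₂ V)
    (ν : Fin (Fintype.card V) ≃ V) : List (List (MergeTree V) × ℤˣ) :=
  (List.ofFn ν).foldl (fun S v => S.flatMap (T.moveVertex v)) [([], 1)]

/-- The parent map of the contracted tree with vertices `L`. -/
def termParent [DecidableEq V] (T : DecoratedTree l₁ l₂ V) (L : List (MergeTree V))
    (i : Fin L.length) : Option (Fin L.length) :=
  (List.finRange L.length).find? fun j => decide (j ≠ i ∧ T.IsArrow (L.get j) (L.get i))

/-- The propagator of the contracted tree with vertices `L`, with integrands given by `Z`. The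
integration rays are the rays `ℝ_{<0} Z'(α)`, rotated clockwise by the small angles
`0, δ, 2δ, …` in the order of `L`; so vertices with a common ray are integrated over nearby rays in
the order of `L`. -/
def termPropagator [DecidableEq V] (T : DecoratedTree l₁ l₂ V) (L : List (MergeTree V))
    (Z Z' : ChargeLattice l₁ l₂ → ℂ) (δ R : ℝ) (ζ : ℂ) : ℂ :=
  propagator (T.termParent L) (fun i => (L.get i).total T.charge) Z
    (fun i => -Z' ((L.get i).total T.charge) * Complex.exp (-(δ * (i : ℕ)) * Complex.I)) R ζ

/-- The terms in which some, but not all, vertices have been contracted: more than one vertex is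
left, and not all vertices are original ones. -/
def intermediateTerms [Fintype V] [DecidableEq V] (T : DecoratedTree l₁ l₂ V)
    (ν : Fin (Fintype.card V) ≃ V) : List (List (MergeTree V) × ℤˣ) :=
  (T.residueTerms ν).filter fun p =>
    decide (1 < p.1.length) && p.1.any fun m => match m with
      | .leaf _ => false
      | .node _ _ => true

end DecoratedTree

/-! ### Plane rational tropical curves and their combinatorial types -/

/-- A combinatorial type: a finite graph with vertices `V`, with unbounded edges `E` attached to
vertices, and for every vertex `v` and every edge at `v` an integral vector, namely `ω(E) m_v(E)`,
the weight times the outgoing primitive direction vector. For an edge joining `v` and `w` this vector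
is `dir v w` at `v` and `dir w v` at `w`; values of `dir` on non-adjacent vertices are irrelevant. -/
structure TropType where
  V : Type
  E : Type
  fintypeV : Fintype V
  fintypeE : Fintype E
  graph : SimpleGraph V
  att : E → V
  dir : V → V → ℤ × ℤ
  endDir : E → ℤ × ℤ

attribute [instance] TropType.fintypeV TropType.fintypeE

/-- Isomorphism of combinatorial types. -/
structure TropType.Iso (A B : TropType) where
  onV : A.V ≃ B.V
  onE : A.E ≃ B.E
  adj_iff : ∀ v w, B.graph.Adj (onV v) (onV w) ↔ A.graph.Adj v w
  att_eq : ∀ e, B.att (onE e) = onV (A.att e)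
  dir_eq : ∀ v w, A.graph.Adj v w → B.dir (onV v) (onV w) = A.dir v w
  endDir_eq : ∀ e, B.endDir (onE e) = A.endDir e

open Classical in
/-- A (trivalent) plane rational tropical curve `(Υ, ω, h)`: the graph is a tree, all edges have
positive weight and rational slope, the balancing condition holds at every vertex, and `pos` gives
the images of the vertices; `h` is affine on bounded edges, and maps an unbounded
edge `e` to the half-line `pos (att e) + ℝ_{≥0} endDir e`. -/
structure TropCurve extends TropType where
  isTree : graph.IsTree
  dir_symm : ∀ v w, graph.Adj v w → dir w v = -dir v w
  dir_ne_zero : ∀ v w, graph.Adj v w → dir v w ≠ 0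
  endDir_ne_zero : ∀ e, endDir e ≠ 0
  trivalent : ∀ v, (Finset.univ.filter fun w => graph.Adj v w).card +
    (Finset.univ.filter fun e => att e = v).card = 3
  balanced : ∀ v, (∑ w with graph.Adj v w, dir v w) + ∑ e with att e = v, endDir e = 0
  pos : V → ℝ × ℝ
  pos_adj : ∀ v w, graph.Adj v w → ∃ t : ℝ, 0 < t ∧
    pos w = pos v + (t * ((dir v w).1 : ℝ), t * ((dir v w).2 : ℝ))

/-- The degree of a tropical curve: the formal sum of the vectors `ω(E) m(E)` of its unbounded
edges, as a multiset. -/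
def TropCurve.degree (Υ : TropCurve) : Multiset (ℤ × ℤ) := Finset.univ.val.map Υ.endDir

/-- The curve has combinatorial type `t`. -/
def TropCurve.HasType (Υ : TropCurve) (t : TropType) : Prop := Nonempty (Υ.toTropType.Iso t)

/-- A weight vector `w = (w₁, w₂)`. -/
structure WeightVector where
  len₁ : ℕ
  len₂ : ℕ
  w₁ : Fin len₁ → ℕ
  w₂ : Fin len₂ → ℕ
  pos₁ : ∀ j, 1 ≤ w₁ j
  pos₂ : ∀ j, 1 ≤ w₂ j
  mono₁ : Monotone w₁
  mono₂ : Monotone w₂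

namespace WeightVector

/-- The weighted direction vectors of the incoming ends: `w_{1j} (0, 1)` and `w_{2j} (1, 0)`. -/
def vec (w : WeightVector) : Fin w.len₁ ⊕ Fin w.len₂ → ℤ × ℤ
  | .inl j => (0, w.w₁ j)
  | .inr j => (w.w₂ j, 0)

/-- The weight vector as a degree. -/
def degree (w : WeightVector) : Multiset (ℤ × ℤ) := Finset.univ.val.map w.vec

/-- The set `S(𝔡, w)` of rational tropical curves whose unbounded edges are incoming ones contained
in the lines `𝔡_{1j} = {x = 𝔡 (inl j)}` and `𝔡_{2j} = {y = 𝔡 (inr j)}`, with the given weights, and a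
single outgoing one. -/
def curves (w : WeightVector) (𝔡 : Fin w.len₁ ⊕ Fin w.len₂ → ℝ) : Set TropCurve :=
  {Υ | ∃ f : Option (Fin w.len₁ ⊕ Fin w.len₂) ≃ Υ.E,
    (∀ i, Υ.endDir (f (some i)) = -w.vec i) ∧
    (∀ j, (Υ.pos (Υ.att (f (some (.inl j))))).1 = 𝔡 (.inl j)) ∧
    (∀ j, (Υ.pos (Υ.att (f (some (.inr j))))).2 = 𝔡 (.inr j)) ∧
    Υ.endDir (f none) = ∑ i, w.vec i}

end WeightVector

/-! ### The tropical type of a sequence of contractions -/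

namespace MergeTree

variable {V : Type}

/-- The trivalent vertices: one for each contraction; `none` is the last one. -/
def Vertex : MergeTree V → Type
  | leaf _ => Empty
  | node l r => Option (l.Vertex ⊕ r.Vertex)

/-- The incoming ends: one for each original vertex. -/
def End : MergeTree V → Type
  | leaf _ => Unit
  | node l r => l.End ⊕ r.End

/-- The vertex at the far end of the outgoing edge (`none` if this edge is unbounded). -/
def up : (m : MergeTree V) → m.Vertex → Option m.Vertex
  | leaf _, x => Empty.elim x
  | node _ _, none => none
  | node l r, some (.inl x) => some ((l.up x).map (Sum.inl : l.Vertex → l.Vertex ⊕ r.Vertex))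
  | node l r, some (.inr x) => some ((r.up x).map (Sum.inr : r.Vertex → l.Vertex ⊕ r.Vertex))

/-- The vertex at which an incoming end arrives (`none` if there are no vertices). -/
def endVertex : (m : MergeTree V) → m.End → Option m.Vertex
  | leaf _, _ => none
  | node l r, .inl e => some ((l.endVertex e).map (Sum.inl : l.Vertex → l.Vertex ⊕ r.Vertex))
  | node l r, .inr e => some ((r.endVertex e).map (Sum.inr : r.Vertex → l.Vertex ⊕ r.Vertex))

/-- The vector of the outgoing edge at a vertex. -/
def outVec (q : V → ℤ × ℤ) : (m : MergeTree V) → m.Vertex → ℤ × ℤ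
  | leaf _, x => Empty.elim x
  | node l r, none => (node l r).total q
  | node l _, some (.inl x) => l.outVec q x
  | node _ r, some (.inr x) => r.outVec q x

/-- The original vertex to which an incoming end belongs. -/
def endMember : (m : MergeTree V) → m.End → V
  | leaf v, _ => v
  | node l _, .inl e => l.endMember e
  | node _ r, .inr e => r.endMember e

instance fintypeVertex : (m : MergeTree V) → Fintype m.Vertex
  | leaf _ => inferInstanceAs (Fintype Empty)
  | node l r =>
    letI := fintypeVertex l
    letI := fintypeVertex r
    inferInstanceAs (Fintype (Option (l.Vertex ⊕ r.Vertex)))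

instance fintypeEnd : (m : MergeTree V) → Fintype m.End
  | leaf _ => inferInstanceAs (Fintype Unit)
  | node l r =>
    letI := fintypeEnd l
    letI := fintypeEnd r
    inferInstanceAs (Fintype (l.End ⊕ r.End))

/-- The graph in which every contraction is joined to the contraction consuming its result. -/
def graph (m : MergeTree V) : SimpleGraph m.Vertex :=
  SimpleGraph.fromRel fun x y => m.up x = some y

open Classical in
/-- The tropical type of the contraction history `node l r`, for original vertices decorated by
`q v ∈ ℤ²`. A contraction of vertices decorated by `a, b` gives a
trivalent vertex with vectors `-a`, `-b`, `a + b`. There is one unbounded incoming edge for each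
original vertex, and one unbounded outgoing edge. -/
def tropType (q : V → ℤ × ℤ) (l r : MergeTree V) : TropType where
  V := (node l r).Vertex
  E := Option (node l r).End
  fintypeV := inferInstance
  fintypeE := inferInstance
  graph := (node l r).graph
  att
    | none => (none : Option (l.Vertex ⊕ r.Vertex))
    | some e => ((node l r).endVertex e).getD (none : Option (l.Vertex ⊕ r.Vertex))
  dir x y := if (node l r).up x = some y then (node l r).outVec q x else -(node l r).outVec q y
  endDir
    | none => (node l r).total q
    | some e => -q ((node l r).endMember e)

end MergeTree

/-- The tropical types attached to `T` and the labelling `ν`, with their signs: one for each term in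
which the tree has been contracted to a single vertex (by at least one contraction). -/
def DecoratedTree.signedTypes {l₁ l₂ : ℕ} {V : Type} [Fintype V] [DecidableEq V]
    (T : DecoratedTree l₁ l₂ V) (ν : Fin (Fintype.card V) ≃ V) : List (TropType × ℤˣ) :=
  (T.residueTerms ν).filterMap fun p => match p.1 with
    | [.node l r] => some (MergeTree.tropType (fun v => (T.charge v).proj) l r, p.2)
    | _ => none

/-- The sum of the signs of the tropical types attached to `T` and `ν`. -/
def DecoratedTree.signSum {l₁ l₂ : ℕ} {V : Type} [Fintype V] [DecidableEq V]
    (T : DecoratedTree l₁ l₂ V) (ν : Fin (Fintype.card V) ≃ V) : ℤ :=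
  ((T.signedTypes ν).map fun t => (t.2 : ℤ)).sum

/-- The asymptotic size `e^{-2π|z|R} / √(|z|R)`, for `z = Z(c)`. -/
def besselRate (z : ℂ) (R : ℝ) : ℝ := Real.exp (-(2 * Real.pi * ‖z‖ * R)) / √(‖z‖ * R)

end

/-! Contour shifting. With ζ' = -e^w the ray ℝ_{<0}Z becomes the horizontal line Im w = arg Z, the
kernel ρ becomes coth of half the difference of two variables divided by 4πi, and ψ⁰ is entire in w.
It decays like exp(-2πRc cosh Re w) on a strip of angles θ for which all Re(Z e^{-iθ}) are at least
c > 0. The iterated integral of a tree is thus one absolutely convergent integral over ℝ^V,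
holomorphic in each variable apart from simple poles where adjacent vertices meet. Hence it depends
only on the order of the angles of adjacent vertices (`clusterIntegral_eq_of_order`). Letting a ray
cross that of an adjacent vertex costs one residue, 2 · 2πi / (4πi) = 1 up to sign times the
integral with the two variables identified (`integral_cothKernel_sub`, `clusterIntegral_cross`).
Contracted vertices are subtrees, so two of them are joined by at most one arrow (`Conn.unique`) and
the poles stay simple. The procedure `push` iterates this exchange identity on lists of vertices
ordered by angle (`listIntegral_swap_of_arrow`, `push_cw`, `push_ccw`); the factor (-1)^⟨α,β⟩ is the
change of the twisted product under a contraction. The outcome is the exact identity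
`residueTerms_sum`, valid for every central charge in the integrand.

The jump. Since only the order of the rays matters, the rays at τ₀ - ε and τ₀ + ε can be forgotten
once their order is known (`IsCritical.arg_lt_of_lt`, `IsCritical.arg_lt_of_gt`). What still varies
with ε is the integrand, and the integrals depend on it in a Lipschitz way, uniformly in R ≥ 1
(`clusterIntegral_lipschitz`). In the expansion for the integrand at τ₀ + ε the uncontracted part
cancels the subtracted propagator, the completely contracted terms give the sum of signs times one
single integral, and the intermediate terms, for the rescaled charge, are E₁; every replacement of a
charge by one at distance O(ε) is put into E₂. An intermediate term decays like exp(-2πRM) with M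
close to the sum of the |Z| of its vertices. As the total charge is primitive, its vertices are not
all parallel, and the strict triangle inequality allows M > |z₀| (`listValue_decay`). The leading
term tends to a Bessel integral by dominated convergence, and Laplace's method gives its size.

Tropical curves. A history of contractions is a rooted binary tree; labelling its edges by sums of
projected charges makes it balanced, and it becomes a plane curve for any choice of positive edge
lengths (`MergeTree.curve`). For ends on prescribed lines, each contraction has to take place
further along both incoming lines than the contractions before it. The lines are placed one after
the other, each so far away that finitely many inequalities hold (`Lines.Dominates`,
`Lines.exists_positions`). If the vertices are moved in the order of their lines, the rays are
contracted in the order in which the lines meet (`push_realizable`). One choice of positions serves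
all trees, because the inequalities are imposed on all histories with the given ends. -/

set_option linter.unusedSectionVars false
set_option linter.unusedSimpArgs false

/-! ### Contour shifts and the residue of the kernel in logarithmic coordinates. -/

section

open Complex MeasureTheory Filter Topology Set

/-- Shifting a horizontal contour across a strip. -/
theorem integral_line_eq_of_strip {f : ℂ → ℂ} {α β : ℝ} (h : α ≤ β) {S : Set ℂ} (hS : S.Countable)
    (hc : ∀ w : ℂ, α ≤ w.im → w.im ≤ β → ContinuousAt f w)
    (hd : ∀ w : ℂ, α ≤ w.im → w.im ≤ β → w ∉ S → DifferentiableAt ℂ f w)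
    (hα : Integrable fun t : ℝ => f (t + α * I)) (hβ : Integrable fun t : ℝ => f (t + β * I))
    {b : ℝ → ℝ} {T₀ : ℝ} (hb : Tendsto b atTop (𝓝 0))
    (hbd : ∀ w : ℂ, α ≤ w.im → w.im ≤ β → T₀ ≤ |w.re| → ‖f w‖ ≤ b |w.re|) :
    ∫ t : ℝ, f (t + α * I) = ∫ t : ℝ, f (t + β * I) := by
  have key : ∀ T : ℝ, (∫ x in (-T)..T, f (x + α * I)) - (∫ x in (-T)..T, f (x + β * I)) =
      -(I • (∫ y in α..β, f (T + y * I)) - I • ∫ y in α..β, f ((-T : ℝ) + y * I)) := by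
    intro T
    have := Complex.integral_boundary_rect_eq_zero_of_differentiable_on_off_countable f
      (⟨-T, α⟩ : ℂ) (⟨T, β⟩ : ℂ) S hS
      (fun w hw => (hc w (by
        have := hw.2; simp only [uIcc_of_le h, mem_preimage, mem_Icc] at this; exact this.1) (by
        have := hw.2; simp only [uIcc_of_le h, mem_preimage, mem_Icc] at this
        exact this.2)).continuousWithinAt)
      (fun w hw => hd w (by
        have := hw.1.2; simp only [min_eq_left h, max_eq_right h, mem_preimage, mem_Ioo] at this
        exact this.1.le) (by
        have := hw.1.2; simp only [min_eq_left h, max_eq_right h, mem_preimage, mem_Ioo] at this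
        exact this.2.le) hw.2)
    simp only at this
    linear_combination this
  have lim1 := (intervalIntegral_tendsto_integral hα tendsto_neg_atTop_atBot tendsto_id).sub
    (intervalIntegral_tendsto_integral hβ tendsto_neg_atTop_atBot tendsto_id)
  have vert : ∀ σ : ℝ, |σ| = 1 →
      Tendsto (fun T : ℝ => ∫ y in α..β, f ((σ * T : ℝ) + y * I)) atTop (𝓝 0) := by
    intro σ hσ
    have h0 : Tendsto (fun T => b T * |β - α|) atTop (𝓝 0) := by
      simpa using hb.mul_const |β - α|
    refine squeeze_zero_norm' ?_ h0
    filter_upwards [eventually_ge_atTop T₀, eventually_ge_atTop 0] with T hT hT0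
    refine intervalIntegral.norm_integral_le_of_norm_le_const fun y hy => ?_
    rw [uIoc_of_le h] at hy
    have e : |(((σ * T : ℝ) : ℂ) + y * I).re| = T := by
      simp only [add_re, ofReal_re, mul_re, I_re, mul_zero, ofReal_im, I_im, mul_one, sub_self,
        add_zero, abs_mul, hσ, one_mul, abs_of_nonneg hT0]
    have := hbd ((σ * T : ℝ) + y * I) (by simpa using hy.1.le) (by simpa using hy.2)
      (by rw [e]; exact hT)
    rwa [e] at this
  have v1 := vert 1 (by simp)
  have v2 := vert (-1) (by simp)
  simp only [one_mul, neg_mul] at v1 v2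
  have lim2 := ((v1.const_smul I).sub (v2.const_smul I)).neg
  have := tendsto_nhds_unique lim1 (lim2.congr fun T => (key T).symm)
  simpa [sub_eq_zero] using this

theorem Real.sin_sq_mul_cosh_sq_le (x y : ℝ) :
    (Real.sin y * Real.cosh x) ^ 2 ≤ Complex.normSq (Complex.sinh (x + y * I)) := by
  have e : Complex.sinh (x + y * I) = ((Real.sinh x * Real.cos y : ℝ) : ℂ) +
      ((Real.cosh x * Real.sin y : ℝ) : ℂ) * I := by
    rw [Complex.sinh_add, Complex.cosh_mul_I, Complex.sinh_mul_I]; push_cast; ring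
  rw [e, Complex.normSq_add_mul_I]
  nlinarith [sq_nonneg (Real.sinh x * Real.cos y)]

theorem Complex.abs_sin_mul_cosh_le (w : ℂ) : |Real.sin w.im| * Real.cosh w.re ≤ ‖Complex.sinh w‖ := by
  have := Real.sin_sq_mul_cosh_sq_le w.re w.im
  rw [Complex.re_add_im, Complex.normSq_eq_norm_sq] at this
  rw [← abs_of_pos (Real.cosh_pos w.re), ← abs_mul]
  exact abs_le_of_sq_le_sq this (norm_nonneg _)

theorem Complex.abs_re_le_norm_sinh (w : ℂ) : |w.re| ≤ ‖Complex.sinh w‖ := by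
  have e : Complex.sinh w = ((Real.sinh w.re * Real.cos w.im : ℝ) : ℂ) +
      ((Real.cosh w.re * Real.sin w.im : ℝ) : ℂ) * I := by
    conv_lhs => rw [← Complex.re_add_im w]
    rw [Complex.sinh_add, Complex.cosh_mul_I, Complex.sinh_mul_I]; push_cast; ring
  have h1 : |w.re| ≤ |Real.sinh w.re| := by
    rcases le_total 0 w.re with h | h
    · rw [abs_of_nonneg h, abs_of_nonneg (Real.sinh_nonneg_iff.2 h)]
      exact Real.self_le_sinh_iff.2 h
    · rw [abs_of_nonpos h, abs_of_nonpos (Real.sinh_nonpos_iff.2 h)]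
      linarith [Real.sinh_le_self_iff.2 h]
  refine h1.trans ?_
  have h2 : Real.sinh w.re ^ 2 ≤ ‖Complex.sinh w‖ ^ 2 := by
    rw [← Complex.normSq_eq_norm_sq, e, Complex.normSq_add_mul_I]
    have a := Real.sin_sq_add_cos_sq w.im
    have b := Real.cosh_sq w.re
    nlinarith [sq_nonneg (Real.sin w.im)]
  simpa using sq_le_sq.mp h2

theorem Complex.sinh_ne_zero_of_abs_im_lt_pi {u : ℂ} (h : |u.im| < Real.pi) (h0 : u ≠ 0) :
    Complex.sinh u ≠ 0 := by
  intro hs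
  by_cases him : u.im = 0
  · have := Complex.abs_re_le_norm_sinh u
    rw [hs, norm_zero] at this
    exact h0 (Complex.ext (abs_nonpos_iff.mp this) him)
  · have := Complex.abs_sin_mul_cosh_le u
    rw [hs, norm_zero] at this
    have h1 : 0 < |Real.sin u.im| := by
      rw [abs_pos]
      intro h2
      rw [Real.sin_eq_zero_iff_of_lt_of_lt (abs_lt.mp h).1 (abs_lt.mp h).2] at h2
      exact him h2
    have := mul_pos h1 (Real.cosh_pos u.re)
    linarith

theorem Real.one_add_sq_div_two_le_cosh (x : ℝ) : 1 + x ^ 2 / 2 ≤ Real.cosh x := by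
  have h1 : Real.cosh x = 1 + 2 * Real.sinh (x / 2) ^ 2 := by
    have := Real.cosh_two_mul (x / 2)
    rw [Real.cosh_sq, show 2 * (x / 2) = x by ring] at this
    linarith
  have h2 : (x / 2) ^ 2 ≤ Real.sinh (x / 2) ^ 2 := by
    rw [sq_le_sq]
    rcases le_total 0 (x / 2) with h | h
    · rw [abs_of_nonneg h, abs_of_nonneg (Real.sinh_nonneg_iff.2 h)]
      exact Real.self_le_sinh_iff.2 h
    · rw [abs_of_nonpos h, abs_of_nonpos (Real.sinh_nonpos_iff.2 h)]
      linarith [Real.sinh_le_self_iff.2 h]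
  rw [h1]; linarith

/-- On a horizontal line avoiding the poles, |sinh(t + iy)| is at least |sin y| cosh t, which grows
at least quadratically. -/
theorem integrable_inv_sinh_line {y : ℝ} (h0 : Real.sin y ≠ 0) :
    Integrable fun t : ℝ => (Complex.sinh (t + y * I))⁻¹ := by
  refine Integrable.mono' (g := fun t => 2 / |Real.sin y| * (1 + t ^ 2)⁻¹)
    (integrable_inv_one_add_sq.const_mul _) ?_ ?_
  · exact (Measurable.inv (by fun_prop)).aestronglyMeasurable
  · refine ae_of_all _ fun t => ?_
    have h1 := Complex.abs_sin_mul_cosh_le (t + y * I)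
    simp only [add_im, ofReal_im, mul_im, ofReal_re, I_im, mul_one, I_re, mul_zero, add_zero,
      zero_add, add_re, mul_re, sub_self] at h1
    have h2 := Real.one_add_sq_div_two_le_cosh t
    have hs : 0 < |Real.sin y| := abs_pos.mpr h0
    have h3 : |Real.sin y| * (1 + t ^ 2) / 2 ≤ ‖Complex.sinh (t + y * I)‖ := by
      refine le_trans ?_ h1
      nlinarith
    rw [norm_inv]
    calc ‖Complex.sinh (t + y * I)‖⁻¹ ≤ (|Real.sin y| * (1 + t ^ 2) / 2)⁻¹ := by
          apply inv_anti₀ _ h3; positivity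
      _ = _ := by field_simp

/-- A primitive of 1/sinh is log((e^w - 1)/(e^w + 1)). For 0 < Im w < π the quotient stays in the
upper half plane, so the principal branch is differentiable along the line; it runs from log(-1) =
πi, approached from above, to log 1 = 0. -/
theorem integral_inv_sinh_line {y : ℝ} (h0 : 0 < y) (h1 : y < Real.pi) :
    ∫ t : ℝ, (Complex.sinh (t + y * I))⁻¹ = -(Real.pi * I) := by
  set E : ℝ → ℂ := fun t => Complex.exp (t + y * I) with hE
  have hsin : 0 < Real.sin y := Real.sin_pos_of_pos_of_lt_pi h0 h1
  have him : ∀ t, 0 < (E t).im := by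
    intro t
    simp only [hE, Complex.exp_im, add_re, ofReal_re, mul_re, I_re, mul_zero, ofReal_im, I_im,
      mul_one, sub_self, add_zero, add_im, mul_im, zero_add]
    positivity
  have hp : ∀ t, E t + 1 ≠ 0 := fun t h => by
    have := congrArg Complex.im h; simp at this; exact (him t).ne' this
  have hm : ∀ t, E t - 1 ≠ 0 := fun t h => by
    have := congrArg Complex.im h; simp at this; exact (him t).ne' this
  have hq : ∀ t, 0 < ((E t - 1) / (E t + 1)).im := by
    intro t
    have hn : 0 < Complex.normSq (E t + 1) := Complex.normSq_pos.mpr (hp t)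
    rw [Complex.div_im]
    simp only [sub_im, one_im, sub_zero, add_re, one_re, sub_re, add_im, add_zero]
    rw [← sub_div]
    apply div_pos _ hn
    have := him t
    nlinarith
  have hdE : ∀ t, HasDerivAt E (E t) t := by
    intro t
    have h2 : HasDerivAt (fun t : ℝ => (t : ℂ) + y * I) 1 t :=
      (Complex.ofRealCLM.hasDerivAt).add_const _
    simpa using h2.cexp
  have hder : ∀ t : ℝ, HasDerivAt (fun t => Complex.log ((E t - 1) / (E t + 1)))
      ((Complex.sinh (t + y * I))⁻¹) t := by
    intro t
    have h2 := (((hdE t).sub_const 1).div ((hdE t).add_const 1) (hp t)).clog_real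
      (Or.inr (hq t).ne')
    simp only [Pi.div_apply] at h2
    refine h2.congr_deriv ?_
    have h3 : Complex.sinh (t + y * I) = (E t ^ 2 - 1) / (2 * E t) := by
      rw [Complex.sinh, Complex.exp_neg]
      change (E t - (E t)⁻¹) / 2 = _
      have : E t ≠ 0 := Complex.exp_ne_zero _
      field_simp
    rw [h3]
    have : E t ≠ 0 := Complex.exp_ne_zero _
    have h4 := hp t
    have h5 := hm t
    rw [show E t ^ 2 - 1 = (E t - 1) * (E t + 1) by ring]
    field_simp
    ring
  have hbot : Tendsto E atBot (𝓝 0) := by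
    rw [tendsto_zero_iff_norm_tendsto_zero]
    simp only [hE, Complex.norm_exp, add_re, ofReal_re, mul_re, I_re, mul_zero, ofReal_im, I_im,
      mul_one, sub_self, add_zero]
    exact Real.tendsto_exp_atBot
  have htop : Tendsto (fun t => (E t)⁻¹) atTop (𝓝 0) := by
    rw [tendsto_zero_iff_norm_tendsto_zero]
    simp only [hE, norm_inv, Complex.norm_exp, add_re, ofReal_re, mul_re, I_re, mul_zero, ofReal_im,
      I_im, mul_one, sub_self, add_zero, ← Real.exp_neg]
    exact Real.tendsto_exp_neg_atTop_nhds_zero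
  have l1 : Tendsto (fun t => Complex.log ((E t - 1) / (E t + 1))) atBot (𝓝 (Real.pi * I)) := by
    have h2 : Tendsto (fun t => (E t - 1) / (E t + 1)) atBot (𝓝 (-1)) := by
      have := (hbot.sub_const 1).div (hbot.add_const 1) (by simp)
      simp only [zero_sub, zero_add, div_one] at this
      exact this
    have h3 : Tendsto (fun t => (E t - 1) / (E t + 1)) atBot (𝓝[{z : ℂ | 0 ≤ z.im}] (-1)) :=
      tendsto_nhdsWithin_iff.mpr ⟨h2, Eventually.of_forall fun t => (hq t).le⟩
    have := (Complex.tendsto_log_nhdsWithin_im_nonneg_of_re_neg_of_im_zero (z := -1)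
      (by simp) (by simp)).comp h3
    simp only [norm_neg, norm_one, Real.log_one, ofReal_zero, zero_add] at this
    exact this
  have l2 : Tendsto (fun t => Complex.log ((E t - 1) / (E t + 1))) atTop (𝓝 0) := by
    have h2 : Tendsto (fun t => (E t - 1) / (E t + 1)) atTop (𝓝 1) := by
      have := ((htop.const_sub 1).div (htop.const_add 1) (by simp))
      simp only [sub_zero, add_zero, div_one] at this
      refine this.congr fun t => ?_
      have h6 : E t ≠ 0 := Complex.exp_ne_zero _
      have h7 := hp t
      have h8 : 1 + (E t)⁻¹ ≠ 0 := by
        intro h9; apply h7; field_simp at h9; linear_combination h9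
      simp only [Pi.div_apply]
      field_simp
    have := (continuousAt_clog (x := 1) (by simp [slitPlane])).tendsto.comp h2
    rw [Complex.log_one] at this
    exact this
  rw [integral_of_hasDerivAt_of_tendsto hder (integrable_inv_sinh_line hsin.ne') l1 l2]
  ring

theorem integral_inv_sinh_line_neg {y : ℝ} (h0 : y < 0) (h1 : -Real.pi < y) :
    ∫ t : ℝ, (Complex.sinh (t + y * I))⁻¹ = Real.pi * I := by
  rw [← integral_neg_eq_self]
  have := integral_inv_sinh_line (y := -y) (by linarith) (by linarith)
  rw [← neg_inj, ← this, ← integral_neg]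
  congr 1; ext t
  rw [← inv_neg, ← Complex.sinh_neg]; congr 2; push_cast; ring

/-- The kernel `ρ` in logarithmic coordinates, up to the factor `1 / (4 π i)`. -/
noncomputable def cothKernel (u : ℂ) : ℂ := (Complex.exp u + 1) / (Complex.exp u - 1)

/-- The kernel is coth(u/2). With denominator sinh u, its polar part can be removed by subtracting a
multiple of 1/sinh, whose line integrals are known exactly. -/
theorem cothKernel_mul_sinh {u : ℂ} (h : Complex.sinh u ≠ 0) :
    cothKernel u = (Complex.cosh u + 1) / Complex.sinh u := by
  have h0 : Complex.exp u ≠ 0 := Complex.exp_ne_zero _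
  have hs : Complex.sinh u = (Complex.exp u ^ 2 - 1) / (2 * Complex.exp u) := by
    rw [Complex.sinh, Complex.exp_neg]; field_simp
  have hc : Complex.cosh u = (Complex.exp u ^ 2 + 1) / (2 * Complex.exp u) := by
    rw [Complex.cosh, Complex.exp_neg]; field_simp
  have h1 : (Complex.exp u - 1) * (Complex.exp u + 1) ≠ 0 := by
    intro h2; apply h; rw [hs, show Complex.exp u ^ 2 - 1 = (Complex.exp u - 1) * (Complex.exp u + 1) by ring, h2]
    simp
  have h2 := left_ne_zero_of_mul h1
  have h3 := right_ne_zero_of_mul h1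
  rw [cothKernel, hs, hc, show Complex.exp u ^ 2 - 1 = (Complex.exp u - 1) * (Complex.exp u + 1) by ring]
  field_simp
  ring

/-- In coth(u/2) the numerator is at most cosh(Re u/2), and the denominator is at least |sin(Im
u/2)| cosh(Re u/2), so the growing factors cancel. The condition |Im u| ≤ π keeps Im u/2 in the
range where the sine is monotone. -/
theorem norm_cothKernel_le {u : ℂ} {y : ℝ} (hy : 0 < y) (h1 : y ≤ |u.im|) (h2 : |u.im| ≤ Real.pi) :
    Complex.exp u - 1 ≠ 0 ∧ ‖cothKernel u‖ ≤ (Real.sin (y / 2))⁻¹ := by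
  have e : u = u / 2 + u / 2 := by ring
  have h0 : Complex.exp (u / 2) ≠ 0 := Complex.exp_ne_zero _
  have him : (u / 2).im = u.im / 2 := by simp
  have hsy : 0 < Real.sin (y / 2) := Real.sin_pos_of_pos_of_lt_pi (by linarith) (by linarith [Real.pi_pos])
  have hs : Real.sin (y / 2) ≤ |Real.sin (u.im / 2)| := by
    have : |Real.sin (u.im / 2)| = Real.sin (|u.im| / 2) := by
      rcases le_total 0 u.im with h | h
      · rw [abs_of_nonneg h] at h2 ⊢
        exact abs_of_nonneg (Real.sin_nonneg_of_nonneg_of_le_pi (by linarith) (by linarith [Real.pi_pos]))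
      · rw [abs_of_nonpos h] at h2 ⊢
        rw [neg_div, Real.sin_neg]
        exact abs_of_nonpos (Real.sin_nonpos_of_nonpos_of_neg_pi_le (by linarith) (by linarith [Real.pi_pos]))
    rw [this]
    exact Real.sin_le_sin_of_le_of_le_pi_div_two (by linarith [Real.pi_pos]) (by linarith) (by linarith)
  have hsinh : Real.sin (y / 2) * Real.cosh (u / 2).re ≤ ‖Complex.sinh (u / 2)‖ := by
    refine le_trans ?_ (Complex.abs_sin_mul_cosh_le (u / 2))
    rw [him]
    exact mul_le_mul_of_nonneg_right hs (Real.cosh_pos _).le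
  have hcosh : ‖Complex.cosh (u / 2)‖ ≤ Real.cosh (u / 2).re := by
    rw [Complex.cosh, Real.cosh_eq]
    rw [norm_div]
    have := norm_add_le (Complex.exp (u / 2)) (Complex.exp (-(u / 2)))
    rw [Complex.norm_exp, Complex.norm_exp, neg_re] at this
    simp only [Complex.norm_ofNat]
    linarith
  have hpos : 0 < ‖Complex.sinh (u / 2)‖ :=
    lt_of_lt_of_le (mul_pos hsy (Real.cosh_pos _)) hsinh
  have hne : Complex.sinh (u / 2) ≠ 0 := norm_pos_iff.mp hpos
  have em : Complex.exp u - 1 = Complex.exp (u / 2) * (2 * Complex.sinh (u / 2)) := by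
    rw [Complex.two_sinh, mul_sub, ← Complex.exp_add, ← Complex.exp_add]; simp
  have ep : Complex.exp u + 1 = Complex.exp (u / 2) * (2 * Complex.cosh (u / 2)) := by
    rw [Complex.two_cosh, mul_add, ← Complex.exp_add, ← Complex.exp_add]; simp
  refine ⟨?_, ?_⟩
  · rw [em]; exact mul_ne_zero h0 (mul_ne_zero two_ne_zero hne)
  · have : cothKernel u = Complex.cosh (u / 2) / Complex.sinh (u / 2) := by
      rw [cothKernel, em, ep]; field_simp
    rw [this, norm_div, div_le_iff₀ hpos]
    refine hcosh.trans ?_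
    rw [inv_mul_eq_div, le_div_iff₀ hsy]; linarith

/-- The residue theorem for a horizontal contour crossing the simple pole of the kernel. -/
theorem integral_cothKernel_sub {f : ℂ → ℂ} {α β : ℝ} {w₀ : ℂ} (h1 : α < w₀.im) (h2 : w₀.im < β)
    (hπ : β - α < Real.pi)
    (hd : ∀ w : ℂ, α ≤ w.im → w.im ≤ β → DifferentiableAt ℂ f w)
    {b : ℝ → ℝ} (hb : Tendsto b atTop (𝓝 0)) (hbi : Integrable fun t => b |t|)
    (hbd : ∀ w : ℂ, α ≤ w.im → w.im ≤ β → ‖f w‖ ≤ b |w.re|) :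
    (∫ t : ℝ, cothKernel (t + α * I - w₀) * f (t + α * I)) -
      (∫ t : ℝ, cothKernel (t + β * I - w₀) * f (t + β * I)) = 4 * Real.pi * I * f w₀ := by
  have hw₀ := hd w₀ h1.le h2.le
  -- Subtracting 2 f(w₀) makes the numerator vanish at the pole. The quotient `h` of the two
  -- difference quotients is then regular on the whole strip, and away from w₀ it equals the
  -- integrand minus 2 f(w₀)/sinh(w - w₀). Its line integral does not change, while those of 1/sinh
  -- below and above the pole are πi and -πi; this gives 4πi f(w₀).
  set N : ℂ → ℂ := fun w => (Complex.cosh (w - w₀) + 1) * f w - 2 * f w₀ with hN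
  set Sh : ℂ → ℂ := fun w => Complex.sinh (w - w₀) with hSh
  set h : ℂ → ℂ := fun w => dslope N w₀ w / dslope Sh w₀ w with hh
  have hNd : ∀ w : ℂ, α ≤ w.im → w.im ≤ β → DifferentiableAt ℂ N w := fun w a c => by
    have := hd w a c
    simp only [hN]; fun_prop
  have hSd : Differentiable ℂ Sh := by simp only [hSh]; fun_prop
  have hN0 : N w₀ = 0 := by simp [hN]; ring
  have hS0 : Sh w₀ = 0 := by simp [hSh]
  have hSne : ∀ w : ℂ, α ≤ w.im → w.im ≤ β → w ≠ w₀ → Sh w ≠ 0 := by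
    intro w a c hw
    apply Complex.sinh_ne_zero_of_abs_im_lt_pi _ (sub_ne_zero.mpr hw)
    rw [sub_im, abs_lt]; constructor <;> linarith
  have hSlne : ∀ w : ℂ, α ≤ w.im → w.im ≤ β → dslope Sh w₀ w ≠ 0 := by
    intro w a c
    by_cases hw : w = w₀
    · subst hw
      rw [dslope_same]
      have : HasDerivAt Sh (Complex.cosh (w - w) * 1) w :=
        ((hasDerivAt_id w).sub_const w).csinh
      rw [this.deriv]; simp
    · rw [dslope_of_ne _ hw, slope_def_field, hS0, sub_zero]
      exact div_ne_zero (hSne w a c hw) (sub_ne_zero.mpr hw)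
  have heq : ∀ w : ℂ, α ≤ w.im → w.im ≤ β → w ≠ w₀ →
      h w = cothKernel (w - w₀) * f w - 2 * f w₀ * (Sh w)⁻¹ := by
    intro w a c hw
    have hs := hSne w a c hw
    simp only [hh]
    rw [dslope_of_ne _ hw, dslope_of_ne _ hw, slope_def_field, slope_def_field, hN0, hS0, sub_zero,
      sub_zero, div_div_div_cancel_right₀ (sub_ne_zero.mpr hw), cothKernel_mul_sinh hs]
    simp only [hN, hSh]
    simp only [hSh] at hs
    field_simp
  have hline : ∀ y : ℝ, α ≤ y → y ≤ β → y ≠ w₀.im →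
      Integrable (fun t : ℝ => cothKernel (t + y * I - w₀) * f (t + y * I)) ∧
      Integrable (fun t : ℝ => (Sh (t + y * I))⁻¹) := by
    intro y a c hy
    have him : ∀ t : ℝ, (t + y * I - w₀ : ℂ).im = y - w₀.im := by intro t; simp
    have hy' : 0 < |y - w₀.im| := abs_pos.mpr (sub_ne_zero.mpr hy)
    have hyp : |y - w₀.im| < Real.pi := by rw [abs_lt]; constructor <;> linarith
    constructor
    · have hfi : Integrable fun t : ℝ => f (t + y * I) := by
        refine hbi.mono' ?_ (ae_of_all _ fun t => ?_)
        · apply Continuous.aestronglyMeasurable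
          rw [continuous_iff_continuousAt]
          intro t
          have := (hd (t + y * I) (by simpa using a) (by simpa using c)).continuousAt
          exact ContinuousAt.comp (f := fun t : ℝ => (t + y * I : ℂ)) this (by fun_prop)
        · simpa using hbd (t + y * I) (by simpa using a) (by simpa using c)
      refine hfi.bdd_mul (c := (Real.sin (|y - w₀.im| / 2))⁻¹) ?_ (ae_of_all _ fun t => ?_)
      · unfold cothKernel
        exact (Measurable.div (by fun_prop) (by fun_prop)).aestronglyMeasurable
      · exact (norm_cothKernel_le hy' (by rw [him]) (by rw [him]; exact hyp.le)).2
    · have hs : Real.sin (y - w₀.im) ≠ 0 := by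
        intro h0
        rw [Real.sin_eq_zero_iff_of_lt_of_lt (abs_lt.mp hyp).1 (abs_lt.mp hyp).2] at h0
        exact hy (sub_eq_zero.mp h0)
      have := (integrable_inv_sinh_line hs).comp_sub_right w₀.re
      refine this.congr (ae_of_all _ fun t => ?_)
      simp only [hSh]
      congr 2
      apply Complex.ext <;> simp
  have hval : ∀ y : ℝ, y ≠ w₀.im → α ≤ y → y ≤ β →
      ∫ t : ℝ, h (t + y * I) = (∫ t : ℝ, cothKernel (t + y * I - w₀) * f (t + y * I)) -
        2 * f w₀ * ∫ t : ℝ, (Complex.sinh (t + (y - w₀.im : ℝ) * I))⁻¹ := by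
    intro y hy a c
    have e2 : ∫ t : ℝ, (Complex.sinh (t + (y - w₀.im : ℝ) * I))⁻¹ = ∫ t : ℝ, (Sh (t + y * I))⁻¹ := by
      rw [← integral_sub_right_eq_self _ w₀.re]
      congr 1; ext t; simp only [hSh]
      congr 2
      apply Complex.ext <;> simp
    rw [e2, ← integral_const_mul, ← integral_sub (hline y a c hy).1 ((hline y a c hy).2.const_mul _)]
    congr 1; ext t
    apply heq
    · simpa using a
    · simpa using c
    · intro e; apply hy; rw [← e]; simp
  have hint : ∀ y : ℝ, y ≠ w₀.im → α ≤ y → y ≤ β → Integrable fun t : ℝ => h (t + y * I) := by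
    intro y hy a c
    refine ((hline y a c hy).1.sub ((hline y a c hy).2.const_mul (2 * f w₀))).congr
      (ae_of_all _ fun t => ?_)
    refine (heq _ ?_ ?_ ?_).symm
    · simpa using a
    · simpa using c
    · intro e; apply hy; rw [← e]; simp
  have hab : α ≤ β := (h1.trans h2).le
  have main := integral_line_eq_of_strip (f := h) hab (S := {w₀}) (countable_singleton _)
    (fun w a c => by
      apply ContinuousAt.div _ _ (hSlne w a c)
      · by_cases hw : w = w₀
        · rw [hw, continuousAt_dslope_same]; exact hNd w₀ h1.le h2.le
        · exact (continuousAt_dslope_of_ne hw).mpr (hNd w a c).continuousAt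
      · by_cases hw : w = w₀
        · rw [hw, continuousAt_dslope_same]; exact hSd w₀
        · exact (continuousAt_dslope_of_ne hw).mpr (hSd w).continuousAt)
    (fun w a c hw => by
      apply DifferentiableAt.div _ _ (hSlne w a c)
      · exact (differentiableAt_dslope_of_ne hw).mpr (hNd w a c)
      · exact (differentiableAt_dslope_of_ne hw).mpr (hSd w))
    (hint α h1.ne le_rfl hab) (hint β h2.ne' hab le_rfl)
    -- At distance at least 2 in the real direction, |cosh| ≤ |sinh| + 1 bounds the kernel by 4, and
    -- |sinh| is at least the real distance from the pole. Decay like 1/x is enough, since the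
    -- vertical sides of the rectangle have fixed length.
    (b := fun x => 4 * b x + 2 * ‖f w₀‖ * (x - |w₀.re|)⁻¹) (T₀ := |w₀.re| + 2)
    (by
      have t1 : Tendsto (fun x : ℝ => (x - |w₀.re|)⁻¹) atTop (𝓝 0) :=
        tendsto_inv_atTop_zero.comp (tendsto_atTop_add_const_right _ _ tendsto_id)
      simpa using (hb.const_mul 4).add (t1.const_mul (2 * ‖f w₀‖)))
    (fun w a c hw => by
      have hre : 2 ≤ |(w - w₀).re| := by
        rw [sub_re]; have := abs_sub_abs_le_abs_sub w.re w₀.re; linarith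
      have hre2 : |w.re| - |w₀.re| ≤ |(w - w₀).re| := by
        rw [sub_re]; exact abs_sub_abs_le_abs_sub w.re w₀.re
      have hne : w ≠ w₀ := by rintro rfl; simp at hre; linarith
      rw [heq w a c hne]
      have hs1 := Complex.abs_re_le_norm_sinh (w - w₀)
      have hk : ‖cothKernel (w - w₀)‖ ≤ 4 := by
        rw [cothKernel_mul_sinh (hSne w a c hne), norm_div]
        have hs2 : (0:ℝ) < ‖Complex.sinh (w - w₀)‖ := by linarith
        rw [div_le_iff₀ hs2]
        have h3 : ‖Complex.cosh (w - w₀)‖ ^ 2 ≤ (‖Complex.sinh (w - w₀)‖ + 1) ^ 2 := by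
          rw [← norm_pow, Complex.cosh_sq]
          calc _ ≤ ‖Complex.sinh (w - w₀) ^ 2‖ + ‖(1:ℂ)‖ := norm_add_le _ _
            _ ≤ _ := by rw [norm_pow, norm_one]; nlinarith
        have h4 := abs_le_of_sq_le_sq h3 (by linarith)
        have := norm_add_le (Complex.cosh (w - w₀)) 1
        rw [norm_one] at this
        linarith [le_abs_self ‖Complex.cosh (w - w₀)‖]
      refine (norm_sub_le _ _).trans (add_le_add ?_ ?_)
      · rw [norm_mul]
        exact mul_le_mul hk (hbd w a c) (norm_nonneg _) (by norm_num)
      · rw [norm_mul, norm_mul, norm_inv, Complex.norm_ofNat]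
        refine mul_le_mul_of_nonneg_left ?_ (by positivity)
        apply inv_anti₀ (by linarith)
        exact hre2.trans hs1)
  rw [hval α h1.ne le_rfl hab, hval β h2.ne' hab le_rfl,
    integral_inv_sinh_line_neg (by linarith) (by linarith),
    integral_inv_sinh_line (by linarith) (by linarith)] at main
  linear_combination main

end

/-! ### Fubini with auxiliary variables; integrands of clustered trees and their integrability. -/

section

open Complex MeasureTheory Filter Topology Set

/-! Auxiliary variables are integrated against a probability density. -/

/-- A probability density on the line, for auxiliary variables. -/
noncomputable def auxDensity (x : ℝ) : ℝ := Real.exp (-1 * x ^ 2) / √(Real.pi / 1)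

theorem auxDensity_nonneg (x : ℝ) : 0 ≤ auxDensity x := by unfold auxDensity; positivity

theorem integrable_auxDensity : Integrable auxDensity :=
  (integrable_exp_neg_mul_sq one_pos).div_const _

theorem integral_auxDensity : ∫ x, auxDensity x = 1 := by
  unfold auxDensity
  rw [integral_div, integral_gaussian, div_self]
  positivity

theorem measurable_auxDensity : Measurable auxDensity := by unfold auxDensity; fun_prop

theorem integral_auxDensity_ofReal : ∫ x, (auxDensity x : ℂ) = 1 := by
  rw [integral_complex_ofReal, integral_auxDensity, ofReal_one]

section Fubini

variable {V : Type} [Fintype V] [DecidableEq V]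

/-- Separating one coordinate. -/
noncomputable def piSplit (i : V) : (V → ℝ) ≃ᵐ ℝ × ({j // ¬ j = i} → ℝ) :=
  (MeasurableEquiv.piEquivPiSubtypeProd (fun _ => ℝ) (· = i)).trans
    (MeasurableEquiv.prodCongr (MeasurableEquiv.funUnique {j // j = i} ℝ) (MeasurableEquiv.refl _))

theorem measurePreserving_piSplit (i : V) : MeasurePreserving (piSplit i) := by
  have h1 := volume_preserving_piEquivPiSubtypeProd (fun _ : V => ℝ) (· = i)
  have h2 := (volume_preserving_funUnique {j // j = i} ℝ).prod
    (MeasurePreserving.id (volume : Measure ({j // ¬ j = i} → ℝ)))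
  refine h2.comp ?_
  convert h1
  · rfl
  · rw [Measure.volume_eq_prod]
    congr!

theorem piSplit_symm_fst (i : V) (t : ℝ) (y) : (piSplit i).symm (t, y) i = t := by
  simp [piSplit, MeasurableEquiv.prodCongr, Equiv.piEquivPiSubtypeProd, MeasurableEquiv.piEquivPiSubtypeProd]

theorem update_piSplit_symm (i : V) (t t' : ℝ) (y) :
    Function.update ((piSplit i).symm (t', y)) i t = (piSplit i).symm (t, y) := by
  ext j
  by_cases h : j = i
  · subst h; rw [Function.update_self, piSplit_symm_fst]
  · rw [Function.update_of_ne h]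
    simp [piSplit, MeasurableEquiv.prodCongr, Equiv.piEquivPiSubtypeProd,
      MeasurableEquiv.piEquivPiSubtypeProd, h]

/-- The integrated variable is reintroduced with a probability density, so that all integrals stay
on the same space V → ℝ even after contractions have removed variables. -/
theorem integrable_integral_update (i : V) {F : (V → ℝ) → ℂ} (hF : Integrable F) :
    Integrable (fun s : V → ℝ => (auxDensity (s i) : ℂ) * ∫ t, F (Function.update s i t)) ∧
      ∫ s, F s = ∫ s : V → ℝ, (auxDensity (s i) : ℂ) * ∫ t, F (Function.update s i t) := by
  have hm := (measurePreserving_piSplit i).symm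
  have hF' : Integrable (fun p : ℝ × ({j // ¬ j = i} → ℝ) => F ((piSplit i).symm p)) :=
    (hm.integrable_comp_emb (piSplit i).symm.measurableEmbedding).mpr hF
  have hF'' := hF'.swap.integral_prod_left
  simp only [Function.comp_def, Prod.swap, Prod.fst, Prod.snd] at hF''
  have e : ∀ p : ℝ × ({j // ¬ j = i} → ℝ),
      (auxDensity ((piSplit i).symm p i) : ℂ) *
        ∫ t, F (Function.update ((piSplit i).symm p) i t) =
      (auxDensity p.1 : ℂ) * ∫ t, F ((piSplit i).symm (t, p.2)) := by
    rintro ⟨t', y⟩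
    rw [piSplit_symm_fst]
    simp_rw [update_piSplit_symm]
  have hG : Integrable (fun p : ℝ × ({j // ¬ j = i} → ℝ) =>
      (auxDensity p.1 : ℂ) * ∫ t, F ((piSplit i).symm (t, p.2))) :=
    integrable_auxDensity.ofReal.mul_prod hF''
  constructor
  · rw [← hm.integrable_comp_emb (piSplit i).symm.measurableEmbedding]
    exact hG.congr (ae_of_all _ fun p => (e p).symm)
  · rw [← hm.integral_comp', ← hm.integral_comp']
    simp_rw [e]
    have h1 : ∫ p : ℝ × ({j // ¬ j = i} → ℝ), F ((piSplit i).symm p) =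
        ∫ y, ∫ t, F ((piSplit i).symm (t, y)) := by
      exact integral_prod_symm _ hF'
    have h2 := integral_prod_mul (μ := (volume : Measure ℝ))
      (ν := (volume : Measure ({j // ¬ j = i} → ℝ))) (fun t : ℝ => (auxDensity t : ℂ))
      (fun y => ∫ t, F ((piSplit i).symm (t, y)))
    rw [h1]
    rw [integral_auxDensity_ofReal, one_mul] at h2
    exact h2.symm

end Fubini

/-! Integrands in logarithmic coordinates. -/

/-- Points of a ray ℝ_{<0}Z are -e^w with Im w = arg Z. The kernel only sees the difference of the
logarithms. -/
theorem rhoKernel_neg_exp (a b : ℂ) :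
    rhoKernel (-Complex.exp a) (-Complex.exp b) = 1 / (4 * Real.pi * I) * cothKernel (b - a) := by
  unfold rhoKernel cothKernel
  congr 1
  have h : Complex.exp a ≠ 0 := Complex.exp_ne_zero a
  rw [Complex.exp_sub]
  have : -Complex.exp b + -Complex.exp a = -(Complex.exp a * (Complex.exp b / Complex.exp a + 1)) := by
    field_simp; ring
  rw [this]
  have : -Complex.exp b - -Complex.exp a = -(Complex.exp a * (Complex.exp b / Complex.exp a - 1)) := by
    field_simp; ring
  rw [this, neg_div_neg_eq, mul_div_mul_left _ _ h]

theorem norm_psiZero_neg_exp (R : ℝ) (z w : ℂ) :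
    ‖psiZero R z (-Complex.exp w)‖ =
      Real.exp (-(2 * Real.pi * R * (z * Complex.exp (-(w.im * I))).re * Real.cosh w.re)) := by
  unfold psiZero
  rw [Complex.norm_exp]
  congr 1
  have h1 : (-Complex.exp w)⁻¹ * z + -Complex.exp w * (starRingEnd ℂ) z =
      -(Complex.exp (-w) * z + Complex.exp w * (starRingEnd ℂ) z) := by
    rw [Complex.exp_neg, inv_neg]; ring
  rw [h1, ← ofReal_mul, Complex.re_ofReal_mul, Real.cosh_eq]
  simp only [neg_re, add_re, mul_re, Complex.exp_re, Complex.exp_im, conj_re, conj_im, neg_im,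
    ofReal_re, ofReal_im, I_re, I_im, mul_im, Real.cos_neg, Real.sin_neg, mul_zero, mul_one, sub_zero,
    add_zero, neg_zero, Real.exp_zero, zero_mul, one_mul]
  ring

theorem differentiable_psiZero_neg_exp (R : ℝ) (z : ℂ) :
    Differentiable ℂ fun w => psiZero R z (-Complex.exp w) := by
  unfold psiZero
  intro w
  have h : -Complex.exp w ≠ 0 := neg_ne_zero.mpr (Complex.exp_ne_zero w)
  have h2 : DifferentiableAt ℂ (fun w => (-Complex.exp w)⁻¹) w :=
    DifferentiableAt.inv (by fun_prop) h
  fun_prop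

theorem differentiableAt_cothKernel {u : ℂ} (h : Complex.exp u - 1 ≠ 0) :
    DifferentiableAt ℂ cothKernel u := by
  unfold cothKernel
  exact DifferentiableAt.div (by fun_prop) (by fun_prop) h

/-- The data of an iterated integral: a forest, the values of the central charge,
the radius and the external variable. -/
structure RayData (V : Type) where
  parent : V → Option V
  z : V → ℂ
  R : ℝ
  ζ : ℂ

/-- The external variable keeps away from rays with angles between `lo` and `hi`. -/
def Away (ζ : ℂ) (lo hi : ℝ) : Prop :=
  ∃ C : ℝ, ∀ w : ℂ, lo ≤ w.im → w.im ≤ hi →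
    -Complex.exp w ≠ ζ ∧ ‖rhoKernel ζ (-Complex.exp w)‖ ≤ C

namespace RayData

variable {V : Type} [Fintype V] [DecidableEq V]

/-- The kernel attached to the arrow into `v`, if the vertices are clustered by `cl`. -/
noncomputable def edge (P : RayData V) (cl : V → V) (w : V → ℂ) (v : V) : ℂ :=
  match P.parent v with
  | none => rhoKernel P.ζ (-Complex.exp (w (cl v)))
  | some p => if cl p = cl v then 1
      else rhoKernel (-Complex.exp (w (cl p))) (-Complex.exp (w (cl v)))

theorem edge_none {P : RayData V} {cl : V → V} {w : V → ℂ} {v : V} (h : P.parent v = none) :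
    P.edge cl w v = rhoKernel P.ζ (-Complex.exp (w (cl v))) := by
  unfold edge; rw [h]

theorem edge_some {P : RayData V} {cl : V → V} {w : V → ℂ} {v p : V} (h : P.parent v = some p) :
    P.edge cl w v = if cl p = cl v then 1
      else rhoKernel (-Complex.exp (w (cl p))) (-Complex.exp (w (cl v))) := by
  unfold edge; rw [h]

noncomputable def psiProd (P : RayData V) (cl : V → V) (w : V → ℂ) : ℂ :=
  ∏ v, psiZero P.R (P.z v) (-Complex.exp (w (cl v)))

/-- The integrand for vertices clustered by `cl`. -/
noncomputable def integrand (P : RayData V) (cl : V → V) (w : V → ℂ) : ℂ :=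
  P.psiProd cl w * ∏ v, P.edge cl w v

/-- The density of the variables which do not represent clusters. -/
noncomputable def aux (cl : V → V) (s : V → ℝ) : ℂ :=
  ∏ v, if cl v = v then 1 else (auxDensity (s v) : ℂ)

/-- The integral for vertices clustered by `cl`, over the rays with logarithms `a`. -/
noncomputable def clusterIntegral (P : RayData V) (cl : V → V) (a : V → ℂ) : ℂ :=
  ∫ s : V → ℝ, P.integrand cl (fun v => s v + a v) * aux cl s

/-- The real and imaginary parts of a logarithmic variable are the position along a ray and the
angle of the ray; `lo` and `hi` bound the angles. The field `half` puts all central charges into a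
common open half plane with respect to every admissible angle, which yields the decay of the
integrand. -/
structure Regular (P : RayData V) (lo hi : ℝ) : Prop where
  R_pos : 0 < P.R
  lt_pi : hi - lo < Real.pi
  half : ∃ c : ℝ, 0 < c ∧ ∀ v, ∀ θ : ℝ, lo ≤ θ → θ ≤ hi → c ≤ (P.z v * Complex.exp (-(θ * I))).re
  away : Away P.ζ lo hi

/-- Only `a (cl v)`, the logarithm attached to the representative, enters the integral. The field
`sep` keeps adjacent clusters on different rays, so that the integrand has no pole; rays of
non-adjacent clusters may coincide. -/
structure Adm (P : RayData V) (lo hi : ℝ) (cl : V → V) (a : V → ℂ) : Prop where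
  idem : ∀ v, cl (cl v) = cl v
  lo_le : ∀ v, lo ≤ (a v).im
  le_hi : ∀ v, (a v).im ≤ hi
  sep : ∀ v p, P.parent v = some p → cl p ≠ cl v → (a (cl p)).im ≠ (a (cl v)).im

theorem exists_norm_edge_le {P : RayData V} {lo hi : ℝ} {cl : V → V} {a : V → ℂ}
    (hπ : hi - lo < Real.pi) (hζ : Away P.ζ lo hi) (h : P.Adm lo hi cl a) (v : V) :
    ∃ C, 0 ≤ C ∧ ∀ s : V → ℝ, ‖P.edge cl (fun v => s v + a v) v‖ ≤ C := by
  rcases hp : P.parent v with _ | p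
  · obtain ⟨C, hC⟩ := hζ
    refine ⟨max C 0, le_max_right _ _, fun s => ?_⟩
    rw [edge_none hp]
    exact (hC _ (by simpa using h.lo_le _) (by simpa using h.le_hi _)).2.trans (le_max_left _ _)
  · by_cases hc : cl p = cl v
    · refine ⟨1, zero_le_one, fun s => ?_⟩
      rw [edge_some hp, if_pos hc, norm_one]
    · set y := |(a (cl v)).im - (a (cl p)).im| with hy
      have hy0 : 0 < y := abs_pos.mpr (sub_ne_zero.mpr (h.sep v p hp hc).symm)
      have hyπ : y ≤ Real.pi := by
        rw [hy, abs_le]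
        constructor <;> linarith [h.lo_le (cl v), h.lo_le (cl p), h.le_hi (cl v), h.le_hi (cl p)]
      have hs : 0 < Real.sin (y / 2) :=
        Real.sin_pos_of_pos_of_lt_pi (by linarith) (by linarith [Real.pi_pos])
      refine ⟨‖(1 / (4 * Real.pi * I) : ℂ)‖ * (Real.sin (y / 2))⁻¹, by positivity, fun s => ?_⟩
      rw [edge_some hp, if_neg hc, rhoKernel_neg_exp, norm_mul]
      refine mul_le_mul_of_nonneg_left ?_ (norm_nonneg _)
      exact (norm_cothKernel_le hy0 (by simp [hy]) (by simpa [hy] using hyπ)).2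

/-- The decay of the integrand. -/
theorem norm_psiProd_le {P : RayData V} {lo hi c : ℝ} {cl : V → V} {w : V → ℂ} (hR : 0 < P.R)
    (hc : ∀ v, ∀ θ : ℝ, lo ≤ θ → θ ≤ hi → c ≤ (P.z v * Complex.exp (-(θ * I))).re)
    (h1 : ∀ v, lo ≤ (w (cl v)).im) (h2 : ∀ v, (w (cl v)).im ≤ hi) :
    ‖P.psiProd cl w‖ ≤ Real.exp (-(2 * Real.pi * P.R * c * ∑ v, Real.cosh (w (cl v)).re)) := by
  unfold psiProd
  rw [norm_prod, Finset.mul_sum, ← Finset.sum_neg_distrib, Real.exp_sum]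
  refine Finset.prod_le_prod (fun _ _ => norm_nonneg _) fun v _ => ?_
  rw [norm_psiZero_neg_exp]
  apply Real.exp_le_exp.mpr
  apply neg_le_neg
  have := hc v _ (h1 v) (h2 v)
  have := Real.cosh_pos (w (cl v)).re
  have := Real.pi_pos
  gcongr

end RayData

theorem integrable_exp_neg_cosh {c : ℝ} (hc : 0 < c) (x₀ : ℝ) :
    Integrable fun x : ℝ => Real.exp (-(c * Real.cosh (x + x₀))) := by
  have h : Integrable fun x : ℝ => Real.exp (-(c * Real.cosh x)) := by
    refine (integrable_exp_neg_mul_sq (b := c / 2) (by linarith)).mono' ?_ (ae_of_all _ fun x => ?_)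
    · exact (Measurable.aestronglyMeasurable (by fun_prop))
    · rw [Real.norm_eq_abs, Real.abs_exp]
      apply Real.exp_le_exp.mpr
      nlinarith [Real.one_add_sq_div_two_le_cosh x]
  exact h.comp_add_right x₀

theorem tendsto_exp_neg_cosh {c : ℝ} (hc : 0 < c) :
    Tendsto (fun x : ℝ => Real.exp (-(c * Real.cosh x))) atTop (𝓝 0) := by
  refine Real.tendsto_exp_neg_atTop_nhds_zero.comp (Tendsto.const_mul_atTop hc ?_)
  refine tendsto_atTop_mono (f := fun x => x) (fun x => ?_) tendsto_id
  nlinarith [Real.one_add_sq_div_two_le_cosh x, sq_nonneg (x - 1)]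

namespace RayData

variable {V : Type} [Fintype V] [DecidableEq V]

/-- A product bound for the integrand. -/
noncomputable def majorant (c : ℝ) (cl : V → V) (a : V → ℂ) (s : V → ℝ) : ℝ :=
  ∏ v, if cl v = v then Real.exp (-(c * Real.cosh (s v + (a v).re))) else auxDensity (s v)

theorem integrable_majorant {c : ℝ} (hc : 0 < c) (cl : V → V) (a : V → ℂ) :
    Integrable (majorant c cl a) := by
  unfold majorant
  refine Integrable.fintype_prod (f := fun v x => if cl v = v then
    Real.exp (-(c * Real.cosh (x + (a v).re))) else auxDensity x) fun v => ?_
  by_cases h : cl v = v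
  · simp only [h, if_true]; exact integrable_exp_neg_cosh hc _
  · simp only [h, if_false]; exact integrable_auxDensity

theorem norm_aux (cl : V → V) (s : V → ℝ) :
    ‖aux cl s‖ = ∏ v, if cl v = v then 1 else auxDensity (s v) := by
  unfold aux
  rw [norm_prod]
  refine Finset.prod_congr rfl fun v _ => ?_
  split_ifs
  · simp
  · rw [Complex.norm_real, Real.norm_eq_abs, abs_of_nonneg (auxDensity_nonneg _)]

/-- Only the variables of representatives are needed for the decay. -/
theorem exp_mul_norm_aux_le {c : ℝ} (hc : 0 < c) {cl : V → V} (a : V → ℂ) (s : V → ℝ) :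
    Real.exp (-(c * ∑ v, Real.cosh ((s (cl v) + a (cl v) : ℂ)).re)) * ‖aux cl s‖ ≤
      majorant c cl a s := by
  have h1 : ∑ v, (if cl v = v then Real.cosh (s v + (a v).re) else 0) ≤
      ∑ v, Real.cosh ((s (cl v) + a (cl v) : ℂ)).re := by
    refine Finset.sum_le_sum fun v _ => ?_
    split_ifs with h
    · rw [h]; simp
    · exact (Real.cosh_pos _).le
  calc _ ≤ Real.exp (-(c * ∑ v, (if cl v = v then Real.cosh (s v + (a v).re) else 0))) *
        ‖aux cl s‖ := by
        refine mul_le_mul_of_nonneg_right (Real.exp_le_exp.mpr ?_) (norm_nonneg _)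
        nlinarith
    _ = majorant c cl a s := by
        rw [norm_aux, majorant, Finset.mul_sum, ← Finset.sum_neg_distrib, Real.exp_sum,
          ← Finset.prod_mul_distrib]
        refine Finset.prod_congr rfl fun v _ => ?_
        split_ifs <;> simp

theorem measurable_edge (P : RayData V) (cl : V → V) (a : V → ℂ) (v : V) :
    Measurable fun s : V → ℝ => P.edge cl (fun v => s v + a v) v := by
  rcases hp : P.parent v with _ | p
  · simp only [edge_none hp]
    unfold rhoKernel
    exact (Measurable.div (by fun_prop) (by fun_prop)).const_mul _
  · simp only [edge_some hp]
    split_ifs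
    · fun_prop
    · unfold rhoKernel
      exact (Measurable.div (by fun_prop) (by fun_prop)).const_mul _

theorem measurable_aux (cl : V → V) : Measurable (aux cl) := by
  unfold aux
  refine Finset.measurable_fun_prod _ fun v _ => ?_
  split_ifs
  · fun_prop
  · exact Complex.measurable_ofReal.comp (measurable_auxDensity.comp (measurable_pi_apply v))

theorem measurable_psiProd (P : RayData V) (cl : V → V) (a : V → ℂ) :
    Measurable fun s : V → ℝ => P.psiProd cl (fun v => s v + a v) := by
  unfold psiProd psiZero
  refine Finset.measurable_fun_prod _ fun v _ => ?_
  have h : Measurable fun s : V → ℝ => (-Complex.exp (s (cl v) + a (cl v)))⁻¹ :=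
    Measurable.inv (by fun_prop)
  fun_prop

theorem measurable_integrand (P : RayData V) (cl : V → V) (a : V → ℂ) :
    Measurable fun s : V → ℝ => P.integrand cl (fun v => s v + a v) * aux cl s := by
  have h1 := P.measurable_psiProd cl a
  have h2 : Measurable fun s : V → ℝ => ∏ v, P.edge cl (fun v => s v + a v) v :=
    Finset.measurable_fun_prod _ fun v _ => P.measurable_edge cl a v
  exact (h1.mul h2).mul (measurable_aux cl)

/-- All kernels are bounded because adjacent rays make a positive angle, below π. The exponentials
decay in the variables of the representatives, and the densities take care of the others. -/
theorem integrable_integrand {P : RayData V} {lo hi : ℝ} {cl : V → V} {a : V → ℂ}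
    (hP : P.Regular lo hi) (h : P.Adm lo hi cl a) :
    Integrable fun s : V → ℝ => P.integrand cl (fun v => s v + a v) * aux cl s := by
  obtain ⟨c, hc0, hc⟩ := hP.half
  choose C hC0 hC using fun v => exists_norm_edge_le hP.lt_pi hP.away h v
  have hk : 0 < 2 * Real.pi * P.R * c := by have := hP.R_pos; have := Real.pi_pos; positivity
  refine ((integrable_majorant hk cl a).const_mul (∏ v, C v)).mono'
    (measurable_integrand P cl a).aestronglyMeasurable (ae_of_all _ fun s => ?_)
  unfold integrand
  rw [norm_mul, norm_mul, mul_comm ‖P.psiProd _ _‖, mul_assoc]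
  refine mul_le_mul ?_ ?_ (by positivity) (Finset.prod_nonneg fun v _ => hC0 v)
  · rw [norm_prod]
    exact Finset.prod_le_prod (fun _ _ => norm_nonneg _) fun v _ => hC v s
  · refine le_trans ?_ (exp_mul_norm_aux_le hk a s)
    refine mul_le_mul_of_nonneg_right ?_ (norm_nonneg _)
    exact norm_psiProd_le hP.R_pos hc (fun v => by simpa using h.lo_le _)
      (fun v => by simpa using h.le_hi _)

end RayData

end

/-! ### Moving one ray: holomorphy in a single variable and the crossing formula. -/

section

open Complex MeasureTheory Filter Topology Set

namespace RayData

variable {V : Type} [Fintype V] [DecidableEq V]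

/-- Holomorphic and bounded on a strip. -/
def StripBdd (α β : ℝ) (f : ℂ → ℂ) : Prop :=
  ∃ C : ℝ, 0 ≤ C ∧ ∀ w : ℂ, α ≤ w.im → w.im ≤ β → DifferentiableAt ℂ f w ∧ ‖f w‖ ≤ C

theorem StripBdd.const (α β : ℝ) (c : ℂ) : StripBdd α β fun _ => c :=
  ⟨‖c‖, norm_nonneg _, fun _ _ _ => ⟨by fun_prop, le_rfl⟩⟩

theorem stripBdd_rhoKernel {lo hi α β : ℝ} {u : ℂ} (hπ : hi - lo < Real.pi) (hu : lo ≤ u.im)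
    (hu' : u.im ≤ hi) (h1 : lo ≤ α) (h2 : β ≤ hi) (h3 : u.im < α ∨ β < u.im) :
    StripBdd α β (fun w => rhoKernel (-Complex.exp w) (-Complex.exp u)) ∧
      StripBdd α β (fun w => rhoKernel (-Complex.exp u) (-Complex.exp w)) := by
  obtain ⟨y, hy0, hy⟩ : ∃ y : ℝ, 0 < y ∧ ∀ w : ℂ, α ≤ w.im → w.im ≤ β → y ≤ |w.im - u.im| := by
    rcases h3 with h | h
    · refine ⟨α - u.im, by linarith, fun w a b => ?_⟩
      rw [abs_of_nonneg (by linarith)]; linarith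
    · refine ⟨u.im - β, by linarith, fun w a b => ?_⟩
      rw [abs_of_nonpos (by linarith)]; linarith
  have hle : ∀ w : ℂ, α ≤ w.im → w.im ≤ β → |w.im - u.im| ≤ Real.pi := fun w a b => by
    rw [abs_le]; constructor <;> linarith
  simp only [rhoKernel_neg_exp]
  have key : ∀ w : ℂ, α ≤ w.im → w.im ≤ β →
      (Complex.exp (u - w) - 1 ≠ 0 ∧ ‖cothKernel (u - w)‖ ≤ (Real.sin (y / 2))⁻¹) ∧
      (Complex.exp (w - u) - 1 ≠ 0 ∧ ‖cothKernel (w - u)‖ ≤ (Real.sin (y / 2))⁻¹) := by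
    intro w a b
    constructor
    · apply norm_cothKernel_le hy0
      · rw [sub_im, abs_sub_comm]; exact hy w a b
      · rw [sub_im, abs_sub_comm]; exact hle w a b
    · apply norm_cothKernel_le hy0
      · rw [sub_im]; exact hy w a b
      · rw [sub_im]; exact hle w a b
  by_cases hne : α ≤ β
  swap
  · exact ⟨⟨0, le_rfl, fun w a b => absurd (a.trans b) hne⟩,
      ⟨0, le_rfl, fun w a b => absurd (a.trans b) hne⟩⟩
  have hs : 0 ≤ (Real.sin (y / 2))⁻¹ :=
    (norm_nonneg _).trans (key ⟨0, α⟩ le_rfl hne).1.2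
  constructor
  · refine ⟨‖(1 / (4 * Real.pi * I) : ℂ)‖ * (Real.sin (y / 2))⁻¹, by positivity, fun w a b => ⟨?_, ?_⟩⟩
    · refine DifferentiableAt.const_mul ?_ _
      exact (differentiableAt_cothKernel (key w a b).1.1).comp w
        (f := fun w => u - w) (by fun_prop)
    · rw [norm_mul]; exact mul_le_mul_of_nonneg_left (key w a b).1.2 (norm_nonneg _)
  · refine ⟨‖(1 / (4 * Real.pi * I) : ℂ)‖ * (Real.sin (y / 2))⁻¹, by positivity, fun w a b => ⟨?_, ?_⟩⟩
    · refine DifferentiableAt.const_mul ?_ _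
      exact (differentiableAt_cothKernel (key w a b).2.1).comp w
        (f := fun w => w - u) (by fun_prop)
    · rw [norm_mul]; exact mul_le_mul_of_nonneg_left (key w a b).2.2 (norm_nonneg _)

theorem stripBdd_edge {P : RayData V} {lo hi α β : ℝ} {cl : V → V} {w : V → ℂ} {i v : V}
    (hP : P.Regular lo hi) (hw : ∀ u, lo ≤ (w u).im) (hw' : ∀ u, (w u).im ≤ hi)
    (h1 : lo ≤ α) (h2 : β ≤ hi)
    (hE : ∀ p, P.parent v = some p → cl p ≠ cl v →
      (cl p = i → (w (cl v)).im < α ∨ β < (w (cl v)).im) ∧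
      (cl v = i → (w (cl p)).im < α ∨ β < (w (cl p)).im)) :
    StripBdd α β fun x => P.edge cl (Function.update w i x) v := by
  rcases hp : P.parent v with _ | p
  · simp only [edge_none hp]
    by_cases hv : cl v = i
    · simp only [hv, Function.update_self]
      obtain ⟨C, hC⟩ := hP.away
      refine ⟨max C 0, le_max_right _ _, fun x a b => ?_⟩
      have hx := hC x (h1.trans a) (b.trans h2)
      refine ⟨?_, hx.2.trans (le_max_left _ _)⟩
      unfold rhoKernel
      refine DifferentiableAt.const_mul (DifferentiableAt.div (by fun_prop) (by fun_prop) ?_) _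
      exact sub_ne_zero.mpr hx.1
    · simp only [Function.update_of_ne hv]
      exact StripBdd.const _ _ _
  · simp only [edge_some hp]
    by_cases hc : cl p = cl v
    · simp only [hc, if_true]; exact StripBdd.const _ _ _
    · simp only [hc, if_false]
      by_cases hv : cl v = i
      · have hpi : cl p ≠ i := fun h => hc (h.trans hv.symm)
        simp only [hv, Function.update_self, Function.update_of_ne hpi]
        exact (stripBdd_rhoKernel hP.lt_pi (hw _) (hw' _) h1 h2 ((hE p hp hc).2 hv)).2
      · by_cases hpi : cl p = i
        · simp only [hpi, Function.update_self, Function.update_of_ne hv]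
          exact (stripBdd_rhoKernel hP.lt_pi (hw _) (hw' _) h1 h2 ((hE p hp hc).1 hpi)).1
        · simp only [Function.update_of_ne hv, Function.update_of_ne hpi]
          exact StripBdd.const _ _ _

theorem StripBdd.prod {α β : ℝ} {ι : Type} (E : Finset ι) {f : ι → ℂ → ℂ}
    (h : ∀ v ∈ E, StripBdd α β (f v)) : StripBdd α β fun w => ∏ v ∈ E, f v w := by
  classical
  induction E using Finset.induction_on with
  | empty => simpa using StripBdd.const α β 1
  | insert v E hv ih =>
    obtain ⟨C, hC0, hC⟩ := h v (Finset.mem_insert_self _ _)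
    obtain ⟨C', hC0', hC'⟩ := ih fun u hu => h u (Finset.mem_insert_of_mem hu)
    refine ⟨C * C', by positivity, fun w a b => ?_⟩
    simp only [Finset.prod_insert hv]
    refine ⟨(hC w a b).1.mul (hC' w a b).1, ?_⟩
    rw [norm_mul]
    exact mul_le_mul (hC w a b).2 (hC' w a b).2 (norm_nonneg _) hC0

/-- As a function of one variable, the integrand is holomorphic and decays. -/
theorem slice_psiProd {P : RayData V} {lo hi α β : ℝ} {cl : V → V} {w : V → ℂ} {i : V}
    (hP : P.Regular lo hi) (hi' : cl i = i) (hw : ∀ u, lo ≤ (w u).im) (hw' : ∀ u, (w u).im ≤ hi)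
    (h1 : lo ≤ α) (h2 : β ≤ hi) :
    ∃ k : ℝ, 0 < k ∧ ∀ x : ℂ, α ≤ x.im → x.im ≤ β →
      DifferentiableAt ℂ (fun x => P.psiProd cl (Function.update w i x)) x ∧
      ‖P.psiProd cl (Function.update w i x)‖ ≤ Real.exp (-(k * Real.cosh x.re)) := by
  obtain ⟨c, hc0, hc⟩ := hP.half
  have hR := hP.R_pos
  refine ⟨2 * Real.pi * P.R * c, by positivity, fun x a b => ⟨?_, ?_⟩⟩
  · unfold psiProd
    refine DifferentiableAt.fun_finsetProd fun v _ => ?_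
    by_cases hv : cl v = i
    · simp only [hv, Function.update_self]
      exact differentiable_psiZero_neg_exp _ _ x
    · simp only [Function.update_of_ne hv]; fun_prop
  · have hb : ∀ v, lo ≤ (Function.update w i x v).im ∧ (Function.update w i x v).im ≤ hi := by
      intro v
      by_cases hv : v = i
      · subst hv; simp only [Function.update_self]; exact ⟨h1.trans a, b.trans h2⟩
      · simp only [Function.update_of_ne hv]; exact ⟨hw v, hw' v⟩
    refine (norm_psiProd_le hP.R_pos hc (fun v => (hb _).1) (fun v => (hb _).2)).trans ?_
    apply Real.exp_le_exp.mpr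
    apply neg_le_neg
    refine mul_le_mul_of_nonneg_left ?_ (by positivity)
    have := Finset.single_le_sum (f := fun v => Real.cosh (Function.update w i x (cl v)).re)
      (fun v _ => (Real.cosh_pos _).le) (Finset.mem_univ i)
    simpa [hi'] using this

/-- The set `E` of arrows is a parameter so that the one arrow producing a pole can be left out when
a ray is crossed; every other neighbour of the moving cluster has its ray outside the strip. -/
theorem slice_bound {P : RayData V} {lo hi α β : ℝ} {cl : V → V} {w : V → ℂ} {i : V}
    (hP : P.Regular lo hi) (hi' : cl i = i) (hw : ∀ u, lo ≤ (w u).im) (hw' : ∀ u, (w u).im ≤ hi)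
    (h1 : lo ≤ α) (h2 : β ≤ hi) (E : Finset V)
    (hE : ∀ v ∈ E, ∀ p, P.parent v = some p → cl p ≠ cl v →
      (cl p = i → (w (cl v)).im < α ∨ β < (w (cl v)).im) ∧
      (cl v = i → (w (cl p)).im < α ∨ β < (w (cl p)).im)) :
    ∃ k C : ℝ, 0 < k ∧ 0 ≤ C ∧ ∀ x : ℂ, α ≤ x.im → x.im ≤ β →
      DifferentiableAt ℂ (fun x => P.psiProd cl (Function.update w i x) *
        ∏ v ∈ E, P.edge cl (Function.update w i x) v) x ∧
      ‖P.psiProd cl (Function.update w i x) * ∏ v ∈ E, P.edge cl (Function.update w i x) v‖ ≤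
        C * Real.exp (-(k * Real.cosh |x.re|)) := by
  obtain ⟨k, hk, hpsi⟩ := slice_psiProd (cl := cl) (w := w) hP hi' hw hw' h1 h2
  obtain ⟨C, hC0, hC⟩ := StripBdd.prod (α := α) (β := β) E fun v hv =>
    stripBdd_edge (cl := cl) (w := w) (i := i) hP hw hw' h1 h2 (hE v hv)
  refine ⟨k, C, hk, hC0, fun x a b => ⟨(hpsi x a b).1.mul (hC x a b).1, ?_⟩⟩
  rw [norm_mul, mul_comm, Real.cosh_abs]
  exact mul_le_mul (hC x a b).2 (hpsi x a b).2 (norm_nonneg _) hC0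

theorem aux_update {cl : V → V} {i : V} (hi' : cl i = i) (s : V → ℝ) (t : ℝ) :
    aux cl (Function.update s i t) = aux cl s := by
  unfold aux
  refine Finset.prod_congr rfl fun v _ => ?_
  by_cases hv : v = i
  · subst hv; simp [hi']
  · rw [Function.update_of_ne hv]

theorem update_add (s : V → ℝ) (a : V → ℂ) (i : V) (t : ℝ) (b : ℂ) :
    (fun v => (Function.update s i t v : ℂ) + Function.update a i b v) =
      Function.update (fun v => (s v : ℂ) + a v) i (t + b) := by
  ext v
  by_cases hv : v = i
  · subst hv; simp
  · simp [Function.update_of_ne hv]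

/-- The real part of a logarithm is absorbed by translating the variable; only the angle of a ray
matters. -/
theorem integral_add_eq_line (f : ℂ → ℂ) (b : ℂ) :
    ∫ t : ℝ, f (t + b) = ∫ t : ℝ, f (t + b.im * I) := by
  rw [← integral_add_right_eq_self (fun t : ℝ => f (t + b.im * I)) b.re]
  congr 1; ext t; congr 1
  apply Complex.ext <;> simp

theorem integral_slice {P : RayData V} {cl : V → V} {i : V} (hi' : cl i = i) (s : V → ℝ)
    (a : V → ℂ) (b : ℂ) :
    ∫ t : ℝ, P.integrand cl (fun v => (Function.update s i t v : ℂ) + Function.update a i b v) *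
        aux cl (Function.update s i t) =
      (∫ t : ℝ, P.integrand cl (Function.update (fun v => (s v : ℂ) + a v) i (t + b.im * I))) *
        aux cl s := by
  simp_rw [aux_update hi', update_add]
  rw [integral_mul_const,
    integral_add_eq_line (fun x => P.integrand cl (Function.update (fun v => (s v : ℂ) + a v) i x))]

/-- This isolates the variable of the moving cluster. The outer integral has the same form for every
position `b` of the ray, so two positions can be compared pointwise in the remaining variables. -/
theorem clusterIntegral_eq_slice {P : RayData V} {lo hi : ℝ} {cl : V → V} {a : V → ℂ} {i : V} {b : ℂ}
    (hP : P.Regular lo hi) (hi' : cl i = i) (h : P.Adm lo hi cl (Function.update a i b)) :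
    Integrable (fun s : V → ℝ => (auxDensity (s i) : ℂ) *
      ((∫ t : ℝ, P.integrand cl (Function.update (fun v => (s v : ℂ) + a v) i (t + b.im * I))) *
        aux cl s)) ∧
    P.clusterIntegral cl (Function.update a i b) = ∫ s : V → ℝ, (auxDensity (s i) : ℂ) *
      ((∫ t : ℝ, P.integrand cl (Function.update (fun v => (s v : ℂ) + a v) i (t + b.im * I))) *
        aux cl s) := by
  have := integrable_integral_update i (integrable_integrand hP h)
  simp_rw [integral_slice hi'] at this
  exact this

/-- The integral only depends on the rays of representatives. -/
theorem clusterIntegral_update_of_ne {P : RayData V} {cl : V → V} {i : V}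
    (hi' : ∀ v, cl v ≠ i) (a : V → ℂ) (b : ℂ) :
    P.clusterIntegral cl (Function.update a i b) = P.clusterIntegral cl a := by
  unfold clusterIntegral integrand psiProd
  congr 1; ext s
  congr 2
  · refine Finset.prod_congr rfl fun v _ => ?_
    simp only [Function.update_of_ne (hi' v)]
  · refine Finset.prod_congr rfl fun v _ => ?_
    rcases hp : P.parent v with _ | p
    · simp only [edge_none hp, Function.update_of_ne (hi' v)]
    · simp only [edge_some hp, Function.update_of_ne (hi' v), Function.update_of_ne (hi' p)]

/-- Moving a ray without crossing rays of adjacent vertices. -/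
theorem clusterIntegral_move_le {P : RayData V} {lo hi : ℝ} {cl : V → V} {a : V → ℂ} {i : V} {b b' : ℂ}
    (hP : P.Regular lo hi) (hi' : cl i = i) (h : P.Adm lo hi cl (Function.update a i b))
    (h' : P.Adm lo hi cl (Function.update a i b')) (hb : b.im ≤ b'.im)
    (hE : ∀ v p, P.parent v = some p → cl p ≠ cl v →
      (cl p = i → (a (cl v)).im < b.im ∨ b'.im < (a (cl v)).im) ∧
      (cl v = i → (a (cl p)).im < b.im ∨ b'.im < (a (cl p)).im)) :
    P.clusterIntegral cl (Function.update a i b) = P.clusterIntegral cl (Function.update a i b') := by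
  rw [(clusterIntegral_eq_slice hP hi' h).2, (clusterIntegral_eq_slice hP hi' h').2]
  congr 1; ext s
  congr 2
  set w : V → ℂ := Function.update (fun v => (s v : ℂ) + a v) i (b : ℂ) with hw
  have hup : ∀ x, Function.update (fun v => (s v : ℂ) + a v) i x = Function.update w i x := by
    intro x; rw [hw, Function.update_idem]
  simp_rw [hup]
  have hwim : ∀ u, (w u).im = (Function.update a i b u).im := by
    intro u
    by_cases hu : u = i
    · subst hu; simp [hw]
    · simp [hw, Function.update_of_ne hu]
  have hlo : lo ≤ b.im := by simpa using h.lo_le i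
  have hhi : b'.im ≤ hi := by simpa using h'.le_hi i
  obtain ⟨k, C, hk, hC, hs⟩ := slice_bound (cl := cl) (w := w) (i := i) (α := b.im) (β := b'.im)
    hP hi' (fun u => by rw [hwim]; exact h.lo_le u) (fun u => by rw [hwim]; exact h.le_hi u) hlo hhi
    Finset.univ (fun v _ p hp hc => ⟨fun e => by
      have hv : cl v ≠ i := fun e' => hc (e.trans e'.symm)
      rw [hwim, Function.update_of_ne hv]; exact (hE v p hp hc).1 e, fun e => by
      have hv : cl p ≠ i := fun e' => hc (e'.trans e.symm)
      rw [hwim, Function.update_of_ne hv]; exact (hE v p hp hc).2 e⟩)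
  have hint : ∀ y : ℝ, b.im ≤ y → y ≤ b'.im →
      Integrable fun t : ℝ => P.integrand cl (Function.update w i (t + y * I)) := by
    intro y h1 h2
    have hi0 := (integrable_exp_neg_cosh hk 0).const_mul C
    simp only [add_zero] at hi0
    refine hi0.mono' ?_ (ae_of_all _ fun t => ?_)
    · apply Continuous.aestronglyMeasurable
      rw [continuous_iff_continuousAt]
      intro t
      have := (hs (t + y * I) (by simpa using h1) (by simpa using h2)).1.continuousAt
      exact ContinuousAt.comp (f := fun t : ℝ => (t + y * I : ℂ)) this (by fun_prop)
    · have := (hs (t + y * I) (by simpa using h1) (by simpa using h2)).2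
      simpa [Real.cosh_abs, integrand] using this
  exact integral_line_eq_of_strip hb (S := ∅) countable_empty
    (fun x h1 h2 => (hs x h1 h2).1.continuousAt) (fun x h1 h2 _ => (hs x h1 h2).1)
    (hint _ le_rfl hb) (hint _ hb le_rfl) (T₀ := 0)
    (b := fun x => C * Real.exp (-(k * Real.cosh x)))
    (by simpa using (tendsto_exp_neg_cosh hk).const_mul C)
    (fun x h1 h2 _ => (hs x h1 h2).2)

/-- Moving a ray clockwise across the ray of one adjacent vertex. -/
theorem clusterIntegral_cross {P : RayData V} {lo hi : ℝ} {cl : V → V} {a : V → ℂ} {i h v₀ p₀ : V}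
    {b b' : ℂ} {ε : ℂ}
    (hP : P.Regular lo hi) (hi' : cl i = i) (hh : cl h = h) (hih : i ≠ h)
    (hA : P.Adm lo hi cl (Function.update a i b)) (hA' : P.Adm lo hi cl (Function.update a i b'))
    (hb : b.im < (a h).im) (hb' : (a h).im < b'.im)
    (hp₀ : P.parent v₀ = some p₀)
    (hε : (cl v₀ = i ∧ cl p₀ = h ∧ ε = 1) ∨ (cl v₀ = h ∧ cl p₀ = i ∧ ε = -1))
    (huniq : ∀ v p, P.parent v = some p → (cl v = i ∧ cl p = h) ∨ (cl v = h ∧ cl p = i) → v = v₀)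
    (hE : ∀ v p, P.parent v = some p → cl p ≠ cl v →
      (cl p = i → cl v ≠ h → (a (cl v)).im < b.im ∨ b'.im < (a (cl v)).im) ∧
      (cl v = i → cl p ≠ h → (a (cl p)).im < b.im ∨ b'.im < (a (cl p)).im)) :
    P.clusterIntegral cl (Function.update a i b) - P.clusterIntegral cl (Function.update a i b') =
      ε * P.clusterIntegral (fun v => if cl v = i then h else cl v) a := by
  obtain ⟨i1, e1⟩ := clusterIntegral_eq_slice hP hi' hA
  obtain ⟨i2, e2⟩ := clusterIntegral_eq_slice hP hi' hA'
  rw [e1, e2, ← integral_sub i1 i2]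
  unfold clusterIntegral
  rw [← integral_const_mul]
  congr 1; ext s
  rw [← mul_sub, ← sub_mul]
  set w : V → ℂ := Function.update (fun v => (s v : ℂ) + a v) i (b : ℂ) with hw
  have hup : ∀ x, Function.update (fun v => (s v : ℂ) + a v) i x = Function.update w i x := by
    intro x; rw [hw, Function.update_idem]
  have hwne : ∀ u, u ≠ i → w u = s u + a u := fun u hu => by simp [hw, Function.update_of_ne hu]
  simp_rw [hup]
  have hwim : ∀ u, (w u).im = (Function.update a i b u).im := by
    intro u
    by_cases hu : u = i
    · subst hu; simp [hw]
    · simp [hw, Function.update_of_ne hu]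
  have hlo : lo ≤ b.im := by simpa using hA.lo_le i
  have hhi : b'.im ≤ hi := by simpa using hA'.le_hi i
  have hwh : (w h).im = (a h).im := by rw [hwim, Function.update_of_ne hih.symm]
  -- Without the factor of the arrow `v₀` the integrand is holomorphic on the whole strip, including
  -- the line of the crossed ray: by uniqueness no other arrow joins the two clusters.
  obtain ⟨k, C, hk, hC, hs⟩ := slice_bound (cl := cl) (w := w) (i := i) (α := b.im) (β := b'.im)
    hP hi' (fun u => by rw [hwim]; exact hA.lo_le u) (fun u => by rw [hwim]; exact hA.le_hi u) hlo hhi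
    (Finset.univ.erase v₀) (fun v hv p hp hc => ⟨fun e => by
      have hvi : cl v ≠ i := fun e' => hc (e.trans e'.symm)
      rw [hwim, Function.update_of_ne hvi]
      exact (hE v p hp hc).1 e fun e' => (Finset.ne_of_mem_erase hv) (huniq v p hp (Or.inr ⟨e', e⟩)),
      fun e => by
      have hvi : cl p ≠ i := fun e' => hc (e'.trans e.symm)
      rw [hwim, Function.update_of_ne hvi]
      exact (hE v p hp hc).2 e fun e' => (Finset.ne_of_mem_erase hv) (huniq v p hp (Or.inl ⟨e, e'⟩))⟩)
  set f : ℂ → ℂ := fun x => P.psiProd cl (Function.update w i x) *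
    ∏ v ∈ Finset.univ.erase v₀, P.edge cl (Function.update w i x) v with hf
  have hbi : Integrable fun t : ℝ => C * Real.exp (-(k * Real.cosh |t|)) := by
    have := (integrable_exp_neg_cosh hk 0).const_mul C
    simpa [Real.cosh_abs] using this
  have res := integral_cothKernel_sub (f := f) (w₀ := w h) (α := b.im) (β := b'.im)
    (by rw [hwh]; exact hb) (by rw [hwh]; exact hb') (by linarith [hP.lt_pi])
    (fun x h1 h2 => (hs x h1 h2).1) (b := fun x => C * Real.exp (-(k * Real.cosh x)))
    (by simpa using (tendsto_exp_neg_cosh hk).const_mul C) hbi (fun x h1 h2 => (hs x h1 h2).2)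
  have hcne : cl p₀ ≠ cl v₀ := by
    rcases hε with ⟨e1, e2, _⟩ | ⟨e1, e2, _⟩
    · rw [e1, e2]; exact hih.symm
    · rw [e1, e2]; exact hih
  have hπI : (4 * Real.pi * I : ℂ) ≠ 0 := by
    simp [Real.pi_ne_zero]
  -- The moving variable is the second argument of ρ if the moving cluster is the child, and the
  -- first if it is the parent. As coth is odd, this is the source of the sign ε.
  have hsplit : ∀ x, P.integrand cl (Function.update w i x) =
      ε * (1 / (4 * Real.pi * I)) * (cothKernel (x - w h) * f x) := by
    intro x
    unfold integrand
    rw [← Finset.mul_prod_erase _ _ (Finset.mem_univ v₀), edge_some hp₀, if_neg hcne]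
    have hodd : ∀ u, cothKernel (-u) = -cothKernel u := by
      intro u
      unfold cothKernel
      rw [Complex.exp_neg]
      have h0 : Complex.exp u ≠ 0 := Complex.exp_ne_zero u
      rw [← mul_div_mul_left _ _ h0, ← div_neg]
      congr 1
      · field_simp; ring
      · field_simp; ring
    rcases hε with ⟨e1, e2, rfl⟩ | ⟨e1, e2, rfl⟩
    · rw [e1, e2, Function.update_self, Function.update_of_ne hih.symm, rhoKernel_neg_exp]
      simp only [hf]; ring
    · rw [e1, e2, Function.update_self, Function.update_of_ne hih.symm, rhoKernel_neg_exp,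
        ← neg_sub x (w h), hodd]
      simp only [hf]; ring
  simp_rw [hsplit]
  rw [integral_const_mul, integral_const_mul, ← mul_sub, res]
  -- At the pole both clusters have the same variable. The arrow `v₀` has become internal and
  -- contributes 1, and by uniqueness no other arrow becomes internal.
  have hmerge : f (w h) = P.integrand (fun v => if cl v = i then h else cl v)
      (fun v => (s v : ℂ) + a v) := by
    have hcl : ∀ v, Function.update w i (w h) (cl v) =
        (s (if cl v = i then h else cl v) : ℂ) + a (if cl v = i then h else cl v) := by
      intro v
      by_cases hv : cl v = i
      · rw [if_pos hv, hv, Function.update_self, hwne h hih.symm]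
      · rw [if_neg hv, Function.update_of_ne hv, hwne _ hv]
    simp only [hf, integrand, psiProd]
    congr 1
    · refine Finset.prod_congr rfl fun v _ => ?_
      rw [hcl]
    · rw [← Finset.mul_prod_erase _ _ (Finset.mem_univ v₀), edge_some hp₀, if_pos, one_mul]
      · refine Finset.prod_congr rfl fun v hv => ?_
        rcases hp : P.parent v with _ | p
        · rw [edge_none hp, edge_none hp, hcl]
        · rw [edge_some hp, edge_some hp, hcl, hcl]
          refine if_congr ?_ rfl rfl
          have hv0 := Finset.ne_of_mem_erase hv
          by_cases c1 : cl v = i <;> by_cases c2 : cl p = i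
          · simp [c1, c2]
          · simp only [c1, c2, if_true, if_false]
            exact ⟨fun e => e.elim, fun e => absurd (huniq v p hp (Or.inl ⟨c1, e⟩)) hv0⟩
          · simp only [c1, c2, if_true, if_false]
            exact ⟨fun e => absurd e.symm c1,
              fun e => absurd (huniq v p hp (Or.inr ⟨e.symm, c2⟩)) hv0⟩
          · simp [c1, c2]
      · rcases hε with ⟨e1, e2, _⟩ | ⟨e1, e2, _⟩
        · rw [if_pos e1, e2, if_neg hih.symm]
        · rw [if_pos e2, e1, if_neg hih.symm]
  -- After the contraction `i` no longer represents a cluster, and the density it acquires is the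
  -- one that Fubini has left in place of its variable.
  have haux : aux (fun v => if cl v = i then h else cl v) s = (auxDensity (s i) : ℂ) * aux cl s := by
    unfold aux
    rw [← Finset.mul_prod_erase _ _ (Finset.mem_univ i), ← Finset.mul_prod_erase Finset.univ
      (fun v => if cl v = v then (1:ℂ) else (auxDensity (s v) : ℂ)) (Finset.mem_univ i)]
    simp only [hi', if_true, if_neg hih.symm, one_mul]
    congr 1
    refine Finset.prod_congr rfl fun v hv => ?_
    have hv0 := Finset.ne_of_mem_erase hv
    by_cases c1 : cl v = i
    · simp only [c1, if_true, if_neg hv0.symm]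
      by_cases c2 : h = v
      · exfalso; rw [← c2, hh] at c1; exact hih c1.symm
      · rw [if_neg c2]
    · simp only [c1, if_false]
  rw [hmerge, haux]
  field_simp

end RayData

end

/-! ### Dependence on the order of the rays only; comparison with iterated integrals. -/

section

open Complex MeasureTheory Filter Topology Set

namespace RayData

variable {V : Type} [Fintype V] [DecidableEq V]

/-- Two clusters are joined by an arrow. -/
def Nbr (P : RayData V) (cl : V → V) (u u' : V) : Prop :=
  ∃ v p, P.parent v = some p ∧ cl p ≠ cl v ∧ ((cl p = u ∧ cl v = u') ∨ (cl p = u' ∧ cl v = u))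

theorem Nbr.symm {P : RayData V} {cl : V → V} {u u' : V} (h : P.Nbr cl u u') : P.Nbr cl u' u := by
  obtain ⟨v, p, hp, hc, h⟩ := h
  exact ⟨v, p, hp, hc, h.symm⟩

theorem adm_iff_nbr {P : RayData V} {cl : V → V} {a : V → ℂ} :
    (∀ v p, P.parent v = some p → cl p ≠ cl v → (a (cl p)).im ≠ (a (cl v)).im) ↔
      ∀ u u', P.Nbr cl u u' → (a u).im ≠ (a u').im := by
  constructor
  · rintro h u u' ⟨v, p, hp, hc, ⟨rfl, rfl⟩ | ⟨rfl, rfl⟩⟩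
    · exact h v p hp hc
    · exact (h v p hp hc).symm
  · intro h v p hp hc
    exact h _ _ ⟨v, p, hp, hc, Or.inl ⟨rfl, rfl⟩⟩

theorem Adm.nbr {P : RayData V} {lo hi : ℝ} {cl : V → V} {a : V → ℂ} (h : P.Adm lo hi cl a)
    {u u' : V} (hn : P.Nbr cl u u') : (a u).im ≠ (a u').im :=
  adm_iff_nbr.mp h.sep _ _ hn

/-- The rays are raised one at a time. Among those not yet in place, the one with the largest final
angle is moved: a neighbour above it must already be in place, hence lies above the final angle, and
a neighbour below it stays below. So nothing adjacent is crossed. -/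
theorem clusterIntegral_eq_of_le {P : RayData V} {lo hi : ℝ} {cl : V → V} {b : V → ℂ}
    (hP : P.Regular lo hi) (hb : P.Adm lo hi cl b) (n : ℕ) :
    ∀ a : V → ℂ, (Finset.univ.filter fun v => a v ≠ b v).card = n → P.Adm lo hi cl a →
      (∀ v, (a v).im ≤ (b v).im) →
      (∀ u u', P.Nbr cl u u' → (a u).im < (a u').im → (b u).im < (b u').im) →
      P.clusterIntegral cl a = P.clusterIntegral cl b := by
  induction n with
  | zero =>
    intro a hn _ _ _
    rw [Finset.card_eq_zero, Finset.filter_eq_empty_iff] at hn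
    congr 1; ext v
    exact not_not.mp (hn (Finset.mem_univ v))
  | succ n ih =>
    intro a hn ha hle hcomp
    have hne : (Finset.univ.filter fun v => a v ≠ b v).Nonempty := by
      rw [← Finset.card_pos]; omega
    obtain ⟨i, hi0, hmax⟩ := Finset.exists_max_image _ (fun v => (b v).im) hne
    have hidiff : a i ≠ b i := (Finset.mem_filter.mp hi0).2
    have dich : ∀ j, P.Nbr cl i j → ((a j).im < (a i).im ∧ (b j).im < (b i).im) ∨
        ((b i).im < (a j).im ∧ (b i).im < (b j).im) := by
      intro j hj
      rcases lt_or_gt_of_ne (ha.nbr hj) with h | h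
      · have h2 := hcomp _ _ hj h
        by_cases hjb : a j = b j
        · right; rw [hjb]; exact ⟨h2, h2⟩
        · have := hmax j (Finset.mem_filter.mpr ⟨Finset.mem_univ _, hjb⟩)
          linarith
      · exact Or.inl ⟨h, hcomp _ _ hj.symm h⟩
    have nbr_ne : ∀ {u u'}, P.Nbr cl u u' → u ≠ u' := by
      rintro u u' ⟨v, p, hp, hc, ⟨rfl, rfl⟩ | ⟨rfl, rfl⟩⟩
      · exact hc
      · exact hc.symm
    have hadm : P.Adm lo hi cl (Function.update a i (b i)) := by
      refine ⟨ha.idem, fun v => ?_, fun v => ?_, adm_iff_nbr.mpr fun u u' hn => ?_⟩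
      · by_cases hv : v = i
        · subst hv; simpa using hb.lo_le v
        · simpa [Function.update_of_ne hv] using ha.lo_le v
      · by_cases hv : v = i
        · subst hv; simpa using hb.le_hi v
        · simpa [Function.update_of_ne hv] using ha.le_hi v
      · have hne' := nbr_ne hn
        by_cases hu : u = i
        · subst hu
          rw [Function.update_self, Function.update_of_ne hne'.symm]
          rcases dich _ hn with h | h
          · have := hle u; exact ne_of_gt (by linarith [h.1])
          · exact h.1.ne
        · by_cases hu' : u' = i
          · subst hu'
            rw [Function.update_self, Function.update_of_ne hu]
            rcases dich _ hn.symm with h | h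
            · have := hle u'; exact ne_of_lt (by linarith [h.1])
            · exact h.1.ne'
          · rw [Function.update_of_ne hu, Function.update_of_ne hu']
            exact ha.nbr hn
    have step : P.clusterIntegral cl a = P.clusterIntegral cl (Function.update a i (b i)) := by
      by_cases hci : cl i = i
      · have h0 : Function.update a i (a i) = a := Function.update_eq_self _ _
        have := clusterIntegral_move_le (a := a) (b := a i) (b' := b i) hP hci (by rwa [h0]) hadm (hle i)
          (fun v p hp hc =>
            ⟨fun e => (dich (cl v) ⟨v, p, hp, hc, Or.inl ⟨e, rfl⟩⟩).imp And.left And.left,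
            fun e => (dich (cl p) ⟨v, p, hp, hc, Or.inr ⟨rfl, e⟩⟩).imp And.left And.left⟩)
        rwa [h0] at this
      · refine (clusterIntegral_update_of_ne (fun v e => hci ?_) a (b i)).symm
        rw [← e, ha.idem]
    rw [step]
    refine ih _ ?_ hadm ?_ ?_
    · have : (Finset.univ.filter fun v => Function.update a i (b i) v ≠ b v) =
          (Finset.univ.filter fun v => a v ≠ b v).erase i := by
        ext v
        by_cases hv : v = i
        · subst hv; simp
        · simp [Function.update_of_ne hv, hv]
      rw [this, Finset.card_erase_of_mem hi0, hn]; rfl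
    · intro v
      by_cases hv : v = i
      · subst hv; simp
      · rw [Function.update_of_ne hv]; exact hle v
    · intro u u' hn h
      have hne' := nbr_ne hn
      by_cases hu : u = i
      · subst hu
        rw [Function.update_self, Function.update_of_ne hne'.symm] at h
        rcases dich _ hn with h1 | h1
        · linarith [hle u, h1.1]
        · exact h1.2
      · by_cases hu' : u' = i
        · subst hu'
          rw [Function.update_self, Function.update_of_ne hu] at h
          rcases dich _ hn.symm with h1 | h1
          · exact h1.2
          · linarith [h1.1]
        · rw [Function.update_of_ne hu, Function.update_of_ne hu'] at h
          exact hcomp _ _ hn h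

/-- The integral only depends on the order of the rays of adjacent clusters. -/
theorem clusterIntegral_eq_of_order {P : RayData V} {lo hi : ℝ} {cl : V → V} {a b : V → ℂ}
    (hP : P.Regular lo hi) (ha : P.Adm lo hi cl a) (hb : P.Adm lo hi cl b)
    (hcomp : ∀ u u', P.Nbr cl u u' → (a u).im < (a u').im → (b u).im < (b u').im) :
    P.clusterIntegral cl a = P.clusterIntegral cl b := by
  -- The pointwise maximum of the two configurations has the same order on neighbours and lies above
  -- both, so each is raised to it.
  set m : V → ℂ := fun v => ((max (a v).im (b v).im : ℝ) : ℂ) * I with hm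
  have him : ∀ v, (m v).im = max (a v).im (b v).im := fun v => by simp [hm]
  have hm1 : ∀ u u', P.Nbr cl u u' → (a u).im < (a u').im → (m u).im < (m u').im := by
    intro u u' hn h
    rw [him, him]
    exact max_lt_max h (hcomp u u' hn h)
  have hadm : P.Adm lo hi cl m := by
    refine ⟨ha.idem, fun v => ?_, fun v => ?_, adm_iff_nbr.mpr fun u u' hn => ?_⟩
    · rw [him]; exact (ha.lo_le v).trans (le_max_left _ _)
    · rw [him]; exact max_le (ha.le_hi v) (hb.le_hi v)
    · rcases lt_or_gt_of_ne (ha.nbr hn) with h | h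
      · exact (hm1 _ _ hn h).ne
      · exact (hm1 _ _ hn.symm h).ne'
  rw [clusterIntegral_eq_of_le hP hadm _ a rfl ha (fun v => by rw [him]; exact le_max_left _ _) hm1,
    clusterIntegral_eq_of_le hP hadm _ b rfl hb (fun v => by rw [him]; exact le_max_right _ _)]
  intro u u' hn h
  rcases lt_or_gt_of_ne (ha.nbr hn) with h1 | h1
  · exact hm1 _ _ hn h1
  · exact absurd (hcomp _ _ hn.symm h1) (not_lt.mpr h.le)

end RayData

/-! Iterated integrals. -/

/-- Iterated integration over the variables in a list. -/
noncomputable def iterInt {V : Type} [DecidableEq V] : List V → ((V → ℝ) → ℂ) → (V → ℝ) → ℂ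
  | [], F, s => F s
  | v :: l, F, s => ∫ t : ℝ, iterInt l F (Function.update s v t)

theorem iterInt_mul_left {V : Type} [DecidableEq V] {c F : (V → ℝ) → ℂ} {l : List V}
    (hc : ∀ v ∈ l, ∀ s t, c (Function.update s v t) = c s) (s : V → ℝ) :
    iterInt l (fun s => c s * F s) s = c s * iterInt l F s := by
  induction l generalizing s with
  | nil => rfl
  | cons v l ih =>
    simp only [iterInt]
    simp_rw [ih fun u hu => hc u (List.mem_cons_of_mem _ hu), hc v (List.mem_cons_self ..)]
    exact integral_const_mul _ _

/-- Fubini, one variable after the other. The densities of the integrated variables accumulate as a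
product, so the iterated integral is still averaged over the whole space. -/
theorem integral_eq_iterInt {V : Type} [Fintype V] [DecidableEq V] {F : (V → ℝ) → ℂ}
    (hF : Integrable F) {l : List V} (hl : l.Nodup) :
    Integrable (fun s : V → ℝ => (∏ v ∈ l.toFinset, (auxDensity (s v) : ℂ)) * iterInt l F s) ∧
      ∫ s, F s = ∫ s : V → ℝ, (∏ v ∈ l.toFinset, (auxDensity (s v) : ℂ)) * iterInt l F s := by
  induction l with
  | nil => simpa [iterInt] using hF
  | cons i l ih =>
    rw [List.nodup_cons] at hl
    obtain ⟨h1, h2⟩ := ih hl.2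
    have h3 := integrable_integral_update i h1
    have e : ∀ s : V → ℝ, (auxDensity (s i) : ℂ) *
        ∫ t, (∏ v ∈ l.toFinset, (auxDensity (Function.update s i t v) : ℂ)) *
          iterInt l F (Function.update s i t) =
        (∏ v ∈ (i :: l).toFinset, (auxDensity (s v) : ℂ)) * iterInt (i :: l) F s := by
      intro s
      have hp : ∀ t, (∏ v ∈ l.toFinset, (auxDensity (Function.update s i t v) : ℂ)) =
          ∏ v ∈ l.toFinset, (auxDensity (s v) : ℂ) := fun t =>
        Finset.prod_congr rfl fun v hv => by
          rw [Function.update_of_ne]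
          rintro rfl; exact hl.1 (List.mem_toFinset.mp hv)
      simp_rw [hp]
      rw [integral_const_mul, List.toFinset_cons, Finset.prod_insert (by simpa using hl.1)]
      simp only [iterInt]
      ring
    simp_rw [e] at h3
    exact ⟨h3.1, h2.trans h3.2⟩

section Convert

variable {ι : Type} [Fintype ι] [DecidableEq ι]

/-- The fuel only has to exceed the depth of the subtree; `N` minus the rank bounds that depth,
because the rank increases along arrows. -/
theorem iteratedIntegral_fuel {par : ι → Option ι} {rank : ι → ℕ}
    (hr : ∀ i j, par j = some i → rank i < rank j) (z ray : ι → ℂ) (R : ℝ) {N : ℕ} (k k' : ℕ) (i : ι)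
    (ζ : ℂ) (hN : rank i < N) (hN' : ∀ j, rank j < N) (h : N ≤ rank i + k) (h' : N ≤ rank i + k') :
    iteratedIntegral par z ray R k i ζ = iteratedIntegral par z ray R k' i ζ := by
  induction k generalizing k' i ζ with
  | zero => omega
  | succ k ih =>
    obtain _ | k' := k'
    · omega
    · simp only [iteratedIntegral]
      congr 1; ext t
      congr 1
      refine Finset.prod_congr rfl fun w hw => ?_
      have := hr _ _ (Finset.mem_filter.mp hw).2
      exact ih k' w _ (hN' w) (by omega) (by omega)

/-- Counting the vertices of smaller depth turns any depth function into one bounded by the number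
of vertices, which is the fuel used in `propagator`. -/
theorem exists_rank_lt_card {par : ι → Option ι} {d : ι → ℕ}
    (hd : ∀ i j, par j = some i → d i < d j) :
    ∃ rank : ι → ℕ, (∀ i j, par j = some i → rank i < rank j) ∧ ∀ j, rank j < Fintype.card ι := by
  refine ⟨fun j => (Finset.univ.filter fun i => d i < d j).card, fun i j h => ?_, fun j => ?_⟩
  · apply Finset.card_lt_card
    have hij := hd i j h
    refine ⟨fun k hk => ?_, fun hk => ?_⟩
    · simp only [Finset.mem_filter, Finset.mem_univ, true_and] at hk ⊢; omega
    · have := hk (Finset.mem_filter.mpr ⟨Finset.mem_univ i, hij⟩)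
      simp at this
  · rw [← Finset.card_univ]
    apply Finset.card_lt_card
    rw [Finset.filter_ssubset]
    exact ⟨j, Finset.mem_univ _, by simp⟩

theorem iteratedIntegral_card {par : ι → Option ι} {d : ι → ℕ}
    (hd : ∀ i j, par j = some i → d i < d j) (z ray : ι → ℂ) (R : ℝ) (i : ι) (ζ : ℂ) :
    iteratedIntegral par z ray R (Fintype.card ι) i ζ =
      ∫ s : ℝ, rhoKernel ζ (Real.exp s * ray i) * psiZero R (z i) (Real.exp s * ray i) *
        ∏ w with par w = some i,
          iteratedIntegral par z ray R (Fintype.card ι) w (Real.exp s * ray i) := by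
  obtain ⟨rank, hr, hlt⟩ := exists_rank_lt_card hd
  obtain ⟨k, hk⟩ : ∃ k, Fintype.card ι = k + 1 := ⟨Fintype.card ι - 1, by have := hlt i; omega⟩
  conv_lhs => rw [hk]
  simp only [iteratedIntegral]
  congr 1; ext t
  congr 1
  refine Finset.prod_congr rfl fun w hw => ?_
  have := hr _ _ (Finset.mem_filter.mp hw).2
  exact iteratedIntegral_fuel hr z ray R _ _ w _ (hlt w) hlt (by omega) (by omega)

variable {V : Type} [DecidableEq V]

/-- The point on the ray of a vertex with parameter given by `s`, or the external variable. -/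
noncomputable def nodePoint (rep : ι → V) (ray : ι → ℂ) (ζ : ℂ) (s : V → ℝ) : Option ι → ℂ
  | none => ζ
  | some i => Real.exp (s (rep i)) * ray i

/-- The list is closed under children and has parents before children, so the outermost integral
belongs to a vertex whose factor does not depend on the later variables. Once that factor is taken
out, its children become the new tops of the remaining list. The product on the right runs over the
current tops, which allows forests in the induction. -/
theorem iterInt_prod_eq {par : ι → Option ι} {d : ι → ℕ}
    (hd : ∀ i j, par j = some i → d i < d j) (z ray : ι → ℂ) (R : ℝ) (ζ : ℂ) {rep : ι → V}
    (hrep : Function.Injective rep) (l : List ι) (hl : l.Nodup)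
    (hchild : ∀ i ∈ l, ∀ j, par j = some i → j ∈ l)
    (hsort : l.Pairwise fun i j => par i ≠ some j) (s : V → ℝ) :
    iterInt (l.map rep) (fun s => ∏ i ∈ l.toFinset,
        (rhoKernel (nodePoint rep ray ζ s (par i)) (nodePoint rep ray ζ s (some i)) *
          psiZero R (z i) (nodePoint rep ray ζ s (some i)))) s =
      ∏ i ∈ l.toFinset with (∀ p, par i = some p → p ∉ l),
        iteratedIntegral par z ray R (Fintype.card ι) i (nodePoint rep ray ζ s (par i)) := by
  induction l generalizing s with
  | nil => simp [iterInt]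
  | cons i l ih =>
    rw [List.nodup_cons] at hl
    rw [List.pairwise_cons] at hsort
    have hni : ∀ j, par j = some i → j ≠ i := by
      rintro j hj rfl; exact lt_irrefl _ (hd _ _ hj)
    have hchild' : ∀ i' ∈ l, ∀ j, par j = some i' → j ∈ l := by
      intro i' hi' j hj
      have := hchild i' (List.mem_cons_of_mem _ hi') j hj
      rcases List.mem_cons.mp this with rfl | h
      · exact absurd hj (hsort.1 i' hi')
      · exact h
    have hpi : ∀ p, par i = some p → p ∉ l := fun p hp hpl => hsort.1 p hpl hp
    have hpi' : ∀ p, par i = some p → p ≠ i := by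
      rintro p hp rfl; exact lt_irrefl _ (hd _ _ hp)
    simp only [List.map_cons, iterInt, List.toFinset_cons]
    have hfac : ∀ t, iterInt (l.map rep) (fun s => ∏ j ∈ insert i l.toFinset,
        (rhoKernel (nodePoint rep ray ζ s (par j)) (nodePoint rep ray ζ s (some j)) *
          psiZero R (z j) (nodePoint rep ray ζ s (some j)))) (Function.update s (rep i) t) =
        (rhoKernel (nodePoint rep ray ζ s (par i)) (Real.exp t * ray i) *
          psiZero R (z i) (Real.exp t * ray i)) *
        ∏ j ∈ l.toFinset with (∀ p, par j = some p → p ∉ l),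
          iteratedIntegral par z ray R (Fintype.card ι) j
            (nodePoint rep ray ζ (Function.update s (rep i) t) (par j)) := by
      intro t
      simp_rw [Finset.prod_insert (show i ∉ l.toFinset by simpa using hl.1)]
      rw [iterInt_mul_left, ih hl.2 hchild' hsort.2]
      · congr 1
        have h1 : nodePoint rep ray ζ (Function.update s (rep i) t) (par i) =
            nodePoint rep ray ζ s (par i) := by
          rcases hp : par i with _ | p
          · rfl
          · simp only [nodePoint]
            rw [Function.update_of_ne (fun e => hpi' p hp (hrep e))]
        rw [h1]; simp [nodePoint]
      · intro v hv s' t'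
        obtain ⟨j, hj, rfl⟩ := List.mem_map.mp hv
        have hji : rep i ≠ rep j := fun e => hl.1 (hrep e ▸ hj)
        have h1 : nodePoint rep ray ζ (Function.update s' (rep j) t') (par i) =
            nodePoint rep ray ζ s' (par i) := by
          rcases hp : par i with _ | p
          · rfl
          · simp only [nodePoint]
            rw [Function.update_of_ne (fun e => hpi p hp (by rw [hrep e]; exact hj))]
        have h2 : nodePoint rep ray ζ (Function.update s' (rep j) t') (some i) =
            nodePoint rep ray ζ s' (some i) := by
          simp only [nodePoint]; rw [Function.update_of_ne hji]
        rw [h1, h2]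
    simp_rw [hfac]
    have hsplit : ∀ t, (∏ j ∈ l.toFinset with (∀ p, par j = some p → p ∉ l),
          iteratedIntegral par z ray R (Fintype.card ι) j
            (nodePoint rep ray ζ (Function.update s (rep i) t) (par j))) =
        (∏ j with par j = some i,
          iteratedIntegral par z ray R (Fintype.card ι) j (Real.exp t * ray i)) *
        ∏ j ∈ l.toFinset with (∀ p, par j = some p → p ∉ i :: l),
          iteratedIntegral par z ray R (Fintype.card ι) j (nodePoint rep ray ζ s (par j)) := by
      intro t
      rw [← Finset.prod_filter_mul_prod_filter_not (l.toFinset.filter _) (fun j => par j = some i)]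
      congr 1
      · refine Finset.prod_congr ?_ ?_
        · ext j
          simp only [Finset.mem_filter, List.mem_toFinset, Finset.mem_univ, true_and]
          constructor
          · exact fun h => h.2
          · intro h
            refine ⟨⟨?_, ?_⟩, h⟩
            · rcases List.mem_cons.mp (hchild i (List.mem_cons_self ..) j h) with h' | h'
              · exact absurd h' (hni j h)
              · exact h'
            · intro p hp; rw [h] at hp; cases hp; exact hl.1
        · intro j hj
          rw [(Finset.mem_filter.mp hj).2]
          simp [nodePoint]
      · refine Finset.prod_congr ?_ ?_
        · ext j
          simp only [Finset.mem_filter, List.mem_toFinset, List.mem_cons, not_or]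
          constructor
          · rintro ⟨⟨a, b⟩, c⟩
            exact ⟨a, fun p hp => ⟨fun e => c (e ▸ hp), b p hp⟩⟩
          · rintro ⟨a, b⟩
            exact ⟨⟨a, fun p hp => (b p hp).2⟩, fun e => (b i e).1 rfl⟩
        · intro j hj
          have hj' := (Finset.mem_filter.mp hj).2
          congr 1
          rcases hp : par j with _ | p
          · rfl
          · simp only [nodePoint]
            have : p ≠ i := fun e => hj' p hp (by simp [e])
            rw [Function.update_of_ne (fun e => this (hrep e))]
    simp_rw [hsplit, ← mul_assoc]
    rw [integral_mul_const, Finset.filter_insert, if_pos, Finset.prod_insert]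
    · rw [iteratedIntegral_card hd]
    · simp [hl.1]
    · intro p hp hpl
      rcases List.mem_cons.mp hpl with e | e
      · exact hpi' p hp e
      · exact hpi p hp e

theorem exists_sorted_list {par : ι → Option ι} {d : ι → ℕ}
    (hd : ∀ i j, par j = some i → d i < d j) :
    ∃ l : List ι, l.Nodup ∧ (∀ i, i ∈ l) ∧ l.Pairwise fun i j => par i ≠ some j := by
  have : Std.Total (fun i j : ι => d i ≤ d j) := ⟨fun i j => le_total _ _⟩
  have : IsTrans ι (fun i j : ι => d i ≤ d j) := ⟨fun i j k => le_trans⟩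
  refine ⟨(Finset.univ : Finset ι).toList.insertionSort (fun i j => d i ≤ d j), ?_, ?_, ?_⟩
  · exact (List.perm_insertionSort _ _).nodup_iff.mpr (Finset.nodup_toList _)
  · intro i
    exact (List.perm_insertionSort _ _).mem_iff.mpr (Finset.mem_toList.mpr (Finset.mem_univ i))
  · refine (List.pairwise_insertionSort (fun i j : ι => d i ≤ d j) _).imp fun {i j} h e => ?_
    exact absurd (hd _ _ e) (not_lt.mpr h)

/-- An iterated integral over a forest is a cluster integral. -/
theorem prod_iteratedIntegral_eq_clusterIntegral [Fintype V] {P : RayData V} {lo hi : ℝ} {cl : V → V}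
    {a : V → ℂ} (hP : P.Regular lo hi) (hA : P.Adm lo hi cl a) {par : ι → Option ι} {d : ι → ℕ}
    (hd : ∀ i j, par j = some i → d i < d j) {z ray : ι → ℂ} {rep : ι → V}
    (hrep : Function.Injective rep) (hran : ∀ v, (∃ i, rep i = v) ↔ cl v = v)
    (hint : ∀ s : V → ℝ, P.integrand cl (fun v => s v + a v) = ∏ i,
      (rhoKernel (nodePoint rep ray P.ζ s (par i)) (nodePoint rep ray P.ζ s (some i)) *
          psiZero P.R (z i) (nodePoint rep ray P.ζ s (some i)))) :
    ∏ i with par i = none, iteratedIntegral par z ray P.R (Fintype.card ι) i P.ζ =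
      P.clusterIntegral cl a := by
  obtain ⟨l, hl, hmem, hsort⟩ := exists_sorted_list hd
  have huniv : l.toFinset = Finset.univ := by ext i; simp [hmem]
  have h1 := (integral_eq_iterInt (P.integrable_integrand hP hA) (hl.map hrep)).2
  unfold RayData.clusterIntegral
  rw [h1]
  have h2 : ∀ s : V → ℝ, iterInt (l.map rep)
      (fun s => P.integrand cl (fun v => s v + a v) * RayData.aux cl s) s =
      RayData.aux cl s *
        ∏ i with par i = none, iteratedIntegral par z ray P.R (Fintype.card ι) i P.ζ := by
    intro s
    have e : (fun s : V → ℝ => P.integrand cl (fun v => s v + a v) * RayData.aux cl s) =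
        fun s => RayData.aux cl s * ∏ i ∈ l.toFinset,
      (rhoKernel (nodePoint rep ray P.ζ s (par i)) (nodePoint rep ray P.ζ s (some i)) *
          psiZero P.R (z i) (nodePoint rep ray P.ζ s (some i))) := by
      ext s; rw [hint, huniv, mul_comm]
    rw [e, iterInt_mul_left, iterInt_prod_eq hd z ray P.R P.ζ hrep l hl (fun _ _ j _ => hmem j) hsort]
    · congr 1
      refine Finset.prod_congr ?_ ?_
      · ext i
        simp only [Finset.mem_filter, huniv, Finset.mem_univ, true_and, hmem, not_true_eq_false]
        constructor
        · intro h
          rcases hp : par i with _ | p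
          · rfl
          · exact (h p hp).elim
        · intro h p hp; rw [h] at hp; cases hp
      · intro i hi
        rw [(Finset.mem_filter.mp hi).2]; rfl
    · intro v hv s t
      obtain ⟨i, _, rfl⟩ := List.mem_map.mp hv
      exact RayData.aux_update ((hran _).mp ⟨i, rfl⟩) s t
  -- The representatives received their densities from Fubini and the other vertices have theirs
  -- from `aux`; together they form a probability density on the whole space.
  have h3 : ∀ s : V → ℝ, (∏ v ∈ (l.map rep).toFinset, (auxDensity (s v) : ℂ)) * RayData.aux cl s =
      ∏ v, (auxDensity (s v) : ℂ) := by
    intro s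
    unfold RayData.aux
    have e : ∏ v ∈ (l.map rep).toFinset, (auxDensity (s v) : ℂ) =
        ∏ v, if v ∈ (l.map rep).toFinset then (auxDensity (s v) : ℂ) else 1 := by
      rw [Finset.prod_ite_mem, Finset.univ_inter]
    rw [e, ← Finset.prod_mul_distrib]
    refine Finset.prod_congr rfl fun v _ => ?_
    have : v ∈ (l.map rep).toFinset ↔ cl v = v := by
      rw [← hran]; simp [hmem]
    by_cases h : cl v = v
    · rw [if_pos (this.mpr h), if_pos h, mul_one]
    · rw [if_neg (fun h' => h (this.mp h')), if_neg h, one_mul]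
  simp_rw [h2, ← mul_assoc, h3]
  rw [integral_mul_const]
  have := integral_fintype_prod_volume_eq_prod (ι := V) (fun (_ : V) (x : ℝ) => (auxDensity x : ℂ))
  rw [this]
  simp [integral_auxDensity_ofReal]

end Convert

end

/-! ### Lists of contracted vertices and the exchange of neighbouring entries. -/

section

open Complex MeasureTheory Filter Topology Set

/-! Lists of contracted vertices. -/

namespace MergeTree

variable {V : Type}

/-- A representative of a contracted vertex. -/
def rep : MergeTree V → V
  | leaf v => v
  | node _ r => r.rep

theorem rep_mem (m : MergeTree V) : m.rep ∈ m.members := by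
  induction m with
  | leaf v => simp [rep, members]
  | node l r _ ih => simp [rep, members, ih]

variable [DecidableEq V]

/-- The position in `L` of the contracted vertex containing `v`. -/
def idx : List (MergeTree V) → V → ℕ
  | [], _ => 0
  | m :: L, v => if v ∈ m.members then 0 else idx L v + 1

/-- The representative of the contracted vertex containing `v`. -/
def clu : List (MergeTree V) → V → V
  | [], v => v
  | m :: L, v => if v ∈ m.members then m.rep else clu L v

/-- The members of the contracted vertices in `L` form a partition. -/
def Covers (L : List (MergeTree V)) : Prop :=
  (L.flatMap members).Nodup ∧ ∀ v, v ∈ L.flatMap members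

theorem Covers.perm {L L' : List (MergeTree V)} (h : Covers L) (hp : L.Perm L') : Covers L' :=
  have := hp.flatMap_right members
  ⟨this.nodup_iff.mp h.1, fun v => this.mem_iff.mp (h.2 v)⟩

theorem idx_append_of_mem {L X : List (MergeTree V)} {v : V} (h : v ∈ L.flatMap members) :
    idx (L ++ X) v = idx L v ∧ idx L v < L.length ∧ clu (L ++ X) v = clu L v := by
  induction L with
  | nil => simp at h
  | cons m L ih =>
    simp only [List.cons_append, idx, clu]
    by_cases hv : v ∈ m.members
    · simp [hv]
    · have := ih (by simpa [hv] using h)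
      simp [hv, this]

theorem idx_append_of_notMem {L X : List (MergeTree V)} {v : V} (h : v ∉ L.flatMap members) :
    idx (L ++ X) v = L.length + idx X v ∧ clu (L ++ X) v = clu X v := by
  induction L with
  | nil => simp
  | cons m L ih =>
    simp only [List.flatMap_cons, List.mem_append, not_or] at h
    have := ih h.2
    simp only [List.cons_append, idx, clu, h.1, if_false, List.length_cons]
    exact ⟨by omega, this.2⟩

theorem exists_of_mem {L : List (MergeTree V)} {v : V} (h : v ∈ L.flatMap members) :
    ∃ m, L[idx L v]? = some m ∧ v ∈ m.members ∧ clu L v = m.rep := by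
  induction L with
  | nil => simp at h
  | cons m L ih =>
    by_cases hv : v ∈ m.members
    · exact ⟨m, by simp [idx, hv], hv, by simp [clu, hv]⟩
    · obtain ⟨m', h1, h2, h3⟩ := ih (by simpa [hv] using h)
      exact ⟨m', by simp [idx, hv, h1], h2, by simp [clu, hv, h3]⟩

theorem idx_eq_of_mem {L : List (MergeTree V)} (hL : (L.flatMap members).Nodup) {k : ℕ}
    {m : MergeTree V} (hk : L[k]? = some m) {v : V} (hv : v ∈ m.members) :
    idx L v = k ∧ clu L v = m.rep := by
  induction L generalizing k with
  | nil => simp at hk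
  | cons m' L ih =>
    simp only [List.flatMap_cons] at hL
    rw [List.nodup_append] at hL
    cases k with
    | zero =>
      simp only [List.getElem?_cons_zero, Option.some.injEq] at hk
      subst hk
      simp [idx, clu, hv]
    | succ k =>
      rw [List.getElem?_cons_succ] at hk
      have hmem : v ∈ L.flatMap members :=
        List.mem_flatMap.mpr ⟨m, List.mem_of_getElem? hk, hv⟩
      have hn : v ∉ m'.members := fun h => hL.2.2 v h v hmem rfl
      have := ih hL.2.1 hk
      simp [idx, clu, hn, this]

theorem Covers.idx_clu {L : List (MergeTree V)} (hL : Covers L) (v : V) :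
    idx L (clu L v) = idx L v := by
  obtain ⟨m, h1, h2, h3⟩ := exists_of_mem (hL.2 v)
  rw [h3]
  exact (idx_eq_of_mem hL.1 h1 m.rep_mem).1

theorem Covers.clu_eq_iff {L : List (MergeTree V)} (hL : Covers L) (u v : V) :
    clu L u = clu L v ↔ idx L u = idx L v := by
  constructor
  · intro h; rw [← hL.idx_clu u, h, hL.idx_clu]
  · intro h
    obtain ⟨m, h1, h2, h3⟩ := exists_of_mem (hL.2 u)
    obtain ⟨m', h1', h2', h3'⟩ := exists_of_mem (hL.2 v)
    rw [h, h1'] at h1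
    cases h1
    rw [h3, h3']

theorem Covers.clu_clu {L : List (MergeTree V)} (hL : Covers L) (v : V) :
    clu L (clu L v) = clu L v := (hL.clu_eq_iff _ _).mpr (hL.idx_clu v)

theorem Covers.clu_eq_rep_iff {L : List (MergeTree V)} (hL : Covers L) {m : MergeTree V} (hm : m ∈ L)
    (v : V) : clu L v = m.rep ↔ v ∈ m.members := by
  obtain ⟨k, hk⟩ := List.mem_iff_getElem?.mp hm
  constructor
  · intro h
    obtain ⟨m', h1, h2, h3⟩ := exists_of_mem (hL.2 v)
    have e1 := (idx_eq_of_mem hL.1 hk m.rep_mem).1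
    have e2 := hL.idx_clu v
    rw [h, e1] at e2
    rw [← e2, hk] at h1
    cases h1
    exact h2
  · intro h; exact (idx_eq_of_mem hL.1 hk h).2

section Swap

variable {pre post : List (MergeTree V)} {A B : MergeTree V}

theorem mem_members_cases (hL : Covers (pre ++ A :: B :: post)) (v : V) :
    (v ∈ pre.flatMap members ∧ v ∉ A.members ∧ v ∉ B.members) ∨
    (v ∉ pre.flatMap members ∧ v ∈ A.members ∧ v ∉ B.members) ∨
    (v ∉ pre.flatMap members ∧ v ∉ A.members ∧ v ∈ B.members) ∨
    (v ∉ pre.flatMap members ∧ v ∉ A.members ∧ v ∉ B.members) := by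
  have h := hL.1
  simp only [List.flatMap_append, List.flatMap_cons] at h
  rw [List.nodup_append] at h
  obtain ⟨_, h2, h3⟩ := h
  rw [List.nodup_append] at h2
  obtain ⟨_, _, h5⟩ := h2
  have a1 : v ∈ pre.flatMap members → v ∉ A.members := fun h h' => h3 v h v (by simp [h']) rfl
  have a2 : v ∈ pre.flatMap members → v ∉ B.members := fun h h' => h3 v h v (by simp [h']) rfl
  have a3 : v ∈ A.members → v ∉ B.members := fun h h' => h5 v h v (by simp [h']) rfl
  tauto

/-- The effect of exchanging, or of contracting, two consecutive entries. As `node A B` is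
represented by the representative of `B`, contraction replaces `A.rep` by `B.rep`, which is the
clustering produced by `RayData.clusterIntegral_cross`; positions behind the pair drop by one. -/
theorem idx_swap (hL : Covers (pre ++ A :: B :: post)) (v : V) :
    clu (pre ++ B :: A :: post) v = clu (pre ++ A :: B :: post) v ∧
    clu (pre ++ .node A B :: post) v = (if clu (pre ++ A :: B :: post) v = A.rep then B.rep
      else clu (pre ++ A :: B :: post) v) ∧
    ((idx (pre ++ A :: B :: post) v < pre.length ∧
      idx (pre ++ B :: A :: post) v = idx (pre ++ A :: B :: post) v ∧
      idx (pre ++ .node A B :: post) v = idx (pre ++ A :: B :: post) v) ∨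
    (idx (pre ++ A :: B :: post) v = pre.length ∧
      idx (pre ++ B :: A :: post) v = pre.length + 1 ∧
      idx (pre ++ .node A B :: post) v = pre.length) ∨
    (idx (pre ++ A :: B :: post) v = pre.length + 1 ∧
      idx (pre ++ B :: A :: post) v = pre.length ∧
      idx (pre ++ .node A B :: post) v = pre.length) ∨
    (pre.length + 2 ≤ idx (pre ++ A :: B :: post) v ∧
      idx (pre ++ B :: A :: post) v = idx (pre ++ A :: B :: post) v ∧
      idx (pre ++ .node A B :: post) v + 1 = idx (pre ++ A :: B :: post) v)) := by
  have hA := hL.clu_eq_rep_iff (m := A) (by simp) v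
  rcases mem_members_cases hL v with ⟨h1, h2, h3⟩ | ⟨h1, h2, h3⟩ | ⟨h1, h2, h3⟩ | ⟨h1, h2, h3⟩
  · have hc : clu pre v ≠ A.rep := fun e => h2 (hA.mp ((idx_append_of_mem h1).2.2.trans e))
    simp only [idx_append_of_mem h1, hc, if_false, true_and, and_true]
    exact Or.inl (idx_append_of_mem (X := []) h1).2.1
  all_goals
    simp only [(idx_append_of_notMem h1).1, (idx_append_of_notMem h1).2] at hA ⊢
    simp [idx, clu, members, rep, h2, h3] at hA ⊢
  · exact ⟨fun h => absurd h hA, by omega⟩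

end Swap

end MergeTree

open MergeTree

/-- Decreasing angles in an interval. -/
noncomputable def stdAngle (lo hi : ℝ) (k : ℕ) : ℝ := lo + (hi - lo) / (k + 2)

theorem stdAngle_strictAnti {lo hi : ℝ} (h : lo < hi) : StrictAnti (stdAngle lo hi) := by
  intro m n hmn
  unfold stdAngle
  have : (m : ℝ) < n := by exact_mod_cast hmn
  have h2 : (hi - lo) / (n + 2) < (hi - lo) / (m + 2) := by
    apply div_lt_div_of_pos_left (by linarith) (by positivity) (by linarith)
  linarith

theorem stdAngle_mem {lo hi : ℝ} (h : lo < hi) (k : ℕ) :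
    lo < stdAngle lo hi k ∧ stdAngle lo hi k < hi := by
  unfold stdAngle
  have h1 : 0 < (hi - lo) / (k + 2) := by apply div_pos <;> [linarith; positivity]
  have h2 : (hi - lo) / (k + 2) < hi - lo := by
    apply div_lt_self (by linarith)
    have : (0 : ℝ) ≤ k := by positivity
    linarith
  exact ⟨by linarith, by linarith⟩

namespace RayData

variable {V : Type} [Fintype V] [DecidableEq V]

/-- The integral for the contracted vertices `L`, over rays in clockwise order. -/
noncomputable def listIntegral (P : RayData V) (lo hi : ℝ) (L : List (MergeTree V)) : ℂ :=
  P.clusterIntegral (clu L) fun v => (stdAngle lo hi (idx L v) : ℂ) * I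

theorem Nbr.idx_ne {P : RayData V} {L : List (MergeTree V)} (hL : Covers L) {u u' : V}
    (h : P.Nbr (clu L) u u') : idx L u ≠ idx L u' ∧ clu L u = u ∧ clu L u' = u' := by
  obtain ⟨v, p, hp, hc, ⟨rfl, rfl⟩ | ⟨rfl, rfl⟩⟩ := h
  · exact ⟨by rw [hL.idx_clu, hL.idx_clu]; exact fun e => hc ((hL.clu_eq_iff _ _).mpr e),
      hL.clu_clu _, hL.clu_clu _⟩
  · exact ⟨by rw [hL.idx_clu, hL.idx_clu]; exact fun e => hc ((hL.clu_eq_iff _ _).mpr e.symm),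
      hL.clu_clu _, hL.clu_clu _⟩

theorem adm_of_order {P : RayData V} {lo hi : ℝ} {L : List (MergeTree V)} (hL : Covers L) {a : V → ℂ}
    (h1 : ∀ v, lo ≤ (a v).im) (h2 : ∀ v, (a v).im ≤ hi)
    (h : ∀ u u', P.Nbr (clu L) u u' → idx L u < idx L u' → (a u').im < (a u).im) :
    P.Adm lo hi (clu L) a := by
  refine ⟨hL.clu_clu, h1, h2, adm_iff_nbr.mpr fun u u' hn => ?_⟩
  rcases lt_or_gt_of_ne (hn.idx_ne hL).1 with h' | h'
  · exact (h _ _ hn h').ne'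
  · exact (h _ _ hn.symm h').ne

theorem adm_stdAngle {P : RayData V} {lo hi : ℝ} (hlt : lo < hi) {L : List (MergeTree V)}
    (hL : Covers L) : P.Adm lo hi (clu L) fun v => (stdAngle lo hi (idx L v) : ℂ) * I := by
  refine adm_of_order hL (fun v => ?_) (fun v => ?_) fun u u' _ h => ?_
  · simpa using (stdAngle_mem hlt _).1.le
  · simpa using (stdAngle_mem hlt _).2.le
  · simpa using stdAngle_strictAnti hlt h

/-- Lists are read clockwise, so angles decrease with the position. The order of neighbours is all
that matters, and standard angles may therefore replace the actual ones. -/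
theorem clusterIntegral_eq_listIntegral {P : RayData V} {lo hi : ℝ} (hlt : lo < hi)
    (hP : P.Regular lo hi) {L : List (MergeTree V)} (hL : Covers L) {a : V → ℂ}
    (h1 : ∀ v, lo ≤ (a v).im) (h2 : ∀ v, (a v).im ≤ hi)
    (h : ∀ u u', P.Nbr (clu L) u u' → idx L u < idx L u' → (a u').im < (a u).im) :
    P.clusterIntegral (clu L) a = P.listIntegral lo hi L := by
  refine clusterIntegral_eq_of_order hP (adm_of_order hL h1 h2 h) (adm_stdAngle hlt hL)
    fun u u' hn hlt' => ?_
  simp only [mul_im, ofReal_re, I_im, mul_one, ofReal_im, I_re, mul_zero, add_zero]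
  refine stdAngle_strictAnti hlt ?_
  rcases lt_or_gt_of_ne (hn.idx_ne hL).1 with h' | h'
  · exact absurd (h _ _ hn h') (not_lt.mpr hlt'.le)
  · exact h'

/-- A contracted vertex is a subtree: all but one of its members have a parent in it. -/
def Conn (P : RayData V) (m : MergeTree V) : Prop :=
  ∃ t ∈ m.members, ∀ a ∈ m.members, a ≠ t → ∃ p ∈ m.members, P.parent a = some p

/-- Every member of a subtree except its top has its parent inside. Hence an arrow between disjoint
subtrees ends at the top of one of them, and arrows in both directions would contradict the depth
function. This keeps the pole at a crossing simple. -/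
theorem Conn.unique {P : RayData V} {d : V → ℕ} (hd : ∀ v w, P.parent w = some v → d v < d w)
    {A B : MergeTree V} (hA : P.Conn A) (hB : P.Conn B) (hAB : ∀ v ∈ A.members, v ∉ B.members)
    {v₀ p₀ : V} (hp₀ : P.parent v₀ = some p₀) (hv₀A : v₀ ∈ A.members) (hp₀B : p₀ ∈ B.members)
    {v p : V} (hp : P.parent v = some p)
    (h : (v ∈ A.members ∧ p ∈ B.members) ∨ (v ∈ B.members ∧ p ∈ A.members)) : v = v₀ := by
  have top_le : ∀ {m : MergeTree V} {t : V}, t ∈ m.members →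
      (∀ a ∈ m.members, a ≠ t → ∃ p ∈ m.members, P.parent a = some p) →
      ∀ n a, d a = n → a ∈ m.members → d t ≤ d a := by
    intro m t _ hm n
    induction n using Nat.strong_induction_on with
    | _ n ih =>
      intro a ha ham
      by_cases hat : a = t
      · rw [hat]
      · obtain ⟨p, hp, hpa⟩ := hm a ham hat
        have h1 := hd _ _ hpa
        exact (ih (d p) (by omega) p rfl hp).trans h1.le
  obtain ⟨tA, htA, hA'⟩ := hA
  obtain ⟨tB, htB, hB'⟩ := hB
  have key : ∀ {w q : V}, P.parent w = some q → w ∈ A.members → q ∈ B.members → w = tA := by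
    intro w q hw hwA hqB
    by_contra hne
    obtain ⟨p', hp', hw'⟩ := hA' w hwA hne
    rw [hw] at hw'; cases hw'
    exact hAB _ hp' hqB
  have key' : ∀ {w q : V}, P.parent w = some q → w ∈ B.members → q ∈ A.members → w = tB := by
    intro w q hw hwA hqB
    by_contra hne
    obtain ⟨p', hp', hw'⟩ := hB' w hwA hne
    rw [hw] at hw'; cases hw'
    exact hAB _ hqB hp'
  have e0 := key hp₀ hv₀A hp₀B
  rcases h with ⟨h1, h2⟩ | ⟨h1, h2⟩
  · rw [key hp h1 h2, e0]
  · exfalso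
    have e1 := key' hp h1 h2
    have := hd _ _ hp₀
    have := hd _ _ hp
    have a1 := top_le htB hB' _ p₀ rfl hp₀B
    have a2 := top_le htA hA' _ p rfl h2
    rw [← e0] at a2
    rw [← e1] at a1
    omega

/-- The connecting arrow ends at the top of the lower subtree, so only the top of the upper subtree
remains without a parent inside. -/
theorem Conn.node {P : RayData V} {A B : MergeTree V} (hA : P.Conn A) (hB : P.Conn B)
    (hAB : ∀ v ∈ A.members, v ∉ B.members)
    (h : (∃ a ∈ A.members, ∃ b ∈ B.members, P.parent a = some b) ∨
      ∃ b ∈ B.members, ∃ a ∈ A.members, P.parent b = some a) : P.Conn (.node A B) := by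
  obtain ⟨tA, htA, hA'⟩ := hA
  obtain ⟨tB, htB, hB'⟩ := hB
  rcases h with ⟨a, ha, b, hb, hab⟩ | ⟨b, hb, a, ha, hab⟩
  · refine ⟨tB, by simp [members, htB], fun x hx hxt => ?_⟩
    simp only [members, List.mem_append] at hx ⊢
    rcases hx with hx | hx
    · by_cases hxa : x = tA
      · have : a = tA := by
          by_contra hne
          obtain ⟨p', hp', hw'⟩ := hA' a ha hne
          rw [hab] at hw'; cases hw'
          exact hAB _ hp' hb
        exact ⟨b, Or.inr hb, by rw [hxa, ← this, hab]⟩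
      · obtain ⟨p, hp, e⟩ := hA' x hx hxa; exact ⟨p, Or.inl hp, e⟩
    · obtain ⟨p, hp, e⟩ := hB' x hx hxt; exact ⟨p, Or.inr hp, e⟩
  · refine ⟨tA, by simp [members, htA], fun x hx hxt => ?_⟩
    simp only [members, List.mem_append] at hx ⊢
    rcases hx with hx | hx
    · obtain ⟨p, hp, e⟩ := hA' x hx hxt; exact ⟨p, Or.inl hp, e⟩
    · by_cases hxa : x = tB
      · have : b = tB := by
          by_contra hne
          obtain ⟨p', hp', hw'⟩ := hB' b hb hne
          rw [hab] at hw'; cases hw'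
          exact hAB _ ha hp'
        exact ⟨a, Or.inl ha, by rw [hxa, ← this, hab]⟩
      · obtain ⟨p, hp, e⟩ := hB' x hx hxa; exact ⟨p, Or.inr hp, e⟩

section Crossing

variable {P : RayData V} {lo hi : ℝ} {pre post : List (MergeTree V)} {A B : MergeTree V}

/-- Without an arrow between the two entries the order of their angles is immaterial; all pairs that
are neighbours keep their order. -/
theorem listIntegral_swap_of_not_arrow (hlt : lo < hi) (hP : P.Regular lo hi)
    (hL : Covers (pre ++ A :: B :: post))
    (h1 : ¬ ∃ a ∈ A.members, ∃ b ∈ B.members, P.parent a = some b)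
    (h2 : ¬ ∃ b ∈ B.members, ∃ a ∈ A.members, P.parent b = some a) :
    P.listIntegral lo hi (pre ++ A :: B :: post) = P.listIntegral lo hi (pre ++ B :: A :: post) := by
  have hL' : Covers (pre ++ B :: A :: post) := hL.perm (List.Perm.append_left _ (List.Perm.swap ..))
  have hcl : clu (pre ++ A :: B :: post) = clu (pre ++ B :: A :: post) := by
    ext v; exact (idx_swap hL v).1.symm
  rw [← clusterIntegral_eq_listIntegral hlt hP hL'
    (a := fun v => (stdAngle lo hi (idx (pre ++ A :: B :: post) v) : ℂ) * I)]
  · unfold listIntegral; rw [hcl]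
  · intro v; simpa using (stdAngle_mem hlt _).1.le
  · intro v; simpa using (stdAngle_mem hlt _).2.le
  · intro u u' hn hlt'
    simp only [mul_im, ofReal_re, I_im, mul_one, ofReal_im, I_re, mul_zero, add_zero]
    apply stdAngle_strictAnti hlt
    have e1 := (idx_swap hL u).2.2
    have e2 := (idx_swap hL u').2.2
    by_contra hcon
    have e3 : idx (pre ++ A :: B :: post) u = pre.length + 1 ∧
        idx (pre ++ A :: B :: post) u' = pre.length := by omega
    have mA : ∀ x, idx (pre ++ A :: B :: post) x = pre.length → x ∈ A.members := by
      intro x hx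
      obtain ⟨m, a1, a2, _⟩ := exists_of_mem (hL.2 x)
      rw [hx] at a1; simp at a1; rwa [a1]
    have mB : ∀ x, idx (pre ++ A :: B :: post) x = pre.length + 1 → x ∈ B.members := by
      intro x hx
      obtain ⟨m, a1, a2, _⟩ := exists_of_mem (hL.2 x)
      rw [hx] at a1; simp at a1; rwa [a1]
    rw [← hcl] at hn
    obtain ⟨v, p, hp, _, ⟨rfl, rfl⟩ | ⟨rfl, rfl⟩⟩ := hn
    · rw [hL.idx_clu, hL.idx_clu] at e3
      exact h1 ⟨v, mA v e3.2, p, mB p e3.1, hp⟩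
    · rw [hL.idx_clu, hL.idx_clu] at e3
      exact h2 ⟨v, mB v e3.1, p, mA p e3.2, hp⟩

/-- The ray of `A` is moved clockwise across the ray of `B` and no further. The result is again in
the order of a list, and so is the residue term; both are brought back to standard angles. -/
theorem listIntegral_swap_of_arrow {d : V → ℕ} (hd : ∀ v w, P.parent w = some v → d v < d w)
    (hlt : lo < hi) (hP : P.Regular lo hi)
    (hL : Covers (pre ++ A :: B :: post)) (hA : P.Conn A) (hB : P.Conn B)
    {v₀ p₀ : V} {ε : ℂ} (hp₀ : P.parent v₀ = some p₀)
    (h : (v₀ ∈ A.members ∧ p₀ ∈ B.members ∧ ε = -1) ∨ (v₀ ∈ B.members ∧ p₀ ∈ A.members ∧ ε = 1)) :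
    P.listIntegral lo hi (pre ++ A :: B :: post) = P.listIntegral lo hi (pre ++ B :: A :: post) +
      ε * P.listIntegral lo hi (pre ++ .node A B :: post) := by
  set L₁ := pre ++ A :: B :: post with hL₁
  set L₂ := pre ++ B :: A :: post with hL₂
  set L₃ := pre ++ .node A B :: post with hL₃
  set n := pre.length with hn
  have hC₂ : Covers L₂ := hL.perm (List.Perm.append_left _ (List.Perm.swap ..))
  have hC₃ : Covers L₃ := by
    have : L₃.flatMap members = L₁.flatMap members := by
      simp [hL₃, hL₁, members, List.append_assoc]
    exact ⟨by rw [this]; exact hL.1, by rw [this]; exact hL.2⟩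
  have hcl : clu L₁ = clu L₂ := by
    ext v; exact (idx_swap hL v).1.symm
  have memA : A ∈ L₁ := by simp [hL₁]
  have memB : B ∈ L₁ := by simp [hL₁]
  have iffA := hL.clu_eq_rep_iff memA
  have iffB := hL.clu_eq_rep_iff memB
  have gA : L₁[n]? = some A := by simp [hL₁, hn]
  have gB : L₁[n + 1]? = some B := by simp [hL₁, hn]
  have iA : idx L₁ A.rep = n := (idx_eq_of_mem hL.1 gA A.rep_mem).1
  have iB : idx L₁ B.rep = n + 1 := (idx_eq_of_mem hL.1 gB B.rep_mem).1
  have cA : clu L₁ A.rep = A.rep := (iffA _).mpr A.rep_mem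
  have cB : clu L₁ B.rep = B.rep := (iffB _).mpr B.rep_mem
  have repA : ∀ u, clu L₁ u = u → (u = A.rep ↔ idx L₁ u = n) := by
    intro u hu
    rw [← iA, ← hL.clu_eq_iff, hu, cA]
  have hdisj : ∀ v ∈ A.members, v ∉ B.members := by
    intro v hv hv'
    have e1 := (idx_eq_of_mem hL.1 gA hv).1
    have e2 := (idx_eq_of_mem hL.1 gB hv').1
    omega
  have anti := stdAngle_strictAnti hlt
  have key : ∀ v, (idx L₁ v < n ∧ idx L₂ v = idx L₁ v ∧ idx L₃ v = idx L₁ v) ∨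
      (idx L₁ v = n ∧ idx L₂ v = n + 1 ∧ idx L₃ v = n) ∨
      (idx L₁ v = n + 1 ∧ idx L₂ v = n ∧ idx L₃ v = n) ∨
      (n + 2 ≤ idx L₁ v ∧ idx L₂ v = idx L₁ v ∧ idx L₃ v + 1 = idx L₁ v) :=
    fun v => (idx_swap hL v).2.2
  -- The midpoint between the standard angles of `B`, at position n + 1, and of position n + 2: it
  -- lies beyond `B` but before everything that follows.
  set θ : ℝ := (stdAngle lo hi (n + 1) + stdAngle lo hi (n + 2)) / 2 with hθ
  have t1 : stdAngle lo hi (n + 1) < stdAngle lo hi n := anti (by omega)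
  have t2 : stdAngle lo hi (n + 2) < stdAngle lo hi (n + 1) := anti (by omega)
  have tθ1 : θ < stdAngle lo hi (n + 1) := by rw [hθ]; linarith
  have tθ2 : stdAngle lo hi (n + 2) < θ := by rw [hθ]; linarith
  set a : V → ℂ := fun v => (stdAngle lo hi (idx L₁ v) : ℂ) * I with ha
  have aim : ∀ v, (a v).im = stdAngle lo hi (idx L₁ v) := fun v => by simp [ha]
  set a' : V → ℂ := Function.update a A.rep ((θ : ℂ) * I) with ha'
  have a'im : ∀ v, (a' v).im = if v = A.rep then θ else stdAngle lo hi (idx L₁ v) := by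
    intro v
    by_cases hv : v = A.rep
    · subst hv; simp [ha']
    · rw [ha', Function.update_of_ne hv, if_neg hv, aim]
  have hbd : ∀ v, lo ≤ (a' v).im ∧ (a' v).im ≤ hi := by
    intro v
    rw [a'im]
    split_ifs
    · constructor <;> linarith [(stdAngle_mem hlt (n + 1)).1, (stdAngle_mem hlt (n + 1)).2,
        (stdAngle_mem hlt (n + 2)).1]
    · exact ⟨(stdAngle_mem hlt _).1.le, (stdAngle_mem hlt _).2.le⟩
  have ord2 : ∀ u u', P.Nbr (clu L₂) u u' → idx L₂ u < idx L₂ u' → (a' u').im < (a' u).im := by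
    intro u u' hnb hlt'
    have hu := (hnb.idx_ne hC₂).2
    rw [← hcl] at hu
    rw [a'im, a'im]
    have e1 := key u
    have e2 := key u'
    have r1 := repA u hu.1
    have r2 := repA u' hu.2
    by_cases c1 : u = A.rep <;> by_cases c2 : u' = A.rep
    · exact absurd hlt' (by rw [c1, c2]; exact lt_irrefl _)
    · rw [if_pos c1, if_neg c2]
      have := r1.mp c1
      have h3 : n + 2 ≤ idx L₁ u' := by
        have := mt r2.mpr c2
        omega
      exact lt_of_le_of_lt (anti.antitone h3) tθ2
    · rw [if_neg c1, if_pos c2]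
      have := r2.mp c2
      have h3 : idx L₁ u ≤ n + 1 := by omega
      exact lt_of_lt_of_le tθ1 (anti.antitone h3)
    · rw [if_neg c1, if_neg c2]
      have := mt r1.mpr c1
      have := mt r2.mpr c2
      exact anti (by omega)
  have I2 : P.clusterIntegral (clu L₁) a' = P.listIntegral lo hi L₂ := by
    rw [hcl]
    exact clusterIntegral_eq_listIntegral hlt hP hC₂ (fun v => (hbd v).1) (fun v => (hbd v).2) ord2
  have I3 : P.clusterIntegral (fun v => if clu L₁ v = A.rep then B.rep else clu L₁ v) a =
      P.listIntegral lo hi L₃ := by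
    have hc3 : (fun v => if clu L₁ v = A.rep then B.rep else clu L₁ v) = clu L₃ := by
      ext v; exact (idx_swap hL v).2.1.symm
    rw [hc3]
    refine clusterIntegral_eq_listIntegral hlt hP hC₃ (fun v => ?_) (fun v => ?_) ?_
    · rw [aim]; exact (stdAngle_mem hlt _).1.le
    · rw [aim]; exact (stdAngle_mem hlt _).2.le
    · intro u u' _ hlt'
      rw [aim, aim]
      have e1 := key u
      have e2 := key u'
      exact anti (by omega)
  have hadm' : P.Adm lo hi (clu L₁) a' := by
    rw [hcl]
    exact adm_of_order hC₂ (fun v => (hbd v).1) (fun v => (hbd v).2) ord2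
  have hadm : P.Adm lo hi (clu L₁) a := adm_stdAngle hlt hL
  have hself : Function.update a A.rep (a A.rep) = a := Function.update_eq_self _ _
  have hdisj' : ∀ v ∈ B.members, v ∉ A.members := fun v h1 h2 => hdisj v h2 h1
  have main := clusterIntegral_cross (P := P) (cl := clu L₁) (a := a) (i := A.rep) (h := B.rep)
    (v₀ := v₀) (p₀ := p₀) (b := (θ : ℂ) * I) (b' := a A.rep) (ε := -ε) hP cA cB
    (fun e => by have := A.rep_mem; rw [e] at this; exact hdisj _ this B.rep_mem)
    hadm' (by rw [hself]; exact hadm)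
    (by rw [aim, iB]; simpa using tθ1) (by rw [aim, aim, iA, iB]; exact t1) hp₀
    (by
      rcases h with ⟨h1, h2, rfl⟩ | ⟨h1, h2, rfl⟩
      · exact Or.inl ⟨(iffA _).mpr h1, (iffB _).mpr h2, by ring⟩
      · exact Or.inr ⟨(iffB _).mpr h1, (iffA _).mpr h2, by ring⟩)
    (by
      intro v p hp hvp
      rw [iffA, iffB, iffA, iffB] at hvp
      rcases h with ⟨h1, h2, _⟩ | ⟨h1, h2, _⟩
      · exact Conn.unique hd hA hB hdisj hp₀ h1 h2 hp hvp
      · exact Conn.unique hd hB hA hdisj' hp₀ h1 h2 hp hvp.symm)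
    (by
      have far : ∀ x, clu L₁ x ≠ A.rep → clu L₁ x ≠ B.rep →
          (a (clu L₁ x)).im < ((θ : ℂ) * I).im ∨ (a A.rep).im < (a (clu L₁ x)).im := by
        intro x h1 h2
        rw [aim, aim, hL.idx_clu, iA]
        rw [← cA, Ne, hL.clu_eq_iff, iA] at h1
        rw [← cB, Ne, hL.clu_eq_iff, iB] at h2
        rcases lt_or_ge (idx L₁ x) n with h3 | h3
        · exact Or.inr (anti h3)
        · left
          have : stdAngle lo hi (idx L₁ x) ≤ stdAngle lo hi (n + 2) := anti.antitone (by omega)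
          simpa using lt_of_le_of_lt this tθ2
      intro v p hp hc
      exact ⟨fun e e' => far v (fun e2 => hc (e.trans e2.symm)) e',
        fun e e' => far p (fun e2 => hc (e2.trans e.symm)) e'⟩)
  rw [hself, ← ha', I2, I3] at main
  change P.clusterIntegral (clu L₁) a = _
  linear_combination -main

end Crossing

end RayData

end

/-! ### Signed sums: the moving procedure as an identity of integrals. -/

section

open Complex MeasureTheory Filter Topology Set MergeTree

namespace ChargeLattice

variable {l₁ l₂ : ℕ}

theorem pairing_add_left (α β γ : ChargeLattice l₁ l₂) :
    pairing (α + β) γ = pairing α γ + pairing β γ := by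
  simp only [pairing, Prod.fst_add, Prod.snd_add, Pi.add_apply, Finset.sum_add_distrib]; ring

theorem pairing_add_right (α β γ : ChargeLattice l₁ l₂) :
    pairing α (β + γ) = pairing α β + pairing α γ := by
  simp only [pairing, Prod.fst_add, Prod.snd_add, Pi.add_apply, Finset.sum_add_distrib]; ring

theorem pairing_swap (α β : ChargeLattice l₁ l₂) : pairing α β = -pairing β α := by
  simp only [pairing]; ring

theorem negOnePow_pairing_comm (α β : ChargeLattice l₁ l₂) :
    Int.negOnePow (pairing α β) = Int.negOnePow (pairing β α) := by
  rw [pairing_swap, Int.negOnePow_neg]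

/-- The sign (-1)^⟨α,β⟩ is symmetric in α and β, so the twisted product is commutative and the order
of the factors is irrelevant. -/
theorem twist_perm {L L' : List (ChargeLattice l₁ l₂)} (h : L.Perm L') : twist L = twist L' := by
  induction h with
  | nil => rfl
  | cons α h ih => simp only [twist, ih, h.sum_eq]
  | swap α β L =>
    simp only [twist, List.sum_cons, pairing_add_right, Int.negOnePow_add]
    rw [negOnePow_pairing_comm β α]
    ac_rfl
  | trans _ _ ih1 ih2 => exact ih1.trans ih2

theorem twist_merge (α β : ChargeLattice l₁ l₂) (L : List (ChargeLattice l₁ l₂)) :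
    twist (α :: β :: L) = Int.negOnePow (pairing α β) * twist ((α + β) :: L) := by
  simp only [twist, List.sum_cons, pairing_add_right, pairing_add_left, Int.negOnePow_add]
  ac_rfl

end ChargeLattice

open ChargeLattice

namespace DecoratedTree

variable {l₁ l₂ : ℕ} {V : Type} [Fintype V] [DecidableEq V]

theorem exists_depth (T : DecoratedTree l₁ l₂ V) :
    ∃ d : V → ℕ, ∀ v w, T.parent w = some v → d v < d w := by
  classical
  let F : ∀ w : V, (∀ v : V, T.parent w = some v → ℕ) → ℕ := fun w f =>
    match h : T.parent w with
    | none => 0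
    | some v => f v h + 1
  refine ⟨T.wf.fix F, fun v w h => ?_⟩
  rw [T.wf.fix_eq F w]
  simp only [F]
  split
  · rename_i h'; rw [h] at h'; cases h'
  · rename_i v' h'; rw [h] at h'; cases h'; exact Nat.lt_succ_self _

/-- The contribution of the contracted vertices `L`, with the sign from the twisted product. -/
noncomputable def listValue (T : DecoratedTree l₁ l₂ V) (P : RayData V) (lo hi : ℝ)
    (L : List (MergeTree V)) : ℂ :=
  ((twist (L.map (total T.charge)) : ℤ) : ℂ) * P.listIntegral lo hi L

/-- The contracted vertices `L` are subtrees which partition the tree. -/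
def Good (T : DecoratedTree l₁ l₂ V) (L : List (MergeTree V)) : Prop :=
  Covers L ∧ ∀ m ∈ L, ∃ t ∈ m.members, ∀ a ∈ m.members, a ≠ t → ∃ p ∈ m.members, T.parent a = some p

theorem Good.perm {T : DecoratedTree l₁ l₂ V} {L L' : List (MergeTree V)} (h : T.Good L)
    (hp : L.Perm L') : T.Good L' :=
  ⟨h.1.perm hp, fun m hm => h.2 m (hp.mem_iff.mpr hm)⟩

theorem Covers.disjoint {pre post : List (MergeTree V)} {A B : MergeTree V}
    (h : Covers (pre ++ A :: B :: post)) : ∀ v ∈ A.members, v ∉ B.members := by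
  intro v hv
  rcases mem_members_cases h v with ⟨_, h, _⟩ | ⟨_, _, h⟩ | ⟨_, h, _⟩ | ⟨_, h, _⟩
  · exact absurd hv h
  · exact h
  · exact absurd hv h
  · exact absurd hv h

theorem Good.merge {T : DecoratedTree l₁ l₂ V} {pre post : List (MergeTree V)} {A B : MergeTree V}
    (h : T.Good (pre ++ A :: B :: post)) (hAB : T.IsArrow B A ∨ T.IsArrow A B) :
    T.Good (pre ++ .node A B :: post) := by
  refine ⟨?_, ?_⟩
  · have : (pre ++ .node A B :: post).flatMap members = (pre ++ A :: B :: post).flatMap members := by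
      simp [members, List.append_assoc]
    exact ⟨by rw [this]; exact h.1.1, by rw [this]; exact h.1.2⟩
  · intro m hm
    simp only [List.mem_append, List.mem_cons] at hm
    rcases hm with hm | rfl | hm
    · exact h.2 m (by simp [hm])
    · exact RayData.Conn.node (P := ⟨T.parent, 0, 0, 0⟩) (h.2 A (by simp)) (h.2 B (by simp))
        (Covers.disjoint h.1) hAB
    · exact h.2 m (by simp [hm])

section Sums

variable {T : DecoratedTree l₁ l₂ V} {P : RayData V} {lo hi : ℝ}
  {pre post : List (MergeTree V)} {A B : MergeTree V}

theorem twist_swap_list :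
    twist ((pre ++ A :: B :: post).map (total T.charge)) =
      twist ((pre ++ B :: A :: post).map (total T.charge)) :=
  twist_perm ((List.Perm.append_left _ (List.Perm.swap ..)).map _)

theorem twist_merge_list :
    twist ((pre ++ A :: B :: post).map (total T.charge)) =
      Int.negOnePow (pairing (A.total T.charge) (B.total T.charge)) *
        twist ((pre ++ .node A B :: post).map (total T.charge)) := by
  have h1 : (pre ++ A :: B :: post).Perm (A :: B :: (pre ++ post)) :=
    List.perm_middle.trans (List.Perm.cons _ List.perm_middle)
  have h2 : (pre ++ .node A B :: post).Perm (.node A B :: (pre ++ post)) := List.perm_middle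
  rw [twist_perm (h1.map _), twist_perm (h2.map _)]
  exact twist_merge _ _ _

theorem listValue_swap_of_not_arrow (hPT : P.parent = T.parent) (hlt : lo < hi) (hP : P.Regular lo hi)
    (h : T.Good (pre ++ A :: B :: post)) (h1 : ¬ T.IsArrow B A) (h2 : ¬ T.IsArrow A B) :
    T.listValue P lo hi (pre ++ A :: B :: post) = T.listValue P lo hi (pre ++ B :: A :: post) := by
  unfold listValue
  rw [twist_swap_list, RayData.listIntegral_swap_of_not_arrow hlt hP h.1 (by rw [hPT]; exact h1)
    (by rw [hPT]; exact h2)]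

/-- The residue sign `e` is combined with the sign (-1)^⟨α,β⟩, the ratio of the twisted products
before and after the contraction. -/
theorem listValue_swap_of_arrow (hPT : P.parent = T.parent) (hlt : lo < hi) (hP : P.Regular lo hi)
    (h : T.Good (pre ++ A :: B :: post)) {e : ℤˣ}
    (hAB : (T.IsArrow B A ∧ e = -1) ∨ (T.IsArrow A B ∧ e = 1)) :
    T.listValue P lo hi (pre ++ A :: B :: post) = T.listValue P lo hi (pre ++ B :: A :: post) +
      ((e * Int.negOnePow (pairing (A.total T.charge) (B.total T.charge)) : ℤˣ) : ℤ) *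
        T.listValue P lo hi (pre ++ .node A B :: post) := by
  obtain ⟨d, hd⟩ := T.exists_depth
  rw [← hPT] at hd
  have main : P.listIntegral lo hi (pre ++ A :: B :: post) =
      P.listIntegral lo hi (pre ++ B :: A :: post) +
      ((e : ℤ) : ℂ) * P.listIntegral lo hi (pre ++ .node A B :: post) := by
    have cA : P.Conn A := by
      have := h.2 A (by simp); rwa [← hPT] at this
    have cB : P.Conn B := by
      have := h.2 B (by simp); rwa [← hPT] at this
    rcases hAB with ⟨⟨v, hv, p, hp, hvp⟩, rfl⟩ | ⟨⟨v, hv, p, hp, hvp⟩, rfl⟩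
    · rw [← hPT] at hvp
      exact RayData.listIntegral_swap_of_arrow hd hlt hP h.1 cA cB hvp
        (Or.inl ⟨hv, hp, by simp⟩)
    · rw [← hPT] at hvp
      exact RayData.listIntegral_swap_of_arrow hd hlt hP h.1 cA cB hvp
        (Or.inr ⟨hv, hp, by simp⟩)
  have t1 := twist_merge_list (T := T) (pre := pre) (post := post) (A := A) (B := B)
  have t2 := (twist_swap_list (T := T) (pre := pre) (post := post) (A := A) (B := B)).symm
  unfold listValue
  rw [main, t2, t1]
  push_cast
  ring

theorem push_true_cons (A h : MergeTree V) (passed rest : List (MergeTree V)) (σ : ℤˣ) :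
    T.push true A passed (h :: rest) σ =
      if 0 < T.det h A then
        T.push true A (passed ++ [h]) rest σ ++
          (if T.IsArrow h A then T.push true (.node A h) passed rest (σ * -1 *
            Int.negOnePow (pairing (A.total T.charge) (h.total T.charge)))
          else if T.IsArrow A h then T.push true (.node A h) passed rest (σ * 1 *
            Int.negOnePow (pairing (A.total T.charge) (h.total T.charge)))
          else [])
      else [(passed ++ A :: h :: rest, σ)] := by
  rw [push]
  simp only [true_and, Bool.true_eq_false, false_and, or_false, if_true]

theorem push_false_cons (A h : MergeTree V) (passed rest : List (MergeTree V)) (σ : ℤˣ) :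
    T.push false A passed (h :: rest) σ =
      if T.det h A < 0 then
        T.push false A (passed ++ [h]) rest σ ++
          (if T.IsArrow h A then T.push false (.node A h) passed rest (σ * 1 *
            Int.negOnePow (pairing (A.total T.charge) (h.total T.charge)))
          else if T.IsArrow A h then T.push false (.node A h) passed rest (σ * -1 *
            Int.negOnePow (pairing (A.total T.charge) (h.total T.charge)))
          else [])
      else [(passed ++ A :: h :: rest, σ)] := by
  rw [push]
  simp only [true_and, Bool.false_eq_true, false_and, false_or, if_false]

/-- Signed sums over terms. -/
noncomputable def signedSum (S : List (List (MergeTree V) × ℤˣ)) (f : List (MergeTree V) → ℂ) : ℂ :=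
  (S.map fun u => ((u.2 : ℤ) : ℂ) * f u.1).sum

theorem signedSum_append (S S' : List (List (MergeTree V) × ℤˣ)) (f : List (MergeTree V) → ℂ) :
    signedSum (S ++ S') f = signedSum S f + signedSum S' f := by
  simp [signedSum]

/-- Each recursive step is one exchange identity, so the signed sum is preserved whether or not the
test on `det` lets the ray move on: the test only decides where the process stops. The lists `pre`
and `post` hold the vertices that have not been moved yet. -/
theorem push_cw (hPT : P.parent = T.parent) (hlt : lo < hi) (hP : P.Regular lo hi)
    (A : MergeTree V) (passed rest : List (MergeTree V)) (σ : ℤˣ)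
    (h : T.Good (pre ++ (passed ++ A :: rest) ++ post)) :
    (∀ u ∈ T.push true A passed rest σ, T.Good (pre ++ u.1 ++ post)) ∧
    signedSum (T.push true A passed rest σ) (fun L => T.listValue P lo hi (pre ++ L ++ post)) =
      ((σ : ℤ) : ℂ) * T.listValue P lo hi (pre ++ (passed ++ A :: rest) ++ post) := by
  induction rest generalizing A passed σ with
  | nil => simpa [push, signedSum] using h
  | cons B rest ih =>
    rw [push_true_cons]
    split_ifs with h1 h2 h3
    · have e1 : pre ++ (passed ++ A :: B :: rest) ++ post = (pre ++ passed) ++ A :: B :: (rest ++ post) := by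
        simp
      have e2 : pre ++ (passed ++ [B] ++ A :: rest) ++ post = (pre ++ passed) ++ B :: A :: (rest ++ post) := by
        simp
      have e3 : pre ++ (passed ++ .node A B :: rest) ++ post = (pre ++ passed) ++ .node A B :: (rest ++ post) := by
        simp
      rw [e1] at h
      obtain ⟨a1, a2⟩ := ih A (passed ++ [B]) σ (by
        rw [e2]; exact h.perm (List.Perm.append_left _ (List.Perm.swap ..)))
      obtain ⟨b1, b2⟩ := ih (.node A B) passed (σ * -1 *
        Int.negOnePow (pairing (A.total T.charge) (B.total T.charge))) (by
        rw [e3]; exact h.merge (Or.inl h2))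
      refine ⟨fun u hu => (List.mem_append.mp hu).elim (a1 u) (b1 u), ?_⟩
      rw [signedSum_append, a2, b2, e1, e2, e3,
        listValue_swap_of_arrow hPT hlt hP h (Or.inl ⟨h2, rfl⟩)]
      push_cast; ring
    · have e1 : pre ++ (passed ++ A :: B :: rest) ++ post = (pre ++ passed) ++ A :: B :: (rest ++ post) := by
        simp
      have e2 : pre ++ (passed ++ [B] ++ A :: rest) ++ post = (pre ++ passed) ++ B :: A :: (rest ++ post) := by
        simp
      have e3 : pre ++ (passed ++ .node A B :: rest) ++ post = (pre ++ passed) ++ .node A B :: (rest ++ post) := by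
        simp
      rw [e1] at h
      obtain ⟨a1, a2⟩ := ih A (passed ++ [B]) σ (by
        rw [e2]; exact h.perm (List.Perm.append_left _ (List.Perm.swap ..)))
      obtain ⟨b1, b2⟩ := ih (.node A B) passed (σ * 1 *
        Int.negOnePow (pairing (A.total T.charge) (B.total T.charge))) (by
        rw [e3]; exact h.merge (Or.inr h3))
      refine ⟨fun u hu => (List.mem_append.mp hu).elim (a1 u) (b1 u), ?_⟩
      rw [signedSum_append, a2, b2, e1, e2, e3,
        listValue_swap_of_arrow hPT hlt hP h (Or.inr ⟨h3, rfl⟩)]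
      push_cast; ring
    · have e1 : pre ++ (passed ++ A :: B :: rest) ++ post = (pre ++ passed) ++ A :: B :: (rest ++ post) := by
        simp
      have e2 : pre ++ (passed ++ [B] ++ A :: rest) ++ post = (pre ++ passed) ++ B :: A :: (rest ++ post) := by
        simp
      rw [e1] at h
      obtain ⟨a1, a2⟩ := ih A (passed ++ [B]) σ (by
        rw [e2]; exact h.perm (List.Perm.append_left _ (List.Perm.swap ..)))
      simp only [List.append_nil]
      refine ⟨a1, ?_⟩
      rw [a2, e1, e2, listValue_swap_of_not_arrow hPT hlt hP h h2 h3]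
    · refine ⟨fun u hu => ?_, ?_⟩
      · simp only [List.mem_singleton] at hu; subst hu; exact h
      · simp [signedSum]

theorem push_ccw (hPT : P.parent = T.parent) (hlt : lo < hi) (hP : P.Regular lo hi)
    (A : MergeTree V) (passed rest : List (MergeTree V)) (σ : ℤˣ)
    (h : T.Good (pre ++ (passed ++ A :: rest).reverse ++ post)) :
    (∀ u ∈ T.push false A passed rest σ, T.Good (pre ++ u.1.reverse ++ post)) ∧
    signedSum (T.push false A passed rest σ)
        (fun L => T.listValue P lo hi (pre ++ L.reverse ++ post)) =
      ((σ : ℤ) : ℂ) * T.listValue P lo hi (pre ++ (passed ++ A :: rest).reverse ++ post) := by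
  induction rest generalizing A passed σ with
  | nil => simpa [push, signedSum] using h
  | cons B rest ih =>
    rw [push_false_cons]
    have e1 : pre ++ (passed ++ A :: B :: rest).reverse ++ post =
        (pre ++ rest.reverse) ++ B :: A :: (passed.reverse ++ post) := by
      simp
    have e2 : pre ++ (passed ++ [B] ++ A :: rest).reverse ++ post =
        (pre ++ rest.reverse) ++ A :: B :: (passed.reverse ++ post) := by
      simp
    have e3 : pre ++ (passed ++ .node A B :: rest).reverse ++ post =
        (pre ++ rest.reverse) ++ .node A B :: (passed.reverse ++ post) := by
      simp
    have h' := h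
    rw [e1] at h'
    -- The list is read from its clockwise end, so `A` stands behind `B` and passes in front of it.
    -- The exchange identity is used from right to left, which reverses the sign of the residue.
    have h'' : T.Good ((pre ++ rest.reverse) ++ A :: B :: (passed.reverse ++ post)) :=
      h'.perm (List.Perm.append_left _ (List.Perm.swap ..))
    split_ifs with h1 h2 h3
    · obtain ⟨a1, a2⟩ := ih A (passed ++ [B]) σ (by rw [e2]; exact h'')
      obtain ⟨b1, b2⟩ := ih (.node A B) passed (σ * 1 *
        Int.negOnePow (pairing (A.total T.charge) (B.total T.charge))) (by
        rw [e3]; exact h''.merge (Or.inl h2))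
      refine ⟨fun u hu => (List.mem_append.mp hu).elim (a1 u) (b1 u), ?_⟩
      rw [signedSum_append, a2, b2, e1, e2, e3,
        listValue_swap_of_arrow hPT hlt hP h'' (Or.inl ⟨h2, rfl⟩)]
      push_cast; ring
    · obtain ⟨a1, a2⟩ := ih A (passed ++ [B]) σ (by rw [e2]; exact h'')
      obtain ⟨b1, b2⟩ := ih (.node A B) passed (σ * -1 *
        Int.negOnePow (pairing (A.total T.charge) (B.total T.charge))) (by
        rw [e3]; exact h''.merge (Or.inr h3))
      refine ⟨fun u hu => (List.mem_append.mp hu).elim (a1 u) (b1 u), ?_⟩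
      rw [signedSum_append, a2, b2, e1, e2, e3,
        listValue_swap_of_arrow hPT hlt hP h'' (Or.inr ⟨h3, rfl⟩)]
      push_cast; ring
    · obtain ⟨a1, a2⟩ := ih A (passed ++ [B]) σ (by rw [e2]; exact h'')
      simp only [List.append_nil]
      refine ⟨a1, ?_⟩
      rw [a2, e1, e2, listValue_swap_of_not_arrow hPT hlt hP h'' h2 h3]
    · refine ⟨fun u hu => ?_, ?_⟩
      · simp only [List.mem_singleton] at hu; subst hu; exact h
      · simp [signedSum]

/-- The vertices `vs` which are still to be moved, and the contracted vertices `L`. -/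
def fullList (T : DecoratedTree l₁ l₂ V) (vs : List V) (L : List (MergeTree V)) : List (MergeTree V) :=
  ((vs.filter fun v => (T.charge v).proj.1 = 0).map leaf).reverse ++ L ++
    (vs.filter fun v => ¬ (T.charge v).proj.1 = 0).map leaf

/-- In `fullList` the unmoved γ-vertices are listed in reverse at the counterclockwise end and the
unmoved η-vertices in order at the clockwise end. In either case the next vertex to be moved stands
directly beside the vertices already moved. -/
theorem moveVertex_sum (hPT : P.parent = T.parent) (hlt : lo < hi) (hP : P.Regular lo hi)
    (v : V) (vs : List V) (p : List (MergeTree V) × ℤˣ) (h : T.Good (T.fullList (v :: vs) p.1)) :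
    (∀ u ∈ T.moveVertex v p, T.Good (T.fullList vs u.1)) ∧
    signedSum (T.moveVertex v p) (fun L => T.listValue P lo hi (T.fullList vs L)) =
      ((p.2 : ℤ) : ℂ) * T.listValue P lo hi (T.fullList (v :: vs) p.1) := by
  unfold moveVertex
  split_ifs with hv
  · have e : T.fullList (v :: vs) p.1 =
        ((vs.filter fun v => (T.charge v).proj.1 = 0).map leaf).reverse ++ ([] ++ leaf v :: p.1) ++
          (vs.filter fun v => ¬ (T.charge v).proj.1 = 0).map leaf := by
      simp [fullList, hv]
    rw [e] at h ⊢
    exact push_cw hPT hlt hP _ _ _ _ h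
  · have e : T.fullList (v :: vs) p.1 =
        ((vs.filter fun v => (T.charge v).proj.1 = 0).map leaf).reverse ++
          ([] ++ leaf v :: p.1.reverse).reverse ++
          (vs.filter fun v => ¬ (T.charge v).proj.1 = 0).map leaf := by
      simp [fullList, hv]
    rw [e] at h ⊢
    obtain ⟨h1, h2⟩ := push_ccw hPT hlt hP _ _ _ p.2 h
    refine ⟨fun u hu => ?_, ?_⟩
    · obtain ⟨q, hq, rfl⟩ := List.mem_map.mp hu
      exact h1 q hq
    · rw [← h2]
      simp [signedSum, fullList, Function.comp_def]

theorem foldl_sum (hPT : P.parent = T.parent) (hlt : lo < hi) (hP : P.Regular lo hi)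
    (vs : List V) (S : List (List (MergeTree V) × ℤˣ)) (h : ∀ u ∈ S, T.Good (T.fullList vs u.1)) :
    (∀ u ∈ vs.foldl (fun S v => S.flatMap (T.moveVertex v)) S, T.Good u.1) ∧
    signedSum (vs.foldl (fun S v => S.flatMap (T.moveVertex v)) S) (T.listValue P lo hi) =
      signedSum S (fun L => T.listValue P lo hi (T.fullList vs L)) := by
  induction vs generalizing S with
  | nil => simpa [fullList] using h
  | cons v vs ih =>
    have hm := fun u hu => moveVertex_sum hPT hlt hP v vs u (h u hu)
    obtain ⟨h1, h2⟩ := ih (S.flatMap (T.moveVertex v)) (fun u hu => by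
      obtain ⟨w, hw, hu⟩ := List.mem_flatMap.mp hu
      exact (hm w hw).1 u hu)
    refine ⟨h1, ?_⟩
    simp only [List.foldl_cons]
    rw [h2]
    clear h1 h2 h ih
    induction S with
    | nil => simp [signedSum]
    | cons u S ih =>
      rw [List.flatMap_cons, signedSum_append, (hm u (by simp)).2,
        ih (fun w hw => hm w (by simp [hw]))]
      simp [signedSum]

/-- The list of the unmoved vertices, in clockwise order of their rays. -/
def initialList (T : DecoratedTree l₁ l₂ V) (ν : Fin (Fintype.card V) ≃ V) : List (MergeTree V) :=
  T.fullList (List.ofFn ν) []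

theorem initialList_perm (ν : Fin (Fintype.card V) ≃ V) :
    (T.initialList ν).Perm ((List.ofFn ν).map leaf) := by
  unfold initialList fullList
  rw [List.append_nil]
  refine ((List.reverse_perm _).append_right _).trans ?_
  rw [← List.map_append]
  refine List.Perm.map _ ?_
  have := List.filter_append_perm (fun v => decide ((T.charge v).proj.1 = 0)) (List.ofFn ν)
  simpa using this

theorem good_of_perm_leaves {L : List (MergeTree V)} {l : List V} (hL : L.Perm (l.map leaf))
    (hl : l.Nodup) (hl' : ∀ v, v ∈ l) : T.Good L := by
  have : T.Good (l.map leaf) := by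
    have e : (l.map (leaf : V → MergeTree V)).flatMap members = l := by
      rw [List.flatMap_map]
      simp [members]
    refine ⟨⟨by rw [e]; exact hl, by rw [e]; exact hl'⟩, fun m hm => ?_⟩
    obtain ⟨v, _, rfl⟩ := List.mem_map.mp hm
    exact ⟨v, by simp [members], fun a ha hne => by simp [members] at ha; exact absurd ha hne⟩
  exact this.perm hL.symm

theorem nodup_ofFn_labelling (ν : Fin (Fintype.card V) ≃ V) :
    (List.ofFn ν).Nodup ∧ ∀ v, v ∈ List.ofFn ν :=
  ⟨List.nodup_ofFn.mpr ν.injective, fun v => List.mem_ofFn.mpr ⟨ν.symm v, by simp⟩⟩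

theorem good_initialList (ν : Fin (Fintype.card V) ≃ V) : T.Good (T.initialList ν) :=
  good_of_perm_leaves (initialList_perm ν) (nodup_ofFn_labelling ν).1 (nodup_ofFn_labelling ν).2

/-- Moving all the rays, in terms of lists. -/
theorem residueTerms_sum (hPT : P.parent = T.parent) (hlt : lo < hi) (hP : P.Regular lo hi)
    (ν : Fin (Fintype.card V) ≃ V) :
    (∀ u ∈ T.residueTerms ν, T.Good u.1) ∧
    signedSum (T.residueTerms ν) (T.listValue P lo hi) = T.listValue P lo hi (T.initialList ν) := by
  have := foldl_sum (T := T) hPT hlt hP (List.ofFn ν) [([], 1)] (by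
    intro u hu
    simp only [List.mem_singleton] at hu
    subst hu
    exact good_initialList ν)
  refine ⟨this.1, this.2.trans ?_⟩
  simp [signedSum, initialList]

end Sums

end DecoratedTree

end

/-! ### Propagators of contracted trees as integrals attached to lists. -/

section

open Complex MeasureTheory Filter Topology Set MergeTree ChargeLattice

theorem MergeTree.total_eq_sum {V A : Type} [AddCommMonoid A] (α : V → A) (m : MergeTree V) :
    m.total α = (m.members.map α).sum := by
  induction m with
  | leaf v => simp [total, members]
  | node l r ihl ihr => simp [total, members, ihl, ihr]

theorem ChargeLattice.centralCharge_add {l₁ l₂ : ℕ} (x y : ℂ) (α β : ChargeLattice l₁ l₂) :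
    centralCharge x y (α + β) = centralCharge x y α + centralCharge x y β := by
  simp only [centralCharge, Prod.fst_add, Prod.snd_add, Pi.add_apply, Finset.sum_add_distrib]
  push_cast; ring

theorem MergeTree.centralCharge_total {l₁ l₂ : ℕ} {V : Type} (x y : ℂ) (α : V → ChargeLattice l₁ l₂)
    (m : MergeTree V) : centralCharge x y (m.total α) = (m.members.map fun v => centralCharge x y (α v)).sum := by
  rw [← MergeTree.total_eq_sum]
  induction m with
  | leaf v => simp [total]
  | node l r ihl ihr => simp [total, centralCharge_add, ihl, ihr]

/-- The exponent of ψ⁰ is additive in the central charge; so members sharing a variable together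
give the ψ⁰ of the contracted vertex. -/
theorem prod_psiZero {ι : Type} (R : ℝ) (z : ι → ℂ) (ζ : ℂ) (S : Finset ι) :
    ∏ v ∈ S, psiZero R (z v) ζ = psiZero R (∑ v ∈ S, z v) ζ := by
  simp only [psiZero, ← Complex.exp_sum, map_sum, Finset.mul_sum, ← Finset.sum_add_distrib, mul_add]

namespace DecoratedTree

variable {l₁ l₂ : ℕ} {V : Type} [Fintype V] [DecidableEq V]

/-- The data of the propagator, with integrands given by the central charge with values `x`, `y`. -/
noncomputable def rayData (T : DecoratedTree l₁ l₂ V) (x y : ℂ) (R : ℝ) (ζ : ℂ) : RayData V :=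
  ⟨T.parent, fun v => centralCharge x y (T.charge v), R, ζ⟩

theorem top_le {T : DecoratedTree l₁ l₂ V} {d : V → ℕ} (hd : ∀ v w, T.parent w = some v → d v < d w)
    {m : MergeTree V} {t : V}
    (hm : ∀ a ∈ m.members, a ≠ t → ∃ p ∈ m.members, T.parent a = some p) (n : ℕ) :
    ∀ a, d a = n → a ∈ m.members → d t ≤ d a := by
  induction n using Nat.strong_induction_on with
  | _ n ih =>
    intro a ha ham
    by_cases hat : a = t
    · rw [hat]
    · obtain ⟨p, hp, hpa⟩ := hm a ham hat
      have h1 := hd _ _ hpa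
      exact (ih (d p) (by omega) p rfl hp).trans h1.le

/-- The propagator of a contracted tree, in terms of the order of the rays. -/
theorem termPropagator_eq_listValue {T : DecoratedTree l₁ l₂ V} {x y ζ : ℂ} {R lo hi δ : ℝ}
    (hlt : lo < hi) (hP : (T.rayData x y R ζ).Regular lo hi) {L : List (MergeTree V)} (hL : T.Good L)
    {Z' : ChargeLattice l₁ l₂ → ℂ} (h0 : ∀ m ∈ L, Z' (m.total T.charge) ≠ 0)
    (hb : ∀ i : Fin L.length, lo ≤ (Z' ((L.get i).total T.charge)).arg - δ * (i : ℕ) ∧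
      (Z' ((L.get i).total T.charge)).arg - δ * (i : ℕ) ≤ hi)
    (hord : ∀ i j : Fin L.length, i < j → (Z' ((L.get j).total T.charge)).arg - δ * (j : ℕ) <
      (Z' ((L.get i).total T.charge)).arg - δ * (i : ℕ)) :
    T.termPropagator L (centralCharge x y) Z' δ R ζ = T.listValue (T.rayData x y R ζ) lo hi L := by
  obtain ⟨d, hd⟩ := T.exists_depth
  obtain ⟨hcov, hconn⟩ := hL
  set P := T.rayData x y R ζ with hPdef
  have hpar : P.parent = T.parent := rfl
  -- the index of a vertex
  have hidx : ∀ v, idx L v < L.length := by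
    intro v
    obtain ⟨m, h1, _⟩ := exists_of_mem (hcov.2 v)
    exact (List.getElem?_eq_some_iff.mp h1).1
  set g : V → Fin L.length := fun v => ⟨idx L v, hidx v⟩ with hg
  have hmem : ∀ v i, v ∈ (L.get i).members ↔ g v = i := by
    intro v i
    constructor
    · intro hv
      have := (idx_eq_of_mem hcov.1 (k := i) (m := L.get i) (by simp) hv).1
      exact Fin.ext this
    · intro h
      obtain ⟨m, h1, h2, _⟩ := exists_of_mem (hcov.2 v)
      rw [List.getElem?_eq_some_iff] at h1
      obtain ⟨h3, h4⟩ := h1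
      have : L.get i = m := by rw [← h4, ← h]; rfl
      rw [this]; exact h2
  have hclu : ∀ v, clu L v = (L.get (g v)).rep := by
    intro v
    exact (hcov.clu_eq_rep_iff (List.get_mem _ _) v).mpr ((hmem v _).mpr rfl)
  have hgrep : ∀ i, g (L.get i).rep = i := fun i => (hmem _ _).mp (L.get i).rep_mem
  have : Nonempty V := ⟨T.root⟩
  -- The top `t m` of each contracted vertex. An arrow of the contracted tree into `m` is the
  -- original arrow into `t m`, which determines `termParent`.
  choose! t htmem htop using hconn
  have htg : ∀ i, g (t (L.get i)) = i := fun i => (hmem _ _).mp (htmem _ (List.get_mem _ _))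
  have htpar : ∀ i p, T.parent (t (L.get i)) = some p → g p ≠ i := by
    intro i p hp hpi
    have h1 := top_le hd (htop (L.get i) (List.get_mem _ _)) _ p rfl ((hmem _ _).mpr hpi)
    have h2 := hd _ _ hp
    omega
  have harrow : ∀ i j, j ≠ i → T.IsArrow (L.get j) (L.get i) →
      ∃ p, T.parent (t (L.get i)) = some p ∧ g p = j := by
    rintro i j hji ⟨a, ha, b, hb, hab⟩
    by_cases hat : a = t (L.get i)
    · exact ⟨b, by rw [← hat, hab], (hmem _ _).mp hb⟩
    · obtain ⟨p, hp, hap⟩ := htop (L.get i) (List.get_mem _ _) a ha hat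
      rw [hab] at hap; cases hap
      rw [hmem] at hb hp
      exact absurd (hb.symm.trans hp) hji
  have hfind : ∀ i j, T.termParent L i = some j → j ≠ i ∧ T.IsArrow (L.get j) (L.get i) := by
    intro i j h
    have := List.find?_some h
    simpa using this
  have hnone : ∀ i, T.parent (t (L.get i)) = none → T.termParent L i = none := by
    intro i hi
    rcases h : T.termParent L i with _ | j
    · rfl
    · obtain ⟨h1, h2⟩ := hfind i j h
      obtain ⟨p, hp, _⟩ := harrow i j h1 h2
      rw [hi] at hp; cases hp
  have hsome : ∀ i p, T.parent (t (L.get i)) = some p → T.termParent L i = some (g p) := by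
    intro i p hp
    rcases h : T.termParent L i with _ | j
    · exfalso
      unfold termParent at h
      rw [List.find?_eq_none] at h
      have := h (g p) (List.mem_finRange _)
      simp only [decide_eq_true_eq, not_and] at this
      exact this (htpar i p hp) ⟨_, htmem _ (List.get_mem _ _), p, (hmem _ _).mpr rfl, hp⟩
    · obtain ⟨h1, h2⟩ := hfind i j h
      obtain ⟨q, hq, hj⟩ := harrow i j h1 h2
      rw [hp] at hq; cases hq
      rw [hj]
  -- The logarithm of a point on the ray, up to the sign; the clockwise rotation by δ times the
  -- position subtracts from the angle.
  set b : Fin L.length → ℂ := fun i =>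
    Complex.log (Z' ((L.get i).total T.charge)) - (δ * (i : ℕ) : ℝ) * I with hbdef
  have hbim : ∀ i, (b i).im = (Z' ((L.get i).total T.charge)).arg - δ * (i : ℕ) := by
    intro i
    simp only [hbdef, sub_im, mul_im, ofReal_re, I_im, mul_one, ofReal_im, I_re, mul_zero, add_zero,
      Complex.log_im]
  set ray : Fin L.length → ℂ := fun i =>
    -Z' ((L.get i).total T.charge) * Complex.exp (-(δ * (i : ℕ)) * Complex.I) with hray
  have hrayb : ∀ i, ray i = -Complex.exp (b i) := by
    intro i
    simp only [hray, hbdef]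
    rw [sub_eq_add_neg, Complex.exp_add, Complex.exp_log (h0 _ (List.get_mem _ _))]
    push_cast
    rw [neg_mul, neg_mul]
  set a : V → ℂ := fun v => b (g v) with ha
  have hord' : ∀ u u', P.Nbr (clu L) u u' → idx L u < idx L u' → (a u').im < (a u).im := by
    intro u u' _ h
    simp only [ha]
    rw [hbim, hbim]
    exact hord (g u) (g u') h
  have hlo : ∀ v, lo ≤ (a v).im := fun v => by simp only [ha]; rw [hbim]; exact (hb _).1
  have hhi : ∀ v, (a v).im ≤ hi := fun v => by simp only [ha]; rw [hbim]; exact (hb _).2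
  have hnode : ∀ (s : V → ℝ) i, nodePoint (fun i => (L.get i).rep) ray P.ζ s (some i) =
      -Complex.exp (s (L.get i).rep + a (L.get i).rep) := by
    intro s i
    simp only [nodePoint, hrayb, ha, hgrep]
    rw [Complex.exp_add, Complex.ofReal_exp]; ring
  have hint : ∀ s : V → ℝ, P.integrand (clu L) (fun v => s v + a v) = ∏ i,
      (rhoKernel (nodePoint (fun i => (L.get i).rep) ray P.ζ s (T.termParent L i))
        (nodePoint (fun i => (L.get i).rep) ray P.ζ s (some i)) *
          psiZero P.R (centralCharge x y ((L.get i).total T.charge))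
            (nodePoint (fun i => (L.get i).rep) ray P.ζ s (some i))) := by
    intro s
    unfold RayData.integrand RayData.psiProd
    rw [Finset.prod_mul_distrib, mul_comm]
    congr 1
    · rw [← Finset.prod_fiberwise Finset.univ g]
      refine Finset.prod_congr rfl fun i _ => ?_
      -- Among the arrows into members of one contracted vertex, all but the one into the top are
      -- internal and contribute 1.
      rw [Finset.prod_eq_single (t (L.get i))]
      · rcases hp : T.parent (t (L.get i)) with _ | p
        · rw [RayData.edge_none (by rw [hpar]; exact hp), hnone i hp, hnode, hclu, htg]
          rfl
        · rw [RayData.edge_some (by rw [hpar]; exact hp), hsome i p hp, hnode, hnode, hclu, hclu, htg,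
            if_neg]
          intro e
          have := hgrep (g p)
          rw [e, hgrep] at this
          exact htpar i p hp this.symm
      · intro v hv hvt
        have hvi := (Finset.mem_filter.mp hv).2
        obtain ⟨p, hp, hvp⟩ := htop (L.get i) (List.get_mem _ _) v ((hmem _ _).mpr hvi) hvt
        rw [RayData.edge_some (by rw [hpar]; exact hvp), if_pos]
        rw [hclu, hclu, hvi, (hmem _ _).mp hp]
      · intro h
        exact absurd (by rw [Finset.mem_filter]; exact ⟨Finset.mem_univ _, htg i⟩) h
    · rw [← Finset.prod_fiberwise Finset.univ g]
      refine Finset.prod_congr rfl fun i _ => ?_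
      rw [hnode, Finset.prod_congr rfl (g := fun v => psiZero P.R (P.z v)
        (-Complex.exp (s (L.get i).rep + a (L.get i).rep)))
        (fun v hv => by rw [hclu, (Finset.mem_filter.mp hv).2]), prod_psiZero,
        MergeTree.centralCharge_total]
      congr 1
      have hnd : (L.get i).members.Nodup := by
        have := hcov.1
        rw [List.nodup_flatMap] at this
        exact this.1 _ (List.get_mem _ _)
      rw [← List.sum_toFinset _ hnd]
      refine Finset.sum_congr ?_ fun _ _ => rfl
      ext v
      simp only [Finset.mem_filter, Finset.mem_univ, true_and, List.mem_toFinset]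
      exact (hmem v i).symm
  have hadm : P.Adm lo hi (clu L) a := RayData.adm_of_order hcov hlo hhi hord'
  have main := prod_iteratedIntegral_eq_clusterIntegral (P := P) (cl := clu L) (a := a)
    hP hadm (par := T.termParent L) (d := fun i => d (t (L.get i)))
    (fun i j hij => by
      obtain ⟨h1, h2⟩ := hfind j i hij
      obtain ⟨p, hp, hj⟩ := harrow j i h1 h2
      have h3 := hd _ _ hp
      have h4 := top_le hd (htop (L.get i) (List.get_mem _ _)) _ p rfl ((hmem _ _).mpr hj)
      exact lt_of_le_of_lt h4 h3)
    (z := fun i => centralCharge x y ((L.get i).total T.charge)) (ray := ray)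
    (rep := fun i => (L.get i).rep)
    (fun i j hij => by
      have := congrArg g hij
      simpa only [hgrep] using this)
    (fun v => by
      constructor
      · rintro ⟨i, rfl⟩
        rw [hclu, hgrep]
      · intro h
        exact ⟨g v, by rw [hclu] at h; exact h⟩) hint
  unfold termPropagator propagator listValue
  rw [← RayData.clusterIntegral_eq_listIntegral hlt hP hcov hlo hhi hord', ← main]
  congr 3
  refine twist_perm ?_
  have e : L.map (total T.charge) = (List.finRange L.length).map fun i => (L.get i).total T.charge := by
    conv_lhs => rw [← List.ofFn_get L, List.ofFn_eq_map, List.map_map]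
    rfl
  rw [e]
  refine List.Perm.map _ ?_
  exact (List.perm_ext_iff_of_nodup (Finset.nodup_toList _) (List.nodup_finRange _)).mpr fun i => by simp

theorem clu_of_perm_leaves {L : List (MergeTree V)} {l : List V} (hL : L.Perm (l.map leaf))
    (hcov : Covers L) (v : V) : clu L v = v := by
  obtain ⟨m, h1, h2, h3⟩ := exists_of_mem (hcov.2 v)
  have : m ∈ l.map leaf := hL.mem_iff.mp (List.mem_of_getElem? h1)
  obtain ⟨u, _, rfl⟩ := List.mem_map.mp this
  simp only [members, List.mem_singleton] at h2
  rw [h3, h2]; rfl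

/-- The propagator of the tree itself, in terms of the order of the rays. -/
theorem G_eq_listValue {T : DecoratedTree l₁ l₂ V} {x y ζ : ℂ} {R lo hi : ℝ}
    (hlt : lo < hi) (hP : (T.rayData x y R ζ).Regular lo hi) {L : List (MergeTree V)} {l : List V}
    (hL : L.Perm (l.map leaf)) (hl : l.Nodup) (hl' : ∀ v, v ∈ l)
    {Z' : ChargeLattice l₁ l₂ → ℂ} (h0 : ∀ v, Z' (T.charge v) ≠ 0)
    (hb : ∀ v, lo ≤ (Z' (T.charge v)).arg ∧ (Z' (T.charge v)).arg ≤ hi)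
    (hord : ∀ u v, (T.parent u = some v ∨ T.parent v = some u) → idx L u < idx L v →
      (Z' (T.charge v)).arg < (Z' (T.charge u)).arg) :
    T.G (centralCharge x y) Z' R ζ = T.listValue (T.rayData x y R ζ) lo hi L := by
  obtain ⟨d, hd⟩ := T.exists_depth
  have hcov : Covers L := (good_of_perm_leaves (T := T) hL hl hl').1
  set P := T.rayData x y R ζ with hPdef
  have hpar : P.parent = T.parent := rfl
  have hclu := clu_of_perm_leaves hL hcov
  set a : V → ℂ := fun v => Complex.log (Z' (T.charge v)) with ha
  have haim : ∀ v, (a v).im = (Z' (T.charge v)).arg := fun v => Complex.log_im _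
  have hord' : ∀ u u', P.Nbr (clu L) u u' → idx L u < idx L u' → (a u').im < (a u).im := by
    rintro u u' ⟨v, p, hp, _, ⟨e1, e2⟩ | ⟨e1, e2⟩⟩ h
    · rw [hclu] at e1 e2; subst e1 e2
      rw [haim, haim]; exact hord _ _ (Or.inr hp) h
    · rw [hclu] at e1 e2; subst e1 e2
      rw [haim, haim]; exact hord _ _ (Or.inl hp) h
  have hlo : ∀ v, lo ≤ (a v).im := fun v => by rw [haim]; exact (hb _).1
  have hhi : ∀ v, (a v).im ≤ hi := fun v => by rw [haim]; exact (hb _).2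
  have hadm : P.Adm lo hi (clu L) a := RayData.adm_of_order hcov hlo hhi hord'
  set ray : V → ℂ := fun v => -Z' (T.charge v) with hray
  have hnode : ∀ (s : V → ℝ) i, nodePoint id ray P.ζ s (some i) = -Complex.exp (s i + a i) := by
    intro s i
    simp only [nodePoint, hray, ha, id]
    rw [Complex.exp_add, Complex.ofReal_exp, Complex.exp_log (h0 i)]; ring
  have main := prod_iteratedIntegral_eq_clusterIntegral (P := P) (cl := clu L) (a := a)
    hP hadm (par := T.parent) (d := d) hd
    (z := fun v => centralCharge x y (T.charge v)) (ray := ray) (rep := id)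
    Function.injective_id (fun v => by simp [hclu])
    (fun s => by
      unfold RayData.integrand RayData.psiProd
      rw [Finset.prod_mul_distrib, mul_comm]
      congr 1
      · refine Finset.prod_congr rfl fun v _ => ?_
        rcases hp : T.parent v with _ | p
        · rw [RayData.edge_none (by rw [hpar]; exact hp), hnode, hclu]; rfl
        · rw [RayData.edge_some (by rw [hpar]; exact hp), hnode, hnode, hclu, hclu, if_neg]
          rintro rfl
          exact lt_irrefl _ (hd _ _ hp)
      · refine Finset.prod_congr rfl fun v _ => ?_
        rw [hnode, hclu]; rfl)
  unfold G propagator listValue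
  rw [← RayData.clusterIntegral_eq_listIntegral hlt hP hcov hlo hhi hord', ← main]
  congr 3
  refine twist_perm ?_
  have e : L.Perm ((Finset.univ : Finset V).toList.map leaf) := by
    refine hL.trans (List.Perm.map _ ?_)
    exact (List.perm_ext_iff_of_nodup hl (Finset.nodup_toList _)).mpr fun i => by simp [hl']
  refine ((e.map _).trans ?_).symm
  rw [List.map_map]; rfl

end DecoratedTree

end

/-! ### Invariants of the moving procedure: sorting, and the count of uncontracted terms. -/

section

open MergeTree ChargeLattice

namespace DecoratedTree

variable {l₁ l₂ : ℕ} {V : Type} [Fintype V] [DecidableEq V] {T : DecoratedTree l₁ l₂ V}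

/-- The orientation of a direction of rotation. -/
def orient (cw : Bool) : ℤ := if cw then 1 else -1

theorem push_condition_iff (cw : Bool) (n : ℤ) :
    ((cw = true ∧ 0 < n) ∨ (cw = false ∧ n < 0)) ↔ 0 < orient cw * n := by
  cases cw <;> simp [orient]

/-- An invariant of the moving process passes to all the terms obtained by moving a ray. -/
theorem push_induction {cw : Bool} {Inv : MergeTree V → List (MergeTree V) → List (MergeTree V) → Prop}
    (pass : ∀ A passed h rest, Inv A passed (h :: rest) → 0 < orient cw * T.det h A →
      Inv A (passed ++ [h]) rest)
    (merge : ∀ A passed h rest, Inv A passed (h :: rest) → 0 < orient cw * T.det h A →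
      (T.IsArrow h A ∨ T.IsArrow A h) → Inv (.node A h) passed rest)
    {A : MergeTree V} {passed rest : List (MergeTree V)} {σ : ℤˣ} (h0 : Inv A passed rest) :
    ∀ u ∈ T.push cw A passed rest σ, ∃ A' passed' rest', Inv A' passed' rest' ∧
      u.1 = passed' ++ A' :: rest' ∧ ∀ h ∈ rest'.head?, orient cw * T.det h A' ≤ 0 := by
  induction rest generalizing A passed σ with
  | nil =>
    intro u hu
    simp only [push, List.mem_singleton] at hu
    subst hu
    exact ⟨A, passed, [], h0, rfl, by simp⟩
  | cons h rest ih =>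
    intro u hu
    rw [push] at hu
    simp only [push_condition_iff] at hu
    split_ifs at hu with h1 h2 h3 h4 h5
    all_goals
      first
      | (simp only [List.append_nil] at hu; exact ih (pass _ _ _ _ h0 h1) u hu)
      | (rcases List.mem_append.mp hu with hu | hu
         · exact ih (pass _ _ _ _ h0 h1) u hu
         · first
           | exact ih (merge _ _ _ _ h0 h1 (Or.inl h2)) u hu
           | exact ih (merge _ _ _ _ h0 h1 (Or.inl ‹_›)) u hu
           | exact ih (merge _ _ _ _ h0 h1 (Or.inr ‹_›)) u hu)
      | (simp only [List.mem_singleton] at hu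
         subst hu
         exact ⟨A, passed, h :: rest, h0, rfl, by simpa using h1⟩)

/-- An invariant of the moving process holds for all the resulting terms. -/
theorem residueTerms_induction {Inv : List V → List (MergeTree V) → Prop}
    (step : ∀ v vs L σ, Inv (v :: vs) L → ∀ u ∈ T.moveVertex v (L, σ), Inv vs u.1)
    {ν : Fin (Fintype.card V) ≃ V} (h0 : Inv (List.ofFn ν) []) :
    ∀ u ∈ T.residueTerms ν, Inv [] u.1 := by
  have key : ∀ (vs : List V) (S : List (List (MergeTree V) × ℤˣ)), (∀ u ∈ S, Inv vs u.1) →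
      ∀ u ∈ vs.foldl (fun S v => S.flatMap (T.moveVertex v)) S, Inv [] u.1 := by
    intro vs
    induction vs with
    | nil => intro S hS u hu; exact hS u hu
    | cons v vs ih =>
      intro S hS u hu
      refine ih (S.flatMap (T.moveVertex v)) (fun w hw => ?_) u hu
      obtain ⟨p, hp, hw⟩ := List.mem_flatMap.mp hw
      exact step v vs p.1 p.2 (hS p hp) w hw
  exact key _ _ (by intro u hu; simp only [List.mem_singleton] at hu; subst hu; exact h0)

theorem IsPositive.proj_leaf (hT : T.IsPositive) (v : V) :
    0 ≤ (T.charge v).proj.1 ∧ 0 ≤ (T.charge v).proj.2 ∧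
      0 < (T.charge v).proj.1 + (T.charge v).proj.2 ∧
      ((T.charge v).proj.1 = 0 ∨ (T.charge v).proj.2 = 0) := by
  rcases hT.charge_pos v with ⟨i, p, hp, h⟩ | ⟨i, p, hp, h⟩ <;> rw [h] <;>
    simp [proj, gam, eta, hp, ← Finset.mul_sum]

theorem proj_add (α β : ChargeLattice l₁ l₂) : (α + β).proj = α.proj + β.proj := by
  simp [proj, Finset.sum_add_distrib]

theorem proj_total (m : MergeTree V) :
    (m.total T.charge).proj = m.total fun v => (T.charge v).proj := by
  induction m with
  | leaf v => rfl
  | node l r ihl ihr => simp only [total, proj_add, ihl, ihr]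

theorem IsPositive.proj_total (hT : T.IsPositive) (m : MergeTree V) :
    0 ≤ (m.total T.charge).proj.1 ∧ 0 ≤ (m.total T.charge).proj.2 ∧
      0 < (m.total T.charge).proj.1 + (m.total T.charge).proj.2 := by
  induction m with
  | leaf v => exact ⟨(hT.proj_leaf v).1, (hT.proj_leaf v).2.1, (hT.proj_leaf v).2.2.1⟩
  | node l r ihl ihr =>
    simp only [total, proj_add, Prod.fst_add, Prod.snd_add]
    omega

theorem det_node_right (A B C : MergeTree V) : T.det C (.node A B) = T.det C A + T.det C B := by
  simp only [det, total, proj_add, Prod.fst_add, Prod.snd_add]; ring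

theorem det_swap (A B : MergeTree V) : T.det A B = -T.det B A := by
  simp only [det]; ring

/-- With s the sum of the two coordinates, det(A,C) s(B) = det(A,B) s(C) + det(B,C) s(A), and s is
positive on the charges that occur. -/
theorem IsPositive.orient_det_trans (hT : T.IsPositive) {o : ℤ} {A B C : MergeTree V}
    (h1 : 0 ≤ o * T.det A B) (h2 : 0 ≤ o * T.det B C) : 0 ≤ o * T.det A C := by
  obtain ⟨_, _, hA⟩ := hT.proj_total A
  obtain ⟨_, _, hB⟩ := hT.proj_total B
  obtain ⟨_, _, hC⟩ := hT.proj_total C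
  have key : (o * T.det A C) * ((B.total T.charge).proj.1 + (B.total T.charge).proj.2) =
      (o * T.det A B) * ((C.total T.charge).proj.1 + (C.total T.charge).proj.2) +
      (o * T.det B C) * ((A.total T.charge).proj.1 + (A.total T.charge).proj.2) := by
    simp only [det]; ring
  have : 0 ≤ (o * T.det A C) * ((B.total T.charge).proj.1 + (B.total T.charge).proj.2) := by
    rw [key]; positivity
  exact nonneg_of_mul_nonneg_left this hB

/-- The invariant is that the other entries stay sorted and that all entries already passed lie
strictly before the moving one. It survives a contraction because det is additive in the moving
entry. At the stopping point the next entry is not strictly before the moving one, and transitivity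
settles the rest. -/
theorem IsPositive.push_sorted (hT : T.IsPositive) {cw : Bool} {A : MergeTree V}
    {L : List (MergeTree V)} {σ : ℤˣ} (hL : L.Pairwise fun A B => 0 ≤ orient cw * T.det A B) :
    ∀ u ∈ T.push cw A [] L σ, u.1.Pairwise fun A B => 0 ≤ orient cw * T.det A B := by
  intro u hu
  obtain ⟨A', p', r', ⟨i1, i2⟩, e, hh⟩ := push_induction
    (Inv := fun A passed rest => (passed ++ rest).Pairwise (fun A B => 0 ≤ orient cw * T.det A B) ∧
      ∀ p ∈ passed, 0 < orient cw * T.det p A)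
    (by
      rintro A passed h rest ⟨i1, i2⟩ hd
      refine ⟨by simpa using i1, fun p hp => ?_⟩
      simp only [List.mem_append, List.mem_singleton] at hp
      rcases hp with hp | rfl
      · exact i2 p hp
      · exact hd)
    (by
      rintro A passed h rest ⟨i1, i2⟩ hd _
      rw [List.pairwise_append] at i1
      refine ⟨?_, fun p hp => ?_⟩
      · rw [List.pairwise_append]
        exact ⟨i1.1, (List.pairwise_cons.mp i1.2.1).2, fun a ha b hb => i1.2.2 a ha b (by simp [hb])⟩
      · rw [det_node_right, mul_add]
        have := i2 p hp
        have := i1.2.2 p hp h (by simp)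
        omega)
    (h0 := ⟨by simpa using hL, by simp⟩) u hu
  rw [e]
  rw [List.pairwise_append] at i1 ⊢
  have hd : ∀ b ∈ r', 0 ≤ orient cw * T.det A' b := by
    rcases r' with _ | ⟨h, r⟩
    · simp
    · have h1 : 0 ≤ orient cw * T.det A' h := by
        have := hh h (by simp)
        rw [det_swap]; linarith
      intro b hb
      rcases List.mem_cons.mp hb with rfl | hb
      · exact h1
      · exact hT.orient_det_trans h1 ((List.pairwise_cons.mp i1.2.1).1 b hb)
  refine ⟨i1.1, List.pairwise_cons.mpr ⟨hd, i1.2.1⟩, fun a ha b hb => ?_⟩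
  rcases List.mem_cons.mp hb with rfl | hb
  · exact (i2 a ha).le
  · exact i1.2.2 a ha b hb

/-- The vertices of every term are listed in clockwise order of their rays. -/
theorem IsPositive.residueTerms_sorted (hT : T.IsPositive) (ν : Fin (Fintype.card V) ≃ V) :
    ∀ u ∈ T.residueTerms ν, u.1.Pairwise fun A B => 0 ≤ T.det A B := by
  refine residueTerms_induction (Inv := fun _ L => L.Pairwise fun A B => 0 ≤ T.det A B) ?_ (by simp)
  intro v vs L σ hL u hu
  unfold moveVertex at hu
  split_ifs at hu with hv
  · simpa [orient] using hT.push_sorted (cw := true) (by simpa [orient] using hL) u hu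
  · obtain ⟨q, hq, rfl⟩ := List.mem_map.mp hu
    have := hT.push_sorted (cw := false) (L := L.reverse) (by
      rw [List.pairwise_reverse]
      refine hL.imp fun {a b} hab => ?_
      rw [det_swap]; simpa [orient] using hab) q hq
    simp only [List.pairwise_reverse]
    refine this.imp fun {a b} hab => ?_
    rw [det_swap]; simpa [orient] using hab

/-- The indicator function of lists of original vertices. -/
noncomputable def leafIndicator (L : List (MergeTree V)) : ℂ :=
  (L.map fun m => match m with
    | .leaf _ => (1 : ℂ)
    | .node _ _ => 0).prod

theorem leafIndicator_eq_one {L : List (MergeTree V)} (h : ∀ m ∈ L, ∃ v, m = leaf v) :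
    leafIndicator L = 1 := by
  induction L with
  | nil => rfl
  | cons m L ih =>
    obtain ⟨v, rfl⟩ := h m (by simp)
    have := ih fun m hm => h m (by simp [hm])
    unfold leafIndicator at this ⊢
    simp [this]

theorem leafIndicator_eq_zero {L : List (MergeTree V)} {l r : MergeTree V} (h : node l r ∈ L) :
    leafIndicator L = 0 := by
  unfold leafIndicator
  exact List.prod_eq_zero (List.mem_map.mpr ⟨_, h, rfl⟩)

/-- A residue term contains a contracted vertex and does not count; the other branch of each
crossing keeps its sign and only permutes the list. -/
theorem signedSum_push_leafIndicator (cw : Bool) (A : MergeTree V) (passed rest : List (MergeTree V))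
    (σ : ℤˣ) : signedSum (T.push cw A passed rest σ) leafIndicator =
      ((σ : ℤ) : ℂ) * leafIndicator (passed ++ A :: rest) := by
  induction rest generalizing A passed σ with
  | nil => simp [push, signedSum]
  | cons h rest ih =>
    have h0 : leafIndicator (passed ++ .node A h :: rest) = 0 :=
      leafIndicator_eq_zero (l := A) (r := h) (by simp)
    have h1 : leafIndicator (passed ++ [h] ++ A :: rest) = leafIndicator (passed ++ A :: h :: rest) := by
      unfold leafIndicator
      exact List.Perm.prod_eq (List.Perm.map _ (by
        rw [List.append_assoc]
        exact List.Perm.append_left _ (List.Perm.swap ..)))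
    rw [push]
    split_ifs <;>
      first
      | simp only [signedSum_append, ih, h0, h1, mul_zero, add_zero, List.append_nil]
      | simp [signedSum]

/-- The uncontracted terms count 1 in total. They therefore reproduce the propagator over the rays
ℓ⁻ exactly once, which cancels the subtracted term of the jump. -/
theorem signedSum_residueTerms_leafIndicator (ν : Fin (Fintype.card V) ≃ V) :
    signedSum (T.residueTerms ν) leafIndicator = 1 := by
  have hm : ∀ v (p : List (MergeTree V) × ℤˣ), signedSum (T.moveVertex v p) leafIndicator =
      ((p.2 : ℤ) : ℂ) * leafIndicator p.1 := by
    intro v p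
    unfold moveVertex
    split_ifs with hv
    · rw [signedSum_push_leafIndicator]
      simp [leafIndicator]
    · have e : signedSum ((T.push false (leaf v) [] p.1.reverse p.2).map fun q => (q.1.reverse, q.2))
          leafIndicator = signedSum (T.push false (leaf v) [] p.1.reverse p.2) leafIndicator := by
        unfold signedSum
        rw [List.map_map]
        congr 1
        refine List.map_congr_left fun q _ => ?_
        change ((q.2 : ℤ) : ℂ) * _ = ((q.2 : ℤ) : ℂ) * _
        congr 1
        unfold leafIndicator
        exact List.Perm.prod_eq (List.Perm.map _ (List.reverse_perm _))
      rw [e, signedSum_push_leafIndicator]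
      congr 1
      have : leafIndicator p.1.reverse = leafIndicator p.1 := by
        unfold leafIndicator
        exact List.Perm.prod_eq (List.Perm.map _ (List.reverse_perm _))
      rw [← this]
      simp [leafIndicator]
  have key : ∀ (vs : List V) (S : List (List (MergeTree V) × ℤˣ)),
      signedSum (vs.foldl (fun S v => S.flatMap (T.moveVertex v)) S) leafIndicator =
        signedSum S leafIndicator := by
    intro vs
    induction vs with
    | nil => intro S; rfl
    | cons v vs ih =>
      intro S
      rw [List.foldl_cons, ih]
      induction S with
      | nil => simp [signedSum]
      | cons u S ih2 =>
        rw [List.flatMap_cons, signedSum_append, ih2, hm]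
        simp [signedSum]
  unfold residueTerms
  rw [key]
  simp [signedSum, leafIndicator]

/-- Splitting a signed sum over the terms into the uncontracted terms, the completely contracted
ones and the intermediate ones. -/
theorem signedSum_residueTerms {ν : Fin (Fintype.card V) ≃ V} {f : List (MergeTree V) → ℂ} {G K : ℂ}
    (hG : ∀ u ∈ T.residueTerms ν, (∀ m ∈ u.1, ∃ v, m = leaf v) → f u.1 = G)
    (hK : ∀ u ∈ T.residueTerms ν, ∀ l r, u.1 = [node l r] → f u.1 = K) :
    signedSum (T.residueTerms ν) f =
      G + (T.signSum ν : ℂ) * K + signedSum (T.intermediateTerms ν) f := by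
  have key : ∀ S : List (List (MergeTree V) × ℤˣ),
      (∀ u ∈ S, (∀ m ∈ u.1, ∃ v, m = leaf v) → f u.1 = G) →
      (∀ u ∈ S, ∀ l r, u.1 = [node l r] → f u.1 = K) →
      signedSum S f = signedSum S leafIndicator * G +
        ((((S.filterMap fun p => match p.1 with
          | [.node l r] => some (MergeTree.tropType (fun v => (T.charge v).proj) l r, p.2)
          | _ => none).map fun t => (t.2 : ℤ)).sum : ℤ) : ℂ) * K +
        signedSum (S.filter fun p => decide (1 < p.1.length) && p.1.any fun m => match m with
          | .leaf _ => false
          | .node _ _ => true) f := by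
    intro S
    induction S with
    | nil => intros; simp [signedSum]
    | cons u S ih =>
      intro h1 h2
      have ih := ih (fun w hw => h1 w (by simp [hw])) (fun w hw => h2 w (by simp [hw]))
      have e : ∀ S g, signedSum (u :: S) g = ((u.2 : ℤ) : ℂ) * g u.1 + signedSum S g := fun S g => by
        simp [signedSum]
      rw [e, e, ih]
      -- An uncontracted term enters only the indicator sum. A term with a contracted vertex is
      -- either a single node, which enters the sign sum, or has several entries and passes the
      -- filter for intermediate terms.
      by_cases hall : ∀ m ∈ u.1, ∃ v, m = leaf v
      · have hany : (u.1.any fun m => match m with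
          | .leaf _ => false
          | .node _ _ => true) = false := by
          rw [List.any_eq_false]
          intro m hm
          obtain ⟨v, rfl⟩ := hall m hm
          simp
        have hnone : (match u.1 with
          | [.node l r] => some (MergeTree.tropType (fun v => (T.charge v).proj) l r, u.2)
          | _ => none) = none := by
          split
          · rename_i l r heq
            obtain ⟨v, hv⟩ := hall (node l r) (by rw [heq]; simp)
            cases hv
          · rfl
        rw [List.filterMap_cons, hnone, List.filter_cons, hany, h1 u (by simp) hall,
          leafIndicator_eq_one hall]
        simp only [Bool.and_false, Bool.false_eq_true, if_false]
        ring
      · push Not at hall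
        obtain ⟨m, hm, hmv⟩ := hall
        rcases m with v | ⟨l, r⟩
        · exact absurd rfl (hmv v)
        have hany : (u.1.any fun m => match m with
          | .leaf _ => false
          | .node _ _ => true) = true := by
          rw [List.any_eq_true]
          exact ⟨_, hm, rfl⟩
        rw [leafIndicator_eq_zero hm, List.filter_cons, hany, Bool.and_true]
        by_cases hlen : 1 < u.1.length
        · have hnone : (match u.1 with
            | [.node l r] => some (MergeTree.tropType (fun v => (T.charge v).proj) l r, u.2)
            | _ => none) = none := by
            split
            · rename_i l r heq
              rw [heq] at hlen; simp at hlen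
            · rfl
          rw [List.filterMap_cons, hnone]
          simp only [hlen, decide_true, if_true, e]
          ring
        · have h1' : u.1 = [node l r] := by
            rcases hu : u.1 with _ | ⟨a, _ | ⟨b, L⟩⟩
            · rw [hu] at hm; simp at hm
            · rw [hu] at hm; simp at hm; rw [hm]
            · rw [hu] at hlen; simp at hlen
          rw [h2 u (by simp) l r h1', List.filterMap_cons]
          rw [show (match u.1 with
            | [.node l r] => some (MergeTree.tropType (fun v => (T.charge v).proj) l r, u.2)
            | _ => none) = some (MergeTree.tropType (fun v => (T.charge v).proj) l r, u.2) by
              rw [h1']]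
          simp only [hlen, decide_false, Bool.false_eq_true, if_false, List.map_cons, List.sum_cons]
          push_cast
          ring
  have := key _ hG hK
  rw [signedSum_residueTerms_leafIndicator, one_mul] at this
  exact this

end DecoratedTree

end

/-! ### Lipschitz dependence on the central charge, decay for large radius, and Laplace's method. -/

section

open Complex MeasureTheory Filter Topology Set MergeTree ChargeLattice

/-- The mean value inequality on the half plane Re ≤ m, which is convex and on which the derivative
is bounded by e^m. -/
theorem Complex.norm_exp_sub_exp_le {A B : ℂ} {m : ℝ} (hA : A.re ≤ m) (hB : B.re ≤ m) :
    ‖Complex.exp A - Complex.exp B‖ ≤ Real.exp m * ‖A - B‖ :=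
  Convex.norm_image_sub_le_of_norm_deriv_le (s := {z : ℂ | z.re ≤ m}) (𝕜 := ℂ)
    (fun _ _ => Complex.differentiableAt_exp)
    (fun z hz => by rw [Complex.deriv_exp, Complex.norm_exp]; exact Real.exp_le_exp.mpr hz)
    (convex_halfSpace_re_le m) hB hA

theorem mul_exp_neg_le {c t : ℝ} (hc : 0 < c) : t * Real.exp (-(c * t)) ≤ 1 / c := by
  have h := Real.add_one_le_exp (c * t)
  rw [Real.exp_neg, ← div_eq_mul_inv, div_le_div_iff₀ (Real.exp_pos _) hc]
  nlinarith

/-- The exponent of the semiflat coefficient. -/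
noncomputable def psiExponent (R : ℝ) (z w : ℂ) : ℂ :=
  Real.pi * R * ((-Complex.exp w)⁻¹ * z + -Complex.exp w * (starRingEnd ℂ) z)

theorem psiZero_neg_exp (R : ℝ) (z w : ℂ) :
    psiZero R z (-Complex.exp w) = Complex.exp (psiExponent R z w) := rfl

theorem re_psiExponent (R : ℝ) (z w : ℂ) : (psiExponent R z w).re =
    -(2 * Real.pi * R * (z * Complex.exp (-(w.im * I))).re * Real.cosh w.re) := by
  have := norm_psiZero_neg_exp R z w
  rw [psiZero_neg_exp, Complex.norm_exp] at this
  exact Real.exp_injective this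

theorem norm_psiExponent_sub_le {R : ℝ} (hR : 0 ≤ R) (z z' w : ℂ) :
    ‖psiExponent R z w - psiExponent R z' w‖ ≤ 2 * Real.pi * R * Real.cosh w.re * ‖z - z'‖ := by
  have e : psiExponent R z w - psiExponent R z' w = (Real.pi * R : ℝ) *
      ((-Complex.exp w)⁻¹ * (z - z') + -Complex.exp w * (starRingEnd ℂ) (z - z')) := by
    unfold psiExponent; rw [map_sub]; push_cast; ring
  rw [e, norm_mul, Complex.norm_real, Real.norm_of_nonneg (by positivity)]
  have h1 : ‖(-Complex.exp w)⁻¹ * (z - z') + -Complex.exp w * (starRingEnd ℂ) (z - z')‖ ≤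
      2 * Real.cosh w.re * ‖z - z'‖ := by
    refine (norm_add_le _ _).trans (le_of_eq ?_)
    rw [norm_mul, norm_mul, norm_inv, norm_neg, Complex.norm_exp, RCLike.norm_conj, Real.cosh_eq,
      ← Real.exp_neg]
    ring
  calc _ ≤ Real.pi * R * (2 * Real.cosh w.re * ‖z - z'‖) := by gcongr
    _ = _ := by ring

namespace RayData

variable {V : Type} [Fintype V] [DecidableEq V]

theorem Adm.congr {P Q : RayData V} {lo hi : ℝ} {cl : V → V} {a : V → ℂ} (h : P.Adm lo hi cl a)
    (hPQ : P.parent = Q.parent) : Q.Adm lo hi cl a :=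
  ⟨h.idem, h.lo_le, h.le_hi, fun v p hp hc => h.sep v p (by rw [hPQ]; exact hp) hc⟩

theorem edge_congr {P Q : RayData V} (h1 : P.parent = Q.parent) (h2 : P.ζ = Q.ζ) (cl : V → V)
    (w : V → ℂ) (v : V) : P.edge cl w v = Q.edge cl w v := by
  unfold edge; rw [h1, h2]

theorem exists_norm_prod_edge_le {parent : V → Option V} {ζ : ℂ} {lo hi : ℝ} {cl : V → V} {a : V → ℂ}
    (hπ : hi - lo < Real.pi) (hζ : Away ζ lo hi) (h : RayData.Adm ⟨parent, 0, 0, ζ⟩ lo hi cl a) :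
    ∃ C, 0 ≤ C ∧ ∀ z R, ∀ s : V → ℝ,
      ‖∏ v, RayData.edge ⟨parent, z, R, ζ⟩ cl (fun v => s v + a v) v‖ ≤ C := by
  choose C hC0 hC using fun v => exists_norm_edge_le hπ hζ h v
  refine ⟨∏ v, C v, Finset.prod_nonneg fun v _ => hC0 v, fun z R s => ?_⟩
  rw [norm_prod]
  exact Finset.prod_le_prod (fun _ _ => norm_nonneg _) fun v _ => hC v s

theorem psiProd_eq_exp (P : RayData V) (cl : V → V) (w : V → ℂ) :
    P.psiProd cl w = Complex.exp (∑ v, psiExponent P.R (P.z v) (w (cl v))) := by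
  rw [Complex.exp_sum]; rfl

/-- The integrals depend on the central charge in a Lipschitz way, uniformly in the radius. -/
theorem clusterIntegral_lipschitz {parent : V → Option V} {ζ : ℂ} {lo hi c : ℝ} {cl : V → V} {a : V → ℂ}
    (hπ : hi - lo < Real.pi) (hζ : Away ζ lo hi) (h : RayData.Adm ⟨parent, 0, 0, ζ⟩ lo hi cl a)
    (hc : 0 < c) : ∃ C, 0 ≤ C ∧ ∀ (z z' : V → ℂ) (R η : ℝ), 1 ≤ R → 0 ≤ η →
      (∀ v, ∀ θ : ℝ, lo ≤ θ → θ ≤ hi → c ≤ (z v * Complex.exp (-(θ * I))).re) →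
      (∀ v, ∀ θ : ℝ, lo ≤ θ → θ ≤ hi → c ≤ (z' v * Complex.exp (-(θ * I))).re) →
      (∀ v, ‖z v - z' v‖ ≤ η) →
      ‖RayData.clusterIntegral ⟨parent, z, R, ζ⟩ cl a - RayData.clusterIntegral ⟨parent, z', R, ζ⟩ cl a‖ ≤
        C * η := by
  obtain ⟨C, hC0, hC⟩ := exists_norm_prod_edge_le hπ hζ h
  have hk : 0 < Real.pi * c := mul_pos Real.pi_pos hc
  have hint := integrable_majorant hk cl a
  have hmaj : ∀ s, 0 ≤ majorant (Real.pi * c) cl a s := fun s =>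
    Finset.prod_nonneg fun v _ => by split_ifs; exacts [(Real.exp_pos _).le, auxDensity_nonneg _]
  refine ⟨C * (2 / c) * ∫ s, majorant (Real.pi * c) cl a s, by
    have := integral_nonneg (μ := volume) (f := majorant (Real.pi * c) cl a) hmaj
    positivity, fun z z' R η hR hη hz hz' hzz => ?_⟩
  have hR0 : 0 < R := by linarith
  have i1 := integrable_integrand (P := ⟨parent, z, R, ζ⟩) ⟨hR0, hπ, ⟨c, hc, hz⟩, hζ⟩ (h.congr rfl)
  have i2 := integrable_integrand (P := ⟨parent, z', R, ζ⟩) ⟨hR0, hπ, ⟨c, hc, hz'⟩, hζ⟩ (h.congr rfl)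
  unfold clusterIntegral
  rw [← integral_sub i1 i2]
  have key : ∀ s, ‖RayData.integrand ⟨parent, z, R, ζ⟩ cl (fun v => s v + a v) * aux cl s -
      RayData.integrand ⟨parent, z', R, ζ⟩ cl (fun v => s v + a v) * aux cl s‖ ≤
      C * (2 / c) * η * majorant (Real.pi * c) cl a s := by
    intro s
    set w : V → ℂ := fun v => s v + a v with hw
    have hlo : ∀ v, lo ≤ (w (cl v)).im := fun v => by simpa [hw] using h.lo_le (cl v)
    have hhi : ∀ v, (w (cl v)).im ≤ hi := fun v => by simpa [hw] using h.le_hi (cl v)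
    set Y : ℝ := ∑ v, Real.cosh (w (cl v)).re with hY
    have hY0 : 0 ≤ Y := Finset.sum_nonneg fun v _ => (Real.cosh_pos _).le
    have hre : ∀ z : V → ℂ, (∀ v, ∀ θ : ℝ, lo ≤ θ → θ ≤ hi → c ≤ (z v * Complex.exp (-(θ * I))).re) →
        (∑ v, psiExponent R (z v) (w (cl v))).re ≤ -(2 * Real.pi * R * c * Y) := by
      intro z hz
      rw [Complex.re_sum, hY, Finset.mul_sum, ← Finset.sum_neg_distrib]
      refine Finset.sum_le_sum fun v _ => ?_
      rw [re_psiExponent]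
      apply neg_le_neg
      have := hz v _ (hlo v) (hhi v)
      have := Real.cosh_pos (w (cl v)).re
      have := Real.pi_pos
      gcongr
    have hd : ‖∑ v, psiExponent R (z v) (w (cl v)) - ∑ v, psiExponent R (z' v) (w (cl v))‖ ≤
        2 * Real.pi * R * Y * η := by
      rw [← Finset.sum_sub_distrib]
      refine (norm_sum_le _ _).trans ?_
      rw [hY, Finset.mul_sum, Finset.sum_mul]
      refine Finset.sum_le_sum fun v _ => (norm_psiExponent_sub_le hR0.le _ _ _).trans ?_
      have := hzz v
      have := Real.cosh_pos (w (cl v)).re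
      have := Real.pi_pos
      gcongr
    have hpsi : ‖RayData.psiProd ⟨parent, z, R, ζ⟩ cl w - RayData.psiProd ⟨parent, z', R, ζ⟩ cl w‖ ≤
        2 / c * η * Real.exp (-(Real.pi * c * Y)) := by
      rw [psiProd_eq_exp, psiProd_eq_exp]
      refine (Complex.norm_exp_sub_exp_le (hre z hz) (hre z' hz')).trans ?_
      calc Real.exp (-(2 * Real.pi * R * c * Y)) *
            ‖∑ v, psiExponent R (z v) (w (cl v)) - ∑ v, psiExponent R (z' v) (w (cl v))‖
          ≤ Real.exp (-(2 * Real.pi * R * c * Y)) * (2 * Real.pi * R * Y * η) := by gcongr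
        -- The difference of the exponents grows like R·Y. Half of the exponential decay absorbs
        -- this factor, since t e^{-ct/2} ≤ 2/c; the other half leaves an integrable majorant
        -- independent of R ≥ 1.
        _ = η * ((2 * Real.pi * R * Y) * Real.exp (-(c / 2 * (2 * Real.pi * R * Y)))) *
            Real.exp (-(Real.pi * c * R * Y)) := by
          rw [show -(2 * Real.pi * R * c * Y) = -(c / 2 * (2 * Real.pi * R * Y)) +
            -(Real.pi * c * R * Y) by ring, Real.exp_add]
          ring
        _ ≤ η * (1 / (c / 2)) * Real.exp (-(Real.pi * c * Y)) := by
          have h1 := mul_exp_neg_le (c := c / 2) (t := 2 * Real.pi * R * Y) (by linarith)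
          have h2 : Real.exp (-(Real.pi * c * R * Y)) ≤ Real.exp (-(Real.pi * c * Y)) := by
            apply Real.exp_le_exp.mpr
            have : 0 ≤ Real.pi * c * Y := by positivity
            nlinarith
          gcongr
        _ = _ := by field_simp
    have e : RayData.integrand ⟨parent, z, R, ζ⟩ cl w * aux cl s -
        RayData.integrand ⟨parent, z', R, ζ⟩ cl w * aux cl s =
        (∏ v, RayData.edge ⟨parent, z, R, ζ⟩ cl w v) *
        ((RayData.psiProd ⟨parent, z, R, ζ⟩ cl w - RayData.psiProd ⟨parent, z', R, ζ⟩ cl w) * aux cl s) := by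
      unfold integrand
      rw [Finset.prod_congr rfl fun v _ => edge_congr (P := ⟨parent, z', R, ζ⟩)
        (Q := ⟨parent, z, R, ζ⟩) rfl rfl cl w v]
      ring
    rw [e, norm_mul, norm_mul]
    calc _ ≤ C * (2 / c * η * Real.exp (-(Real.pi * c * Y)) * ‖aux cl s‖) := by
          gcongr
          exact hC z R s
      _ = C * (2 / c) * η * (Real.exp (-(Real.pi * c * Y)) * ‖aux cl s‖) := by ring
      _ ≤ _ := by
          gcongr
          exact exp_mul_norm_aux_le hk a s
  calc _ ≤ ∫ s, C * (2 / c) * η * majorant (Real.pi * c) cl a s :=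
        norm_integral_le_of_norm_le (hint.const_mul _) (ae_of_all _ key)
    _ = _ := by rw [integral_const_mul]; ring

/-- The exponential decay of the integrals for large radius. -/
theorem clusterIntegral_decay {parent : V → Option V} {ζ : ℂ} {lo hi c : ℝ} {cl : V → V} {a : V → ℂ}
    (hπ : hi - lo < Real.pi) (hζ : Away ζ lo hi) (h : RayData.Adm ⟨parent, 0, 0, ζ⟩ lo hi cl a)
    (hc : 0 < c) {z : V → ℂ} {κ : V → ℝ} (hκ : ∀ v, c ≤ κ v)
    (hz : ∀ v, κ v ≤ (z v * Complex.exp (-((a (cl v)).im * I))).re) :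
    ∃ C, ∀ R : ℝ, 1 ≤ R → ‖RayData.clusterIntegral ⟨parent, z, R, ζ⟩ cl a‖ ≤
      C * Real.exp (-(2 * Real.pi * R * ∑ v, κ v)) := by
  obtain ⟨C, hC0, hC⟩ := exists_norm_prod_edge_le hπ hζ h
  have hk : 0 < 2 * Real.pi * c := by have := Real.pi_pos; positivity
  have hint := integrable_majorant hk cl a
  refine ⟨C * Real.exp (∑ _v : V, 2 * Real.pi * c) * ∫ s, majorant (2 * Real.pi * c) cl a s,
    fun R hR => ?_⟩
  have key : ∀ s, ‖RayData.integrand ⟨parent, z, R, ζ⟩ cl (fun v => s v + a v) * aux cl s‖ ≤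
      C * Real.exp (∑ _v : V, 2 * Real.pi * c) * Real.exp (-(2 * Real.pi * R * ∑ v, κ v)) *
        majorant (2 * Real.pi * c) cl a s := by
    intro s
    set w : V → ℂ := fun v => s v + a v with hw
    have him : ∀ v, (w (cl v)).im = (a (cl v)).im := fun v => by simp [hw]
    set Y : ℝ := ∑ v, Real.cosh (w (cl v)).re with hY
    have hpsi : ‖RayData.psiProd ⟨parent, z, R, ζ⟩ cl w‖ ≤
        Real.exp (∑ _v : V, 2 * Real.pi * c) * Real.exp (-(2 * Real.pi * R * ∑ v, κ v)) *
          Real.exp (-(2 * Real.pi * c * Y)) := by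
      rw [psiProd_eq_exp, Complex.norm_exp, ← Real.exp_add, ← Real.exp_add, Complex.re_sum, hY,
        Finset.mul_sum, Finset.mul_sum, ← Finset.sum_neg_distrib, ← Finset.sum_neg_distrib,
        ← Finset.sum_add_distrib, ← Finset.sum_add_distrib]
      refine Real.exp_le_exp.mpr (Finset.sum_le_sum fun v _ => ?_)
      rw [re_psiExponent, him]
      have h1 := Real.one_le_cosh (w (cl v)).re
      have h2 := hκ v
      have h3 := hz v
      set k := (z v * Complex.exp (-((a (cl v)).im * I))).re
      set X := Real.cosh (w (cl v)).re
      -- As cosh ≥ 1, the exponent is split as Rκ cosh = Rκ + Rκ(cosh - 1). The first part is the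
      -- full decay rate in R; the second is at least c(cosh - 1) and secures integrability
      -- uniformly in R ≥ 1.
      have h4 : c * (X - 1) ≤ R * κ v * (X - 1) := by
        have : c ≤ R * κ v := by nlinarith
        nlinarith
      have h5 : R * κ v * X ≤ R * k * X := by gcongr
      have : 2 * Real.pi * (c * (X - 1) + R * κ v) ≤ 2 * Real.pi * (R * k * X) := by
        have := Real.pi_pos
        gcongr
        linarith
      linarith
    unfold integrand
    rw [norm_mul, norm_mul]
    calc _ ≤ (Real.exp (∑ _v : V, 2 * Real.pi * c) * Real.exp (-(2 * Real.pi * R * ∑ v, κ v)) *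
          Real.exp (-(2 * Real.pi * c * Y))) * C * ‖aux cl s‖ := by
          gcongr
          exact hC z R s
      _ = C * Real.exp (∑ _v : V, 2 * Real.pi * c) * Real.exp (-(2 * Real.pi * R * ∑ v, κ v)) *
          (Real.exp (-(2 * Real.pi * c * Y)) * ‖aux cl s‖) := by ring
      _ ≤ _ := by
          gcongr
          exact exp_mul_norm_aux_le hk a s
  unfold clusterIntegral
  calc _ ≤ ∫ s, C * Real.exp (∑ _v : V, 2 * Real.pi * c) * Real.exp (-(2 * Real.pi * R * ∑ v, κ v)) *
        majorant (2 * Real.pi * c) cl a s :=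
        norm_integral_le_of_norm_le (hint.const_mul _) (ae_of_all _ key)
    _ = _ := by rw [integral_const_mul]; ring

end RayData

/-! The leading term. -/

theorem Real.cosh_sub_one_bounds (t : ℝ) :
    t ^ 2 / 2 ≤ Real.cosh t - 1 ∧ Real.cosh t - 1 ≤ Real.exp (t ^ 2 / 2) - 1 :=
  ⟨by linarith [Real.one_add_sq_div_two_le_cosh t], by linarith [Real.cosh_le_exp_half_sq t]⟩

/-- Squeezed between t²/2 ≤ cosh t - 1 ≤ e^{t²/2} - 1 at t = v/√X, with the quadratic Taylor bound
for the exponential. -/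
theorem tendsto_mul_cosh_sub_one (v : ℝ) :
    Tendsto (fun X : ℝ => X * (Real.cosh (v / √X) - 1)) atTop (𝓝 (v ^ 2 / 2)) := by
  have hsq : ∀ X : ℝ, 0 < X → (v / √X) ^ 2 / 2 = v ^ 2 / 2 / X := fun X hX => by
    rw [div_pow, Real.sq_sqrt hX.le]; ring
  have hup : Tendsto (fun X : ℝ => v ^ 2 / 2 + (v ^ 2 / 2) ^ 2 / X) atTop (𝓝 (v ^ 2 / 2)) := by
    have := (tendsto_const_nhds (x := (v ^ 2 / 2) ^ 2)).div_atTop (tendsto_id (α := ℝ) (x := atTop))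
    simpa using this.const_add (v ^ 2 / 2)
  refine tendsto_of_tendsto_of_tendsto_of_le_of_le' tendsto_const_nhds hup ?_ ?_
  · filter_upwards [eventually_gt_atTop 0] with X hX
    have h := (Real.cosh_sub_one_bounds (v / √X)).1
    rw [hsq X hX] at h
    calc v ^ 2 / 2 = X * (v ^ 2 / 2 / X) := by field_simp
      _ ≤ _ := by gcongr
  · filter_upwards [eventually_ge_atTop (v ^ 2 / 2), eventually_gt_atTop 0] with X hX hX0
    have h := (Real.cosh_sub_one_bounds (v / √X)).2
    rw [hsq X hX0] at h
    have h1 : |v ^ 2 / 2 / X| ≤ 1 := by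
      rw [abs_of_nonneg (by positivity), div_le_one hX0]; exact hX
    have h2 := (abs_le.mp (Real.abs_exp_sub_one_sub_id_le h1)).2
    calc X * (Real.cosh (v / √X) - 1) ≤ X * (v ^ 2 / 2 / X + (v ^ 2 / 2 / X) ^ 2) := by
          gcongr; linarith
      _ = _ := by field_simp

/-- Laplace's method for the modified Bessel function. -/
theorem tendsto_sqrt_mul_integral_cosh :
    Tendsto (fun X : ℝ => √X * Real.exp X * ∫ u : ℝ, Real.exp (-(X * Real.cosh u))) atTop
      (𝓝 √(2 * Real.pi)) := by
  -- The substitution v = u√X: at the scale of the minimum of cosh the integrand is dominated by a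
  -- Gaussian and converges to it.
  have hlim : Tendsto (fun X : ℝ => ∫ v : ℝ, Real.exp (-(X * (Real.cosh (v / √X) - 1)))) atTop
      (𝓝 (∫ v : ℝ, Real.exp (-(v ^ 2 / 2)))) := by
    refine tendsto_integral_filter_of_dominated_convergence (fun v => Real.exp (-(1 / 2) * v ^ 2)) ?_ ?_ ?_ ?_
    · exact Eventually.of_forall fun X => (Measurable.aestronglyMeasurable (by fun_prop))
    · filter_upwards [eventually_gt_atTop 0] with X hX
      refine ae_of_all _ fun v => ?_
      rw [Real.norm_eq_abs, Real.abs_exp]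
      apply Real.exp_le_exp.mpr
      have h := (Real.cosh_sub_one_bounds (v / √X)).1
      rw [div_pow, Real.sq_sqrt hX.le] at h
      have : v ^ 2 / 2 = X * (v ^ 2 / X / 2) := by field_simp
      nlinarith
    · exact integrable_exp_neg_mul_sq (by norm_num)
    · exact ae_of_all _ fun v => (Real.continuous_exp.tendsto _).comp (tendsto_mul_cosh_sub_one v).neg
  have e : ∫ v : ℝ, Real.exp (-(v ^ 2 / 2)) = √(2 * Real.pi) := by
    have := integral_gaussian (1 / 2)
    rw [show Real.pi / (1 / 2) = 2 * Real.pi by ring] at this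
    rw [← this]
    congr 1; ext v; ring_nf
  rw [e] at hlim
  refine hlim.congr' ?_
  filter_upwards [eventually_gt_atTop 0] with X hX
  have hs : 0 < √X := Real.sqrt_pos.mpr hX
  have h1 := Measure.integral_comp_div (fun u : ℝ => Real.exp (-(X * (Real.cosh u - 1)))) √X
  rw [h1, abs_of_pos hs, smul_eq_mul, mul_assoc]
  congr 1
  rw [← integral_const_mul]
  refine integral_congr_ae (ae_of_all _ fun u => ?_)
  simp only
  rw [← Real.exp_add]; congr 1; ring

end

/-! ### First quadrant geometry; estimates for positive trees; terms with a single vertex. -/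

section

open Complex MeasureTheory Filter Topology Set MergeTree ChargeLattice

/-! Plane geometry in the first quadrant. -/

/-- The determinant of two complex numbers. -/
def cross (z w : ℂ) : ℝ := z.re * w.im - z.im * w.re

theorem arg_mem_of_firstQuadrant {z : ℂ} (hz : z ∈ firstQuadrant) :
    0 ≤ z.arg ∧ z.arg < Real.pi / 2 :=
  ⟨Complex.arg_nonneg_iff.mpr hz.2.le,
    (abs_lt.mp (Complex.abs_arg_lt_pi_div_two_iff.mpr (Or.inl hz.1))).2⟩

theorem cross_eq_sin (z w : ℂ) : cross z w = ‖z‖ * ‖w‖ * Real.sin (w.arg - z.arg) := by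
  rw [Real.sin_sub, cross, ← Complex.norm_mul_cos_arg z, ← Complex.norm_mul_sin_arg z,
    ← Complex.norm_mul_cos_arg w, ← Complex.norm_mul_sin_arg w]
  ring

theorem ne_zero_of_firstQuadrant {z : ℂ} (hz : z ∈ firstQuadrant) : z ≠ 0 := fun h => by
  have := hz.1; rw [h] at this; exact lt_irrefl _ this

theorem cross_pos_iff {z w : ℂ} (hz : z ∈ firstQuadrant) (hw : w ∈ firstQuadrant) :
    0 < cross z w ↔ z.arg < w.arg := by
  have h1 := arg_mem_of_firstQuadrant hz
  have h2 := arg_mem_of_firstQuadrant hw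
  have h3 : 0 < ‖z‖ * ‖w‖ := mul_pos (norm_pos_iff.mpr (ne_zero_of_firstQuadrant hz))
    (norm_pos_iff.mpr (ne_zero_of_firstQuadrant hw))
  have hpi := Real.pi_pos
  rw [cross_eq_sin, mul_pos_iff_of_pos_left h3]
  constructor
  · intro h
    by_contra hc
    push Not at hc
    have := Real.sin_nonpos_of_nonpos_of_neg_pi_le (x := w.arg - z.arg) (by linarith) (by linarith)
    linarith
  · intro h
    exact Real.sin_pos_of_pos_of_lt_pi (by linarith) (by linarith)

theorem cross_swap (z w : ℂ) : cross z w = -cross w z := by unfold cross; ring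

theorem cross_nonneg_iff {z w : ℂ} (hz : z ∈ firstQuadrant) (hw : w ∈ firstQuadrant) :
    0 ≤ cross z w ↔ z.arg ≤ w.arg := by
  rw [← not_lt, ← not_lt, ← cross_pos_iff hw hz, cross_swap]
  simp

/-- The real part is Re z cos θ + Im z sin θ, and cos θ + sin θ ≥ 1 for 0 ≤ θ ≤ π/2. A common lower
bound for real and imaginary parts thus serves for all rays at once. -/
theorem le_re_mul_exp {c θ : ℝ} {z : ℂ} (hc : 0 ≤ c) (h1 : c ≤ z.re) (h2 : c ≤ z.im) (h3 : 0 ≤ θ)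
    (h4 : θ ≤ Real.pi / 2) : c ≤ (z * Complex.exp (-(θ * I))).re := by
  have e : (z * Complex.exp (-(θ * I))).re = z.re * Real.cos θ + z.im * Real.sin θ := by
    simp [Complex.exp_re, Complex.exp_im]
  have hcos := Real.cos_nonneg_of_neg_pi_div_two_le_of_le (by linarith [Real.pi_pos]) h4
  have hsin := Real.sin_nonneg_of_nonneg_of_le_pi h3 (by linarith [Real.pi_pos])
  have h5 : 1 ≤ Real.cos θ + Real.sin θ := by
    nlinarith [Real.cos_sq_add_sin_sq θ, Real.cos_le_one θ, Real.sin_le_one θ]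
  rw [e]
  nlinarith

theorem ChargeLattice.centralCharge_eq {l₁ l₂ : ℕ} (x y : ℂ) (α : ChargeLattice l₁ l₂) :
    centralCharge x y α = (α.proj.2 : ℂ) * x + (α.proj.1 : ℂ) * y := rfl

/-- Both numbers have real and imaginary parts at least `c`. -/
def BoundedBelow (c : ℝ) (x y : ℂ) : Prop := (c ≤ x.re ∧ c ≤ x.im) ∧ c ≤ y.re ∧ c ≤ y.im

theorem exists_boundedBelow {x y : ℂ} (hx : x ∈ firstQuadrant) (hy : y ∈ firstQuadrant) :
    ∃ c, 0 < c ∧ BoundedBelow c x y :=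
  ⟨min (min x.re x.im) (min y.re y.im), by
    simp only [lt_min_iff]; exact ⟨⟨hx.1, hx.2⟩, hy.1, hy.2⟩,
    ⟨(min_le_left _ _).trans (min_le_left _ _), (min_le_left _ _).trans (min_le_right _ _)⟩,
    (min_le_right _ _).trans (min_le_left _ _), (min_le_right _ _).trans (min_le_right _ _)⟩

theorem BoundedBelow.centralCharge {l₁ l₂ : ℕ} {c : ℝ} {x y : ℂ} (h : BoundedBelow c x y) (hc : 0 ≤ c)
    {α : ChargeLattice l₁ l₂} (h1 : 0 ≤ α.proj.1) (h2 : 0 ≤ α.proj.2) (h3 : 0 < α.proj.1 + α.proj.2) :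
    c ≤ (centralCharge x y α).re ∧ c ≤ (centralCharge x y α).im := by
  have h1' : (0 : ℝ) ≤ α.proj.1 := by exact_mod_cast h1
  have h2' : (0 : ℝ) ≤ α.proj.2 := by exact_mod_cast h2
  have h3' : (1 : ℝ) ≤ α.proj.1 + α.proj.2 := by exact_mod_cast h3
  obtain ⟨⟨a1, a2⟩, a3, a4⟩ := h
  rw [centralCharge_eq]
  simp only [add_re, mul_re, intCast_re, intCast_im, add_im, mul_im, zero_mul, sub_zero, add_zero]
  constructor <;> nlinarith

theorem centralCharge_mem {l₁ l₂ : ℕ} {x y : ℂ} (hx : x ∈ firstQuadrant) (hy : y ∈ firstQuadrant)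
    {α : ChargeLattice l₁ l₂} (h1 : 0 ≤ α.proj.1) (h2 : 0 ≤ α.proj.2) (h3 : 0 < α.proj.1 + α.proj.2) :
    ChargeLattice.centralCharge x y α ∈ firstQuadrant := by
  obtain ⟨c, hc, h⟩ := exists_boundedBelow hx hy
  have := h.centralCharge hc.le h1 h2 h3
  exact ⟨hc.trans_le this.1, hc.trans_le this.2⟩

namespace DecoratedTree

variable {l₁ l₂ : ℕ} {V : Type} [Fintype V] [DecidableEq V] {T : DecoratedTree l₁ l₂ V}

theorem IsPositive.charge_mem (hT : T.IsPositive) {x y : ℂ} (hx : x ∈ firstQuadrant)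
    (hy : y ∈ firstQuadrant) (m : MergeTree V) :
    centralCharge x y (m.total T.charge) ∈ firstQuadrant :=
  centralCharge_mem hx hy (hT.proj_total m).1 (hT.proj_total m).2.1 (hT.proj_total m).2.2

theorem IsPositive.half (hT : T.IsPositive) {c lo hi : ℝ} {x y : ℂ} (h : BoundedBelow c x y)
    (hc : 0 ≤ c) (hlo : 0 ≤ lo) (hhi : hi ≤ Real.pi / 2) (v : V) (θ : ℝ) (h1 : lo ≤ θ) (h2 : θ ≤ hi) :
    c ≤ (centralCharge x y (T.charge v) * Complex.exp (-(θ * I))).re := by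
  obtain ⟨a1, a2, a3, _⟩ := hT.proj_leaf v
  have := h.centralCharge hc a1 a2 a3
  exact le_re_mul_exp hc this.1 this.2 (by linarith) (by linarith)

theorem IsPositive.regular (hT : T.IsPositive) {lo hi R : ℝ} {x y ζ : ℂ} (hx : x ∈ firstQuadrant)
    (hy : y ∈ firstQuadrant) (hR : 0 < R) (hlo : 0 ≤ lo) (hhi : hi ≤ Real.pi / 2)
    (hζ : Away ζ lo hi) : (T.rayData x y R ζ).Regular lo hi := by
  obtain ⟨c, hc, h⟩ := exists_boundedBelow hx hy
  exact ⟨hR, by linarith [Real.pi_pos], ⟨c, hc, fun v θ h1 h2 => hT.half h hc.le hlo hhi v θ h1 h2⟩, hζ⟩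

theorem IsPositive.listValue_lipschitz (hT : T.IsPositive) {lo hi c : ℝ} {ζ : ℂ} (hlt : lo < hi)
    (hlo : 0 ≤ lo) (hhi : hi ≤ Real.pi / 2) (hζ : Away ζ lo hi) (hc : 0 < c) {L : List (MergeTree V)}
    (hL : T.Good L) :
    ∃ C, 0 ≤ C ∧ ∀ (x y x' y' : ℂ) (R η : ℝ), 1 ≤ R → BoundedBelow c x y → BoundedBelow c x' y' →
      ‖x - x'‖ ≤ η → ‖y - y'‖ ≤ η →
      ‖T.listValue (T.rayData x y R ζ) lo hi L - T.listValue (T.rayData x' y' R ζ) lo hi L‖ ≤ C * η := by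
  obtain ⟨C, hC0, hC⟩ := RayData.clusterIntegral_lipschitz (parent := T.parent) (cl := clu L)
    (a := fun v => (stdAngle lo hi (idx L v) : ℂ) * I) (by linarith [Real.pi_pos]) hζ
    (RayData.adm_stdAngle hlt hL.1) hc
  set N : ℝ := ∑ v, ((T.charge v).proj.1 + (T.charge v).proj.2 : ℝ) with hN
  have hNv : ∀ v, (0 : ℝ) ≤ (T.charge v).proj.1 ∧ (0 : ℝ) ≤ (T.charge v).proj.2 := fun v => by
    obtain ⟨a1, a2, _⟩ := hT.proj_leaf v
    exact ⟨by exact_mod_cast a1, by exact_mod_cast a2⟩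
  have hN0 : 0 ≤ N := Finset.sum_nonneg fun v _ => by linarith [(hNv v).1, (hNv v).2]
  refine ⟨C * N, by positivity, fun x y x' y' R η hR h h' hx hy => ?_⟩
  have hη : 0 ≤ η := (norm_nonneg _).trans hx
  have main := hC (fun v => centralCharge x y (T.charge v)) (fun v => centralCharge x' y' (T.charge v))
    R (N * η) hR (by positivity) (fun v θ => hT.half h hc.le hlo hhi v θ)
    (fun v θ => hT.half h' hc.le hlo hhi v θ) (fun v => by
      rw [centralCharge_eq, centralCharge_eq, show ((T.charge v).proj.2 : ℂ) * x + (T.charge v).proj.1 * y -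
        ((T.charge v).proj.2 * x' + (T.charge v).proj.1 * y') =
        ((T.charge v).proj.2 : ℝ) * (x - x') + ((T.charge v).proj.1 : ℝ) * (y - y') by push_cast; ring]
      refine (norm_add_le _ _).trans ?_
      rw [norm_mul, norm_mul, Complex.norm_real, Complex.norm_real, Real.norm_of_nonneg (hNv v).1,
        Real.norm_of_nonneg (hNv v).2]
      have h1 : ((T.charge v).proj.1 + (T.charge v).proj.2 : ℝ) ≤ N :=
        Finset.single_le_sum (f := fun v => ((T.charge v).proj.1 + (T.charge v).proj.2 : ℝ))
          (fun v _ => by linarith [(hNv v).1, (hNv v).2]) (Finset.mem_univ v)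
      have := (hNv v).1
      have := (hNv v).2
      calc _ ≤ ((T.charge v).proj.2 : ℝ) * η + ((T.charge v).proj.1 : ℝ) * η := by gcongr
        _ = ((T.charge v).proj.1 + (T.charge v).proj.2 : ℝ) * η := by ring
        _ ≤ N * η := by gcongr)
  unfold listValue
  rw [← mul_sub, norm_mul]
  have ht : ‖((twist (L.map (total T.charge)) : ℤ) : ℂ)‖ = 1 := by
    rcases Int.units_eq_one_or (twist (L.map (total T.charge))) with h | h <;> rw [h] <;> simp
  rw [ht, one_mul, mul_assoc]
  exact main

theorem norm_unit_mul (σ : ℤˣ) (z : ℂ) : ‖((σ : ℤ) : ℂ) * z‖ = ‖z‖ := by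
  rcases Int.units_eq_one_or σ with h | h <;> rw [h] <;> simp

theorem IsPositive.signedSum_lipschitz (hT : T.IsPositive) {lo hi c : ℝ} {ζ : ℂ} (hlt : lo < hi)
    (hlo : 0 ≤ lo) (hhi : hi ≤ Real.pi / 2) (hζ : Away ζ lo hi) (hc : 0 < c)
    {S : List (List (MergeTree V) × ℤˣ)} (hS : ∀ u ∈ S, T.Good u.1) :
    ∃ C, 0 ≤ C ∧ ∀ (x y x' y' : ℂ) (R η : ℝ), 1 ≤ R → BoundedBelow c x y → BoundedBelow c x' y' →
      ‖x - x'‖ ≤ η → ‖y - y'‖ ≤ η →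
      ‖signedSum S (T.listValue (T.rayData x y R ζ) lo hi) -
        signedSum S (T.listValue (T.rayData x' y' R ζ) lo hi)‖ ≤ C * η := by
  induction S with
  | nil => exact ⟨0, le_rfl, fun _ _ _ _ _ _ _ _ _ _ _ => by simp [signedSum]⟩
  | cons u S ih =>
    obtain ⟨C, hC0, hC⟩ := ih fun w hw => hS w (by simp [hw])
    obtain ⟨C', hC0', hC'⟩ := hT.listValue_lipschitz hlt hlo hhi hζ hc (hS u (by simp))
    refine ⟨C' + C, by positivity, fun x y x' y' R η hR h h' hx hy => ?_⟩
    have e : ∀ f, signedSum (u :: S) f = ((u.2 : ℤ) : ℂ) * f u.1 + signedSum S f := fun f => by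
      simp [signedSum]
    rw [e, e, add_sub_add_comm, ← mul_sub, add_mul]
    refine (norm_add_le _ _).trans (add_le_add ?_ (hC x y x' y' R η hR h h' hx hy))
    rw [norm_unit_mul]
    exact hC' x y x' y' R η hR h h' hx hy

/-- A single vertex carries the total charge. -/
theorem Good.total_single {m : MergeTree V} (h : T.Good [m]) : m.total T.charge = T.totalCharge := by
  rw [MergeTree.total_eq_sum, totalCharge]
  have h1 := h.1.1
  have h2 := h.1.2
  simp only [List.flatMap_cons, List.flatMap_nil, List.append_nil] at h1 h2
  rw [← List.sum_toFinset _ h1]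
  refine Finset.sum_congr ?_ fun _ _ => rfl
  ext v; simp [h2]

theorem termPropagator_single (m : MergeTree V) (Z Z' : ChargeLattice l₁ l₂ → ℂ) (δ R : ℝ) (ζ : ℂ) :
    T.termPropagator [m] Z Z' δ R ζ = ∫ s : ℝ, rhoKernel ζ (Real.exp s * -Z' (m.total T.charge)) *
      psiZero R (Z (m.total T.charge)) (Real.exp s * -Z' (m.total T.charge)) := by
  have hpar : ∀ i, T.termParent [m] i = none := by
    intro i
    unfold termParent
    rw [List.find?_eq_none]
    intro j _
    have : j = i := Subsingleton.elim (α := Fin 1) j i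
    simp [this]
  unfold termPropagator propagator
  simp only [hpar]
  have : (Finset.univ : Finset (Fin [m].length)).toList = [(0 : Fin 1)] := Finset.toList_singleton (0 : Fin 1)
  rw [this]
  have h2 : ∀ f : Fin [m].length → ℂ, ∏ v with True, f v = f (0 : Fin 1) := by
    intro f
    simp only [Finset.filter_true]
    exact Fin.prod_univ_one (f : Fin 1 → ℂ)
  rw [h2]
  have hcard : Fintype.card (Fin [m].length) = 1 := rfl
  rw [hcard]
  simp only [iteratedIntegral]
  simp [twist, pairing]

/-- A history containing all vertices. -/
theorem exists_good_single (T : DecoratedTree l₁ l₂ V) : ∃ m : MergeTree V, T.Good [m] := by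
  have key : ∀ l : List V, l ≠ [] → ∃ m : MergeTree V, m.members = l := by
    intro l
    induction l with
    | nil => intro h; exact absurd rfl h
    | cons v l ih =>
      intro _
      rcases eq_or_ne l [] with rfl | h
      · exact ⟨leaf v, rfl⟩
      · obtain ⟨m, hm⟩ := ih h
        exact ⟨node (leaf v) m, by simp [members, hm]⟩
  obtain ⟨m, hm⟩ := key Finset.univ.toList (by
    intro h
    have : T.root ∈ (Finset.univ : Finset V).toList := by simp
    rw [h] at this; simp at this)
  refine ⟨m, ⟨⟨by simp [hm, Finset.nodup_toList], by simp [hm]⟩, fun m' hm' => ?_⟩⟩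
  simp only [List.mem_singleton] at hm'
  subst hm'
  refine ⟨T.root, by simp [hm], fun a _ ha => ?_⟩
  rcases h : T.parent a with _ | p
  · exact absurd ((T.parent_eq_none_iff a).mp h) ha
  · exact ⟨p, by simp [hm], rfl⟩

/-- The value of a single contracted vertex. -/
theorem listValue_single {x y x' y' ζ : ℂ} {R lo hi : ℝ} (hlt : lo < hi)
    (hP : (T.rayData x y R ζ).Regular lo hi) {m : MergeTree V} (hL : T.Good [m])
    (h0 : centralCharge x' y' T.totalCharge ≠ 0)
    (h1 : lo ≤ (centralCharge x' y' T.totalCharge).arg) (h2 : (centralCharge x' y' T.totalCharge).arg ≤ hi) :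
    T.listValue (T.rayData x y R ζ) lo hi [m] = ∫ s : ℝ,
      rhoKernel ζ (Real.exp s * -centralCharge x' y' T.totalCharge) *
      psiZero R (centralCharge x y T.totalCharge) (Real.exp s * -centralCharge x' y' T.totalCharge) := by
  have hm := hL.total_single
  rw [← termPropagator_eq_listValue (δ := 0) hlt hP hL (Z' := centralCharge x' y')
    (fun m' hm' => by
      simp only [List.mem_singleton] at hm'
      rw [hm', hm]; exact h0)
    (fun i => by
      have : [m].get i = m := by
        simp
      rw [this, hm]; simpa using ⟨h1, h2⟩)
    (fun i j hij => absurd (Subsingleton.elim (α := Fin 1) i j) hij.ne), termPropagator_single, hm]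

end DecoratedTree

end

/-! ### Decay of terms with several vertices; propagators over the rays ℓ⁺ and ℓ⁻. -/

section

open Complex MeasureTheory Filter Topology Set MergeTree ChargeLattice

theorem arg_intCast_mul {n : ℤ} (hn : 0 < n) (z : ℂ) : ((n : ℂ) * z).arg = z.arg := by
  have := Complex.arg_real_mul z (r := (n : ℝ)) (by exact_mod_cast hn)
  simpa using this

theorem cross_centralCharge {l₁ l₂ : ℕ} (x y : ℂ) (α β : ChargeLattice l₁ l₂) :
    cross (centralCharge x y α) (centralCharge x y β) =
      (α.proj.1 * β.proj.2 - α.proj.2 * β.proj.1 : ℤ) * cross y x := by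
  rw [centralCharge_eq, centralCharge_eq]
  unfold cross
  simp only [add_re, mul_re, intCast_re, intCast_im, add_im, mul_im, zero_mul, sub_zero, add_zero]
  push_cast
  ring

theorem norm_add_lt_of_cross_ne_zero {z w : ℂ} (h : cross z w ≠ 0) : ‖z + w‖ < ‖z‖ + ‖w‖ := by
  refine norm_add_lt_of_not_sameRay fun hs => h ?_
  rcases Complex.sameRay_iff.mp hs with rfl | rfl | h
  · simp [cross]
  · simp [cross]
  · rw [cross_eq_sin, h]; simp

theorem norm_list_sum_le (L : List ℂ) : ‖L.sum‖ ≤ (L.map fun z => ‖z‖).sum := by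
  induction L with
  | nil => simp
  | cons z L ih =>
    rw [List.sum_cons, List.map_cons, List.sum_cons]
    exact (norm_add_le _ _).trans (by linarith)

theorem re_mul_exp_neg_arg (z : ℂ) : (z * Complex.exp (-(z.arg * I))).re = ‖z‖ := by
  nth_rewrite 1 [← Complex.norm_mul_exp_arg_mul_I z]
  rw [mul_assoc, ← Complex.exp_add]
  simp

theorem continuous_re_mul_exp (z : ℂ) (A k : ℝ) :
    Continuous fun δ : ℝ => (z * Complex.exp (-((A - δ * k : ℝ) * I))).re := by
  refine Complex.continuous_re.comp ?_
  fun_prop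

theorem MergeTree.Covers.sum_flatMap {V A : Type} [Fintype V] [DecidableEq V] [AddCommMonoid A]
    {L : List (MergeTree V)} (hL : Covers L) (f : V → A) :
    (L.map fun m => (m.members.map f).sum).sum = ∑ v, f v := by
  have h1 : (L.map fun m => (m.members.map f).sum).sum = ((L.flatMap members).map f).sum := by
    clear hL
    induction L with
    | nil => simp
    | cons m L ih => simp [ih]
  rw [h1, ← List.sum_toFinset _ hL.1]
  refine Finset.sum_congr ?_ fun _ _ => rfl
  ext v; simpa using hL.2 v

namespace DecoratedTree

variable {l₁ l₂ : ℕ} {V : Type} [Fintype V] [DecidableEq V] {T : DecoratedTree l₁ l₂ V}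

theorem Good.sum_total {L : List (MergeTree V)} (h : T.Good L) : (L.map (total T.charge)).sum = T.totalCharge := by
  rw [totalCharge, ← h.1.sum_flatMap]
  congr 1
  exact List.map_congr_left fun m _ => MergeTree.total_eq_sum _ _

theorem proj_list_sum (L : List (ChargeLattice l₁ l₂)) : L.sum.proj = (L.map proj).sum := by
  induction L with
  | nil => simp [proj]
  | cons α L ih => rw [List.sum_cons, proj_add, ih]; simp

/-- If the total charge is primitive, not all the vertices of a term have parallel charges. -/
theorem IsPositive.exists_det_ne_zero (hT : T.IsPositive)
    (hprim : IsCoprime T.reducedCharge.1 T.reducedCharge.2) {L : List (MergeTree V)} (hL : T.Good L)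
    (hlen : 1 < L.length) : ∃ A ∈ L, (A.total T.charge).proj.1 * T.reducedCharge.2 -
      (A.total T.charge).proj.2 * T.reducedCharge.1 ≠ 0 := by
  by_contra hcon
  push Not at hcon
  set c := T.reducedCharge with hc
  have hsum : (L.map fun m => (m.total T.charge).proj).sum = c := by
    rw [hc, reducedCharge, ← hL.sum_total, proj_list_sum, List.map_map]; rfl
  have hs : (L.map fun m => (m.total T.charge).proj.1 + (m.total T.charge).proj.2).sum = c.1 + c.2 := by
    rw [← hsum]
    clear hsum hcon hlen hL
    induction L with
    | nil => simp
    | cons m L ih =>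
      simp only [List.map_cons, List.sum_cons, ih, Prod.fst_add, Prod.snd_add]; ring
  have hge : ∀ m ∈ L, c.1 + c.2 ≤ (m.total T.charge).proj.1 + (m.total T.charge).proj.2 ∨ c.1 + c.2 ≤ 0 := by
    intro m hm
    obtain ⟨_, _, hpos⟩ := hT.proj_total m
    have h0 := hcon m hm
    obtain ⟨u, v, huv⟩ := hprim
    set a := (m.total T.charge).proj.1
    set b := (m.total T.charge).proj.2
    -- A charge parallel to the primitive vector c is k·c with k = ua + vb, from the Bézout
    -- relation. By positivity k ≥ 1, so each vertex is at least as large as the total, which is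
    -- impossible for two or more vertices.
    have e : a + b = (u * a + v * b) * (c.1 + c.2) := by
      linear_combination (-(a + b)) * huv + (v - u) * h0
    by_cases hcc : c.1 + c.2 ≤ 0
    · exact Or.inr hcc
    · left
      push Not at hcc
      have hk : 0 < u * a + v * b := by
        by_contra hk
        push Not at hk
        nlinarith
      rw [e]; nlinarith
  rcases L with _ | ⟨m1, _ | ⟨m2, L⟩⟩
  · simp at hlen
  · simp at hlen
  · obtain ⟨_, _, p1⟩ := hT.proj_total m1
    obtain ⟨_, _, p2⟩ := hT.proj_total m2
    have h1 := hge m1 (by simp)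
    have h2 := hge m2 (by simp)
    have h3 : 0 ≤ (L.map fun m => (m.total T.charge).proj.1 + (m.total T.charge).proj.2).sum := by
      refine List.sum_nonneg fun n hn => ?_
      obtain ⟨m, _, rfl⟩ := List.mem_map.mp hn
      exact (hT.proj_total m).2.2.le
    simp only [List.map_cons, List.sum_cons] at hs
    omega

/-- The exponential decay of the terms with several vertices. -/
theorem IsPositive.listValue_decay (hT : T.IsPositive)
    (hprim : IsCoprime T.reducedCharge.1 T.reducedCharge.2) {lo hi : ℝ} {ζ x y : ℂ}
    (hlo : 0 ≤ lo) (hhi : hi ≤ Real.pi / 2) (hζ : Away ζ lo hi)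
    (hx : x ∈ firstQuadrant) (hy : y ∈ firstQuadrant) (hxy : x.arg < y.arg) (hlx : lo < x.arg)
    (hyh : y.arg ≤ hi) {L : List (MergeTree V)} (hL : T.Good L)
    (hsort : L.Pairwise fun A B => 0 ≤ T.det A B) (hlen : 1 < L.length) :
    ∃ M C : ℝ, ‖centralCharge x y T.totalCharge‖ < M ∧ ∀ R : ℝ, 1 ≤ R →
      ‖T.listValue (T.rayData x y R ζ) lo hi L‖ ≤ C * Real.exp (-(2 * Real.pi * R * M)) := by
  have hlt : lo < hi := hlx.trans (hxy.trans_le hyh)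
  have hcov := hL.1
  have hidx : ∀ v, idx L v < L.length := by
    intro v
    obtain ⟨m, h1, _⟩ := exists_of_mem (hcov.2 v)
    exact (List.getElem?_eq_some_iff.mp h1).1
  set Z : MergeTree V → ℂ := fun m => centralCharge x y (m.total T.charge) with hZ
  have hZm : ∀ m, Z m ∈ firstQuadrant := fun m => hT.charge_mem hx hy m
  set A : V → ℝ := fun v => (Z (L[idx L v]'(hidx v))).arg with hA
  have hAm : ∀ m ∈ L, ∀ v ∈ m.members, A v = (Z m).arg := by
    intro m hm v hv
    obtain ⟨k, hk⟩ := List.mem_iff_getElem?.mp hm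
    have h1 := (idx_eq_of_mem hcov.1 hk hv).1
    simp only [hA]
    have : L[idx L v]'(hidx v) = m := by
      have h2 := List.getElem?_eq_getElem (hidx v)
      rw [show L[idx L v]? = some m by rw [h1]; exact hk] at h2
      exact (Option.some.inj h2).symm
    rw [this]
  have hcr : 0 < cross x y := (cross_pos_iff hx hy).mpr hxy
  -- the rays of contracted vertices lie between those of the generators
  have hbd : ∀ m, x.arg ≤ (Z m).arg ∧ (Z m).arg ≤ y.arg := by
    intro m
    obtain ⟨p1, p2, _⟩ := hT.proj_total m
    have p1' : (0 : ℝ) ≤ (m.total T.charge).proj.1 := by exact_mod_cast p1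
    have p2' : (0 : ℝ) ≤ (m.total T.charge).proj.2 := by exact_mod_cast p2
    constructor
    · rw [← cross_nonneg_iff hx (hZm m)]
      have : cross x (Z m) = (m.total T.charge).proj.1 * cross x y := by
        simp only [hZ, centralCharge_eq, cross, add_re, mul_re, intCast_re, intCast_im, add_im, mul_im,
          zero_mul, sub_zero, add_zero]
        ring
      rw [this]; positivity
    · rw [← cross_nonneg_iff (hZm m) hy]
      have : cross (Z m) y = (m.total T.charge).proj.2 * cross x y := by
        simp only [hZ, centralCharge_eq, cross, add_re, mul_re, intCast_re, intCast_im, add_im, mul_im,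
          zero_mul, sub_zero, add_zero]
        ring
      rw [this]; positivity
  have hArg : ∀ u v, idx L u < idx L v → A v ≤ A u := by
    intro u v huv
    simp only [hA]
    rw [← cross_nonneg_iff (hZm _) (hZm _)]
    have := List.pairwise_iff_getElem.mp hsort _ _ (hidx u) (hidx v) huv
    simp only [hZ, cross_centralCharge]
    have h2 : (0 : ℝ) ≤ (T.det (L[idx L u]'(hidx u)) (L[idx L v]'(hidx v)) : ℤ) := by exact_mod_cast this
    rw [det] at h2
    push_cast at h2 ⊢
    rw [cross_swap y x]
    nlinarith
  set z : V → ℂ := fun v => centralCharge x y (T.charge v) with hz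
  -- the total decay rate at separation `δ`
  set S : ℝ → ℝ := fun δ => ∑ v, (z v * Complex.exp (-((A v - δ * (idx L v : ℕ) : ℝ) * I))).re with hS
  have hScont : Continuous S := continuous_finsetSum _ fun v _ => continuous_re_mul_exp _ _ _
  have hS0 : ‖centralCharge x y T.totalCharge‖ < S 0 := by
    -- At δ = 0 all members of a contracted vertex m are turned by the argument of Z(m), so their
    -- contributions add up to |Z(m)|.
    have e0 : S 0 = (L.map fun m => ‖Z m‖).sum := by
      simp only [hS, zero_mul, sub_zero]
      rw [← hcov.sum_flatMap]
      congr 1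
      refine List.map_congr_left fun m hm => ?_
      rw [← re_mul_exp_neg_arg (Z m)]
      have : Z m = (m.members.map z).sum := MergeTree.centralCharge_total _ _ _ _
      conv_rhs => enter [1, 1]; rw [this]
      have hml : ∀ l : List V, (∀ v ∈ l, v ∈ m.members) →
          (l.map fun v => (z v * Complex.exp (-((A v : ℝ) * I))).re).sum =
          ((l.map z).sum * Complex.exp (-((Z m).arg * I))).re := by
        intro l
        induction l with
        | nil => simp
        | cons v l ih =>
          intro h
          rw [List.map_cons, List.sum_cons, ih fun w hw => h w (by simp [hw]), List.map_cons,
            List.sum_cons, add_mul, add_re, hAm m hm v (h v (by simp))]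
      exact hml _ fun _ h => h
    -- One vertex not parallel to the total is not parallel to the sum of the others either, and
    -- makes the triangle inequality strict.
    obtain ⟨B, hB, hdet⟩ := hT.exists_det_ne_zero hprim hL hlen
    obtain ⟨s, t, rfl⟩ := List.append_of_mem hB
    have htot : centralCharge x y T.totalCharge = Z B + ((s ++ t).map Z).sum := by
      rw [← hL.sum_total]
      have : ∀ l : List (MergeTree V), centralCharge x y (l.map (total T.charge)).sum = (l.map Z).sum := by
        intro l
        induction l with
        | nil => simp [centralCharge]
        | cons m l ih => simp [centralCharge_add, ih, hZ]
      rw [this]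
      simp only [List.map_append, List.map_cons, List.sum_append, List.sum_cons]
      ring
    have hc1 : cross (Z B) (centralCharge x y T.totalCharge) ≠ 0 := by
      simp only [hZ, cross_centralCharge]
      refine mul_ne_zero ?_ (by rw [cross_swap]; linarith)
      exact_mod_cast hdet
    have hc2 : cross (Z B) ((s ++ t).map Z).sum ≠ 0 := by
      rw [htot] at hc1
      intro h
      apply hc1
      unfold cross at h ⊢
      simp only [add_re, add_im]
      linarith
    have h3 := norm_add_lt_of_cross_ne_zero hc2
    have h4 := norm_list_sum_le ((s ++ t).map Z)
    rw [e0, htot]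
    simp only [List.map_append, List.map_cons, List.sum_append, List.sum_cons, List.map_map,
      Function.comp_def] at h3 h4 ⊢
    linarith
  -- Coinciding rays have to be separated by an angle. By continuity of the rate, a small separation
  -- keeps it above |Z(c)|; the last condition keeps the rotated rays above `lo`.
  obtain ⟨δ, hδ, hSδ, hδ2⟩ : ∃ δ : ℝ, 0 < δ ∧ ‖centralCharge x y T.totalCharge‖ < S δ ∧
      δ * L.length < x.arg - lo := by
    have h1 : ∀ᶠ δ in 𝓝[>] (0 : ℝ), ‖centralCharge x y T.totalCharge‖ < S δ :=
      nhdsWithin_le_nhds (hScont.continuousAt.eventually (lt_mem_nhds hS0))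
    have h2 : ∀ᶠ δ in 𝓝[>] (0 : ℝ), δ * L.length < x.arg - lo := by
      refine nhdsWithin_le_nhds ?_
      have : Continuous fun δ : ℝ => δ * L.length := by fun_prop
      refine this.continuousAt.eventually (gt_mem_nhds ?_)
      simpa using hlx
    obtain ⟨δ, ⟨a1, a2⟩, a3⟩ := ((h1.and h2).and self_mem_nhdsWithin).exists
    exact ⟨δ, a3, a1, a2⟩
  set a : V → ℂ := fun v => ((A v - δ * (idx L v : ℕ) : ℝ) : ℂ) * I with ha
  have haim : ∀ v, (a v).im = A v - δ * (idx L v : ℕ) := fun v => by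
    simp only [ha, mul_im, ofReal_re, I_im, mul_one, ofReal_im, I_re, mul_zero, add_zero]
  have hal : ∀ v, lo ≤ (a v).im := by
    intro v
    rw [haim]
    have h1 := (hbd (L[idx L v]'(hidx v))).1
    have h2 : (idx L v : ℝ) ≤ L.length := by exact_mod_cast (hidx v).le
    have : δ * (idx L v : ℝ) ≤ δ * L.length := by gcongr
    simp only [hA]
    linarith
  have hah : ∀ v, (a v).im ≤ hi := by
    intro v
    rw [haim]
    have h1 := (hbd (L[idx L v]'(hidx v))).2
    have : 0 ≤ δ * (idx L v : ℝ) := by positivity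
    simp only [hA]
    linarith
  have haord : ∀ (P : RayData V) u u', P.Nbr (clu L) u u' → idx L u < idx L u' → (a u').im < (a u).im := by
    intro P u u' _ h
    rw [haim, haim]
    have h1 := hArg u u' h
    have h2 : (idx L u : ℝ) < idx L u' := by exact_mod_cast h
    have : δ * (idx L u : ℝ) < δ * idx L u' := by gcongr
    linarith
  obtain ⟨c, hc, hcb⟩ := exists_boundedBelow hx hy
  have hacl : ∀ v, (a (clu L v)).im = (a v).im := by
    intro v
    rw [haim, haim]
    have h1 := hcov.idx_clu v
    simp only [hA, h1]
  obtain ⟨C, hC⟩ := RayData.clusterIntegral_decay (parent := T.parent) (ζ := ζ) (lo := lo) (hi := hi)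
    (cl := clu L) (a := a) (by linarith [Real.pi_pos]) hζ
    (RayData.adm_of_order hcov hal hah (haord _)) hc (z := z)
    (κ := fun v => (z v * Complex.exp (-((A v - δ * (idx L v : ℕ) : ℝ) * I))).re)
    (fun v => by
      have := hT.half hcb hc.le hlo hhi v _ (hal v) (hah v)
      rwa [haim] at this)
    (fun v => by rw [hacl, haim])
  refine ⟨S δ, C, hSδ, fun R hR => ?_⟩
  have hreg : (T.rayData x y R ζ).Regular lo hi := hT.regular hx hy (by linarith) hlo hhi hζ
  unfold listValue
  rw [norm_unit_mul, ← RayData.clusterIntegral_eq_listIntegral hlt hreg hcov hal hah (haord _)]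
  exact hC R hR

/-- The propagator with the rays `ℓ⁺`. -/
theorem IsPositive.G_eq_initialList (hT : T.IsPositive) {x y x' y' ζ : ℂ} {R lo hi : ℝ} (hlt : lo < hi)
    (hP : (T.rayData x y R ζ).Regular lo hi) (ν : Fin (Fintype.card V) ≃ V)
    (hx' : x' ≠ 0) (hy' : y' ≠ 0) (h : y'.arg < x'.arg) (h1 : lo ≤ y'.arg) (h2 : x'.arg ≤ hi) :
    T.G (centralCharge x y) (centralCharge x' y') R ζ =
      T.listValue (T.rayData x y R ζ) lo hi (T.initialList ν) := by
  have hcase : ∀ v, ((T.charge v).proj.1 = 0 ∧ (centralCharge x' y' (T.charge v)).arg = x'.arg ∧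
      centralCharge x' y' (T.charge v) ≠ 0) ∨
      (¬ (T.charge v).proj.1 = 0 ∧ (T.charge v).proj.2 = 0 ∧
        (centralCharge x' y' (T.charge v)).arg = y'.arg ∧ centralCharge x' y' (T.charge v) ≠ 0) := by
    intro v
    obtain ⟨a1, a2, a3, a4⟩ := hT.proj_leaf v
    by_cases h0 : (T.charge v).proj.1 = 0
    · have : 0 < (T.charge v).proj.2 := by omega
      refine Or.inl ⟨h0, ?_, ?_⟩
      · rw [centralCharge_eq, h0, ← arg_intCast_mul this x']; simp
      · rw [centralCharge_eq, h0]
        have : ((T.charge v).proj.2 : ℂ) ≠ 0 := by exact_mod_cast this.ne'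
        simp [this, hx']
    · have h20 : (T.charge v).proj.2 = 0 := by tauto
      have : 0 < (T.charge v).proj.1 := by omega
      refine Or.inr ⟨h0, h20, ?_, ?_⟩
      · rw [centralCharge_eq, h20, ← arg_intCast_mul this y']; simp
      · rw [centralCharge_eq, h20]
        have : ((T.charge v).proj.1 : ℂ) ≠ 0 := by exact_mod_cast this.ne'
        simp [this, hy']
  refine G_eq_listValue hlt hP (initialList_perm ν) (nodup_ofFn_labelling ν).1 (nodup_ofFn_labelling ν).2
    (fun v => ?_) (fun v => ?_) fun u v huv hidx => ?_
  · rcases hcase v with h | h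
    exacts [h.2.2, h.2.2.2]
  · rcases hcase v with h | h
    · rw [h.2.1]; constructor <;> linarith
    · rw [h.2.2.1]; constructor <;> linarith
  · have hne : (T.charge u).proj.2 * (T.charge v).proj.1 - (T.charge u).proj.1 * (T.charge v).proj.2 ≠ 0 := by
      rcases huv with huv | huv
      · have := hT.pairing_ne_zero v u huv
        intro e
        apply this
        unfold pairing
        unfold proj at e
        linarith
      · exact hT.pairing_ne_zero u v huv
    rcases hcase u with hu | hu <;> rcases hcase v with hv | hv
    · rw [hu.1, hv.1] at hne; simp at hne
    · rw [hu.2.1, hv.2.2.1]; exact h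
    · exfalso
      have hvm : v ∈ (((List.ofFn ν).filter fun v => (T.charge v).proj.1 = 0).map leaf).reverse.flatMap
          members := by
        rw [List.mem_flatMap]
        refine ⟨leaf v, ?_, by simp [members]⟩
        simp only [List.mem_reverse, List.mem_map, List.mem_filter, decide_eq_true_eq]
        exact ⟨v, ⟨(nodup_ofFn_labelling ν).2 v, hv.1⟩, rfl⟩
      have hum : u ∉ (((List.ofFn ν).filter fun v => (T.charge v).proj.1 = 0).map leaf).reverse.flatMap
          members := by
        rw [List.mem_flatMap]
        rintro ⟨m, hm, hum⟩
        simp only [List.mem_reverse, List.mem_map, List.mem_filter, decide_eq_true_eq] at hm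
        obtain ⟨w, ⟨_, hw⟩, rfl⟩ := hm
        simp only [members, List.mem_singleton] at hum
        subst hum
        exact hu.1 hw
      have e1 := idx_append_of_mem (X := [] ++
        ((List.ofFn ν).filter fun v => ¬ (T.charge v).proj.1 = 0).map leaf) hvm
      have e2 := (idx_append_of_notMem (X := [] ++
        ((List.ofFn ν).filter fun v => ¬ (T.charge v).proj.1 = 0).map leaf) hum).1
      unfold initialList fullList at hidx
      rw [List.append_assoc, e1.1, e2] at hidx
      have := e1.2.1
      omega
    · rw [hu.2.1, hv.2.1] at hne; simp at hne

/-- The propagator with the rays `ℓ⁻`. -/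
theorem IsPositive.G_eq_sorted (hT : T.IsPositive) {x y x' y' ζ : ℂ} {R lo hi : ℝ} (hlt : lo < hi)
    (hP : (T.rayData x y R ζ).Regular lo hi) {L : List (MergeTree V)} (hL : T.Good L)
    (hleaf : ∀ m ∈ L, ∃ v, m = leaf v) (hsort : L.Pairwise fun A B => 0 ≤ T.det A B)
    (hx' : x' ∈ firstQuadrant) (hy' : y' ∈ firstQuadrant) (h : x'.arg < y'.arg)
    (hb : ∀ v, lo ≤ (centralCharge x' y' (T.charge v)).arg ∧ (centralCharge x' y' (T.charge v)).arg ≤ hi) :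
    T.G (centralCharge x y) (centralCharge x' y') R ζ = T.listValue (T.rayData x y R ζ) lo hi L := by
  have hmem : L = (L.map rep).map leaf := by
    rw [List.map_map]
    conv_lhs => rw [← List.map_id L]
    refine List.map_congr_left fun m hm => ?_
    obtain ⟨v, rfl⟩ := hleaf m hm
    rfl
  have hfm : L.flatMap members = L.map rep := by
    conv_lhs => rw [hmem]
    rw [List.flatMap_map]
    simp [members]
  have hcov := hL.1
  refine G_eq_listValue hlt hP (l := L.map rep) (by rw [← hmem]) (by rw [← hfm]; exact hcov.1)
    (by rw [← hfm]; exact hcov.2) (fun v => ne_zero_of_firstQuadrant (hT.charge_mem hx' hy' (leaf v))) hb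
    fun u v huv hidx => ?_
  have hget : ∀ w, L[idx L w]? = some (leaf w) := by
    intro w
    obtain ⟨m, a1, a2, _⟩ := exists_of_mem (hcov.2 w)
    obtain ⟨w', rfl⟩ := hleaf m (List.mem_of_getElem? a1)
    simp only [members, List.mem_singleton] at a2
    rw [a1, a2]
  obtain ⟨lu, eu⟩ := List.getElem?_eq_some_iff.mp (hget u)
  obtain ⟨lv, ev⟩ := List.getElem?_eq_some_iff.mp (hget v)
  have hd := List.pairwise_iff_getElem.mp hsort _ _ lu lv hidx
  rw [eu, ev] at hd
  -- The list is sorted only weakly; for adjacent original vertices the determinant is nonzero up to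
  -- sign by the pairing condition, so their rays are strictly ordered.
  have hne : T.det (leaf u) (leaf v) ≠ 0 := by
    unfold det
    simp only [total]
    rcases huv with huv | huv
    · have := hT.pairing_ne_zero v u huv
      intro e
      apply this
      unfold pairing
      unfold proj at e
      linarith
    · have := hT.pairing_ne_zero u v huv
      intro e
      apply this
      unfold pairing
      unfold proj at e
      linarith
  have hd' : (0 : ℝ) < T.det (leaf u) (leaf v) := by exact_mod_cast lt_of_le_of_ne hd hne.symm
  refine (cross_pos_iff (hT.charge_mem hx' hy' (leaf v)) (hT.charge_mem hx' hy' (leaf u))).mp ?_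
  rw [cross_swap]
  have h1 := cross_centralCharge x' y' (T.charge u) (T.charge v)
  have h2 := (cross_pos_iff hx' hy').mpr h
  change 0 < -cross (centralCharge x' y' (T.charge u)) (centralCharge x' y' (T.charge v))
  rw [h1, cross_swap y' x']
  have h3 : (((T.charge u).proj.1 * (T.charge v).proj.2 - (T.charge u).proj.2 * (T.charge v).proj.1 : ℤ) : ℝ) =
    T.det (leaf u) (leaf v) := rfl
  rw [h3]
  nlinarith

end DecoratedTree

end

/-! ### The cone, the path of central charges and the critical value. -/

section

open Complex MeasureTheory Filter Topology Set MergeTree ChargeLattice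

theorem arg_pos_of_firstQuadrant {z : ℂ} (hz : z ∈ firstQuadrant) : 0 < z.arg := by
  refine lt_of_le_of_ne (arg_mem_of_firstQuadrant hz).1 fun h => ?_
  have := (Complex.arg_eq_zero_iff.mp h.symm).2
  exact hz.2.ne' this

theorem cross_add_left (z z' w : ℂ) : cross (z + z') w = cross z w + cross z' w := by
  simp only [cross, add_re, add_im]; ring

theorem cross_add_right (z w w' : ℂ) : cross z (w + w') = cross z w + cross z w' := by
  simp only [cross, add_re, add_im]; ring

theorem cross_ofReal_mul_left (a : ℝ) (z w : ℂ) : cross (a * z) w = a * cross z w := by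
  simp only [cross, re_ofReal_mul, im_ofReal_mul]; ring

theorem cross_ofReal_mul_right (a : ℝ) (z w : ℂ) : cross z (a * w) = a * cross z w := by
  simp only [cross, re_ofReal_mul, im_ofReal_mul]; ring

theorem cross_diag (z : ℂ) : cross z z = 0 := by unfold cross; ring

/-- (ζ' + ζ)/(ζ' - ζ) = 1 + 2ζ/(ζ' - ζ). With d proportional to |ζ| the bound is uniform as ζ → 0,
as needed for the nontangential limit. -/
theorem norm_rhoKernel_le {ζ ζ' : ℂ} {d : ℝ} (hd : 0 < d) (h : d ≤ ‖ζ' - ζ‖) :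
    ‖rhoKernel ζ ζ'‖ ≤ 1 / (4 * Real.pi) * (1 + 2 * ‖ζ‖ / d) := by
  have hne : ζ' - ζ ≠ 0 := norm_pos_iff.mp (hd.trans_le h)
  have e : (ζ' + ζ) / (ζ' - ζ) = 1 + 2 * ζ / (ζ' - ζ) := by
    field_simp; ring
  have h1 : ‖(1 : ℂ) / (4 * Real.pi * I)‖ = 1 / (4 * Real.pi) := by
    rw [norm_div, norm_mul, norm_mul, Complex.norm_real, Complex.norm_I, Real.norm_of_nonneg Real.pi_pos.le]
    simp
  rw [rhoKernel, norm_mul, h1, e]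
  have := Real.pi_pos
  refine mul_le_mul_of_nonneg_left ((norm_add_le _ _).trans ?_) (by positivity)
  rw [norm_one, norm_div, norm_mul, Complex.norm_ofNat]
  gcongr

namespace WallCrossing

variable (D : WallCrossing)

theorem cross_eP_gM : 0 < cross D.eP D.gM := (cross_pos_iff D.eP_mem D.gM_mem).mpr D.arg_lt₁
theorem cross_gM_eM : 0 < cross D.gM D.eM := (cross_pos_iff D.gM_mem D.eM_mem).mpr D.arg_lt₂
theorem cross_eM_gP : 0 < cross D.eM D.gP := (cross_pos_iff D.eM_mem D.gP_mem).mpr D.arg_lt₃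
theorem cross_eP_eM : 0 < cross D.eP D.eM :=
  (cross_pos_iff D.eP_mem D.eM_mem).mpr (D.arg_lt₁.trans D.arg_lt₂)
theorem cross_gM_gP : 0 < cross D.gM D.gP :=
  (cross_pos_iff D.gM_mem D.gP_mem).mpr (D.arg_lt₂.trans D.arg_lt₃)
theorem arg_eP_lt_arg_gP : D.eP.arg < D.gP.arg := D.arg_lt₁.trans (D.arg_lt₂.trans D.arg_lt₃)
theorem cross_eP_gP : 0 < cross D.eP D.gP := (cross_pos_iff D.eP_mem D.gP_mem).mpr D.arg_eP_lt_arg_gP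

theorem cramer (z : ℂ) : z = (cross D.eP z / cross D.eP D.gP : ℝ) * D.gP +
    (cross z D.gP / cross D.eP D.gP : ℝ) * D.eP := by
  have h := D.cross_eP_gP.ne'
  apply Complex.ext
  · rw [add_re, re_ofReal_mul, re_ofReal_mul]
    field_simp
    simp only [cross]; ring
  · rw [add_im, im_ofReal_mul, im_ofReal_mul]
    field_simp
    simp only [cross]; ring

/-- Cramer's rule describes the cone by linear inequalities. They show that it is closed, and
membership becomes a comparison of arguments. -/
theorem cone_eq : D.cone = {z | 0 ≤ cross D.eP z ∧ 0 ≤ cross z D.gP} ∪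
    {z | 0 ≤ cross D.eP (-z) ∧ 0 ≤ cross (-z) D.gP} := by
  have hpos := D.cross_eP_gP
  have key : ∀ z, (0 ≤ cross D.eP z ∧ 0 ≤ cross z D.gP) ↔
      ∃ a b : ℝ, 0 ≤ a ∧ 0 ≤ b ∧ z = a * D.gP + b * D.eP := by
    intro z
    constructor
    · rintro ⟨h1, h2⟩
      exact ⟨_, _, div_nonneg h1 hpos.le, div_nonneg h2 hpos.le, D.cramer z⟩
    · rintro ⟨a, b, ha, hb, rfl⟩
      rw [cross_add_right, cross_add_left, cross_ofReal_mul_right, cross_ofReal_mul_right,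
        cross_ofReal_mul_left, cross_ofReal_mul_left, cross_diag, cross_diag]
      constructor <;> nlinarith
  ext z
  simp only [cone, mem_ofPred_eq, mem_union, key]
  constructor
  · rintro ⟨a, b, ha, hb, h | h⟩
    · exact Or.inl ⟨a, b, ha, hb, h⟩
    · exact Or.inr ⟨a, b, ha, hb, by rw [h, neg_neg]⟩
  · rintro (⟨a, b, ha, hb, h⟩ | ⟨a, b, ha, hb, h⟩)
    · exact ⟨a, b, ha, hb, Or.inl h⟩
    · exact ⟨a, b, ha, hb, Or.inr (by rw [← h, neg_neg])⟩

theorem isClosed_cone : IsClosed D.cone := by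
  rw [cone_eq]
  have h1 : Continuous fun z : ℂ => cross D.eP z := by unfold cross; fun_prop
  have h2 : Continuous fun z : ℂ => cross z D.gP := by unfold cross; fun_prop
  exact ((isClosed_le continuous_const h1).inter (isClosed_le continuous_const h2)).union
    ((isClosed_le continuous_const (h1.comp continuous_neg)).inter
      (isClosed_le continuous_const (h2.comp continuous_neg)))

theorem neg_mem_cone {z : ℂ} (hz : z ∈ firstQuadrant) (h1 : D.eP.arg ≤ z.arg) (h2 : z.arg ≤ D.gP.arg) :
    -z ∈ D.cone := by
  rw [cone_eq]
  refine Or.inr ?_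
  rw [mem_ofPred_eq, neg_neg]
  exact ⟨(cross_nonneg_iff D.eP_mem hz).mpr h1, (cross_nonneg_iff hz D.gP_mem).mpr h2⟩

theorem infDist_cone_pos {ζ : ℂ} (hζ : ζ ∉ D.cone) : 0 < Metric.infDist ζ D.cone :=
  (D.isClosed_cone.notMem_iff_infDist_pos ⟨0, by
    refine ⟨0, 0, le_rfl, le_rfl, Or.inl (by simp)⟩⟩).mp hζ

theorem infDist_le_norm_sub {ζ ζ' : ℂ} (h : ζ' ∈ D.cone) : Metric.infDist ζ D.cone ≤ ‖ζ' - ζ‖ := by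
  rw [← dist_eq_norm, dist_comm]; exact Metric.infDist_le_dist_of_mem h

/-- The points -e^w with angles between those of Z⁺(η) and Z⁺(γ) lie in the closed cone, from which
ζ has positive distance. -/
theorem away {ζ : ℂ} (hζ : ζ ∉ D.cone) : Away ζ D.eP.arg D.gP.arg := by
  have hd := D.infDist_cone_pos hζ
  refine ⟨1 / (4 * Real.pi) * (1 + 2 * ‖ζ‖ / Metric.infDist ζ D.cone), fun w h1 h2 => ?_⟩
  have hpi := Real.pi_pos
  have h3 := arg_pos_of_firstQuadrant D.eP_mem
  have h4 := (arg_mem_of_firstQuadrant D.gP_mem).2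
  have hfq : Complex.exp w ∈ firstQuadrant := by
    refine ⟨?_, ?_⟩
    · rw [Complex.exp_re]
      exact mul_pos (Real.exp_pos _) (Real.cos_pos_of_mem_Ioo ⟨by linarith, by linarith⟩)
    · rw [Complex.exp_im]
      exact mul_pos (Real.exp_pos _) (Real.sin_pos_of_pos_of_lt_pi (by linarith) (by linarith))
  have harg : (Complex.exp w).arg = w.im := by
    rw [← Complex.log_im, Complex.log_exp (by linarith) (by linarith)]
  have hmem := D.neg_mem_cone hfq (by rw [harg]; exact h1) (by rw [harg]; exact h2)
  have hle := D.infDist_le_norm_sub (ζ := ζ) hmem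
  exact ⟨fun e => hζ (e ▸ hmem), norm_rhoKernel_le hd hle⟩

theorem g_eq (τ : ℝ) : D.g τ = ((1 - τ : ℝ) : ℂ) * D.gP + (τ : ℂ) * D.gM := by
  unfold g; push_cast; rfl

theorem e_eq (τ : ℝ) : D.e τ = ((1 - τ : ℝ) : ℂ) * D.eP + (τ : ℂ) * D.eM := by
  unfold e; push_cast; rfl

theorem exists_boundedBelow : ∃ c, 0 < c ∧ ∀ τ : ℝ, 0 ≤ τ → τ ≤ 1 → BoundedBelow c (D.g τ) (D.e τ) := by
  obtain ⟨c, hc, ⟨h1, h2⟩, h3, h4⟩ := _root_.exists_boundedBelow D.gP_mem D.eP_mem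
  obtain ⟨c', hc', ⟨h1', h2'⟩, h3', h4'⟩ := _root_.exists_boundedBelow D.gM_mem D.eM_mem
  refine ⟨min c c', lt_min hc hc', fun τ h0 h1 => ?_⟩
  have a1 := min_le_left c c'
  have a2 := min_le_right c c'
  unfold BoundedBelow
  rw [g_eq, e_eq]
  simp only [add_re, add_im, re_ofReal_mul, im_ofReal_mul]
  refine ⟨⟨?_, ?_⟩, ?_, ?_⟩ <;> nlinarith

theorem mem_firstQuadrant {τ : ℝ} (h0 : 0 ≤ τ) (h1 : τ ≤ 1) :
    D.g τ ∈ firstQuadrant ∧ D.e τ ∈ firstQuadrant := by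
  obtain ⟨c, hc, h⟩ := D.exists_boundedBelow
  obtain ⟨⟨a1, a2⟩, a3, a4⟩ := h τ h0 h1
  exact ⟨⟨hc.trans_le a1, hc.trans_le a2⟩, hc.trans_le a3, hc.trans_le a4⟩

/-- Inside the interval all rays lie strictly between ℓ⁺_η and ℓ⁺_γ at τ = 0; the strict
inequalities leave room for the infinitesimal rotations. -/
theorem arg_bounds {τ : ℝ} (h0 : 0 < τ) (h1 : τ < 1) :
    (D.eP.arg < (D.g τ).arg ∧ (D.g τ).arg < D.gP.arg) ∧
      D.eP.arg < (D.e τ).arg ∧ (D.e τ).arg < D.gP.arg := by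
  obtain ⟨hg, he⟩ := D.mem_firstQuadrant h0.le h1.le
  rw [← cross_pos_iff D.eP_mem hg, ← cross_pos_iff hg D.gP_mem, ← cross_pos_iff D.eP_mem he,
    ← cross_pos_iff he D.gP_mem, g_eq, e_eq]
  simp only [cross_add_right, cross_add_left, cross_ofReal_mul_right, cross_ofReal_mul_left, cross_diag]
  have := D.cross_eP_gM
  have := D.cross_eM_gP
  have := D.cross_eP_eM
  have := D.cross_gM_gP
  have := D.cross_eP_gP
  have h1' : 0 < 1 - τ := by linarith
  simp only [mul_zero, zero_add, add_zero]
  refine ⟨⟨by positivity, by positivity⟩, by positivity, by positivity⟩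

theorem cross_e_g (τ : ℝ) : cross (D.e τ) (D.g τ) = (1 - τ) ^ 2 * cross D.eP D.gP +
    (1 - τ) * τ * (cross D.eP D.gM + cross D.eM D.gP) + τ ^ 2 * cross D.eM D.gM := by
  rw [g_eq, e_eq]
  simp only [cross_add_right, cross_add_left, cross_ofReal_mul_right, cross_ofReal_mul_left]
  ring

/-- The quadratic polynomial which changes sign at the critical value. -/
theorem cross_e_g_sub {σ τ : ℝ} (h0 : 0 ≤ σ) (hst : σ < τ) (h1 : τ ≤ 1) :
    0 < cross (D.e σ) (D.g σ) * τ ^ 2 - cross (D.e τ) (D.g τ) * σ ^ 2 := by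
  have := D.cross_eP_gM
  have := D.cross_eM_gP
  have := D.cross_eP_gP
  -- Divided by τ², the polynomial has a constant last term, and its other terms strictly decrease
  -- in τ; so it changes sign only once.
  have e : cross (D.e σ) (D.g σ) * τ ^ 2 - cross (D.e τ) (D.g τ) * σ ^ 2 =
      (τ - σ) * (cross D.eP D.gP * ((1 - σ) * τ + (1 - τ) * σ) +
        σ * τ * (cross D.eP D.gM + cross D.eM D.gP)) := by
    rw [cross_e_g, cross_e_g]; ring
  rw [e]
  have a1 : 0 < τ - σ := by linarith
  have a2 : 0 < (1 - σ) * τ := mul_pos (by linarith) (by linarith)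
  have a3 : 0 ≤ (1 - τ) * σ := mul_nonneg (by linarith) h0
  have a4 : 0 ≤ σ * τ := mul_nonneg h0 (by linarith)
  positivity

variable {D} {τ₀ : ℝ}

theorem IsCritical.cross_eq_zero (h : D.IsCritical τ₀) : cross (D.e τ₀) (D.g τ₀) = 0 := by
  have := h.2
  rw [mul_im, conj_re, conj_im] at this
  unfold cross; linarith

/-- At the two endpoints the determinant of Z(η), Z(γ) has opposite nonzero signs. -/
theorem IsCritical.mem (h : D.IsCritical τ₀) : 0 < τ₀ ∧ τ₀ < 1 := by
  have h0 := h.cross_eq_zero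
  have h2 := h.1.1
  have h3 := h.1.2
  have h4 := D.cross_eP_gP
  have h5 := D.cross_gM_eM
  rw [cross_swap] at h5
  rw [cross_e_g] at h0
  constructor
  · refine lt_of_le_of_ne h2 fun e => ?_
    rw [← e] at h0; simp at h0; linarith
  · refine lt_of_le_of_ne h3 fun e => ?_
    rw [e] at h0; simp at h0; linarith

theorem IsCritical.arg_lt_of_lt (h : D.IsCritical τ₀) {τ : ℝ} (h0 : 0 ≤ τ) (h1 : τ < τ₀) :
    (D.e τ).arg < (D.g τ).arg := by
  obtain ⟨a1, a2⟩ := h.mem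
  obtain ⟨hg, he⟩ := D.mem_firstQuadrant h0 (by linarith)
  rw [← cross_pos_iff he hg]
  have := D.cross_e_g_sub h0 h1 a2.le
  rw [h.cross_eq_zero] at this
  have h2 : 0 < τ₀ ^ 2 := by positivity
  by_contra hc
  push Not at hc
  nlinarith

theorem IsCritical.arg_lt_of_gt (h : D.IsCritical τ₀) {τ : ℝ} (h0 : τ₀ < τ) (h1 : τ ≤ 1) :
    (D.g τ).arg < (D.e τ).arg := by
  obtain ⟨a1, a2⟩ := h.mem
  obtain ⟨hg, he⟩ := D.mem_firstQuadrant (a1.le.trans h0.le) h1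
  rw [← cross_pos_iff hg he, cross_swap]
  have := D.cross_e_g_sub a1.le h0 h1
  rw [h.cross_eq_zero] at this
  have h2 : 0 < τ₀ ^ 2 := by positivity
  by_contra hc
  push Not at hc
  nlinarith

end WallCrossing

/-- The argument of a central charge lies between those of its values on the generators. -/
theorem arg_centralCharge_bounds {l₁ l₂ : ℕ} {x y : ℂ} (hx : x ∈ firstQuadrant) (hy : y ∈ firstQuadrant)
    {α : ChargeLattice l₁ l₂} (h1 : 0 ≤ α.proj.1) (h2 : 0 ≤ α.proj.2) (h3 : 0 < α.proj.1 + α.proj.2)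
    {w : ℂ} (hw : w ∈ firstQuadrant) :
    (w.arg ≤ x.arg → w.arg ≤ y.arg → w.arg ≤ (centralCharge x y α).arg) ∧
    (x.arg ≤ w.arg → y.arg ≤ w.arg → (centralCharge x y α).arg ≤ w.arg) := by
  have hm := centralCharge_mem hx hy h1 h2 h3
  have h1' : (0 : ℝ) ≤ α.proj.1 := by exact_mod_cast h1
  have h2' : (0 : ℝ) ≤ α.proj.2 := by exact_mod_cast h2
  have e : centralCharge x y α = ((α.proj.2 : ℝ) : ℂ) * x + ((α.proj.1 : ℝ) : ℂ) * y := by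
    rw [centralCharge_eq]; push_cast; rfl
  rw [← cross_nonneg_iff hw hx, ← cross_nonneg_iff hw hy, ← cross_nonneg_iff hx hw,
    ← cross_nonneg_iff hy hw, ← cross_nonneg_iff hw hm, ← cross_nonneg_iff hm hw, e]
  simp only [cross_add_right, cross_add_left, cross_ofReal_mul_right, cross_ofReal_mul_left]
  exact ⟨fun _ _ => by positivity, fun _ _ => by positivity⟩

end

/-! ### The expansion of the jump and the asymptotics of the leading term. -/

section

open Complex MeasureTheory Filter Topology Set MergeTree ChargeLattice

/-- The quotient is √(|z|R) exp(-2π(M - |z|)R), and a positive gap in the exponential rate beats the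
square root. -/
theorem isLittleO_besselRate {z : ℂ} (hz : z ≠ 0) {M : ℝ} (hM : ‖z‖ < M) :
    (fun R : ℝ => Real.exp (-(2 * Real.pi * R * M))) =o[atTop] besselRate z := by
  have hz' : 0 < ‖z‖ := norm_pos_iff.mpr hz
  have hk : 0 < 2 * Real.pi * (M - ‖z‖) := by
    have := Real.pi_pos; have : 0 < M - ‖z‖ := by linarith
    positivity
  rw [Asymptotics.isLittleO_iff_tendsto']
  · have h1 : Tendsto (fun R : ℝ => √‖z‖ * (R ^ (1 / 2 : ℝ) * Real.exp (-(2 * Real.pi * (M - ‖z‖)) * R)))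
        atTop (𝓝 (√‖z‖ * 0)) := (tendsto_rpow_mul_exp_neg_mul_atTop_nhds_zero (1 / 2) _ hk).const_mul _
    rw [mul_zero] at h1
    refine h1.congr' ?_
    filter_upwards [eventually_gt_atTop 0] with R hR
    unfold besselRate
    rw [Real.sqrt_mul hz'.le, ← Real.sqrt_eq_rpow, div_div_eq_mul_div,
      show -(2 * Real.pi * (M - ‖z‖)) * R = -(2 * Real.pi * R * M) - -(2 * Real.pi * ‖z‖ * R) by ring,
      Real.exp_sub]
    ring
  · filter_upwards [eventually_gt_atTop 0] with R hR h
    have : 0 < besselRate z R := by unfold besselRate; positivity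
    exact absurd h this.ne'

namespace WallCrossing

variable (D : WallCrossing)

/-- A bound for the values of the central charges on the generators. -/
noncomputable def size : ℝ := ‖D.gP‖ + ‖D.gM‖ + ‖D.eP‖ + ‖D.eM‖

theorem size_nonneg : 0 ≤ D.size := by unfold size; positivity

theorem norm_le {τ : ℝ} (h0 : 0 ≤ τ) (h1 : τ ≤ 1) : ‖D.g τ‖ ≤ D.size ∧ ‖D.e τ‖ ≤ D.size := by
  have a1 := norm_nonneg D.gP
  have a2 := norm_nonneg D.gM
  have a3 := norm_nonneg D.eP
  have a4 := norm_nonneg D.eM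
  rw [g_eq, e_eq]
  have key : ∀ z w : ℂ, ‖((1 - τ : ℝ) : ℂ) * z + (τ : ℂ) * w‖ ≤ ‖z‖ + ‖w‖ := fun z w => by
    refine (norm_add_le _ _).trans ?_
    rw [norm_mul, norm_mul, Complex.norm_real, Complex.norm_real,
      Real.norm_of_nonneg (by linarith : 0 ≤ 1 - τ), Real.norm_of_nonneg h0]
    have := norm_nonneg z
    have := norm_nonneg w
    nlinarith
  unfold size
  exact ⟨(key _ _).trans (by linarith), (key _ _).trans (by linarith)⟩

theorem norm_sub_le (σ τ : ℝ) :
    ‖D.g σ - D.g τ‖ ≤ |σ - τ| * D.size ∧ ‖D.e σ - D.e τ‖ ≤ |σ - τ| * D.size := by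
  have e1 : D.g σ - D.g τ = ((σ - τ : ℝ) : ℂ) * (D.gM - D.gP) := by
    simp only [g]; push_cast; ring
  have e2 : D.e σ - D.e τ = ((σ - τ : ℝ) : ℂ) * (D.eM - D.eP) := by
    simp only [e]; push_cast; ring
  rw [e1, e2, norm_mul, norm_mul, Complex.norm_real, Real.norm_eq_abs]
  unfold size
  exact ⟨mul_le_mul_of_nonneg_left ((_root_.norm_sub_le _ _).trans (by
      linarith [norm_nonneg D.eP, norm_nonneg D.eM])) (abs_nonneg _),
    mul_le_mul_of_nonneg_left ((_root_.norm_sub_le _ _).trans (by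
      linarith [norm_nonneg D.gP, norm_nonneg D.gM])) (abs_nonneg _)⟩

end WallCrossing

namespace DecoratedTree

variable {l₁ l₂ : ℕ} {V : Type} [Fintype V] [DecidableEq V] {T : DecoratedTree l₁ l₂ V}

theorem signedSum_isLittleO {g : ℝ → ℝ} {S : List (List (MergeTree V) × ℤˣ)}
    {f : ℝ → List (MergeTree V) → ℂ} (h : ∀ u ∈ S, (fun R => f R u.1) =o[atTop] g) :
    (fun R => signedSum S (f R)) =o[atTop] g := by
  induction S with
  | nil => simp [signedSum]
  | cons u S ih =>
    have e : (fun R => signedSum (u :: S) (f R)) =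
        fun R => ((u.2 : ℤ) : ℂ) * f R u.1 + signedSum S (f R) := by
      ext R; simp [signedSum]
    rw [e]
    exact ((h u (by simp)).const_mul_left _).add (ih fun w hw => h w (by simp [hw]))

theorem IsPositive.totalCharge_pos (hT : T.IsPositive) : 0 ≤ T.totalCharge.proj.1 ∧
    0 ≤ T.totalCharge.proj.2 ∧ 0 < T.totalCharge.proj.1 + T.totalCharge.proj.2 := by
  obtain ⟨m, hm⟩ := T.exists_good_single
  rw [← hm.total_single]
  exact hT.proj_total m

/-- The terms of the residue expansion, in terms of the order of the rays. -/
theorem IsPositive.termPropagator_eq (hT : T.IsPositive) {x y x' y' ζ : ℂ} {R lo hi δ : ℝ}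
    (hlt : lo < hi) (hP : (T.rayData x y R ζ).Regular lo hi) {L : List (MergeTree V)} (hL : T.Good L)
    (hsort : L.Pairwise fun A B => 0 ≤ T.det A B)
    (hx' : x' ∈ firstQuadrant) (hy' : y' ∈ firstQuadrant) (h : x'.arg < y'.arg) (hyh : y'.arg ≤ hi)
    (hδ : 0 < δ) (hδ2 : δ * L.length ≤ x'.arg - lo) :
    T.termPropagator L (centralCharge x y) (centralCharge x' y') δ R ζ =
      T.listValue (T.rayData x y R ζ) lo hi L := by
  refine termPropagator_eq_listValue hlt hP hL
    (fun m _ => ne_zero_of_firstQuadrant (hT.charge_mem hx' hy' m)) (fun i => ?_) fun i j hij => ?_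
  · obtain ⟨p1, p2, p3⟩ := hT.proj_total (L.get i)
    have h1 := (arg_centralCharge_bounds hx' hy' p1 p2 p3 hx').1 le_rfl h.le
    have h2 := (arg_centralCharge_bounds hx' hy' p1 p2 p3 hy').2 h.le le_rfl
    have h3 : ((i : ℕ) : ℝ) ≤ L.length := by exact_mod_cast i.2.le
    have h4 : δ * ((i : ℕ) : ℝ) ≤ δ * L.length := by gcongr
    have h5 : 0 ≤ δ * ((i : ℕ) : ℝ) := by positivity
    constructor <;> linarith
  · have h1 : (centralCharge x' y' ((L.get j).total T.charge)).arg ≤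
        (centralCharge x' y' ((L.get i).total T.charge)).arg := by
      rw [← cross_nonneg_iff (hT.charge_mem hx' hy' _) (hT.charge_mem hx' hy' _), cross_centralCharge]
      have h2 := List.pairwise_iff_get.mp hsort i j hij
      have h3 := (cross_pos_iff hx' hy').mpr h
      have h4 : (0 : ℝ) ≤ (T.det (L.get i) (L.get j) : ℤ) := by exact_mod_cast h2
      rw [det] at h4
      push_cast at h4 ⊢
      rw [cross_swap y' x']
      nlinarith
    have h2 : ((i : ℕ) : ℝ) < (j : ℕ) := by exact_mod_cast hij
    have : δ * ((i : ℕ) : ℝ) < δ * (j : ℕ) := by gcongr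
    linarith

theorem signedSum_congr {S : List (List (MergeTree V) × ℤˣ)} {f g : List (MergeTree V) → ℂ}
    (h : ∀ u ∈ S, f u.1 = g u.1) : signedSum S f = signedSum S g := by
  unfold signedSum
  congr 1
  exact List.map_congr_left fun u hu => by rw [h u hu]

set_option maxHeartbeats 1000000 in
/-- The expansion of the jump at the critical value. -/
theorem IsPositive.jump_expansion (hT : T.IsPositive) (D : WallCrossing) {τ₀ : ℝ} (hcrit : D.IsCritical τ₀)
    (hprim : IsCoprime T.reducedCharge.1 T.reducedCharge.2) (ν : Fin (Fintype.card V) ≃ V)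
    {ζ : ℂ} (hζ : ζ ∉ D.cone) :
    ∃ (ε₀ C : ℝ) (δ₀ : ℝ → ℝ) (E₁ E₂ : ℝ → ℝ → ℂ), 0 < ε₀ ∧
      ∀ ε : ℝ, 0 < ε → ε < ε₀ → 0 < δ₀ ε ∧
        (∀ x ∈ firstQuadrant, ∀ y ∈ firstQuadrant, ∀ R δ : ℝ, 0 < R → 0 < δ → δ < δ₀ ε →
          T.G (ChargeLattice.centralCharge x y) (D.Z (τ₀ - ε)) R ζ =
            ((T.residueTerms ν).map fun u => ((u.2 : ℤ) : ℂ) *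
              T.termPropagator u.1 (ChargeLattice.centralCharge x y) (D.Z (τ₀ + ε)) δ R ζ).sum) ∧
        (∀ R : ℝ, 0 < R → T.jump D τ₀ ζ ε R =
          (T.signSum ν : ℂ) * singleIntegral (D.Z τ₀ T.totalCharge) ζ R + E₁ ε R + E₂ ε R) ∧
        (∀ R δ : ℝ, 0 < R → 0 < δ → δ < δ₀ ε → E₁ ε R =
          ((T.intermediateTerms ν).map fun u => ((u.2 : ℤ) : ℂ) *
            T.termPropagator u.1
              (fun α => ((‖D.Z τ₀ T.totalCharge‖ / ‖D.Z (τ₀ + ε) T.totalCharge‖ : ℝ) : ℂ) *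
                D.Z (τ₀ + ε) α) (D.Z (τ₀ + ε)) δ R ζ).sum) ∧
        Asymptotics.IsLittleO Filter.atTop (E₁ ε) (besselRate (D.Z τ₀ T.totalCharge)) ∧
        (∀ R : ℝ, 1 ≤ R → ‖E₂ ε R‖ ≤ C * ε) := by
  set lo := D.eP.arg with hlodef
  set hi := D.gP.arg with hhidef
  have hlt : lo < hi := D.arg_eP_lt_arg_gP
  have hlo : 0 ≤ lo := (arg_mem_of_firstQuadrant D.eP_mem).1
  have hhi : hi ≤ Real.pi / 2 := (arg_mem_of_firstQuadrant D.gP_mem).2.le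
  have haway : Away ζ lo hi := D.away hζ
  obtain ⟨hτ0, hτ1⟩ := hcrit.mem
  obtain ⟨c₀, hc₀, hbd⟩ := D.exists_boundedBelow
  obtain ⟨t1, t2, t3⟩ := hT.totalCharge_pos
  set c := T.totalCharge with hc
  -- bounds for the total central charge
  have hZge : ∀ τ, 0 ≤ τ → τ ≤ 1 → c₀ ≤ ‖D.Z τ c‖ := fun τ h0 h1 =>
    (((hbd τ h0 h1).centralCharge hc₀.le t1 t2 t3).1).trans (Complex.re_le_norm _)
  set M : ℝ := ‖D.Z 0 c‖ + ‖D.Z 1 c‖ with hM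
  have hZaff : ∀ τ : ℝ, D.Z τ c = (1 - τ : ℝ) * D.Z 0 c + (τ : ℝ) * D.Z 1 c := by
    intro τ
    simp only [WallCrossing.Z, centralCharge_eq, WallCrossing.g, WallCrossing.e]
    push_cast; ring
  have hZle : ∀ τ, 0 ≤ τ → τ ≤ 1 → ‖D.Z τ c‖ ≤ M := by
    intro τ h0 h1
    rw [hZaff]
    refine (norm_add_le _ _).trans ?_
    rw [norm_mul, norm_mul, Complex.norm_real, Complex.norm_real, Real.norm_of_nonneg h0,
      Real.norm_of_nonneg (by linarith : 0 ≤ 1 - τ)]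
    have h2 := norm_nonneg (D.Z 0 c)
    have h3 := norm_nonneg (D.Z 1 c)
    nlinarith
  have hM0 : 0 < M := hc₀.trans_le ((hZge 0 le_rfl zero_le_one).trans (hZle 0 le_rfl zero_le_one))
  set lam : ℝ → ℝ := fun ε => ‖D.Z τ₀ c‖ / ‖D.Z (τ₀ + ε) c‖ with hlam
  -- The rescaling factor is at least c₀/M, so c₁ is a common lower bound for the coordinates of the
  -- original and the rescaled charges, independent of ε.
  set c₁ : ℝ := min c₀ (c₀ / M * c₀) with hc₁
  have hc₁0 : 0 < c₁ := by positivity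
  have hbd1 : ∀ τ, 0 ≤ τ → τ ≤ 1 → BoundedBelow c₁ (D.g τ) (D.e τ) := fun τ h0 h1 => by
    obtain ⟨⟨a1, a2⟩, a3, a4⟩ := hbd τ h0 h1
    have := min_le_left c₀ (c₀ / M * c₀)
    exact ⟨⟨this.trans a1, this.trans a2⟩, this.trans a3, this.trans a4⟩
  -- Any history with all vertices as members will do, whether or not it occurs among the terms: the
  -- value of a single vertex depends only on the total charge.
  obtain ⟨m₀, hm₀⟩ := T.exists_good_single
  have hgood : ∀ u ∈ T.residueTerms ν, T.Good u.1 := by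
    obtain ⟨hgP, heP⟩ := D.mem_firstQuadrant hτ0.le hτ1.le
    exact (residueTerms_sum (P := T.rayData (D.g τ₀) (D.e τ₀) 1 ζ) rfl hlt
      (hT.regular hgP heP one_pos hlo hhi haway) ν).1
  have hsorted := hT.residueTerms_sorted ν
  have hsub : ∀ u ∈ T.intermediateTerms ν, u ∈ T.residueTerms ν ∧ 1 < u.1.length := fun u hu => by
    have := List.mem_filter.mp hu
    simp only [Bool.and_eq_true, decide_eq_true_eq] at this
    exact ⟨this.1, this.2.1⟩
  obtain ⟨C1, hC10, hC1⟩ := hT.listValue_lipschitz hlt hlo hhi haway hc₁0 (good_initialList ν)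
  obtain ⟨C2, hC20, hC2⟩ := hT.listValue_lipschitz hlt hlo hhi haway hc₁0 hm₀
  obtain ⟨C3, hC30, hC3⟩ := hT.signedSum_lipschitz hlt hlo hhi haway hc₁0
    (S := T.intermediateTerms ν) fun u hu => hgood u (hsub u hu).1
  have hB0 : 0 ≤ D.size := D.size_nonneg
  set K : ℝ := 2 * D.size + M / c₀ * D.size with hK
  have hK0 : 0 ≤ K := by positivity
  -- An upper bound for the lengths of all terms. With δ below the gap over N, all the rotations
  -- together keep the rays within the strip.
  set N : ℝ := ((T.residueTerms ν).map fun u => u.1.length).sum + 1 with hN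
  have hN0 : 0 < N := by positivity
  have hNle : ∀ u ∈ T.residueTerms ν, (u.1.length : ℝ) ≤ N := fun u hu => by
    have h1 : u.1.length ≤ ((T.residueTerms ν).map fun u => u.1.length).sum :=
      List.single_le_sum (fun _ _ => Nat.zero_le _) _ (List.mem_map.mpr ⟨u, hu, rfl⟩)
    have h2 : (u.1.length : ℝ) ≤ (((T.residueTerms ν).map fun u => u.1.length).sum : ℕ) := by
      exact_mod_cast h1
    rw [hN]; linarith
  set LV : ℝ → ℂ → ℂ → List (MergeTree V) → ℂ := fun R x y => T.listValue (T.rayData x y R ζ) lo hi with hLV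
  refine ⟨min τ₀ (1 - τ₀), (C1 + |(T.signSum ν : ℝ)| * C2 + C3) * K,
    fun ε => ((D.g (τ₀ + ε)).arg - lo) / N,
    fun ε R => signedSum (T.intermediateTerms ν)
      (LV R (lam ε * D.g (τ₀ + ε)) (lam ε * D.e (τ₀ + ε))),
    fun ε R => T.jump D τ₀ ζ ε R - (T.signSum ν : ℂ) * singleIntegral (D.Z τ₀ c) ζ R -
      signedSum (T.intermediateTerms ν) (LV R (lam ε * D.g (τ₀ + ε)) (lam ε * D.e (τ₀ + ε))),
    lt_min hτ0 (by linarith), fun ε hε hε' => ?_⟩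
  obtain ⟨hε1, hε2⟩ := lt_min_iff.mp hε'
  have hp0 : 0 < τ₀ + ε := by linarith
  have hp1 : τ₀ + ε < 1 := by linarith
  have hn0 : 0 < τ₀ - ε := by linarith
  have hn1 : τ₀ - ε < 1 := by linarith
  obtain ⟨hgp, hep⟩ := D.mem_firstQuadrant hp0.le hp1.le
  obtain ⟨hgn, hen⟩ := D.mem_firstQuadrant hn0.le hn1.le
  obtain ⟨hg0, he0⟩ := D.mem_firstQuadrant hτ0.le hτ1.le
  obtain ⟨⟨bgp1, bgp2⟩, bep1, bep2⟩ := D.arg_bounds hp0 hp1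
  obtain ⟨⟨bgn1, bgn2⟩, ben1, ben2⟩ := D.arg_bounds hn0 hn1
  obtain ⟨⟨bg01, bg02⟩, be01, be02⟩ := D.arg_bounds hτ0 hτ1
  have hordp : (D.g (τ₀ + ε)).arg < (D.e (τ₀ + ε)).arg := hcrit.arg_lt_of_gt (by linarith) hp1.le
  have hordn : (D.e (τ₀ - ε)).arg < (D.g (τ₀ - ε)).arg := hcrit.arg_lt_of_lt hn0.le (by linarith)
  -- the rescaling factor
  have hZp := hZge (τ₀ + ε) hp0.le hp1.le
  have hlam0 : c₀ / M ≤ lam ε := by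
    simp only [hlam]
    have := hZge τ₀ hτ0.le hτ1.le
    have := hZle (τ₀ + ε) hp0.le hp1.le
    have : 0 < ‖D.Z (τ₀ + ε) c‖ := hc₀.trans_le hZp
    gcongr
  have hlampos : 0 < lam ε := lt_of_lt_of_le (by positivity) hlam0
  have hfql : ∀ z ∈ firstQuadrant, (lam ε : ℂ) * z ∈ firstQuadrant := fun z hz => by
    refine ⟨?_, ?_⟩
    · rw [re_ofReal_mul]; exact mul_pos hlampos hz.1
    · rw [im_ofReal_mul]; exact mul_pos hlampos hz.2
  have hbdl : BoundedBelow c₁ (lam ε * D.g (τ₀ + ε)) (lam ε * D.e (τ₀ + ε)) := by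
    obtain ⟨⟨a1, a2⟩, a3, a4⟩ := hbd (τ₀ + ε) hp0.le hp1.le
    have h1 : c₁ ≤ c₀ / M * c₀ := min_le_right _ _
    have h2 : ∀ r, c₀ ≤ r → c₁ ≤ lam ε * r := fun r hr =>
      h1.trans (mul_le_mul hlam0 hr hc₀.le hlampos.le)
    refine ⟨⟨?_, ?_⟩, ?_, ?_⟩ <;> simp only [re_ofReal_mul, im_ofReal_mul]
    exacts [h2 _ a1, h2 _ a2, h2 _ a3, h2 _ a4]
  have hregp : ∀ x ∈ firstQuadrant, ∀ y ∈ firstQuadrant, ∀ R : ℝ, 0 < R →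
      (T.rayData x y R ζ).Regular lo hi := fun x hx y hy R hR => hT.regular hx hy hR hlo hhi haway
  have hδ₀ : ∀ δ, δ < ((D.g (τ₀ + ε)).arg - lo) / N → 0 < δ → ∀ u ∈ T.residueTerms ν,
      δ * u.1.length ≤ (D.g (τ₀ + ε)).arg - lo := fun δ h1 h2 u hu => by
    rw [lt_div_iff₀ hN0] at h1
    have := hNle u hu
    nlinarith
  have hterm : ∀ x ∈ firstQuadrant, ∀ y ∈ firstQuadrant, ∀ R δ : ℝ, 0 < R → 0 < δ →
      δ < ((D.g (τ₀ + ε)).arg - lo) / N → ∀ u ∈ T.residueTerms ν,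
      T.termPropagator u.1 (centralCharge x y) (D.Z (τ₀ + ε)) δ R ζ = LV R x y u.1 :=
    fun x hx y hy R δ hR hδ hδ' u hu => hT.termPropagator_eq hlt (hregp x hx y hy R hR) (hgood u hu)
      (hsorted u hu) hgp hep hordp bep2.le hδ (hδ₀ δ hδ' hδ u hu)
  have hinit : ∀ x ∈ firstQuadrant, ∀ y ∈ firstQuadrant, ∀ R : ℝ, 0 < R →
      T.G (centralCharge x y) (D.Z (τ₀ - ε)) R ζ = LV R x y (T.initialList ν) :=
    fun x hx y hy R hR => hT.G_eq_initialList hlt (hregp x hx y hy R hR) ν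
      (ne_zero_of_firstQuadrant hgn) (ne_zero_of_firstQuadrant hen) hordn ben1.le bgn2.le
  have hsum : ∀ x ∈ firstQuadrant, ∀ y ∈ firstQuadrant, ∀ R : ℝ, 0 < R →
      signedSum (T.residueTerms ν) (LV R x y) = LV R x y (T.initialList ν) :=
    fun x hx y hy R hR => (residueTerms_sum rfl hlt (hregp x hx y hy R hR) ν).2
  have hsingle : ∀ x ∈ firstQuadrant, ∀ y ∈ firstQuadrant, ∀ R : ℝ, 0 < R → ∀ m, T.Good [m] →
      LV R x y [m] = ∫ s : ℝ, rhoKernel ζ (Real.exp s * -D.Z τ₀ c) *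
        psiZero R (centralCharge x y c) (Real.exp s * -D.Z τ₀ c) := fun x hx y hy R hR m hm =>
    listValue_single hlt (hregp x hx y hy R hR) hm
      (ne_zero_of_firstQuadrant (centralCharge_mem hg0 he0 t1 t2 t3))
      (by
        have h1 := (arg_centralCharge_bounds hg0 he0 t1 t2 t3 D.eP_mem).1 bg01.le be01.le
        exact h1)
      ((arg_centralCharge_bounds hg0 he0 t1 t2 t3 D.gP_mem).2 bg02.le be02.le)
  refine ⟨div_pos (by linarith) hN0, ?_, ?_, ?_, ?_, ?_⟩
  · intro x hx y hy R δ hR hδ hδ'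
    rw [hinit x hx y hy R hR, ← hsum x hx y hy R hR]
    exact (signedSum_congr (f := fun L => T.termPropagator L (centralCharge x y) (D.Z (τ₀ + ε)) δ R ζ)
      (g := LV R x y) (fun u hu => hterm x hx y hy R δ hR hδ hδ' u hu)).symm
  · intro R hR; ring
  · intro R δ hR hδ hδ'
    refine signedSum_congr (g := fun L => T.termPropagator L (fun α =>
      ((‖D.Z τ₀ c‖ / ‖D.Z (τ₀ + ε) c‖ : ℝ) : ℂ) * D.Z (τ₀ + ε) α) (D.Z (τ₀ + ε)) δ R ζ) fun u hu => ?_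
    rw [← hterm _ (hfql _ hgp) _ (hfql _ hep) R δ hR hδ hδ' u (hsub u hu).1]
    congr 1
    funext α
    simp only [WallCrossing.Z, centralCharge_eq, hlam]
    ring
  · refine signedSum_isLittleO fun u hu => ?_
    obtain ⟨hu1, hu2⟩ := hsub u hu
    obtain ⟨M', C', hM', hC'⟩ := hT.listValue_decay hprim hlo hhi haway (hfql _ hgp) (hfql _ hep)
      (by rw [Complex.arg_real_mul _ hlampos, Complex.arg_real_mul _ hlampos]; exact hordp)
      (by rw [Complex.arg_real_mul _ hlampos]; exact bgp1)
      (by rw [Complex.arg_real_mul _ hlampos]; exact bep2.le) (hgood u hu1) (hsorted u hu1) hu2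
    -- This is the purpose of the rescaling: the total charge has modulus exactly |z₀|, so the decay
    -- of E₁ can be compared with the rate at the critical value for fixed ε.
    have hnorm : ‖centralCharge (lam ε * D.g (τ₀ + ε)) (lam ε * D.e (τ₀ + ε)) c‖ = ‖D.Z τ₀ c‖ := by
      have e : centralCharge (lam ε * D.g (τ₀ + ε)) (lam ε * D.e (τ₀ + ε)) c =
          (lam ε : ℂ) * D.Z (τ₀ + ε) c := by
        simp only [WallCrossing.Z, centralCharge_eq]; ring
      rw [e, norm_mul, Complex.norm_real, Real.norm_of_nonneg hlampos.le]
      simp only [hlam]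
      rw [div_mul_cancel₀ _ (hc₀.trans_le hZp).ne']
    rw [hnorm] at hM'
    refine Asymptotics.IsBigO.trans_isLittleO ?_ (isLittleO_besselRate
      (ne_zero_of_firstQuadrant (centralCharge_mem hg0 he0 t1 t2 t3)) hM')
    refine Asymptotics.IsBigO.of_bound C' ?_
    filter_upwards [eventually_ge_atTop 1] with R hR
    rw [Real.norm_of_nonneg (Real.exp_pos _).le]
    exact hC' R hR
  · intro R hR
    have hR0 : 0 < R := by linarith
    -- The value at τ₀ + ε of the integral over the rays ℓ⁺, split by the kinds of terms. All
    -- completely contracted terms have the same value, and the uncontracted ones give the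
    -- propagator over ℓ⁻.
    have hexp : LV R (D.g (τ₀ + ε)) (D.e (τ₀ + ε)) (T.initialList ν) =
        T.G (D.Z (τ₀ + ε)) (D.Z (τ₀ + ε)) R ζ +
        (T.signSum ν : ℂ) * LV R (D.g (τ₀ + ε)) (D.e (τ₀ + ε)) [m₀] +
        signedSum (T.intermediateTerms ν) (LV R (D.g (τ₀ + ε)) (D.e (τ₀ + ε))) := by
      rw [← hsum _ hgp _ hep R hR0]
      refine signedSum_residueTerms (fun u hu hleaf => ?_) fun u hu l r hlr => ?_
      · refine (hT.G_eq_sorted hlt (hregp _ hgp _ hep R hR0) (hgood u hu) hleaf (hsorted u hu)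
          hgp hep hordp fun v => ?_).symm
        obtain ⟨p1, p2, p3⟩ := hT.proj_total (leaf v)
        exact ⟨(arg_centralCharge_bounds hgp hep p1 p2 p3 D.eP_mem).1 bgp1.le bep1.le,
          (arg_centralCharge_bounds hgp hep p1 p2 p3 D.gP_mem).2 bgp2.le bep2.le⟩
      · have hg := hgood u hu
        rw [hlr] at hg ⊢
        rw [hsingle _ hgp _ hep R hR0 _ hg, hsingle _ hgp _ hep R hR0 _ hm₀]
    have hsing : singleIntegral (D.Z τ₀ c) ζ R = LV R (D.g τ₀) (D.e τ₀) [m₀] :=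
      (hsingle _ hg0 _ he0 R hR0 _ hm₀).symm
    -- Three replacements of the charge in the integrand: from τ₀ - ε to τ₀ + ε in the whole tree,
    -- from τ₀ + ε to τ₀ in the single integral, and from τ₀ + ε to its rescaling in the
    -- intermediate terms. Each moves the charges by at most Kε.
    have e : T.jump D τ₀ ζ ε R - (T.signSum ν : ℂ) * singleIntegral (D.Z τ₀ c) ζ R -
        signedSum (T.intermediateTerms ν) (LV R (lam ε * D.g (τ₀ + ε)) (lam ε * D.e (τ₀ + ε))) =
        (LV R (D.g (τ₀ - ε)) (D.e (τ₀ - ε)) (T.initialList ν) -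
          LV R (D.g (τ₀ + ε)) (D.e (τ₀ + ε)) (T.initialList ν)) +
        (T.signSum ν : ℂ) * (LV R (D.g (τ₀ + ε)) (D.e (τ₀ + ε)) [m₀] - LV R (D.g τ₀) (D.e τ₀) [m₀]) +
        (signedSum (T.intermediateTerms ν) (LV R (D.g (τ₀ + ε)) (D.e (τ₀ + ε))) -
          signedSum (T.intermediateTerms ν) (LV R (lam ε * D.g (τ₀ + ε)) (lam ε * D.e (τ₀ + ε)))) := by
      have h1 : T.G (D.Z (τ₀ - ε)) (D.Z (τ₀ - ε)) R ζ =
        LV R (D.g (τ₀ - ε)) (D.e (τ₀ - ε)) (T.initialList ν) := hinit _ hgn _ hen R hR0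
      rw [jump, hsing, h1, hexp]
      ring
    beta_reduce
    rw [e]
    have hd : ∀ σ τ : ℝ, |σ - τ| ≤ 2 * ε →
        ‖D.g σ - D.g τ‖ ≤ K * ε ∧ ‖D.e σ - D.e τ‖ ≤ K * ε := by
      intro σ τ h
      have h3 : 0 ≤ M / c₀ * D.size * ε := by positivity
      have h4 : |σ - τ| * D.size ≤ K * ε := by
        calc _ ≤ (2 * ε) * D.size := by gcongr
          _ ≤ K * ε := by rw [hK]; linarith
      exact ⟨(D.norm_sub_le σ τ).1.trans h4, (D.norm_sub_le σ τ).2.trans h4⟩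
    have hl : ‖D.g (τ₀ + ε) - lam ε * D.g (τ₀ + ε)‖ ≤ K * ε ∧
        ‖D.e (τ₀ + ε) - lam ε * D.e (τ₀ + ε)‖ ≤ K * ε := by
      have hl1 : |1 - lam ε| ≤ M / c₀ * ε := by
        have hZpos : 0 < ‖D.Z (τ₀ + ε) c‖ := hc₀.trans_le hZp
        have e3 : 1 - lam ε = (‖D.Z (τ₀ + ε) c‖ - ‖D.Z τ₀ c‖) / ‖D.Z (τ₀ + ε) c‖ := by
          simp only [hlam]; rw [sub_div, div_self hZpos.ne']
        have e4 : D.Z (τ₀ + ε) c - D.Z τ₀ c = (ε : ℝ) * (D.Z 1 c - D.Z 0 c) := by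
          rw [hZaff (τ₀ + ε), hZaff τ₀]; push_cast; ring
        have e5 : |‖D.Z (τ₀ + ε) c‖ - ‖D.Z τ₀ c‖| ≤ ε * M := by
          refine (abs_norm_sub_norm_le _ _).trans ?_
          rw [e4, norm_mul, Complex.norm_real, Real.norm_of_nonneg hε.le]
          exact mul_le_mul_of_nonneg_left ((norm_sub_le _ _).trans (by rw [hM, add_comm])) hε.le
        rw [e3, abs_div, abs_of_pos hZpos]
        calc _ ≤ ε * M / c₀ := by gcongr
          _ = _ := by ring
      have hnb := D.norm_le hp0.le hp1.le
      have e6 : ∀ z : ℂ, ‖z‖ ≤ D.size → ‖z - lam ε * z‖ ≤ K * ε := by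
        intro z hz
        rw [show z - lam ε * z = ((1 - lam ε : ℝ) : ℂ) * z by push_cast; ring, norm_mul,
          Complex.norm_real, Real.norm_eq_abs]
        calc _ ≤ (M / c₀ * ε) * D.size := by gcongr
          _ ≤ K * ε := by
            rw [hK]
            have : 0 ≤ 2 * D.size * ε := by positivity
            linarith
      exact ⟨e6 _ hnb.1, e6 _ hnb.2⟩
    have hd1 := hd (τ₀ - ε) (τ₀ + ε) (by rw [abs_le]; constructor <;> linarith)
    have hd2 := hd (τ₀ + ε) τ₀ (by rw [abs_le]; constructor <;> linarith)
    have b1 := hC1 _ _ _ _ R (K * ε) hR (hbd1 _ hn0.le hn1.le) (hbd1 _ hp0.le hp1.le) hd1.1 hd1.2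
    have b2 := hC2 _ _ _ _ R (K * ε) hR (hbd1 _ hp0.le hp1.le) (hbd1 _ hτ0.le hτ1.le) hd2.1 hd2.2
    have b3 := hC3 _ _ _ _ R (K * ε) hR (hbd1 _ hp0.le hp1.le) hbdl hl.1 hl.2
    refine (norm_add₃_le).trans ?_
    rw [norm_mul, Complex.norm_intCast]
    calc _ ≤ C1 * (K * ε) + |(T.signSum ν : ℝ)| * (C2 * (K * ε)) + C3 * (K * ε) := by gcongr
      _ = _ := by ring

end DecoratedTree

/-! The leading term near the origin. -/

theorem rhoKernel_zero {ζ' : ℂ} (h : ζ' ≠ 0) : rhoKernel 0 ζ' = 1 / (4 * Real.pi * I) := by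
  simp [rhoKernel, h]

theorem continuousAt_rhoKernel {ζ' : ℂ} (h : ζ' ≠ 0) : ContinuousAt (fun ζ => rhoKernel ζ ζ') 0 := by
  unfold rhoKernel
  exact ContinuousAt.const_mul (ContinuousAt.div (by fun_prop) (by fun_prop) (by simpa using h)) _

/-- The semiflat coefficient along its ray. -/
theorem psiZero_ray {z : ℂ} (hz : z ≠ 0) (R s : ℝ) : psiZero R z (Real.exp s * -z) =
    (Real.exp (-(2 * Real.pi * ‖z‖ * R * Real.cosh (s + Real.log ‖z‖))) : ℂ) := by
  have hz' : 0 < ‖z‖ := norm_pos_iff.mpr hz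
  refine (congrArg Complex.exp ?_).trans (Complex.ofReal_exp _).symm
  have h1 : ((Real.exp s : ℂ) * -z)⁻¹ * z = -(Real.exp (-s) : ℝ) := by
    have : (Real.exp s : ℂ) ≠ 0 := by exact_mod_cast (Real.exp_pos s).ne'
    rw [Real.exp_neg]; push_cast at this ⊢; field_simp
  have h2 : (Real.exp s : ℂ) * -z * (starRingEnd ℂ) z = -((Real.exp s * ‖z‖ ^ 2 : ℝ) : ℂ) := by
    rw [mul_assoc, neg_mul, Complex.mul_conj, Complex.normSq_eq_norm_sq]; push_cast; ring
  rw [h1, h2, Real.cosh_eq, neg_add, Real.exp_add, Real.exp_add, Real.exp_neg (Real.log ‖z‖),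
    Real.exp_log hz']
  norm_cast
  field_simp
  ring

theorem integral_psiZero_ray {z : ℂ} (hz : z ≠ 0) (R : ℝ) :
    ∫ s : ℝ, psiZero R z (Real.exp s * -z) =
      ((∫ u : ℝ, Real.exp (-(2 * Real.pi * ‖z‖ * R * Real.cosh u)) : ℝ) : ℂ) := by
  simp only [psiZero_ray hz]
  rw [integral_complex_ofReal, integral_add_right_eq_self
    (fun u => Real.exp (-(2 * Real.pi * ‖z‖ * R * Real.cosh u))) (Real.log ‖z‖)]

/-- Dominated convergence. Nontangential approach keeps ζ at distance at least κ|ζ| from the ray, so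
ρ is bounded by (1 + 2/κ)/(4π), while pointwise it tends to 1/(4πi). The semiflat factor along its
own ray is exp(-2π|z|R cosh) after a translation by log |z|. -/
theorem tendsto_singleIntegral (D : WallCrossing) {z : ℂ} (hz : z ∈ firstQuadrant)
    (h1 : D.eP.arg ≤ z.arg) (h2 : z.arg ≤ D.gP.arg) {R κ : ℝ} (hR : 0 < R) (hκ : 0 < κ) :
    Tendsto (fun ζ => singleIntegral z ζ R) (𝓝[D.nontangential κ] 0)
      (𝓝 (1 / (4 * Real.pi * I) *
        ((∫ u : ℝ, Real.exp (-(2 * Real.pi * ‖z‖ * R * Real.cosh u)) : ℝ) : ℂ))) := by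
  have hz0 := ne_zero_of_firstQuadrant hz
  have hz' : 0 < ‖z‖ := norm_pos_iff.mpr hz0
  have hpi := Real.pi_pos
  rw [← integral_psiZero_ray hz0, ← integral_const_mul]
  unfold singleIntegral
  have hne : ∀ s : ℝ, (Real.exp s : ℂ) * -z ≠ 0 := fun s =>
    mul_ne_zero (by exact_mod_cast (Real.exp_pos s).ne') (neg_ne_zero.mpr hz0)
  have hmem : ∀ s : ℝ, (Real.exp s : ℂ) * -z ∈ D.cone := fun s => by
    rw [mul_neg]
    refine D.neg_mem_cone ⟨?_, ?_⟩ ?_ ?_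
    · rw [re_ofReal_mul]; exact mul_pos (Real.exp_pos s) hz.1
    · rw [im_ofReal_mul]; exact mul_pos (Real.exp_pos s) hz.2
    · rwa [Complex.arg_real_mul _ (Real.exp_pos s)]
    · rwa [Complex.arg_real_mul _ (Real.exp_pos s)]
  refine tendsto_integral_filter_of_dominated_convergence
    (fun s => 1 / (4 * Real.pi) * (1 + 2 / κ) *
      Real.exp (-(2 * Real.pi * ‖z‖ * R * Real.cosh (s + Real.log ‖z‖)))) ?_ ?_ ?_ ?_
  · refine Eventually.of_forall fun ζ => Measurable.aestronglyMeasurable ?_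
    unfold rhoKernel
    simp only [psiZero_ray hz0]
    refine Measurable.mul (Measurable.const_mul (Measurable.div ?_ ?_) _) ?_
    all_goals fun_prop
  · filter_upwards [self_mem_nhdsWithin] with ζ hζ
    refine ae_of_all _ fun s => ?_
    obtain ⟨hζ0, hζ1⟩ := hζ
    have hζ' : 0 < ‖ζ‖ := norm_pos_iff.mpr hζ0
    have h3 := norm_rhoKernel_le (d := κ * ‖ζ‖) (by positivity)
      (hζ1.trans (D.infDist_le_norm_sub (hmem s)))
    rw [norm_mul, psiZero_ray hz0, Complex.norm_real, Real.norm_of_nonneg (Real.exp_pos _).le]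
    have e : 2 * ‖ζ‖ / (κ * ‖ζ‖) = 2 / κ := by field_simp
    rw [e] at h3
    gcongr
  · exact (integrable_exp_neg_cosh (by positivity) _).const_mul _
  · refine ae_of_all _ fun s => ?_
    have h3 := (continuousAt_rhoKernel (hne s)).tendsto
    rw [rhoKernel_zero (hne s)] at h3
    exact (h3.mono_left nhdsWithin_le_nhds).mul_const _

/-- Laplace's asymptotics √(2π/X) e^{-X} at X = 2π|z|R; the factors 2π cancel. -/
theorem isEquivalent_integral_cosh {z : ℂ} (hz : z ≠ 0) :
    Asymptotics.IsEquivalent atTop (fun R : ℝ => 1 / (4 * Real.pi * I) *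
      ((∫ u : ℝ, Real.exp (-(2 * Real.pi * ‖z‖ * R * Real.cosh u)) : ℝ) : ℂ))
      fun R => 1 / (4 * Real.pi * I) * (besselRate z R : ℂ) := by
  have hz' : 0 < ‖z‖ := norm_pos_iff.mpr hz
  have hpi := Real.pi_pos
  refine Asymptotics.IsEquivalent.mul Asymptotics.IsEquivalent.refl ?_
  have hlim : Tendsto (fun R : ℝ => 2 * Real.pi * ‖z‖ * R) atTop atTop :=
    tendsto_id.const_mul_atTop (by positivity)
  have h1 := (tendsto_sqrt_mul_integral_cosh.comp hlim).div_const √(2 * Real.pi)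
  rw [div_self (Real.sqrt_pos.mpr (by positivity)).ne'] at h1
  refine (Asymptotics.isEquivalent_iff_tendsto_one ?_).mpr ?_
  · filter_upwards [eventually_gt_atTop 0] with R hR
    have : 0 < besselRate z R := by unfold besselRate; positivity
    exact_mod_cast this.ne'
  · have h2 : Tendsto (fun R : ℝ => (((√(2 * Real.pi * ‖z‖ * R) * Real.exp (2 * Real.pi * ‖z‖ * R) *
        ∫ u : ℝ, Real.exp (-(2 * Real.pi * ‖z‖ * R * Real.cosh u))) / √(2 * Real.pi) : ℝ) : ℂ)) atTop
        (𝓝 ((1 : ℝ) : ℂ)) := (Complex.continuous_ofReal.tendsto _).comp h1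
    rw [Complex.ofReal_one] at h2
    refine h2.congr' ?_
    filter_upwards [eventually_gt_atTop 0] with R hR
    rw [Pi.div_apply, ← Complex.ofReal_div]
    congr 1
    unfold besselRate
    rw [mul_assoc (2 * Real.pi), Real.sqrt_mul (by positivity), Real.exp_neg]
    have h3 : 0 < √(‖z‖ * R) := Real.sqrt_pos.mpr (by positivity)
    have h4 : 0 < √(2 * Real.pi) := Real.sqrt_pos.mpr (by positivity)
    field_simp

end

/-! ### The tropical type of a contraction history: tree, trivalence, balancing. -/

section

namespace MergeTree

variable {V A : Type} [AddCommMonoid A]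

/-- A value attached to the subtrees, as a function on the vertices. -/
def outVal (val : MergeTree V → A) : (m : MergeTree V) → m.Vertex → A
  | leaf _, x => Empty.elim x
  | node l r, none => val (node l r)
  | node l _, some (.inl x) => l.outVal val x
  | node _ r, some (.inr x) => r.outVal val x

/-- The sum of the values of the two subtrees contracted at a vertex. -/
def inVal (val : MergeTree V → A) : (m : MergeTree V) → m.Vertex → A
  | leaf _, x => Empty.elim x
  | node l r, none => val l + val r
  | node l _, some (.inl x) => l.inVal val x
  | node _ r, some (.inr x) => r.inVal val x

theorem outVec_eq_outVal (q : V → ℤ × ℤ) (m : MergeTree V) (x : m.Vertex) :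
    m.outVec q x = m.outVal (total q) x := by
  induction m with
  | leaf v => exact x.elim
  | node l r ihl ihr =>
    rcases x with _ | x | x
    · rfl
    · exact ihl x
    · exact ihr x

theorem inVal_total (q : V → ℤ × ℤ) (m : MergeTree V) (x : m.Vertex) :
    m.inVal (total q) x = m.outVec q x := by
  induction m with
  | leaf v => exact x.elim
  | node l r ihl ihr =>
    rcases x with _ | x | x
    · rfl
    · exact ihl x
    · exact ihr x

theorem outVal_const (n : A) (m : MergeTree V) (x : m.Vertex) : m.outVal (fun _ => n) x = n := by
  induction m with
  | leaf v => exact x.elim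
  | node l r ihl ihr =>
    rcases x with _ | x | x
    · rfl
    · exact ihl x
    · exact ihr x

theorem inVal_const (n : A) (m : MergeTree V) (x : m.Vertex) : m.inVal (fun _ => n) x = n + n := by
  induction m with
  | leaf v => exact x.elim
  | node l r ihl ihr =>
    rcases x with _ | x | x
    · rfl
    · exact ihl x
    · exact ihr x

/-- The last vertex. -/
def topV (l r : MergeTree V) : (node l r).Vertex := (none : Option (l.Vertex ⊕ r.Vertex))

/-- A vertex of the first branch. -/
def inlV {l r : MergeTree V} (x : l.Vertex) : (node l r).Vertex :=
  (some (Sum.inl x) : Option (l.Vertex ⊕ r.Vertex))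

/-- A vertex of the second branch. -/
def inrV {l r : MergeTree V} (x : r.Vertex) : (node l r).Vertex :=
  (some (Sum.inr x) : Option (l.Vertex ⊕ r.Vertex))

/-- An end of the first branch. -/
def inlE {l r : MergeTree V} (x : l.End) : (node l r).End := (Sum.inl x : l.End ⊕ r.End)

/-- An end of the second branch. -/
def inrE {l r : MergeTree V} (x : r.End) : (node l r).End := (Sum.inr x : l.End ⊕ r.End)

section Node

variable {l r : MergeTree V}

theorem vertex_cases (x : (node l r).Vertex) :
    x = topV l r ∨ (∃ y : l.Vertex, x = inlV y) ∨ ∃ y : r.Vertex, x = inrV y := by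
  rcases x with _ | x | x
  exacts [Or.inl rfl, Or.inr (Or.inl ⟨x, rfl⟩), Or.inr (Or.inr ⟨x, rfl⟩)]

theorem end_cases (x : (node l r).End) : (∃ y : l.End, x = inlE y) ∨ ∃ y : r.End, x = inrE y := by
  rcases x with x | x
  exacts [Or.inl ⟨x, rfl⟩, Or.inr ⟨x, rfl⟩]

theorem inlV_inj {x y : l.Vertex} : (inlV x : (node l r).Vertex) = inlV y ↔ x = y :=
  ⟨fun h => Sum.inl_injective (Option.some_injective _ h), fun h => h ▸ rfl⟩

theorem inrV_inj {x y : r.Vertex} : (inrV x : (node l r).Vertex) = inrV y ↔ x = y :=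
  ⟨fun h => Sum.inr_injective (Option.some_injective _ h), fun h => h ▸ rfl⟩

theorem inlV_ne_topV {x : l.Vertex} : (inlV x : (node l r).Vertex) ≠ topV l r := fun h =>
  Option.some_ne_none _ h

theorem inrV_ne_topV {x : r.Vertex} : (inrV x : (node l r).Vertex) ≠ topV l r := fun h =>
  Option.some_ne_none _ h

theorem inlV_ne_inrV {x : l.Vertex} {y : r.Vertex} : (inlV x : (node l r).Vertex) ≠ inrV y := fun h =>
  Sum.inl_ne_inr (Option.some_injective _ h)

theorem up_topV : (node l r).up (topV l r) = none := rfl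

theorem up_inlV (x : l.Vertex) :
    (node l r).up (inlV x) = some ((l.up x).elim (topV l r) inlV) := by
  change some _ = _
  cases h : l.up x <;> rfl

theorem up_inrV (x : r.Vertex) :
    (node l r).up (inrV x) = some ((r.up x).elim (topV l r) inrV) := by
  change some _ = _
  cases h : r.up x <;> rfl

theorem endVertex_inlE (x : l.End) :
    (node l r).endVertex (inlE x) = some ((l.endVertex x).elim (topV l r) inlV) := by
  change some _ = _
  cases h : l.endVertex x <;> rfl

theorem endVertex_inrE (x : r.End) :
    (node l r).endVertex (inrE x) = some ((r.endVertex x).elim (topV l r) inrV) := by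
  change some _ = _
  cases h : r.endVertex x <;> rfl

theorem elim_inlV_eq_topV {o : Option l.Vertex} :
    (o.elim (topV l r) inlV = topV l r) ↔ o = none := by
  cases o <;> simp [inlV_ne_topV]

theorem elim_inrV_eq_topV {o : Option r.Vertex} :
    (o.elim (topV l r) inrV = topV l r) ↔ o = none := by
  cases o <;> simp [inrV_ne_topV]

theorem elim_inlV_eq_inlV {o : Option l.Vertex} {x : l.Vertex} :
    (o.elim (topV l r) inlV = inlV x) ↔ o = some x := by
  cases o <;> simp [inlV_ne_topV.symm, inlV_inj]

theorem elim_inrV_eq_inrV {o : Option r.Vertex} {x : r.Vertex} :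
    (o.elim (topV l r) inrV = inrV x) ↔ o = some x := by
  cases o <;> simp [inrV_ne_topV.symm, inrV_inj]

theorem elim_inlV_eq_inrV {o : Option l.Vertex} {x : r.Vertex} :
    (o.elim (topV l r) inlV = inrV x) ↔ False := by
  cases o <;> simp [inrV_ne_topV.symm, inlV_ne_inrV]

theorem elim_inrV_eq_inlV {o : Option r.Vertex} {x : l.Vertex} :
    (o.elim (topV l r) inrV = inlV x) ↔ False := by
  cases o <;> simp [inlV_ne_topV.symm, inlV_ne_inrV.symm]

theorem sum_vertex_node (f : (node l r).Vertex → A) :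
    ∑ x, f x = f (topV l r) + (∑ x : l.Vertex, f (inlV x) + ∑ x : r.Vertex, f (inrV x)) := by
  let e : Option (l.Vertex ⊕ r.Vertex) ≃ (node l r).Vertex := Equiv.refl _
  rw [← Fintype.sum_equiv e (fun x => f (e x)) f fun _ => rfl, Fintype.sum_option, Fintype.sum_sum_type]
  rfl

theorem sum_end_node (f : (node l r).End → A) :
    ∑ x, f x = ∑ x : l.End, f (inlE x) + ∑ x : r.End, f (inrE x) := by
  let e : l.End ⊕ r.End ≃ (node l r).End := Equiv.refl _
  rw [← Fintype.sum_equiv e (fun x => f (e x)) f fun _ => rfl, Fintype.sum_sum_type]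
  rfl

theorem up_ne_none {x : (node l r).Vertex} (h : x ≠ topV l r) : ∃ y, (node l r).up x = some y := by
  rcases vertex_cases x with rfl | ⟨y, rfl⟩ | ⟨y, rfl⟩
  exacts [absurd rfl h, ⟨_, up_inlV y⟩, ⟨_, up_inrV y⟩]

end Node

/-- The number of contractions consuming the result at a vertex. -/
def height : (m : MergeTree V) → m.Vertex → ℕ
  | leaf _, x => Empty.elim x
  | node _ _, none => 0
  | node l _, some (.inl x) => l.height x + 1
  | node _ r, some (.inr x) => r.height x + 1

theorem height_up {m : MergeTree V} {x y : m.Vertex} (h : m.up x = some y) : m.height y < m.height x := by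
  induction m with
  | leaf v => exact x.elim
  | node l r ihl ihr =>
    rcases vertex_cases x with rfl | ⟨x, rfl⟩ | ⟨x, rfl⟩
    · rw [up_topV] at h; cases h
    · rw [up_inlV, Option.some_inj] at h
      rcases hx : l.up x with _ | y'
      · rw [hx] at h; subst h; exact Nat.succ_pos _
      · rw [hx] at h; subst h; exact Nat.succ_lt_succ (ihl hx)
    · rw [up_inrV, Option.some_inj] at h
      rcases hx : r.up x with _ | y'
      · rw [hx] at h; subst h; exact Nat.succ_pos _
      · rw [hx] at h; subst h; exact Nat.succ_lt_succ (ihr hx)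

open Classical in
/-- The branch entering the last vertex. -/
theorem sum_top (val : MergeTree V → A) (m : MergeTree V) :
    (∑ x, if m.up x = none then m.outVal val x else 0) +
      (∑ e, if m.endVertex e = none then val (leaf (m.endMember e)) else 0) = val m := by
  cases m with
  | leaf v =>
    have h1 : ∑ x : (leaf v).Vertex, (if (leaf v).up x = none then (leaf v).outVal val x else 0) = 0 :=
      Finset.sum_eq_zero fun x _ => x.elim
    have h2 : ∑ e : (leaf v).End, (if (leaf v).endVertex e = none then
        val (leaf ((leaf v).endMember e)) else 0) = ∑ e : Unit, val (leaf v) :=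
      Fintype.sum_equiv (Equiv.refl _) _ _ fun _ => if_pos rfl
    rw [h1, h2]; simp
  | node l r =>
    rw [sum_vertex_node, sum_end_node]
    simp only [up_topV, up_inlV, up_inrV, if_true, reduceCtorEq, if_false, Finset.sum_const_zero, add_zero,
      endVertex_inlE, endVertex_inrE]
    rfl

open Classical in
/-- The two branches entering a vertex. -/
theorem sum_inputs (val : MergeTree V → A) (m : MergeTree V) (x : m.Vertex) :
    (∑ y, if m.up y = some x then m.outVal val y else 0) +
      (∑ e, if m.endVertex e = some x then val (leaf (m.endMember e)) else 0) = m.inVal val x := by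
  induction m with
  | leaf v => exact x.elim
  | node l r ihl ihr =>
    rw [sum_vertex_node, sum_end_node]
    simp only [up_topV, up_inlV, up_inrV, endVertex_inlE, endVertex_inrE, reduceCtorEq, if_false,
      Option.some_inj, zero_add]
    rcases vertex_cases x with rfl | ⟨x, rfl⟩ | ⟨x, rfl⟩
    · simp only [elim_inlV_eq_topV, elim_inrV_eq_topV]
      change _ = val l + val r
      rw [add_add_add_comm, ← sum_top val l, ← sum_top val r]
      rfl
    · simp only [elim_inlV_eq_inlV, elim_inrV_eq_inlV, if_false, Finset.sum_const_zero, add_zero]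
      exact ihl x
    · simp only [elim_inrV_eq_inrV, elim_inlV_eq_inrV, if_false, Finset.sum_const_zero, zero_add]
      exact ihr x

theorem graph_adj (m : MergeTree V) (x y : m.Vertex) :
    m.graph.Adj x y ↔ m.up x = some y ∨ m.up y = some x := by
  unfold graph
  rw [SimpleGraph.fromRel_adj]
  refine ⟨fun h => h.2, fun h => ⟨?_, h⟩⟩
  rintro rfl
  rcases h with h | h <;> exact lt_irrefl _ (height_up h)

theorem up_asymm {m : MergeTree V} {x y : m.Vertex} (h : m.up x = some y) : m.up y ≠ some x := fun h' =>
  lt_asymm (height_up h) (height_up h')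

/-- Following outgoing edges leads every vertex to the last contraction, so the graph is connected.
Each edge is the outgoing edge of a vertex other than the last one, so there are too few edges for a
cycle. -/
theorem graph_isTree (l r : MergeTree V) : (node l r).graph.IsTree := by
  classical
  set top : (node l r).Vertex := topV l r with htop
  have hreach : ∀ n, ∀ x : (node l r).Vertex, (node l r).height x = n → (node l r).graph.Reachable x top := by
    intro n
    induction n using Nat.strong_induction_on with
    | _ n ih =>
      intro x hx
      by_cases h : x = top
      · rw [h]
      · obtain ⟨y, hy⟩ := up_ne_none h
        have h1 : (node l r).graph.Adj x y := (graph_adj _ _ _).mpr (Or.inl hy)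
        exact h1.reachable.trans (ih _ (hx ▸ height_up hy) y rfl)
  have hconn : (node l r).graph.Connected := by
    have : Nonempty (node l r).Vertex := ⟨top⟩
    exact ⟨fun x y => (hreach _ x rfl).trans (hreach _ y rfl).symm⟩
  rw [SimpleGraph.isTree_iff_connected_and_card]
  refine ⟨hconn, ?_⟩
  have h1 := hconn.card_vert_le_card_edgeSet_add_one
  refine le_antisymm ?_ h1
  -- every edge is the outgoing edge of a vertex
  let f : {x : (node l r).Vertex // x ≠ top} → (node l r).graph.edgeSet := fun x =>
    ⟨s(x.1, (up_ne_none x.2).choose), (graph_adj _ _ _).mpr (Or.inl (up_ne_none x.2).choose_spec)⟩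
  have hf : Function.Surjective f := by
    have key : ∀ x y (h : (node l r).up x = some y), ∃ z, (f z).1 = s(x, y) := by
      intro x y h
      have hx : x ≠ top := by rintro rfl; rw [htop, up_topV] at h; cases h
      refine ⟨⟨x, hx⟩, ?_⟩
      have := Option.some_inj.mp (h.symm.trans (up_ne_none hx).choose_spec)
      exact congrArg (fun w => s(x, w)) this.symm
    rintro ⟨e, he⟩
    induction e using Sym2.ind with
    | _ x y =>
      rcases (graph_adj _ _ _).mp he with h | h
      · obtain ⟨z, hz⟩ := key x y h
        exact ⟨z, Subtype.ext hz⟩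
      · obtain ⟨z, hz⟩ := key y x h
        exact ⟨z, Subtype.ext (hz.trans Sym2.eq_swap)⟩
  have h2 := Nat.card_le_card_of_surjective f hf
  have h3 : Nat.card {x : (node l r).Vertex // x ≠ top} = Nat.card (node l r).Vertex - 1 := by
    rw [Nat.card_eq_fintype_card, Nat.card_eq_fintype_card, Fintype.card_subtype_compl]
    simp
  have h4 : 0 < Nat.card (node l r).Vertex := by
    rw [Nat.card_eq_fintype_card]; exact Fintype.card_pos_iff.mpr ⟨top⟩
  omega

theorem endVertex_node (l r : MergeTree V) (e : (node l r).End) :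
    (node l r).endVertex e = some (((node l r).endVertex e).getD (topV l r)) := by
  rcases end_cases e with ⟨e, rfl⟩ | ⟨e, rfl⟩ <;> rfl

theorem tropType_adj (q : V → ℤ × ℤ) (l r : MergeTree V) (x y : (node l r).Vertex) :
    (tropType q l r).graph.Adj x y ↔ (node l r).up x = some y ∨ (node l r).up y = some x :=
  graph_adj _ _ _

open Classical in
/-- Sums over the edges and ends at a vertex. -/
theorem sum_edges_tropType (q : V → ℤ × ℤ) (l r : MergeTree V) (x : (node l r).Vertex)
    (F : (node l r).Vertex → A) (G : Option (node l r).End → A) :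
    (∑ y with (tropType q l r).graph.Adj x y, F y) + (∑ e with (tropType q l r).att e = x, G e) =
      (∑ y, if (node l r).up x = some y then F y else 0) +
      (if topV l r = x then G none else 0) +
      ((∑ y, if (node l r).up y = some x then F y else 0) +
      ∑ e, if (node l r).endVertex e = some x then G (some e) else 0) := by
  have h1 : (∑ y with (tropType q l r).graph.Adj x y, F y) =
      (∑ y, if (node l r).up x = some y then F y else 0) +
      (∑ y, if (node l r).up y = some x then F y else 0) := by
    refine (Finset.sum_filter (s := (Finset.univ : Finset (tropType q l r).V)) _ _).trans ?_
    rw [← Finset.sum_add_distrib]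
    have key : ∀ y : (node l r).Vertex, (if (tropType q l r).graph.Adj x y then F y else 0) =
        (if (node l r).up x = some y then F y else 0) + if (node l r).up y = some x then F y else 0 := ?_
    · exact Fintype.sum_equiv (Equiv.refl _) _ _ key
    intro y
    by_cases h1 : (node l r).up x = some y
    · rw [if_pos ((tropType_adj q l r x y).mpr (Or.inl h1)), if_pos h1, if_neg (up_asymm h1), add_zero]
    · by_cases h2 : (node l r).up y = some x
      · rw [if_pos ((tropType_adj q l r x y).mpr (Or.inr h2)), if_neg h1, if_pos h2, zero_add]
      · rw [if_neg fun h => (tropType_adj q l r x y).mp h |>.elim h1 h2, if_neg h1, if_neg h2, add_zero]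
  have h2 : (∑ e with (tropType q l r).att e = x, G e) = (if topV l r = x then G none else 0) +
      ∑ e, if (node l r).endVertex e = some x then G (some e) else 0 := by
    refine (Finset.sum_filter (s := (Finset.univ : Finset (tropType q l r).E)) _ _).trans ?_
    have h3 : (∑ e : (tropType q l r).E, if (tropType q l r).att e = x then G e else 0) =
        ∑ e : Option (node l r).End, if (tropType q l r).att e = x then G e else 0 :=
      Fintype.sum_equiv (Equiv.refl _) _ _ fun _ => rfl
    rw [h3, Fintype.sum_option]
    congr 1
    refine Finset.sum_congr rfl fun e _ => if_congr ?_ rfl rfl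
    rw [endVertex_node, Option.some_inj]
    rfl
  rw [h1, h2]
  abel

theorem outVec_ne_zero {q : V → ℤ × ℤ} (hq : ∀ m : MergeTree V, m.total q ≠ 0) (m : MergeTree V)
    (x : m.Vertex) : m.outVec q x ≠ 0 := by
  induction m with
  | leaf v => exact x.elim
  | node l r ihl ihr =>
    rcases x with _ | x | x
    · exact hq (node l r)
    · exact ihl x
    · exact ihr x

open Classical in
-- The incoming vectors at a contraction are the two charges contracted there, and the outgoing
-- vector is their sum.
theorem tropType_balanced (q : V → ℤ × ℤ) (l r : MergeTree V) (x : (node l r).Vertex) :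
    (∑ y with (tropType q l r).graph.Adj x y, (tropType q l r).dir x y) +
      ∑ e with (tropType q l r).att e = x, (tropType q l r).endDir e = 0 := by
  have h := sum_edges_tropType q l r x ((tropType q l r).dir x) (tropType q l r).endDir
  have h2 := sum_inputs (total q) (node l r) x
  simp only [inVal_total, ← outVec_eq_outVal] at h2
  have h3 : (∑ y, if (node l r).up x = some y then (tropType q l r).dir x y else 0) +
      (if topV l r = x then (tropType q l r).endDir none else 0) = (node l r).outVec q x := by
    have key : ∀ y, (node l r).up x = some y → topV l r ≠ x →
        (∑ y, if (node l r).up x = some y then (tropType q l r).dir x y else 0) +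
        (if topV l r = x then (tropType q l r).endDir none else 0) = (node l r).outVec q x := by
      intro y hy hx
      rw [if_neg hx, add_zero, hy, Finset.sum_eq_single y]
      · rw [if_pos rfl]
        exact if_pos hy
      · intro z _ hz
        exact if_neg fun h => hz (Option.some_inj.mp h).symm
      · intro h; exact absurd (Finset.mem_univ _) h
    rcases vertex_cases x with rfl | ⟨x, rfl⟩ | ⟨x, rfl⟩
    · rw [if_pos rfl, Finset.sum_eq_zero, zero_add]
      · rfl
      · intro y _
        rw [up_topV]
        exact if_neg (by simp)
    · exact key _ (up_inlV x) inlV_ne_topV.symm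
    · exact key _ (up_inrV x) inrV_ne_topV.symm
  have h4 : (∑ y, if (node l r).up y = some x then (tropType q l r).dir x y else 0) =
      -∑ y, if (node l r).up y = some x then (node l r).outVec q y else 0 := by
    rw [← Finset.sum_neg_distrib]
    refine Finset.sum_congr rfl fun y _ => ?_
    by_cases hy : (node l r).up y = some x
    · rw [if_pos hy, if_pos hy]
      exact if_neg (up_asymm hy)
    · rw [if_neg hy, if_neg hy, neg_zero]
  have h5 : (∑ e, if (node l r).endVertex e = some x then (tropType q l r).endDir (some e) else 0) =
      -∑ e, if (node l r).endVertex e = some x then (leaf ((node l r).endMember e)).total q else 0 := by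
    rw [← Finset.sum_neg_distrib]
    refine Finset.sum_congr rfl fun e _ => ?_
    by_cases he : (node l r).endVertex e = some x
    · rw [if_pos he, if_pos he]; rfl
    · rw [if_neg he, if_neg he, neg_zero]
  refine h.trans ?_
  rw [h3, h4, h5, ← neg_add, h2, add_neg_cancel]

/-- The tropical curve with given positions of the vertices. -/
noncomputable def curve (q : V → ℤ × ℤ) (hq : ∀ m : MergeTree V, m.total q ≠ 0) (l r : MergeTree V)
    (pos : (node l r).Vertex → ℝ × ℝ)
    (hpos : ∀ x y, (node l r).up x = some y → ∃ t : ℝ, 0 < t ∧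
      pos y = pos x + (t * (((node l r).outVec q x).1 : ℝ), t * (((node l r).outVec q x).2 : ℝ))) :
    TropCurve where
  toTropType := tropType q l r
  isTree := graph_isTree l r
  dir_symm x y h := by
    rcases (graph_adj _ _ _).mp h with h | h
    · have h' := up_asymm h
      simp only [tropType]
      rw [if_pos h, if_neg h']
    · have h' := up_asymm h
      simp only [tropType]
      rw [if_pos h, if_neg h', neg_neg]
  dir_ne_zero x y h := by
    simp only [tropType]
    split_ifs
    · exact outVec_ne_zero hq _ _
    · exact neg_ne_zero.mpr (outVec_ne_zero hq _ _)
  endDir_ne_zero e := by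
    rcases e with _ | e
    · exact hq (node l r)
    · exact neg_ne_zero.mpr (hq (leaf _))
  trivalent x := by
    classical
    -- The argument used for balancing, with the constant value 1 in place of charges: two incoming
    -- edges or ends and one outgoing.
    have h := sum_edges_tropType q l r x (fun _ => 1) (fun _ => (1 : ℕ))
    have h2 := sum_inputs (fun _ => (1 : ℕ)) (node l r) x
    simp only [outVal_const] at h2
    rw [inVal_const (1 : ℕ) (node l r) x] at h2
    have h3 : (∑ y, if (node l r).up x = some y then 1 else 0) + (if topV l r = x then 1 else 0) = 1 := by
      rcases vertex_cases x with rfl | ⟨x, rfl⟩ | ⟨x, rfl⟩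
      · simp [up_topV]
      · simp [up_inlV, inlV_ne_topV.symm]
      · simp [up_inrV, inrV_ne_topV.symm]
    rw [h2, h3, Finset.sum_const, Finset.sum_const, smul_eq_mul, smul_eq_mul, mul_one, mul_one] at h
    have h4 := h.trans (c := 3) rfl
    convert h4
  balanced x := by
    convert tropType_balanced q l r x
  pos := pos
  pos_adj x y h := by
    rcases (graph_adj _ _ _).mp h with h | h
    · obtain ⟨t, ht, e⟩ := hpos x y h
      refine ⟨t, ht, ?_⟩
      simp only [tropType]
      rw [if_pos h, e]
    · obtain ⟨t, ht, e⟩ := hpos y x h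
      refine ⟨t, ht, ?_⟩
      have h' := up_asymm h
      simp only [tropType]
      rw [if_neg h', e]
      ext <;> simp

end MergeTree

end

/-! ### Degrees of the curves attached to a tree. -/

section

open MergeTree ChargeLattice

namespace MergeTree

variable {V : Type}

/-- The ends of a history enumerate its members with multiplicity; this yields the degree and,
later, the matching of ends with vertices. -/
theorem map_endMember (m : MergeTree V) :
    (Finset.univ : Finset m.End).val.map m.endMember = (m.members : Multiset V) := by
  induction m with
  | leaf v => rfl
  | node l r ihl ihr =>
    have h : (Finset.univ : Finset (node l r).End).val =
        (Finset.univ : Finset l.End).val.map inlE + (Finset.univ : Finset r.End).val.map inrE := rfl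
    rw [h, Multiset.map_add, Multiset.map_map, Multiset.map_map]
    exact congrArg₂ (· + ·) ihl ihr

theorem up_eq_none_outVal {A : Type} [AddCommMonoid A] (val : MergeTree V → A) {m : MergeTree V}
    {x : m.Vertex} (h : m.up x = none) : m.outVal val x = val m := by
  cases m with
  | leaf v => exact x.elim
  | node l r =>
    rcases vertex_cases x with rfl | ⟨x, rfl⟩ | ⟨x, rfl⟩
    · rfl
    · rw [up_inlV] at h; cases h
    · rw [up_inrV] at h; cases h

/-- Positions of the vertices for which every bounded edge has the length of its vector. -/
noncomputable def unitPos (q : V → ℤ × ℤ) : (m : MergeTree V) → m.Vertex → ℝ × ℝ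
  | leaf _, x => Empty.elim x
  | node _ _, none => 0
  | node l _, some (.inl x) => l.unitPos q x - (((l.total q).1 : ℝ), ((l.total q).2 : ℝ))
  | node _ r, some (.inr x) => r.unitPos q x - (((r.total q).1 : ℝ), ((r.total q).2 : ℝ))

theorem unitPos_eq_zero (q : V → ℤ × ℤ) {m : MergeTree V} {x : m.Vertex} (h : m.up x = none) :
    m.unitPos q x = 0 := by
  cases m with
  | leaf v => exact x.elim
  | node l r =>
    rcases vertex_cases x with rfl | ⟨x, rfl⟩ | ⟨x, rfl⟩
    · rfl
    · rw [up_inlV] at h; cases h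
    · rw [up_inrV] at h; cases h

theorem unitPos_up (q : V → ℤ × ℤ) {m : MergeTree V} {x y : m.Vertex} (h : m.up x = some y) :
    m.unitPos q y = m.unitPos q x + (((m.outVec q x).1 : ℝ), ((m.outVec q x).2 : ℝ)) := by
  induction m with
  | leaf v => exact x.elim
  | node l r ihl ihr =>
    rcases vertex_cases x with rfl | ⟨x, rfl⟩ | ⟨x, rfl⟩
    · rw [up_topV] at h; cases h
    · rw [up_inlV, Option.some_inj] at h
      rcases hx : l.up x with _ | y'
      · rw [hx] at h; subst h
        change (0 : ℝ × ℝ) = l.unitPos q x - (((l.total q).1 : ℝ), ((l.total q).2 : ℝ)) +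
          (((l.outVec q x).1 : ℝ), ((l.outVec q x).2 : ℝ))
        rw [unitPos_eq_zero q hx, outVec_eq_outVal, up_eq_none_outVal _ hx, sub_add_cancel]
      · rw [hx] at h; subst h
        change l.unitPos q y' - (((l.total q).1 : ℝ), ((l.total q).2 : ℝ)) = l.unitPos q x -
          (((l.total q).1 : ℝ), ((l.total q).2 : ℝ)) + (((l.outVec q x).1 : ℝ), ((l.outVec q x).2 : ℝ))
        rw [ihl hx]; abel
    · rw [up_inrV, Option.some_inj] at h
      rcases hx : r.up x with _ | y'
      · rw [hx] at h; subst h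
        change (0 : ℝ × ℝ) = r.unitPos q x - (((r.total q).1 : ℝ), ((r.total q).2 : ℝ)) +
          (((r.outVec q x).1 : ℝ), ((r.outVec q x).2 : ℝ))
        rw [unitPos_eq_zero q hx, outVec_eq_outVal, up_eq_none_outVal _ hx, sub_add_cancel]
      · rw [hx] at h; subst h
        change r.unitPos q y' - (((r.total q).1 : ℝ), ((r.total q).2 : ℝ)) = r.unitPos q x -
          (((r.total q).1 : ℝ), ((r.total q).2 : ℝ)) + (((r.outVec q x).1 : ℝ), ((r.outVec q x).2 : ℝ))
        rw [ihr hx]; abel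

theorem degree_curve (q : V → ℤ × ℤ) (hq : ∀ m : MergeTree V, m.total q ≠ 0) (l r : MergeTree V)
    (pos : (node l r).Vertex → ℝ × ℝ)
    (hpos : ∀ x y, (node l r).up x = some y → ∃ t : ℝ, 0 < t ∧
      pos y = pos x + (t * (((node l r).outVec q x).1 : ℝ), t * (((node l r).outVec q x).2 : ℝ))) :
    (curve q hq l r pos hpos).degree =
      (node l r).total q ::ₘ (((node l r).members : Multiset V).map fun v => -q v) := by
  have h : (curve q hq l r pos hpos).degree = (none ::ₘ (Finset.univ : Finset (node l r).End).val.map some).map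
      (tropType q l r).endDir := rfl
  refine h.trans ((Multiset.map_cons _ _ _).trans ?_)
  rw [← map_endMember, Multiset.map_map]
  exact congrArg _ (Multiset.map_map _ _ _)

end MergeTree

/-- Every combinatorial type is isomorphic to itself. -/
def TropType.Iso.refl (A : TropType) : A.Iso A where
  onV := Equiv.refl _
  onE := Equiv.refl _
  adj_iff _ _ := Iff.rfl
  att_eq _ := rfl
  dir_eq _ _ _ := rfl
  endDir_eq _ := rfl

namespace DecoratedTree

variable {l₁ l₂ : ℕ} {V : Type} [Fintype V] [DecidableEq V] {T : DecoratedTree l₁ l₂ V}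

/-- Moving a ray does not change the set of original vertices. -/
theorem push_members {cw : Bool} {A : MergeTree V} {L : List (MergeTree V)} {σ : ℤˣ} :
    ∀ u ∈ T.push cw A [] L σ, (u.1.flatMap members).Perm (A.members ++ L.flatMap members) := by
  intro u hu
  obtain ⟨A', p', r', i, e, -⟩ := push_induction
    (Inv := fun B passed rest => ∀ x, B.members.count x + (passed.flatMap members).count x +
      (rest.flatMap members).count x = (A.members ++ L.flatMap members).count x)
    (by
      intro B passed h rest i _ x
      rw [← i x]
      simp only [List.flatMap_append, List.flatMap_cons, List.flatMap_nil, List.append_nil,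
        List.count_append]
      omega)
    (by
      intro B passed h rest i _ _ x
      rw [← i x]
      simp only [members, List.flatMap_cons, List.count_append]
      omega)
    (h0 := fun x => by simp [List.count_append]) u hu
  rw [List.perm_iff_count]
  intro x
  rw [← i x, e]
  simp only [List.flatMap_append, List.flatMap_cons, List.count_append]
  omega

theorem moveVertex_members {v : V} {L : List (MergeTree V)} {σ : ℤˣ} :
    ∀ u ∈ T.moveVertex v (L, σ), (u.1.flatMap members).Perm (v :: L.flatMap members) := by
  intro u hu
  unfold moveVertex at hu
  split_ifs at hu with hv
  · exact push_members u hu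
  · obtain ⟨q, hq, rfl⟩ := List.mem_map.mp hu
    exact ((List.reverse_perm _).flatMap_right _).trans ((push_members q hq).trans
      (List.Perm.cons _ ((List.reverse_perm _).flatMap_right _)))

/-- The original vertices contracted in a term. -/
theorem residueTerms_members (ν : Fin (Fintype.card V) ≃ V) :
    ∀ u ∈ T.residueTerms ν, (u.1.flatMap members).Perm (List.ofFn ν) := by
  intro u hu
  have := residueTerms_induction (T := T) (ν := ν)
    (Inv := fun vs L => (L.flatMap members ++ vs).Perm (List.ofFn ν))
    (fun v vs L σ h u hu => ((moveVertex_members u hu).append_right vs).trans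
      (List.perm_middle.symm.trans h)) (by simp) u hu
  simpa using this

theorem map_ofFn_labelling {A : Type} (ν : Fin (Fintype.card V) ≃ V) (f : V → A) :
    (List.ofFn ν : Multiset V).map f = Finset.univ.val.map f := by
  congr 1
  refine (Multiset.Nodup.ext ?_ Finset.univ.nodup).mpr fun v => ?_
  · exact List.nodup_ofFn.mpr ν.injective
  · simpa [List.mem_ofFn] using ν.surjective v

theorem residueTerms_single_map {A : Type} {ν : Fin (Fintype.card V) ≃ V} {m : MergeTree V} {σ : ℤˣ}
    (h : ([m], σ) ∈ T.residueTerms ν) (f : V → A) :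
    (m.members : Multiset V).map f = Finset.univ.val.map f := by
  rw [← map_ofFn_labelling ν f]
  have := residueTerms_members ν _ h
  simp only [List.flatMap_cons, List.flatMap_nil, List.append_nil] at this
  rw [Multiset.coe_eq_coe.mpr this]

theorem IsPositive.total_proj_ne_zero (hT : T.IsPositive) (m : MergeTree V) :
    (m.total fun v => (T.charge v).proj) ≠ 0 := by
  rw [← DecoratedTree.proj_total]
  intro h
  have := (hT.proj_total m).2.2
  rw [h] at this
  simp at this

theorem mem_signedTypes {ν : Fin (Fintype.card V) ≃ V} {t : TropType × ℤˣ} :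
    t ∈ T.signedTypes ν ↔ ∃ l r, ([node l r], t.2) ∈ T.residueTerms ν ∧
      tropType (fun v => (T.charge v).proj) l r = t.1 := by
  unfold signedTypes
  rw [List.mem_filterMap]
  constructor
  · rintro ⟨⟨L, σ⟩, hu, h⟩
    split at h
    · rename_i l r heq
      cases h
      simp only at heq
      subst heq
      exact ⟨l, r, hu, rfl⟩
    · cases h
  · rintro ⟨l, r, hu, h⟩
    exact ⟨_, hu, congrArg (fun s => some (s, t.2)) h⟩

theorem total_proj_eq_reducedCharge {ν : Fin (Fintype.card V) ≃ V} {m : MergeTree V} {σ : ℤˣ}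
    (h : ([m], σ) ∈ T.residueTerms ν) :
    (m.total fun v => (T.charge v).proj) = T.reducedCharge := by
  rw [← DecoratedTree.proj_total, reducedCharge, totalCharge, MergeTree.total_eq_sum, ← Multiset.sum_coe,
    ← Multiset.map_coe, residueTerms_single_map h]
  rfl

/-- Every type is the type of a tropical curve of the degree of the tree. -/
theorem IsPositive.exists_curve (hT : T.IsPositive) (ν : Fin (Fintype.card V) ≃ V) :
    ∀ t ∈ T.signedTypes ν, ∃ Υ : TropCurve, Υ.HasType t.1 ∧
      Υ.degree = T.reducedCharge ::ₘ T.degree.map (fun a => -a) := by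
  intro t ht
  obtain ⟨l, r, hu, e⟩ := mem_signedTypes.mp ht
  refine ⟨curve (fun v => (T.charge v).proj) hT.total_proj_ne_zero l r (unitPos _ _)
    fun x y h => ⟨1, one_pos, by simpa using unitPos_up _ h⟩, ⟨?_⟩, ?_⟩
  · rw [← e]
    exact TropType.Iso.refl _
  · rw [degree_curve, total_proj_eq_reducedCharge hu, residueTerms_single_map hu, degree, Multiset.map_map]
    rfl

end DecoratedTree

end

/-! ### Oriented lines in the plane and realizable histories. -/

section

open MergeTree ChargeLattice

/-- A family of oriented lines in the plane: the line of `v` has direction `(dx v, dy v)`, and `pos v` is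
its constant coordinate, for a horizontal or vertical line. -/
structure Lines (V : Type) where
  dx : V → ℝ
  dy : V → ℝ
  pos : V → ℝ

namespace Lines

variable {V : Type} (F : Lines V)

/-- The lines are horizontal, directed to the right, or vertical, directed upwards. -/
def IsAxial : Prop := ∀ v, (F.dx v = 0 ∧ 0 < F.dy v) ∨ (0 < F.dx v ∧ F.dy v = 0)

/-- The sum of the coordinates of the direction. -/
def size (m : MergeTree V) : ℝ := m.total F.dx + m.total F.dy

/-- The area spanned by two directions. -/
def area (A B : MergeTree V) : ℝ := A.total F.dx * B.total F.dy - A.total F.dy * B.total F.dx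

/-- The value of `y dx - x dy` on the line of a contracted vertex. -/
def moment (m : MergeTree V) : ℝ := m.total fun v => (F.dx v - F.dy v) * F.pos v

/-- The point where the lines of two contracted vertices meet. -/
noncomputable def crossing : MergeTree V → ℝ × ℝ
  | leaf _ => 0
  | node A B => ((F.moment A * B.total F.dx - F.moment B * A.total F.dx) / F.area A B,
      (F.moment A * B.total F.dy - F.moment B * A.total F.dy) / F.area A B)

/-- The sum of the coordinates of the crossing point. -/
noncomputable def level (m : MergeTree V) : ℝ := (F.crossing m).1 + (F.crossing m).2

/-- The contractions take place at points further and further along the lines. -/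
def Realizable : MergeTree V → Prop
  | leaf _ => True
  | node A B => Realizable A ∧ Realizable B ∧ F.area A B ≠ 0 ∧
      (∀ C D, A = node C D → F.level A < F.level (node A B)) ∧
      ∀ C D, B = node C D → F.level B < F.level (node A B)

theorem realizable_leaf (v : V) : F.Realizable (leaf v) := trivial

theorem size_node (A B : MergeTree V) : F.size (node A B) = F.size A + F.size B := by
  simp only [size, total]; ring

theorem moment_node (A B : MergeTree V) : F.moment (node A B) = F.moment A + F.moment B := rfl

theorem area_node_left (A B C : MergeTree V) : F.area (node A B) C = F.area A C + F.area B C := by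
  simp only [area, total]; ring

theorem area_node_right (A B C : MergeTree V) : F.area C (node A B) = F.area C A + F.area C B := by
  simp only [area, total]; ring

theorem area_swap (A B : MergeTree V) : F.area A B = -F.area B A := by
  simp only [area]; ring

theorem area_self (A : MergeTree V) : F.area A A = 0 := by
  simp only [area]; ring

theorem size_mul_area (A B C : MergeTree V) :
    F.size A * F.area B C + F.size B * F.area C A + F.size C * F.area A B = 0 := by
  simp only [area, size]; ring

theorem level_node (A B : MergeTree V) :
    F.level (node A B) = (F.moment A * F.size B - F.moment B * F.size A) / F.area A B := by
  simp only [level, crossing, size, ← add_div]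
  ring

variable {F}

theorem IsAxial.size_pos (hF : F.IsAxial) (m : MergeTree V) : 0 < F.size m := by
  induction m with
  | leaf v => rcases hF v with ⟨h1, h2⟩ | ⟨h1, h2⟩ <;> simp [size, total, h1, h2]
  | node l r ihl ihr => rw [size_node]; positivity

theorem crossing_mem_left {A B : MergeTree V} (h : F.area A B ≠ 0) :
    (F.crossing (node A B)).2 * A.total F.dx - (F.crossing (node A B)).1 * A.total F.dy = F.moment A := by
  simp only [crossing]
  field_simp
  simp only [area]; ring

theorem crossing_mem_right {A B : MergeTree V} (h : F.area A B ≠ 0) :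
    (F.crossing (node A B)).2 * B.total F.dx - (F.crossing (node A B)).1 * B.total F.dy = F.moment B := by
  simp only [crossing]
  field_simp
  simp only [area]; ring

/-- Moments add under contraction just as directions do, so the line with the summed data passes
through the crossing point: this is the line of the outgoing edge. -/
theorem Realizable.crossing_mem {A B : MergeTree V} (h : F.Realizable (node A B)) :
    (F.crossing (node A B)).2 * (node A B).total F.dx - (F.crossing (node A B)).1 * (node A B).total F.dy =
      F.moment (node A B) := by
  rw [moment_node, ← crossing_mem_left h.2.2.1, ← crossing_mem_right h.2.2.1]
  simp only [total]; ring

/-- All directions have positive coordinate sum, so on each line x + y is an increasing parameter; a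
comparison of levels decides the orientation of an edge. -/
theorem IsAxial.exists_forward (hF : F.IsAxial) (m : MergeTree V) {P P' : ℝ × ℝ}
    (h : P.2 * m.total F.dx - P.1 * m.total F.dy = F.moment m)
    (h' : P'.2 * m.total F.dx - P'.1 * m.total F.dy = F.moment m) (hlt : P.1 + P.2 < P'.1 + P'.2) :
    ∃ t : ℝ, 0 < t ∧ P' = P + (t * m.total F.dx, t * m.total F.dy) := by
  have hs := hF.size_pos m
  refine ⟨(P'.1 + P'.2 - (P.1 + P.2)) / F.size m, div_pos (by linarith) hs, ?_⟩
  ext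
  · simp only [Prod.fst_add]
    field_simp
    simp only [size]
    linear_combination h - h'
  · simp only [Prod.snd_add]
    field_simp
    simp only [size]
    linear_combination h' - h

/-- Placing each vertex at the crossing point of its two incoming lines gives bounded edges of
positive length, by the inequalities between levels in `Realizable`. -/
theorem IsAxial.forward_of_up (hF : F.IsAxial) {m : MergeTree V} (hm : F.Realizable m) {x y : m.Vertex}
    (h : m.up x = some y) : ∃ t : ℝ, 0 < t ∧ m.outVal F.crossing y = m.outVal F.crossing x +
      (t * m.outVal (total F.dx) x, t * m.outVal (total F.dy) x) := by
  induction m with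
  | leaf v => exact x.elim
  | node l r ihl ihr =>
    obtain ⟨h1, h2, h3, h4, h5⟩ := hm
    rcases vertex_cases x with rfl | ⟨x, rfl⟩ | ⟨x, rfl⟩
    · rw [up_topV] at h; cases h
    · rw [up_inlV, Option.some_inj] at h
      rcases hx : l.up x with _ | y'
      · rw [hx] at h; subst h
        change ∃ t : ℝ, 0 < t ∧ F.crossing (node l r) = l.outVal F.crossing x +
          (t * l.outVal (total F.dx) x, t * l.outVal (total F.dy) x)
        simp only [up_eq_none_outVal _ hx]
        cases l with
        | leaf v => exact x.elim
        | node C D => exact hF.exists_forward _ h1.crossing_mem (crossing_mem_left h3) (h4 C D rfl)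
      · rw [hx] at h; subst h
        exact ihl h1 hx
    · rw [up_inrV, Option.some_inj] at h
      rcases hx : r.up x with _ | y'
      · rw [hx] at h; subst h
        change ∃ t : ℝ, 0 < t ∧ F.crossing (node l r) = r.outVal F.crossing x +
          (t * r.outVal (total F.dx) x, t * r.outVal (total F.dy) x)
        simp only [up_eq_none_outVal _ hx]
        cases r with
        | leaf v => exact x.elim
        | node C D => exact hF.exists_forward _ h2.crossing_mem (crossing_mem_right h3) (h5 C D rfl)
      · rw [hx] at h; subst h
        exact ihr h2 hx

theorem IsAxial.leaf_line (hF : F.IsAxial) {v : V} {P : ℝ × ℝ}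
    (h : P.2 * (leaf v).total F.dx - P.1 * (leaf v).total F.dy = F.moment (leaf v)) :
    (F.dx v = 0 → P.1 = F.pos v) ∧ (F.dy v = 0 → P.2 = F.pos v) := by
  simp only [total, moment] at h
  rcases hF v with ⟨h1, h2⟩ | ⟨h1, h2⟩
  · refine ⟨fun _ => ?_, fun h3 => absurd h3 h2.ne'⟩
    rw [h1] at h
    exact mul_right_cancel₀ h2.ne' (by linarith)
  · refine ⟨fun h3 => absurd h3 h1.ne', fun _ => ?_⟩
    rw [h2] at h
    exact mul_right_cancel₀ h1.ne' (by linarith)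

theorem IsAxial.endVertex_line (hF : F.IsAxial) {m : MergeTree V} (hm : F.Realizable m) {e : m.End}
    {y : m.Vertex} (h : m.endVertex e = some y) :
    (F.dx (m.endMember e) = 0 → (m.outVal F.crossing y).1 = F.pos (m.endMember e)) ∧
      (F.dy (m.endMember e) = 0 → (m.outVal F.crossing y).2 = F.pos (m.endMember e)) := by
  induction m with
  | leaf v => exact y.elim
  | node l r ihl ihr =>
    obtain ⟨h1, h2, h3, -⟩ := hm
    rcases end_cases e with ⟨e, rfl⟩ | ⟨e, rfl⟩
    · rw [endVertex_inlE, Option.some_inj] at h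
      rcases he : l.endVertex e with _ | y'
      · rw [he] at h; subst h
        cases l with
        | leaf v => exact hF.leaf_line (crossing_mem_left h3)
        | node C D => rw [endVertex_node] at he; cases he
      · rw [he] at h; subst h
        exact ihl h1 he
    · rw [endVertex_inrE, Option.some_inj] at h
      rcases he : r.endVertex e with _ | y'
      · rw [he] at h; subst h
        cases r with
        | leaf v => exact hF.leaf_line (crossing_mem_right h3)
        | node C D => rw [endVertex_node] at he; cases he
      · rw [he] at h; subst h
        exact ihr h2 he

variable (F)

/-- Far away in the direction from which rays arrive, the ray of `A` is met before the ray of `B`. -/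
def Before (o : ℝ) (A B : MergeTree V) : Prop :=
  0 < o * F.area A B ∨ (F.area A B = 0 ∧ 0 < o * (F.moment B * F.size A - F.moment A * F.size B))

/-- The line of `A` is far away, compared to the lines of `B` and `C`. -/
def Dominates (o : ℝ) (A B C : MergeTree V) : Prop :=
  F.level B * (o * F.area B A) < -(o * F.moment A) * F.size B + o * F.moment B * F.size A ∧
  (0 < o * F.area C B → 0 < -(o * F.moment A) * (o * F.area C B) + o * F.moment B * (o * F.area C A) -
    o * F.moment C * (o * F.area B A)) ∧
  o * F.moment A * F.size B < o * F.moment B * F.size A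

variable {F}

theorem Before.nonneg {o : ℝ} {A B : MergeTree V} (h : F.Before o A B) : 0 ≤ o * F.area A B := by
  rcases h with h | h
  · exact h.le
  · rw [h.1, mul_zero]

theorem IsAxial.area_trans (hF : F.IsAxial) {o : ℝ} {A B C : MergeTree V} (h1 : 0 ≤ o * F.area A B)
    (h2 : 0 ≤ o * F.area B C) : 0 ≤ o * F.area A C := by
  have hA := hF.size_pos A
  have hB := hF.size_pos B
  have hC := hF.size_pos C
  have h := F.size_mul_area A B C
  rw [F.area_swap C A] at h
  have key : (o * F.area A C) * F.size B = F.size A * (o * F.area B C) + F.size C * (o * F.area A B) := by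
    linear_combination -o * h
  have : 0 ≤ (o * F.area A C) * F.size B := by rw [key]; positivity
  exact nonneg_of_mul_nonneg_left this hB

theorem level_node_of_orient {o : ℝ} (ho : o * o = 1) (A B : MergeTree V) :
    F.level (node A B) = (-(o * F.moment A) * F.size B + o * F.moment B * F.size A) / (o * F.area B A) := by
  have ho' : o ≠ 0 := by rintro rfl; simp at ho
  rw [level_node, F.area_swap A B]
  rw [show -(o * F.moment A) * F.size B + o * F.moment B * F.size A =
    o * (F.moment B * F.size A - F.moment A * F.size B) by ring, mul_div_mul_left _ _ ho', div_neg, ← neg_div,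
    neg_sub]

theorem Dominates.level_lt {o : ℝ} (ho : o * o = 1) {A B C : MergeTree V} (h : F.Dominates o A B C)
    (hBA : 0 < o * F.area B A) : F.level B < F.level (node A B) := by
  rw [level_node_of_orient ho, lt_div_iff₀ hBA]
  exact h.1

/-- The edge leaving the contraction of `A` and `C` has to meet the next line `B` further on. The
difference of the two levels is a positive multiple of a determinant of the three lines. It is
positive by domination if `C` and `B` are not parallel, and by the order of their moments if they
are. -/
theorem Dominates.level_merge_lt {o : ℝ} (ho : o * o = 1) (hF : F.IsAxial) {A B C : MergeTree V}
    (h : F.Dominates o (node A C) B C) (hCB : F.Before o C B) (hCA : 0 < o * F.area C A)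
    (hBA : 0 < o * F.area B (node A C)) : F.level (node A C) < F.level (node (node A C) B) := by
  -- The line of the contraction meets `C` at the point where `A` does. Both crossings therefore lie
  -- on one line `A'`, and `A` itself disappears from the computation.
  have e : F.level (node A C) = F.level (node (node A C) C) := by
    rw [level_node, level_node, moment_node, size_node, area_node_left, area_self]
    congr 1 <;> ring
  have hCA' : 0 < o * F.area C (node A C) := by
    rw [area_node_right, area_self, add_zero]; exact hCA
  set A' := node A C with hA'
  rw [e, level_node_of_orient ho, level_node_of_orient ho, div_lt_div_iff₀ hCA' hBA]
  have hA := hF.size_pos A'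
  have hB := hF.size_pos B
  have hC := hF.size_pos C
  have hp := F.size_mul_area C B A'
  rw [F.area_swap A' C] at hp
  set br := -(o * F.moment A') * (o * F.area C B) + o * F.moment B * (o * F.area C A') -
    o * F.moment C * (o * F.area B A') with hbr
  have hpos : 0 < br := by
    rcases hCB with h1 | ⟨h1, h2⟩
    · exact h.2.1 h1
    · rw [h1] at hp
      have : br * F.size B = (o * F.area B A') * (o * (F.moment B * F.size C - F.moment C * F.size B)) := by
        rw [hbr, h1]
        linear_combination (-o * o * F.moment B) * hp
      have h3 : 0 < br * F.size B := by rw [this]; positivity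
      exact (mul_pos_iff_of_pos_right hB).mp h3
  have key : (-(o * F.moment A') * F.size B + o * F.moment B * F.size A') * (o * F.area C A') -
      (-(o * F.moment A') * F.size C + o * F.moment C * F.size A') * (o * F.area B A') = F.size A' * br := by
    rw [hbr]
    linear_combination (o * o * F.moment A') * hp
  have := mul_pos hA hpos
  linarith

end Lines

namespace DecoratedTree

variable {l₁ l₂ : ℕ} {V : Type} [Fintype V] [DecidableEq V] {T : DecoratedTree l₁ l₂ V}

/-- Moving the ray of a vertex whose line is far away leads to realizable contractions. -/
theorem push_realizable {F : Lines V} (hF : F.IsAxial)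
    (hx : ∀ v, F.dx v = ((T.charge v).proj.1 : ℝ)) (hy : ∀ v, F.dy v = ((T.charge v).proj.2 : ℝ))
    {cw : Bool} {k : V} {L : List (MergeTree V)} {σ : ℤˣ} (hL : L.Pairwise (F.Before (orient cw)))
    (hR : ∀ m ∈ L, F.Realizable m) (hnd : (k :: L.flatMap members).Nodup)
    (hdom : ∀ A B C : MergeTree V, A.members ⊆ k :: L.flatMap members → B.members ⊆ L.flatMap members →
      C.members ⊆ L.flatMap members → A.members.Nodup → B.members.Nodup → C.members.Nodup →
      k ∈ A.members → F.Dominates (orient cw) A B C) :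
    ∀ u ∈ T.push cw (leaf k) [] L σ, u.1.Pairwise (F.Before (orient cw)) ∧ ∀ m ∈ u.1, F.Realizable m := by
  intro u hu
  set o : ℝ := ((orient cw : ℤ) : ℝ) with ho
  have hoo : o * o = 1 := by rw [ho]; cases cw <;> simp [orient]
  have hdet : ∀ A B, ((T.det A B : ℤ) : ℝ) = F.area A B := by
    intro A B
    have h : ∀ m : MergeTree V, (((m.total T.charge).proj.1 : ℤ) : ℝ) = m.total F.dx ∧
        (((m.total T.charge).proj.2 : ℤ) : ℝ) = m.total F.dy := by
      intro m
      induction m with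
      | leaf v => exact ⟨(hx v).symm, (hy v).symm⟩
      | node l r ihl ihr =>
        simp only [total, proj_add, Prod.fst_add, Prod.snd_add]
        push_cast
        exact ⟨by rw [ihl.1, ihr.1], by rw [ihl.2, ihr.2]⟩
    simp only [det, Lines.area]
    push_cast
    rw [(h A).1, (h A).2, (h B).1, (h B).2]
  have hdet' : ∀ {A B}, 0 < orient cw * T.det A B → 0 < o * F.area A B := by
    intro A B h
    rw [← hdet, ho]
    exact_mod_cast h
  -- The last clause of the invariant is the essential one: a contracted moving vertex meets every
  -- line still ahead further along than its own starting point. It is void for the original vertex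
  -- `k`, and `level_merge_lt` restores it after each contraction.
  obtain ⟨A', p', r', ⟨i1, i2, i3, i4, i5, i6⟩, e, hh⟩ := push_induction
    (Inv := fun A passed rest =>
      (A.members ++ passed.flatMap members ++ rest.flatMap members).Perm (k :: L.flatMap members) ∧
      k ∈ A.members ∧ (passed ++ rest).Pairwise (F.Before o) ∧ (∀ p ∈ passed, 0 < o * F.area p A) ∧
      (F.Realizable A ∧ ∀ m ∈ passed ++ rest, F.Realizable m) ∧
      ∀ h ∈ rest, 0 < o * F.area h A → ∀ C D, A = node C D → F.level A < F.level (node A h))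
    (by
      rintro A passed h rest ⟨i1, i2, i3, i4, i5, i6⟩ hd
      refine ⟨by simpa using i1, i2, by simpa using i3, fun p hp => ?_, by simpa using i5,
        fun h' hh' => i6 h' (List.mem_cons_of_mem _ hh')⟩
      rcases List.mem_append.mp hp with hp | hp
      · exact i4 p hp
      · rw [List.mem_singleton.mp hp]
        exact hdet' hd)
    (by
      rintro A passed h rest ⟨i1, i2, i3, i4, ⟨i5, i5'⟩, i6⟩ hd -
      have hd' := hdet' hd
      have hmem : ∀ m ∈ h :: rest, m.members ⊆ L.flatMap members ∧ m.members.Nodup := by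
        intro m hm
        have h1 := i1.nodup_iff.mpr hnd
        rw [List.nodup_append] at h1
        have h2 : m.members ⊆ (h :: rest).flatMap members := fun x hx => List.mem_flatMap.mpr ⟨m, hm, hx⟩
        refine ⟨fun x hx => ?_, ?_⟩
        · have h3 := i1.mem_iff.mp (List.mem_append_right _ (h2 hx))
          rcases List.mem_cons.mp h3 with rfl | h3
          · exact absurd rfl (h1.2.2 x (List.mem_append_left _ i2) x (h2 hx))
          · exact h3
        · exact (List.nodup_flatMap.mp h1.2.1).1 m hm
      have hA' : (node A h).members ⊆ k :: L.flatMap members ∧ (node A h).members.Nodup := by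
        have h2 : (node A h).members.Sublist (A.members ++ passed.flatMap members ++ (h :: rest).flatMap members) := by
          simp only [members, List.flatMap_cons]
          exact List.Sublist.append (List.sublist_append_left _ _) (List.sublist_append_left _ _)
        exact ⟨fun x hx => i1.mem_iff.mp (h2.subset hx), h2.nodup (i1.nodup_iff.mpr hnd)⟩
      have hA : A.members ⊆ k :: L.flatMap members ∧ A.members.Nodup :=
        ⟨fun x hx => hA'.1 (List.mem_append_left _ hx), (List.nodup_append.mp hA'.2).1⟩
      have i3' := List.pairwise_append.mp i3
      obtain ⟨hb1, hb2⟩ := hmem h List.mem_cons_self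
      refine ⟨?_, List.mem_append_left _ i2, ?_, fun p hp => ?_, ⟨⟨i5, i5' h (by simp), ?_, ?_, ?_⟩, ?_⟩, ?_⟩
      · refine List.Perm.trans ?_ i1
        rw [List.perm_iff_count]
        intro x
        simp only [members, List.flatMap_cons, List.count_append]
        omega
      · exact List.pairwise_append.mpr ⟨i3'.1, (List.pairwise_cons.mp i3'.2.1).2,
          fun a ha b hb => i3'.2.2 a ha b (List.mem_cons_of_mem _ hb)⟩
      · rw [F.area_node_right, mul_add]
        exact add_pos_of_pos_of_nonneg (i4 p hp) (i3'.2.2 p hp h List.mem_cons_self).nonneg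
      · intro h0
        rw [F.area_swap] at h0
        rw [neg_eq_zero.mp h0, mul_zero] at hd'
        exact lt_irrefl _ hd'
      · exact i6 h List.mem_cons_self hd'
      · exact fun _ _ _ => (hdom A h h hA.1 hb1 hb1 hA.2 hb2 hb2 i2).level_lt hoo hd'
      · intro m hm
        refine i5' m ?_
        rcases List.mem_append.mp hm with hm | hm
        · exact List.mem_append_left _ hm
        · exact List.mem_append_right _ (List.mem_cons_of_mem _ hm)
      · intro h' hh' hpos C D _
        obtain ⟨hc1, hc2⟩ := hmem h' (List.mem_cons_of_mem _ hh')
        exact (hdom (node A h) h' h hA'.1 hc1 hb1 hA'.2 hc2 hb2 (List.mem_append_left _ i2)).level_merge_lt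
          hoo hF ((List.pairwise_cons.mp i3'.2.1).1 h' hh') hd' hpos)
    (h0 := ⟨by simp [members], by simp [members], by simpa using hL, by simp, ⟨F.realizable_leaf k, by simpa using hR⟩,
      fun _ _ _ _ _ h => by cases h⟩) u hu
  rw [e]
  have hd : ∀ b ∈ r', 0 ≤ o * F.area A' b := by
    rw [List.pairwise_append] at i3
    rcases r' with _ | ⟨h, r⟩
    · simp
    · have h1 : 0 ≤ o * F.area A' h := by
        have := hh h (by simp)
        rw [F.area_swap, ← hdet, ho, mul_neg, neg_nonneg]
        exact_mod_cast this
      intro b hb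
      rcases List.mem_cons.mp hb with rfl | hb
      · exact h1
      · exact hF.area_trans h1 ((List.pairwise_cons.mp i3.2.1).1 b hb).nonneg
  have hnd' := i1.nodup_iff.mpr hnd
  have hbef : ∀ b ∈ r', F.Before o A' b := by
    intro b hb
    rcases (hd b hb).lt_or_eq with h | h
    · exact Or.inl h
    · refine Or.inr ⟨?_, ?_⟩
      · have ho0 : o ≠ 0 := by intro h0; rw [h0] at hoo; simp at hoo
        exact (mul_eq_zero.mp h.symm).resolve_left ho0
      · rw [List.nodup_append] at hnd'
        have hb' : b.members ⊆ r'.flatMap members := fun x hx => List.mem_flatMap.mpr ⟨b, hb, hx⟩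
        have hb1 : b.members ⊆ L.flatMap members := fun x hx => by
          have h3 := i1.mem_iff.mp (List.mem_append_right _ (hb' hx))
          rcases List.mem_cons.mp h3 with rfl | h3
          · exact absurd rfl (hnd'.2.2 x (List.mem_append_left _ i2) x (hb' hx))
          · exact h3
        have hb2 := (List.nodup_flatMap.mp hnd'.2.1).1 b hb
        have := (hdom A' b b (fun x hx => i1.mem_iff.mp (List.mem_append_left _ (List.mem_append_left _ hx)))
          hb1 hb1 (List.nodup_append.mp hnd'.1).1 hb2 hb2 i2).2.2
        linarith
  rw [List.pairwise_append] at i3 ⊢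
  refine ⟨⟨i3.1, List.pairwise_cons.mpr ⟨hbef, i3.2.1⟩, fun a ha b hb => ?_⟩, fun m hm => ?_⟩
  · rcases List.mem_cons.mp hb with rfl | hb
    · exact Or.inl (i4 a ha)
    · exact i3.2.2 a ha b hb
  · rcases List.mem_append.mp hm with hm | hm
    · exact i5.2 m (List.mem_append_left _ hm)
    · rcases List.mem_cons.mp hm with rfl | hm
      · exact i5.1
      · exact i5.2 m (List.mem_append_right _ hm)

end DecoratedTree

end

/-! ### Positions of lines in which each one dominates its predecessors. -/

section

open MergeTree ChargeLattice Filter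

namespace MergeTree

variable {V W : Type}

/-- Renaming the original vertices. -/
def map (e : V → W) : MergeTree V → MergeTree W
  | leaf v => leaf (e v)
  | node l r => node (l.map e) (r.map e)

theorem members_map (e : V → W) (m : MergeTree V) : (m.map e).members = m.members.map e := by
  induction m with
  | leaf v => rfl
  | node l r ihl ihr => simp only [map, members, ihl, ihr, List.map_append]

theorem total_map {A : Type} [Add A] (e : V → W) (f : W → A) (m : MergeTree V) :
    (m.map e).total f = m.total fun v => f (e v) := by
  induction m with
  | leaf v => rfl
  | node l r ihl ihr => simp only [map, total, ihl, ihr]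

theorem one_le_length_members (m : MergeTree V) : 1 ≤ m.members.length := by
  induction m with
  | leaf v => simp [members]
  | node l r ihl ihr => simp only [members, List.length_append]; omega

theorem finite_setOf_length_le (K N : ℕ) :
    {m : MergeTree ℕ | m.members.length ≤ N ∧ ∀ i ∈ m.members, i < K}.Finite := by
  induction N with
  | zero =>
    refine Set.finite_empty.subset fun m hm => ?_
    have := m.one_le_length_members
    have := hm.1
    omega
  | succ N ih =>
    refine (((Set.finite_Iio K).image leaf).union (ih.image2 node ih)).subset fun m hm => ?_
    obtain ⟨h1, h2⟩ := hm
    cases m with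
    | leaf i => exact Or.inl ⟨i, h2 i (by simp [members]), rfl⟩
    | node l r =>
      simp only [members, List.length_append, List.mem_append] at h1 h2
      have hl := l.one_le_length_members
      have hr := r.one_le_length_members
      exact Or.inr ⟨l, ⟨by omega, fun i hi => h2 i (Or.inl hi)⟩, r, ⟨by omega, fun i hi => h2 i (Or.inr hi)⟩,
        rfl⟩

theorem finite_setOf_nodup (K : ℕ) :
    {m : MergeTree ℕ | m.members.Nodup ∧ ∀ i ∈ m.members, i < K}.Finite := by
  refine (finite_setOf_length_le K K).subset fun m hm => ⟨?_, hm.2⟩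
  rw [← List.toFinset_card_of_nodup hm.1]
  refine (Finset.card_le_card (t := Finset.range K) fun i hi => ?_).trans_eq (Finset.card_range K)
  exact Finset.mem_range.mpr (hm.2 i (List.mem_toFinset.mp hi))

end MergeTree

namespace Lines

variable {V W : Type}

/-- Renaming the lines. -/
def comap (F : Lines W) (e : V → W) : Lines V where
  dx v := F.dx (e v)
  dy v := F.dy (e v)
  pos v := F.pos (e v)

theorem crossing_comap (F : Lines W) (e : V → W) (m : MergeTree V) :
    (F.comap e).crossing m = F.crossing (m.map e) := by
  cases m with
  | leaf v => rfl
  | node l r => simp only [crossing, MergeTree.map, area, moment, total_map]; rfl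

theorem dominates_comap (F : Lines W) (e : V → W) (o : ℝ) (A B C : MergeTree V) :
    (F.comap e).Dominates o A B C ↔ F.Dominates o (A.map e) (B.map e) (C.map e) := by
  simp only [Dominates, level, crossing_comap, area, size, moment, total_map]
  rfl

/-- The same lines in other positions. -/
def withPos (F : Lines V) (p : V → ℝ) : Lines V := { F with pos := p }

variable {F : Lines V} {p p' : V → ℝ}

theorem moment_congr {m : MergeTree V} (h : ∀ v ∈ m.members, p v = p' v) :
    (F.withPos p).moment m = (F.withPos p').moment m := by
  simp only [moment, MergeTree.total_eq_sum]
  refine congrArg List.sum (List.map_congr_left fun v hv => ?_)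
  simp only [withPos, h v hv]

theorem level_congr {m : MergeTree V} (h : ∀ v ∈ m.members, p v = p' v) :
    (F.withPos p).level m = (F.withPos p').level m := by
  cases m with
  | leaf v => rfl
  | node l r =>
    rw [level_node, level_node, moment_congr (m := l) fun v hv => h v (List.mem_append_left _ hv),
      moment_congr (m := r) fun v hv => h v (List.mem_append_right _ hv)]
    rfl

theorem Dominates.congr {o : ℝ} {A B C : MergeTree V} (h : (F.withPos p).Dominates o A B C)
    (hA : ∀ v ∈ A.members, p v = p' v) (hB : ∀ v ∈ B.members, p v = p' v)
    (hC : ∀ v ∈ C.members, p v = p' v) : (F.withPos p').Dominates o A B C := by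
  unfold Dominates at h ⊢
  rwa [← moment_congr hA, ← moment_congr hB, ← moment_congr hC, ← level_congr hB]

variable (F) in
/-- The side from which the ray of `v` arrives. -/
noncomputable def side (v : V) : ℝ := if F.dx v = 0 then 1 else -1

/-- The moment is affine in the position of the line `k`. With the sign given by the side of
arrival, the slope is positive exactly when needed: moving `k` to +∞ moves every history containing
it away. -/
theorem exists_moment_eq [DecidableEq V] (hF : F.IsAxial) (k : V) (m : MergeTree V) :
    ∃ c₀ c₁ : ℝ, 0 ≤ c₁ ∧ (k ∈ m.members → 0 < c₁) ∧
      ∀ x, -(F.side k * (F.withPos (Function.update p k x)).moment m) = c₀ + c₁ * x := by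
  induction m with
  | leaf v =>
    by_cases hv : v = k
    · subst hv
      refine ⟨0, F.dx v + F.dy v, ?_, fun _ => ?_, fun x => ?_⟩
      · rcases hF v with ⟨h1, h2⟩ | ⟨h1, h2⟩ <;> simp [h1, h2, h1.le, h2.le]
      · rcases hF v with ⟨h1, h2⟩ | ⟨h1, h2⟩ <;> simp [h1, h2]
      · simp only [moment, total, withPos, Function.update_self, side]
        rcases hF v with ⟨h1, h2⟩ | ⟨h1, h2⟩
        · simp [h1]
        · simp [h1.ne', h2]
    · refine ⟨-(F.side k * ((F.dx v - F.dy v) * p v)), 0, le_rfl, fun h => ?_, fun x => ?_⟩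
      · exact absurd (List.mem_singleton.mp h).symm hv
      · simp only [moment, total, withPos, Function.update_of_ne hv]; ring
  | node l r ihl ihr =>
    obtain ⟨a₀, a₁, ha, ha', hl⟩ := ihl
    obtain ⟨b₀, b₁, hb, hb', hr⟩ := ihr
    refine ⟨a₀ + b₀, a₁ + b₁, by positivity, fun h => ?_, fun x => ?_⟩
    · rcases List.mem_append.mp h with h | h
      · exact add_pos_of_pos_of_nonneg (ha' h) hb
      · exact add_pos_of_nonneg_of_pos ha (hb' h)
    · rw [moment_node, mul_add, neg_add, hl, hr]; ring

/-- Areas, sizes and the data of `B` and `C` do not depend on the position of `k`. Each required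
inequality compares a constant with c₀ + c₁x times a positive factor, and c₁ > 0. -/
theorem eventually_dominates [DecidableEq V] (hF : F.IsAxial) {k : V} {A B C : MergeTree V}
    (hA : k ∈ A.members) (hB : k ∉ B.members) (hC : k ∉ C.members) :
    ∀ᶠ x in atTop, (F.withPos (Function.update p k x)).Dominates (F.side k) A B C := by
  obtain ⟨c₀, c₁, -, hc, h⟩ := exists_moment_eq (p := p) hF k A
  have hne : ∀ {m : MergeTree V}, k ∉ m.members → ∀ x, ∀ v ∈ m.members, Function.update p k x v = p v :=
    fun hm x v hv => Function.update_of_ne (fun h : v = k => hm (h ▸ hv)) _ _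
  have hmB : ∀ x, (F.withPos (Function.update p k x)).moment B = (F.withPos p).moment B := fun x =>
    moment_congr (hne hB x)
  have hmC : ∀ x, (F.withPos (Function.update p k x)).moment C = (F.withPos p).moment C := fun x =>
    moment_congr (hne hC x)
  have hlB : ∀ x, (F.withPos (Function.update p k x)).level B = (F.withPos p).level B := fun x =>
    level_congr (hne hB x)
  have key : ∀ s : ℝ, 0 < s → ∀ e : ℝ, ∀ᶠ x in atTop, e < (c₀ + c₁ * x) * s := fun s hs e =>
    ((tendsto_atTop_add_const_left _ c₀ (tendsto_id.const_mul_atTop (hc hA))).atTop_mul_const hs).eventually_gt_atTop e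
  have hs := hF.size_pos B
  set o := F.side k
  filter_upwards [key _ hs ((F.withPos p).level B * (o * F.area B A) - o * (F.withPos p).moment B * F.size A),
    key _ hs (-(o * (F.withPos p).moment B * F.size A)),
    show ∀ᶠ x in atTop, 0 < o * F.area C B → -(o * (F.withPos p).moment B * (o * F.area C A) -
      o * (F.withPos p).moment C * (o * F.area B A)) < (c₀ + c₁ * x) * (o * F.area C B) by
      by_cases h0 : 0 < o * F.area C B
      · filter_upwards [key _ h0 (-(o * (F.withPos p).moment B * (o * F.area C A) -
          o * (F.withPos p).moment C * (o * F.area B A)))] with x hx _ using hx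
      · exact Eventually.of_forall fun x hx => absurd hx h0] with x h1 h2 h3
  have e1 : ∀ m, (F.withPos (Function.update p k x)).size m = F.size m := fun _ => rfl
  have e2 : ∀ m m', (F.withPos (Function.update p k x)).area m m' = F.area m m' := fun _ _ => rfl
  have hx := h x
  have hx' : o * (F.withPos (Function.update p k x)).moment A = -(c₀ + c₁ * x) := by linarith
  unfold Dominates
  rw [hmB, hmC, hlB, hx']
  simp only [e1, e2]
  refine ⟨by linarith, fun h0 => ?_, by linarith⟩
  have := h3 h0
  linarith

/-- Lines may be placed one after the other, each far away compared to the previous ones, in positions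
linearly independent over `ℚ`. -/
theorem exists_positions {F : Lines ℕ} (hF : F.IsAxial) (n : ℕ) :
    ∃ p : ℕ → ℝ, LinearIndependent ℚ (fun i : Fin n => p i) ∧ ∀ k < n, ∀ A B C : MergeTree ℕ,
      A.members.Nodup → B.members.Nodup → C.members.Nodup → (∀ i ∈ A.members, i < k + 1) →
      (∀ i ∈ B.members, i < k) → (∀ i ∈ C.members, i < k) → k ∈ A.members →
      (F.withPos p).Dominates (F.side k) A B C := by
  induction n with
  | zero => exact ⟨0, linearIndependent_empty_type, fun k hk => absurd hk (Nat.not_lt_zero _)⟩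
  | succ n ih =>
    obtain ⟨p, hp, hd⟩ := ih
    -- Only finitely many histories without repeated members use the lines up to n, so one position
    -- can satisfy all the inequalities.
    have hfin := finite_setOf_nodup (n + 1)
    have hfin' := finite_setOf_nodup n
    have hev : ∀ᶠ x in atTop, ∀ A ∈ {m : MergeTree ℕ | m.members.Nodup ∧ ∀ i ∈ m.members, i < n + 1},
        ∀ B ∈ {m : MergeTree ℕ | m.members.Nodup ∧ ∀ i ∈ m.members, i < n},
        ∀ C ∈ {m : MergeTree ℕ | m.members.Nodup ∧ ∀ i ∈ m.members, i < n}, n ∈ A.members →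
        (F.withPos (Function.update p n x)).Dominates (F.side n) A B C := by
      rw [eventually_all_finite hfin]
      intro A _
      rw [eventually_all_finite hfin']
      intro B hB
      rw [eventually_all_finite hfin']
      intro C hC
      by_cases hA : n ∈ A.members
      · filter_upwards [eventually_dominates (p := p) hF hA (fun h => lt_irrefl _ (hB.2 n h))
          (fun h => lt_irrefl _ (hC.2 n h))] with x hx _ using hx
      · exact Eventually.of_forall fun x h => absurd h hA
    obtain ⟨a, ha⟩ := eventually_atTop.mp hev
    -- The rational span of the earlier positions is countable, whereas the admissible positions
    -- contain a half-line; so the new position can be chosen outside the span.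
    have hcount : (Submodule.span ℚ (Set.range fun i : Fin n => p i) : Set ℝ).Countable :=
      Set.countable_coe_iff.mp (inferInstanceAs (Countable (Submodule.span ℚ (Set.range fun i : Fin n => p i))))
    obtain ⟨x, hx, hx'⟩ : ∃ x, a ≤ x ∧ x ∉ Submodule.span ℚ (Set.range fun i : Fin n => p i) := by
      by_contra! hcon
      have h := Cardinal.le_aleph0_iff_set_countable.mpr (hcount.mono (s₁ := Set.Ici a) fun x hx => hcon x hx)
      rw [Cardinal.mk_Ici_real] at h
      exact h.not_gt Cardinal.aleph0_lt_continuum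
    refine ⟨Function.update p n x, ?_, fun k hk A B C hA hB hC hA' hB' hC' hkA => ?_⟩
    · have : (fun i : Fin (n + 1) => Function.update p n x i) = Fin.snoc (fun i : Fin n => p i) x := by
        funext i
        refine Fin.lastCases ?_ (fun j => ?_) i
        · simp
        · simp [j.2.ne]
      rw [this, linearIndependent_finSnoc]
      exact ⟨hp, hx'⟩
    · rcases Nat.lt_succ_iff_lt_or_eq.mp hk with hk | rfl
      · have hne : ∀ i, i < n → p i = Function.update p n x i := fun i hi =>
          (Function.update_of_ne hi.ne _ _).symm
        exact (hd k hk A B C hA hB hC hA' hB' hC' hkA).congr (fun i hi => hne i (by have := hA' i hi; omega))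
          (fun i hi => hne i ((hB' i hi).trans hk)) (fun i hi => hne i ((hC' i hi).trans hk))
      · exact ha x hx A ⟨hA, hA'⟩ B ⟨hB, hB'⟩ C ⟨hC, hC'⟩ hkA

end Lines

end

/-! ### Realization of all types by curves with ends on general lines. -/

section

open MergeTree ChargeLattice Filter

/-- Equal multisets of values mean fibres of equal size, and these can be matched one by one.
Applied to degrees, this pairs the vertices of a tree with the prescribed ends. -/
theorem exists_equiv_of_map_eq {α β γ : Type} [Fintype α] [Fintype β] {f : α → γ} {g : β → γ}
    (h : Finset.univ.val.map f = Finset.univ.val.map g) : ∃ e : α ≃ β, ∀ a, g (e a) = f a := by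
  classical
  have hc : ∀ c, Nonempty ({a // f a = c} ≃ {b // g b = c}) := by
    intro c
    refine ⟨Fintype.equivOfCardEq ?_⟩
    have := congrArg (Multiset.count c) h
    rw [Multiset.count_map, Multiset.count_map] at this
    rw [Fintype.card_subtype, Fintype.card_subtype]
    simp only [Finset.card, Finset.filter_val]
    simpa only [eq_comm] using this
  exact ⟨Equiv.ofFiberEquiv fun c => (hc c).some, fun a => Equiv.ofFiberEquiv_map _ a⟩

namespace MergeTree

variable {V : Type}

/-- The ends of a tree correspond to the original vertices. -/
noncomputable def endEquiv [Fintype V] {m : MergeTree V} (h : (m.members : Multiset V) = Finset.univ.val) :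
    m.End ≃ V :=
  Equiv.ofBijective m.endMember (by
    have h1 := m.map_endMember
    rw [h] at h1
    have hnd : (Multiset.map m.endMember Finset.univ.val).Nodup := h1 ▸ Finset.univ.nodup
    refine ⟨fun x y hxy => Multiset.inj_on_of_nodup_map hnd x (Finset.mem_univ _) y (Finset.mem_univ _) hxy,
      fun v => ?_⟩
    have : v ∈ Multiset.map m.endMember Finset.univ.val := by rw [h1]; exact Finset.mem_univ v
    obtain ⟨e, -, he⟩ := Multiset.mem_map.mp this
    exact ⟨e, he⟩)

end MergeTree

namespace DecoratedTree

variable {l₁ l₂ : ℕ} {V : Type} [Fintype V] [DecidableEq V] {T : DecoratedTree l₁ l₂ V}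

/-- The lines carrying the rays of the vertices, for given positions. -/
def lines (T : DecoratedTree l₁ l₂ V) (p : V → ℝ) : Lines V where
  dx v := (T.charge v).proj.1
  dy v := (T.charge v).proj.2
  pos := p

theorem IsPositive.isAxial (hT : T.IsPositive) (p : V → ℝ) : (T.lines p).IsAxial := by
  intro v
  obtain ⟨h1, h2, h3, h4⟩ := hT.proj_leaf v
  rcases h4 with h4 | h4
  · exact Or.inl ⟨by simp [lines, h4], by simp only [lines]; exact_mod_cast (by omega : 0 < (T.charge v).proj.2)⟩
  · exact Or.inr ⟨by simp only [lines]; exact_mod_cast (by omega : 0 < (T.charge v).proj.1), by simp [lines, h4]⟩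

theorem total_lines (T : DecoratedTree l₁ l₂ V) (p : V → ℝ) (m : MergeTree V) :
    m.total (T.lines p).dx = ((m.total fun v => (T.charge v).proj).1 : ℝ) ∧
      m.total (T.lines p).dy = ((m.total fun v => (T.charge v).proj).2 : ℝ) := by
  induction m with
  | leaf v => exact ⟨rfl, rfl⟩
  | node l r ihl ihr =>
    simp only [total, ihl.1, ihl.2, ihr.1, ihr.2, Prod.fst_add, Prod.snd_add, Int.cast_add, and_self]

theorem outVal_lines (T : DecoratedTree l₁ l₂ V) (p : V → ℝ) (m : MergeTree V) (x : m.Vertex) :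
    m.outVal (total (T.lines p).dx) x = ((m.outVec (fun v => (T.charge v).proj) x).1 : ℝ) ∧
      m.outVal (total (T.lines p).dy) x = ((m.outVec (fun v => (T.charge v).proj) x).2 : ℝ) := by
  induction m with
  | leaf v => exact x.elim
  | node l r ihl ihr =>
    rcases x with _ | x | x
    · exact T.total_lines p (node l r)
    · exact ihl x
    · exact ihr x

/-- If the vertices are moved in the order of the distance of their lines, all contractions are
realizable. -/
theorem IsPositive.residueTerms_realizable (hT : T.IsPositive) {p : V → ℝ}
    (ν : Fin (Fintype.card V) ≃ V)
    (hdom : ∀ (k : V) (A B C : MergeTree V), A.members.Nodup → B.members.Nodup → C.members.Nodup →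
      (∀ v ∈ A.members, ν.symm v ≤ ν.symm k) → (∀ v ∈ B.members, ν.symm v < ν.symm k) →
      (∀ v ∈ C.members, ν.symm v < ν.symm k) → k ∈ A.members →
      (T.lines p).Dominates ((T.lines p).side k) A B C) :
    ∀ u ∈ T.residueTerms ν, ∀ m ∈ u.1, (T.lines p).Realizable m := by
  intro u hu
  refine (residueTerms_induction (T := T) (ν := ν) (Inv := fun vs L =>
    (L.flatMap members ++ vs).Perm (List.ofFn ν) ∧ vs.Pairwise (fun v w => ν.symm v < ν.symm w) ∧
    (∀ x ∈ L.flatMap members, ∀ v ∈ vs, ν.symm x < ν.symm v) ∧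
    L.Pairwise ((T.lines p).Before 1) ∧ ∀ m ∈ L, (T.lines p).Realizable m) ?_ ?_ u hu).2.2.2.2
  · rintro k vs L σ ⟨i1, i2, i3, i4, i5⟩ w hw
    have hperm := moveVertex_members w hw
    have hnd : (k :: L.flatMap members).Nodup := by
      have := i1.nodup_iff.mpr (List.nodup_ofFn.mpr ν.injective)
      have h2 := (List.perm_middle.nodup_iff.mp this)
      exact h2.sublist ((List.sublist_append_left _ _).cons_cons k)
    refine ⟨(hperm.append_right vs).trans (List.perm_middle.symm.trans i1), (List.pairwise_cons.mp i2).2,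
      fun x hx v hv => ?_, ?_⟩
    · rcases List.mem_cons.mp (hperm.mem_iff.mp hx) with rfl | hx
      · exact (List.pairwise_cons.mp i2).1 v hv
      · exact i3 x hx v (List.mem_cons_of_mem _ hv)
    have hlt : ∀ x ∈ L.flatMap members, ν.symm x < ν.symm k := fun x hx => i3 x hx k List.mem_cons_self
    have hle : ∀ x ∈ k :: L.flatMap members, ν.symm x ≤ ν.symm k := by
      intro x hx
      rcases List.mem_cons.mp hx with rfl | hx
      · exact le_rfl
      · exact (hlt x hx).le
    unfold moveVertex at hw
    split_ifs at hw with hv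
    · have hside : (T.lines p).side k = ((orient true : ℤ) : ℝ) := by
        simp [Lines.side, lines, orient, hv]
      have := push_realizable (hT.isAxial p) (fun _ => rfl) (fun _ => rfl) (cw := true) (k := k) (L := L)
        (by simpa [orient] using i4) i5 hnd (fun A B C hA hB hC hA' hB' hC' hk => by
          rw [← hside]
          exact hdom k A B C hA' hB' hC' (fun x hx => hle x (hA hx)) (fun x hx => hlt x (hB hx))
            (fun x hx => hlt x (hC hx)) hk) w hw
      simpa [orient] using this
    · have hside : (T.lines p).side k = ((orient false : ℤ) : ℝ) := by
        simp [Lines.side, lines, orient, hv]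
      obtain ⟨q, hq, rfl⟩ := List.mem_map.mp hw
      have hrev : (L.reverse.flatMap members).Perm (L.flatMap members) :=
        (List.reverse_perm L).flatMap_right _
      -- Counterclockwise motion reads the list from its other end; reversing the list and changing
      -- the orientation leave the order relation intact.
      have hflip : ∀ A B : MergeTree V, (T.lines p).Before ((orient false : ℤ) : ℝ) A B ↔
          (T.lines p).Before 1 B A := by
        intro A B
        unfold Lines.Before
        rw [(T.lines p).area_swap A B]
        simp only [orient]
        norm_num
      have := push_realizable (hT.isAxial p) (fun _ => rfl) (fun _ => rfl) (cw := false) (k := k)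
        (L := L.reverse) (by
          rw [List.pairwise_reverse]
          exact i4.imp fun {a b} h => (hflip b a).mpr h) (fun m hm => i5 m (List.mem_reverse.mp hm))
        ((hrev.cons k).nodup_iff.mpr hnd) (fun A B C hA hB hC hA' hB' hC' hk => by
          rw [← hside]
          exact hdom k A B C hA' hB' hC' (fun x hx => hle x ((hrev.cons k).mem_iff.mp (hA hx)))
            (fun x hx => hlt x (hrev.mem_iff.mp (hB hx))) (fun x hx => hlt x (hrev.mem_iff.mp (hC hx))) hk) q hq
      refine ⟨?_, fun m hm => this.2 m (List.mem_reverse.mp hm)⟩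
      rw [List.pairwise_reverse]
      exact this.1.imp fun {a b} h => (hflip a b).mp h
  · refine ⟨by simp, ?_, by simp, List.Pairwise.nil, by simp⟩
    rw [List.pairwise_ofFn]
    intro i j hij
    simpa using hij

end DecoratedTree

namespace WeightVector

/-- The lines of a weight vector, enumerated by natural numbers. -/
def lines (w : WeightVector) {n : ℕ} (e : Fin w.len₁ ⊕ Fin w.len₂ ≃ Fin n) : Lines ℕ where
  -- Indices beyond n receive an arbitrary horizontal direction, only to keep the family axial.
  dx k := if h : k < n then ((w.vec (e.symm ⟨k, h⟩)).1 : ℝ) else 1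
  dy k := if h : k < n then ((w.vec (e.symm ⟨k, h⟩)).2 : ℝ) else 0
  pos _ := 0

theorem isAxial_lines (w : WeightVector) {n : ℕ} (e : Fin w.len₁ ⊕ Fin w.len₂ ≃ Fin n) :
    (w.lines e).IsAxial := by
  intro k
  by_cases h : k < n
  · simp only [lines, h, dite_true]
    rcases e.symm ⟨k, h⟩ with j | j
    · have := w.pos₁ j
      exact Or.inl ⟨by simp [vec], by simpa [vec] using (by omega : 0 < w.w₁ j)⟩
    · have := w.pos₂ j
      exact Or.inr ⟨by simpa [vec] using (by omega : 0 < w.w₂ j), by simp [vec]⟩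
  · exact Or.inr ⟨by simp [lines, h], by simp [lines, h]⟩

/-- For lines far away from each other, the types of all trees of the given degree are realized by curves
with ends in the lines. -/
theorem exists_general_lines (w : WeightVector) :
    ∃ 𝔡 : Fin w.len₁ ⊕ Fin w.len₂ → ℝ, LinearIndependent ℚ 𝔡 ∧
      ∀ {l₁ l₂ : ℕ} (V : Type) [Fintype V] [DecidableEq V] (T : DecoratedTree l₁ l₂ V),
        T.IsPositive → T.degree = w.degree →
        ∃ ν : Fin (Fintype.card V) ≃ V, ∀ t ∈ T.signedTypes ν,
          ∃ Υ ∈ w.curves 𝔡, Υ.HasType t.1 := by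
  set I := Fin w.len₁ ⊕ Fin w.len₂ with hI
  set n := Fintype.card I with hn
  let e : I ≃ Fin n := Fintype.equivFin I
  obtain ⟨p, hp, hd⟩ := Lines.exists_positions (w.isAxial_lines e) n
  refine ⟨fun i => p (e i), hp.comp e e.injective, ?_⟩
  intro l₁ l₂ V _ _ T hT hdeg
  obtain ⟨f, hf⟩ := exists_equiv_of_map_eq (f := fun v => (T.charge v).proj) (g := w.vec) hdeg
  have hcard : Fintype.card V = n := Fintype.card_congr f
  -- The vertices are moved in the order in which their lines were placed, so the line of the moving
  -- vertex dominates those of all vertices moved before.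
  let ν : Fin (Fintype.card V) ≃ V := (finCongr hcard).trans (e.symm.trans f.symm)
  let pV : V → ℝ := fun v => p (e (f v))
  have hν : ∀ v, ((ν.symm v : Fin _) : ℕ) = (e (f v) : ℕ) := fun v => rfl
  let idx : V → ℕ := fun v => e (f v)
  have hinj : Function.Injective idx := fun v v' h => f.injective (e.injective (Fin.ext h))
  -- The inequalities were imposed on lines indexed by natural numbers, independently of any tree; a
  -- tree of the given degree pulls them back along the matching of its vertices with the ends.
  have hcomap : T.lines pV = ((w.lines e).withPos p).comap idx := by
    have h1 : ∀ v, (T.charge v).proj = w.vec (f v) := fun v => (hf v).symm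
    simp only [DecoratedTree.lines, Lines.comap, Lines.withPos, lines, idx, h1, Fin.is_lt, dite_true, Fin.eta,
      Equiv.symm_apply_apply]
    rfl
  have hreal := hT.residueTerms_realizable (p := pV) ν (by
    intro k A B C hA hB hC hA' hB' hC' hk
    rw [hcomap, Lines.dominates_comap]
    refine hd (idx k) (e (f k)).2 _ _ _ ?_ ?_ ?_ ?_ ?_ ?_ ?_
    · rw [members_map]; exact hA.map hinj
    · rw [members_map]; exact hB.map hinj
    · rw [members_map]; exact hC.map hinj
    · rw [members_map]
      intro i hi
      obtain ⟨v, hv, rfl⟩ := List.mem_map.mp hi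
      exact Nat.lt_succ_of_le (hA' v hv)
    · rw [members_map]
      intro i hi
      obtain ⟨v, hv, rfl⟩ := List.mem_map.mp hi
      exact hB' v hv
    · rw [members_map]
      intro i hi
      obtain ⟨v, hv, rfl⟩ := List.mem_map.mp hi
      exact hC' v hv
    · rw [members_map]
      exact List.mem_map_of_mem hk)
  refine ⟨ν, fun t ht => ?_⟩
  obtain ⟨l, r, hu, et⟩ := DecoratedTree.mem_signedTypes.mp ht
  have hR := hreal _ hu (node l r) List.mem_cons_self
  have hmem : ((node l r).members : Multiset V) = Finset.univ.val := by
    simpa using DecoratedTree.residueTerms_single_map hu (fun v => v)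
  have hAx := hT.isAxial pV
  set Υ := curve (fun v => (T.charge v).proj) hT.total_proj_ne_zero l r
    ((node l r).outVal (T.lines pV).crossing) (fun x y h => by
      obtain ⟨s, hs, h2⟩ := hAx.forward_of_up hR h
      rw [(T.outVal_lines pV _ x).1, (T.outVal_lines pV _ x).2] at h2
      exact ⟨s, hs, h2⟩) with hΥ
  have hline : ∀ a : (node l r).End, ((T.charge ((node l r).endMember a)).proj.1 = 0 →
      (Υ.pos (Υ.att (some a))).1 = pV ((node l r).endMember a)) ∧
      ((T.charge ((node l r).endMember a)).proj.2 = 0 →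
      (Υ.pos (Υ.att (some a))).2 = pV ((node l r).endMember a)) := by
    intro a
    have := hAx.endVertex_line hR (endVertex_node l r a)
    exact ⟨fun h => this.1 (by simp [DecoratedTree.lines, h]), fun h => this.2 (by simp [DecoratedTree.lines, h])⟩
  let g : I ≃ (node l r).End := f.symm.trans (endEquiv hmem).symm
  have hg : ∀ i, (node l r).endMember (g i) = f.symm i := fun i => (endEquiv hmem).apply_symm_apply _
  have hq : ∀ i, (T.charge (f.symm i)).proj = w.vec i := fun i => by
    have := hf (f.symm i)
    rw [f.apply_symm_apply] at this
    exact this.symm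
  have hpV : ∀ i, pV (f.symm i) = p (e i) := fun i => by simp [pV]
  refine ⟨Υ, ⟨Equiv.optionCongr g, fun i => ?_, fun j => ?_, fun j => ?_, ?_⟩, ⟨?_⟩⟩
  · change -(T.charge ((node l r).endMember (g i))).proj = _
    rw [hg, hq]
  · have := (hline (g (.inl j))).1
    rw [hg, hq, hpV] at this
    exact this rfl
  · have := (hline (g (.inr j))).2
    rw [hg, hq, hpV] at this
    exact this rfl
  · change (node l r).total (fun v => (T.charge v).proj) = _
    rw [DecoratedTree.total_proj_eq_reducedCharge hu, ← DecoratedTree.total_proj_eq_reducedCharge hu,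
      MergeTree.total_eq_sum, ← Multiset.sum_coe, ← Multiset.map_coe, DecoratedTree.residueTerms_single_map hu]
    exact congrArg Multiset.sum hdeg
  · rw [← et]
    exact TropType.Iso.refl _

end WeightVector

end

/-! ### Assembly of the tropical and analytic statements. -/

theorem lemmaA (l₁ l₂ : ℕ) :
    -- Tropical types, for all trees and labellings.
    (∀ (V : Type) [Fintype V] [DecidableEq V] (T : DecoratedTree l₁ l₂ V),
      T.IsPositive → IsCoprime T.reducedCharge.1 T.reducedCharge.2 →
      ∀ ν : Fin (Fintype.card V) ≃ V, ∀ t ∈ T.signedTypes ν,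
        ∃ Υ : TropCurve, Υ.HasType t.1 ∧
          Υ.degree = T.reducedCharge ::ₘ T.degree.map (fun a => -a)) ∧
    -- For suitable labellings the types lie in a single set, as the tree varies.
    (∀ w : WeightVector, IsCoprime (∑ i, w.vec i).1 (∑ i, w.vec i).2 →
      ∃ 𝔡 : Fin w.len₁ ⊕ Fin w.len₂ → ℝ, LinearIndependent ℚ 𝔡 ∧
        ∀ (V : Type) [Fintype V] [DecidableEq V] (T : DecoratedTree l₁ l₂ V),
          T.IsPositive → T.degree = w.degree →
          ∃ ν : Fin (Fintype.card V) ≃ V, ∀ t ∈ T.signedTypes ν,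
            ∃ Υ ∈ w.curves 𝔡, Υ.HasType t.1) ∧
    -- The expansion of the jump.
    (∀ (D : WallCrossing) (τ₀ : ℝ), D.IsCritical τ₀ →
      ∀ (V : Type) [Fintype V] [DecidableEq V] (T : DecoratedTree l₁ l₂ V),
      T.IsPositive → IsCoprime T.reducedCharge.1 T.reducedCharge.2 →
      ∀ ν : Fin (Fintype.card V) ≃ V,
      (∀ ζ : ℂ, ζ ∉ D.cone →
        ∃ (ε₀ C : ℝ) (δ₀ : ℝ → ℝ) (E₁ E₂ : ℝ → ℝ → ℂ), 0 < ε₀ ∧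
          ∀ ε : ℝ, 0 < ε → ε < ε₀ → 0 < δ₀ ε ∧
            -- the residue expansion, when the rays move from `ℓ⁺` to `ℓ⁻`
            (∀ x ∈ firstQuadrant, ∀ y ∈ firstQuadrant, ∀ R δ : ℝ, 0 < R → 0 < δ → δ < δ₀ ε →
              T.G (ChargeLattice.centralCharge x y) (D.Z (τ₀ - ε)) R ζ =
                ((T.residueTerms ν).map fun u => ((u.2 : ℤ) : ℂ) *
                  T.termPropagator u.1 (ChargeLattice.centralCharge x y) (D.Z (τ₀ + ε)) δ R ζ).sum) ∧
            -- the expansion of the jump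
            (∀ R : ℝ, 0 < R → T.jump D τ₀ ζ ε R =
              (T.signSum ν : ℂ) * singleIntegral (D.Z τ₀ T.totalCharge) ζ R + E₁ ε R + E₂ ε R) ∧
            -- the first error term is the contribution of the intermediate terms, for the
            -- central charge `Z^{τ₀ + ε}` rescaled to have modulus `|Z^{τ₀}(c)|` on `c`
            (∀ R δ : ℝ, 0 < R → 0 < δ → δ < δ₀ ε → E₁ ε R =
              ((T.intermediateTerms ν).map fun u => ((u.2 : ℤ) : ℂ) *
                T.termPropagator u.1
                  (fun α => ((‖D.Z τ₀ T.totalCharge‖ / ‖D.Z (τ₀ + ε) T.totalCharge‖ : ℝ) : ℂ) *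
                    D.Z (τ₀ + ε) α) (D.Z (τ₀ + ε)) δ R ζ).sum) ∧
            Asymptotics.IsLittleO Filter.atTop (E₁ ε) (besselRate (D.Z τ₀ T.totalCharge)) ∧
            (∀ R : ℝ, 1 ≤ R → ‖E₂ ε R‖ ≤ C * ε)) ∧
      -- the leading term, as `ζ → 0` nontangentially and then `R → ∞`
      (∃ f₀ : ℝ → ℂ,
        (∀ R κ : ℝ, 0 < R → 0 < κ →
          Filter.Tendsto (fun ζ => singleIntegral (D.Z τ₀ T.totalCharge) ζ R)
            (nhdsWithin 0 (D.nontangential κ)) (nhds (f₀ R))) ∧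
        Asymptotics.IsEquivalent Filter.atTop f₀ fun R =>
          1 / (4 * Real.pi * Complex.I) * (besselRate (D.Z τ₀ T.totalCharge) R : ℂ))) := by
  refine ⟨fun V _ _ T hT _ ν => hT.exists_curve ν, fun w _ => ?_,
    fun D τ₀ hcrit V _ _ T hT hprim ν => ⟨fun ζ hζ => hT.jump_expansion D hcrit hprim ν hζ, ?_⟩⟩
  · obtain ⟨𝔡, h𝔡, h⟩ := w.exists_general_lines
    exact ⟨𝔡, h𝔡, fun V _ _ T => h V T⟩
  · obtain ⟨hτ0, hτ1⟩ := hcrit.mem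
    obtain ⟨⟨g1, g2⟩, e1, e2⟩ := D.arg_bounds hτ0 hτ1
    obtain ⟨hg, he⟩ := D.mem_firstQuadrant hτ0.le hτ1.le
    obtain ⟨t1, t2, t3⟩ := hT.totalCharge_pos
    have hz : D.Z τ₀ T.totalCharge ∈ firstQuadrant := centralCharge_mem hg he t1 t2 t3
    exact ⟨_, fun R κ hR hκ => tendsto_singleIntegral D hz
      ((arg_centralCharge_bounds hg he t1 t2 t3 D.eP_mem).1 g1.le e1.le)
      ((arg_centralCharge_bounds hg he t1 t2 t3 D.gP_mem).2 g2.le e2.le) hR hκ,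
      isEquivalent_integral_cosh (ne_zero_of_firstQuadrant hz)⟩
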